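/- Throughout, a 2-category is strict (a category enriched in categories), a 2-functor is strict, a pseudofunctor preserves composition and identities up to coherent invertible 2-cells, and $\mathcal{X}^{op}$ is obtained from $\mathcal{X}$ by reversing 1-cells only. For 2-categories $\mathcal{X},\mathcal{Y}$, $\mathcal{H}om(\mathcal{X},\mathcal{Y})$ is the 2-category of 2-functors, (strict) 2-natural transformations and modifications. *2-filtered.* A 2-category $\mathcal{I}$ is 2-filtered if it is non-empty and: (F0) for objects $i,j$ there are an object $k$ and 1-cells $i\to k$, $j\to k$; (F1) for 1-cells $f,g\colon i\to j$ there are a 1-cell $h\colon j\to k$ and an invertible 2-cell $hf\cong hg$; (F2) for 2-cells $\alpha,\beta\colon f\Rightarrow g\colon i\to j$ there is a 1-cell $h\colon j\to k$ with $h\alpha=h\beta$. *Pseudo-limits.* A pseudo-cone with vertex $A$ over a pseudofunctor $F\colon\mathcal{J}\to\mathcal{A}$ is a pseudonatural transformation from the constant 2-functor at $A$ to $F$; with modifications as morphisms, pseudo-cones with vertex $A$ form a category $PC(A,F)$. A pseudo-cone $\pi$ with vertex $L$ is a pseudo-limit cone if for every object $A$ the functor $\mathcal{A}(A,L)\to PC(A,F)$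 given by composition with $\pi$ is an isomorphism of categories. $\mathcal{A}$ is closed under small 2-cofiltered pseudo-limits if every pseudofunctor $\mathcal{J}^{op}\to\mathcal{A}$ with $\mathcal{J}$ a small 2-filtered 2-category has a pseudo-limit cone. A 2-functor preserves small 2-cofiltered pseudo-limits if it sends every pseudo-limit cone over such a pseudofunctor to a pseudo-limit cone over the composite pseudofunctor. *2-pro-objects.* Let $\mathcal{C}$ be a 2-category with small hom-categories. An object of the 2-category $2\text{-}\mathcal{P}ro(\mathcal{C})$ is a 2-functor $X\colon\mathcal{I}^{op}\to\mathcal{C}$ with $\mathcal{I}$ a small 2-filtered 2-category. Put $L_X=\operatorname{colim}_{i\in\mathcal{I}}\mathcal{C}(X_i,-)$, the (pointwise) pseudo-colimit in $\mathcal{H}om(\mathcal{C},\mathcal{C}at)$. The hom-categories of $2\text{-}\mathcal{P}ro(\mathcal{C})$ are $$2\text{-}\mathcal{P}ro(\mathcal{C})(X,Y)=\mathcal{H}om(\mathcal{C},\mathcal{C}at)(L_Y,L_X),$$ with compositions those of $\mathcal{H}om(\mathcal{C},\mathcal{C}at)^{op}$. The canonical 2-functor $c\colon\mathcal{C}\to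 2\text{-}\mathcal{P}ro(\mathcal{C})$ sends an object to the 2-pro-object with that value indexed by the one-point 2-category, and acts on 1-cells and 2-cells by precomposition on representable 2-functors. **Theorem.** Let $\mathcal{C}$ be a 2-category with small hom-categories, and let $\mathcal{E}$ be a 2-category closed under small 2-cofiltered pseudo-limits. Let $\mathcal{H}om(2\text{-}\mathcal{P}ro(\mathcal{C}),\mathcal{E})_+$ be the full sub-2-category of $\mathcal{H}om(2\text{-}\mathcal{P}ro(\mathcal{C}),\mathcal{E})$ whose objects are the 2-functors that preserve small 2-cofiltered pseudo-limits. Then precomposition with $c$, $$c^*\colon\mathcal{H}om(2\text{-}\mathcal{P}ro(\mathcal{C}),\mathcal{E})_+\longrightarrow\mathcal{H}om(\mathcal{C},\mathcal{E}),$$ is a 2-equivalence: there are a 2-functor $G$ in the opposite direction and invertible 2-natural transformations $c^*G\Rightarrow\mathrm{id}$ and $G\,c^*\Rightarrow\mathrm{id}$. -/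

import Mathlib

set_option linter.unusedVariables false
set_option linter.unusedSectionVars false

open CategoryTheory Bicategory

universe w w₁ w₂ w₃ v₁ v₂ v₃ u u₁ u₂ u₃

/- The 1-cells of a strict bicategory are composed with the composition of the bicategory. -/
attribute [-instance] StrictBicategory.category

namespace TwoCat

section TwoFunctors

variable {B : Type u₁} [Bicategory.{w₁, v₁} B] {C : Type u₂} [Bicategory.{w₂, v₂} C]

/-- A 2-natural transformation: components `F a ⟶ G a` that commute strictly with 1-cells and
2-cells. -/
@[ext]
structure TwoNatTrans (F G : StrictPseudofunctor B C) where
  app (a : B) : F.obj a ⟶ G.obj a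
  naturality {a b : B} (f : a ⟶ b) : F.map f ≫ app b = app a ≫ G.map f
  naturality₂ {a b : B} {f g : a ⟶ b} (η : f ⟶ g) :
    F.map₂ η ▷ app b ≫ eqToHom (naturality g) = eqToHom (naturality f) ≫ app a ◁ G.map₂ η

/-- A modification between 2-natural transformations. -/
@[ext]
structure Modif {F G : StrictPseudofunctor B C} (α β : TwoNatTrans F G) where
  app (a : B) : α.app a ⟶ β.app a
  naturality {a b : B} (f : a ⟶ b) :
    F.map f ◁ app b ≫ eqToHom (β.naturality f) = eqToHom (α.naturality f) ≫ app a ▷ G.map f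

variable [Strict C]

theorem whiskerRight_comp' {a b c d : C} {f f' : a ⟶ b} (η : f ⟶ f') (g : b ⟶ c) (h : c ⟶ d) :
    η ▷ (g ≫ h) = eqToHom (Strict.assoc f g h).symm ≫ η ▷ g ▷ h ≫ eqToHom (Strict.assoc f' g h) := by
  simp [Strict.associator_eqToIso]

theorem comp_whiskerLeft' {a b c d : C} (f : a ⟶ b) (g : b ⟶ c) {h h' : c ⟶ d} (η : h ⟶ h') :
    (f ≫ g) ◁ η = eqToHom (Strict.assoc f g h) ≫ f ◁ g ◁ η ≫ eqToHom (Strict.assoc f g h').symm := by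
  simp [Strict.associator_eqToIso]

theorem whisker_assoc' {a b c d : C} (f : a ⟶ b) {g g' : b ⟶ c} (η : g ⟶ g') (h : c ⟶ d) :
    (f ◁ η) ▷ h = eqToHom (Strict.assoc f g h) ≫ f ◁ η ▷ h ≫ eqToHom (Strict.assoc f g' h).symm := by
  simp [Strict.associator_eqToIso]

theorem id_whiskerLeft' {a b : C} {f g : a ⟶ b} (η : f ⟶ g) :
    𝟙 a ◁ η = eqToHom (Strict.id_comp f) ≫ η ≫ eqToHom (Strict.id_comp g).symm := by
  simp [Strict.leftUnitor_eqToIso]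

theorem whiskerRight_id' {a b : C} {f g : a ⟶ b} (η : f ⟶ g) :
    η ▷ 𝟙 b = eqToHom (Strict.comp_id f) ≫ η ≫ eqToHom (Strict.comp_id g).symm := by
  simp [Strict.rightUnitor_eqToIso]

def TwoNatTrans.id (F : StrictPseudofunctor B C) : TwoNatTrans F F where
  app a := 𝟙 _
  naturality f := by rw [Strict.id_comp, Strict.comp_id]
  naturality₂ η := by
    rw [id_whiskerLeft', whiskerRight_id']
    simp

def TwoNatTrans.comp {F G H : StrictPseudofunctor B C} (α : TwoNatTrans F G)
    (β : TwoNatTrans G H) : TwoNatTrans F H where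
  app a := α.app a ≫ β.app a
  naturality f := by
    rw [← Strict.assoc, α.naturality, Strict.assoc, β.naturality, Strict.assoc]
  naturality₂ {a b f g} η := by
    have h1 := α.naturality₂ η
    have h2 := β.naturality₂ η
    rw [← cancel_mono (eqToHom (α.naturality g).symm)] at h1
    rw [← cancel_mono (eqToHom (β.naturality g).symm)] at h2
    simp only [Category.assoc, eqToHom_trans, eqToHom_refl, Category.comp_id] at h1 h2
    rw [whiskerRight_comp', h1, comp_whiskerLeft']
    simp [Strict.associator_eqToIso, h2]

section Auxiliary

@[reducible]
def TwoNatTrans.categoryStruct : CategoryStruct (StrictPseudofunctor B C) where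
  Hom F G := TwoNatTrans F G
  id F := TwoNatTrans.id F
  comp α β := TwoNatTrans.comp α β

attribute [local instance] TwoNatTrans.categoryStruct

theorem TwoNatTrans.hom_ext_aux {F G : StrictPseudofunctor B C} {α β : F ⟶ G}
    (h : ∀ a, TwoNatTrans.app α a = TwoNatTrans.app β a) : α = β :=
  TwoNatTrans.ext (funext h)

@[reducible]
def Modif.category (F G : StrictPseudofunctor B C) : Category (F ⟶ G) where
  Hom α β := Modif α β
  id α := ⟨fun a => 𝟙 _, fun f => by simp⟩
  comp Γ Λ := ⟨fun a => Γ.app a ≫ Λ.app a, fun f => by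
    rw [whiskerLeft_comp, Category.assoc, Λ.naturality, ← Category.assoc, Γ.naturality,
      comp_whiskerRight, Category.assoc]⟩
  id_comp Γ := by ext; exact Category.id_comp _
  comp_id Γ := by ext; exact Category.comp_id _
  assoc Γ Λ Θ := by ext; exact Category.assoc _ _ _

attribute [local instance] Modif.category

theorem Modif.hom_ext_aux {F G : StrictPseudofunctor B C} {α β : F ⟶ G} {Γ Λ : α ⟶ β}
    (h : ∀ a, Modif.app Γ a = Modif.app Λ a) : Γ = Λ :=
  Modif.ext (funext h)

theorem whiskerLeft_congr {a b c : C} {f f' : a ⟶ b} (h : f = f') {g g' : b ⟶ c} (η : g ⟶ g') :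
    f ◁ η = eqToHom (by rw [h]) ≫ f' ◁ η ≫ eqToHom (by rw [h]) := by
  subst h; simp

theorem whiskerRight_congr {a b c : C} {f f' : a ⟶ b} (η : f ⟶ f') {g g' : b ⟶ c} (h : g = g') :
    η ▷ g = eqToHom (by rw [h]) ≫ η ▷ g' ≫ eqToHom (by rw [h]) := by
  subst h; simp

theorem paste_whiskerLeft {x y x' y' z z' : C} {f : x ⟶ y} {p : x ⟶ x'} {q : y ⟶ y'}
    {g : x' ⟶ y'} (h : f ≫ q = p ≫ g) {r s : x' ⟶ z} {r' s' : y' ⟶ z'} {k : z ⟶ z'}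
    (hr : g ≫ r' = r ≫ k) (hs : g ≫ s' = s ≫ k) (θ : r ⟶ s) (θ' : r' ⟶ s')
    (e : g ◁ θ' ≫ eqToHom hs = eqToHom hr ≫ θ ▷ k)
    (h₁ : f ≫ q ≫ s' = (p ≫ s) ≫ k) (h₂ : f ≫ q ≫ r' = (p ≫ r) ≫ k) :
    f ◁ q ◁ θ' ≫ eqToHom h₁ = eqToHom h₂ ≫ (p ◁ θ) ▷ k := by
  have e₁ := whiskerLeft_congr h θ'
  rw [comp_whiskerLeft', comp_whiskerLeft'] at e₁
  have e₂ : f ◁ q ◁ θ' = eqToHom (by rw [← Strict.assoc, h, Strict.assoc]) ≫ p ◁ g ◁ θ' ≫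
      eqToHom (by rw [← Strict.assoc, ← h, Strict.assoc]) := by
    rw [← cancel_mono (eqToHom (Strict.assoc f q s').symm),
      ← cancel_epi (eqToHom (Strict.assoc f q r'))]
    refine Eq.trans ?_ (e₁.trans ?_) <;> simp
  have e₃ : g ◁ θ' = eqToHom hr ≫ θ ▷ k ≫ eqToHom hs.symm := by
    rw [← Category.assoc, ← e]; simp
  rw [e₂, e₃]
  simp [Strict.associator_eqToIso]

theorem paste_whiskerRight {x y x' y' z z' : C} {f : x ⟶ y} {p p₂ : x ⟶ x'} {q q₂ : y ⟶ y'}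
    {g : x' ⟶ y'} (h : f ≫ q = p ≫ g) (h' : f ≫ q₂ = p₂ ≫ g) {r : x' ⟶ z} {r' : y' ⟶ z'}
    {k : z ⟶ z'} (hr : g ≫ r' = r ≫ k) (θ : p ⟶ p₂) (θ' : q ⟶ q₂)
    (e : f ◁ θ' ≫ eqToHom h' = eqToHom h ≫ θ ▷ g)
    (h₁ : f ≫ q₂ ≫ r' = (p₂ ≫ r) ≫ k) (h₂ : f ≫ q ≫ r' = (p ≫ r) ≫ k) :
    f ◁ θ' ▷ r' ≫ eqToHom h₁ = eqToHom h₂ ≫ (θ ▷ r) ▷ k := by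
  have e₁ := whiskerRight_congr θ hr
  rw [whiskerRight_comp', whiskerRight_comp'] at e₁
  have e₂ : θ ▷ r ▷ k = eqToHom (by rw [Strict.assoc, ← hr, Strict.assoc]) ≫ θ ▷ g ▷ r' ≫
      eqToHom (by rw [Strict.assoc, hr, Strict.assoc]) := by
    rw [← cancel_mono (eqToHom (Strict.assoc p₂ r k)),
      ← cancel_epi (eqToHom (Strict.assoc p r k).symm)]
    rw [← cancel_mono (eqToHom (show p₂ ≫ g ≫ r' = p₂ ≫ r ≫ k by rw [hr])),
      ← cancel_epi (eqToHom (show p ≫ r ≫ k = p ≫ g ≫ r' by rw [hr]))] at e₁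
    simp only [Category.assoc, eqToHom_trans, eqToHom_trans_assoc] at e₁ ⊢
    rw [← cancel_mono (eqToHom (show p₂ ≫ r ≫ k = p₂ ≫ g ≫ r' by rw [hr])),
      ← cancel_epi (eqToHom (show p ≫ g ≫ r' = p ≫ r ≫ k by rw [hr]))]
    simp [e₁]
  have e₃ : θ ▷ g = eqToHom h.symm ≫ f ◁ θ' ≫ eqToHom h' := by
    rw [e]; simp
  rw [e₂, e₃]
  simp [Strict.associator_eqToIso]

def Modif.whiskerLeft {F G H : StrictPseudofunctor B C} (α : F ⟶ G) {β γ : G ⟶ H} (Γ : β ⟶ γ) :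
    α ≫ β ⟶ α ≫ γ :=
  Modif.mk (fun a => TwoNatTrans.app α a ◁ Modif.app Γ a) fun f =>
    paste_whiskerLeft (TwoNatTrans.naturality α f) _ _ _ _ (Modif.naturality Γ f) _ _

def Modif.whiskerRight {F G H : StrictPseudofunctor B C} {α β : F ⟶ G} (Γ : α ⟶ β) (γ : G ⟶ H) :
    α ≫ γ ⟶ β ≫ γ :=
  Modif.mk (fun a => Modif.app Γ a ▷ TwoNatTrans.app γ a) fun f =>
    paste_whiskerRight _ _ (TwoNatTrans.naturality γ f) _ _ (Modif.naturality Γ f) _ _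

theorem Modif.app_conj_aux {F G : StrictPseudofunctor B C} {α β γ δ : F ⟶ G} (h : α = β)
    (Γ : β ⟶ γ) (h' : γ = δ) (a : B) :
    Modif.app (eqToHom h ≫ Γ ≫ eqToHom h') a =
      eqToHom (by rw [h]) ≫ Modif.app Γ a ≫ eqToHom (by rw [h']) := by
  subst h h'
  rw [eqToHom_refl, eqToHom_refl, Category.id_comp, Category.comp_id, eqToHom_refl,
    eqToHom_refl, Category.id_comp, Category.comp_id]

theorem Modif.whiskerLeft_eqToHom {F G H : StrictPseudofunctor B C} (α : F ⟶ G)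
    {β γ : G ⟶ H} (h : β = γ) :
    Modif.whiskerLeft α (eqToHom h) = eqToHom (by rw [h]) := by
  subst h
  exact Modif.hom_ext_aux fun _ => whiskerLeft_id _ _

theorem Modif.whiskerRight_eqToHom {F G H : StrictPseudofunctor B C} {α β : F ⟶ G}
    (h : α = β) (γ : G ⟶ H) :
    Modif.whiskerRight (eqToHom h) γ = eqToHom (by rw [h]) := by
  subst h
  exact Modif.hom_ext_aux fun _ => id_whiskerRight _ _

theorem TwoNatTrans.id_comp_aux {F G : StrictPseudofunctor B C} (α : F ⟶ G) : 𝟙 F ≫ α = α :=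
  TwoNatTrans.hom_ext_aux fun _ => Strict.id_comp _

theorem TwoNatTrans.comp_id_aux {F G : StrictPseudofunctor B C} (α : F ⟶ G) : α ≫ 𝟙 G = α :=
  TwoNatTrans.hom_ext_aux fun _ => Strict.comp_id _

theorem TwoNatTrans.assoc_aux {F G H K : StrictPseudofunctor B C} (α : F ⟶ G) (β : G ⟶ H)
    (γ : H ⟶ K) : (α ≫ β) ≫ γ = α ≫ β ≫ γ :=
  TwoNatTrans.hom_ext_aux fun _ => Strict.assoc _ _ _

/-- The 2-category `Hom(B, C)` of 2-functors, 2-natural transformations and modifications. -/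
@[reducible]
def homBicategory : Bicategory (StrictPseudofunctor B C) where
  homCategory := Modif.category
  whiskerLeft := Modif.whiskerLeft
  whiskerRight := Modif.whiskerRight
  associator α β γ := eqToIso (TwoNatTrans.assoc_aux α β γ)
  leftUnitor α := eqToIso (TwoNatTrans.id_comp_aux α)
  rightUnitor α := eqToIso (TwoNatTrans.comp_id_aux α)
  whiskerLeft_id _ _ := Modif.hom_ext_aux fun _ => whiskerLeft_id _ _
  whiskerLeft_comp _ _ _ _ _ _ := Modif.hom_ext_aux fun _ => whiskerLeft_comp _ _ _
  id_whiskerLeft Γ := Modif.hom_ext_aux fun a =>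
    (id_whiskerLeft' _).trans
      (Modif.app_conj_aux (TwoNatTrans.id_comp_aux _) Γ (TwoNatTrans.id_comp_aux _).symm a).symm
  comp_whiskerLeft α β _ _ Γ := Modif.hom_ext_aux fun a =>
    (comp_whiskerLeft' _ _ _).trans
      (Modif.app_conj_aux (TwoNatTrans.assoc_aux α β _) (Modif.whiskerLeft α (Modif.whiskerLeft β Γ))
        (TwoNatTrans.assoc_aux α β _).symm a).symm
  id_whiskerRight _ _ := Modif.hom_ext_aux fun _ => id_whiskerRight _ _
  comp_whiskerRight _ _ _ := Modif.hom_ext_aux fun _ => comp_whiskerRight _ _ _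
  whiskerRight_id Γ := Modif.hom_ext_aux fun a =>
    (whiskerRight_id' _).trans
      (Modif.app_conj_aux (TwoNatTrans.comp_id_aux _) Γ (TwoNatTrans.comp_id_aux _).symm a).symm
  whiskerRight_comp Γ α β := Modif.hom_ext_aux fun a =>
    (whiskerRight_comp' _ _ _).trans
      (Modif.app_conj_aux (TwoNatTrans.assoc_aux _ α β).symm
        (Modif.whiskerRight (Modif.whiskerRight Γ α) β) (TwoNatTrans.assoc_aux _ α β) a).symm
  whisker_assoc α _ _ Γ β := Modif.hom_ext_aux fun a =>
    (whisker_assoc' _ _ _).trans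
      (Modif.app_conj_aux (TwoNatTrans.assoc_aux α _ β)
        (Modif.whiskerLeft α (Modif.whiskerRight Γ β)) (TwoNatTrans.assoc_aux α _ β).symm a).symm
  whisker_exchange _ _ := Modif.hom_ext_aux fun _ => whisker_exchange _ _
  pentagon α β γ δ := by
    simp only [eqToIso.hom, Modif.whiskerLeft_eqToHom, Modif.whiskerRight_eqToHom, eqToHom_trans]
  triangle α β := by
    simp only [eqToIso.hom, Modif.whiskerLeft_eqToHom, Modif.whiskerRight_eqToHom, eqToHom_trans]

end Auxiliary

instance : Bicategory (StrictPseudofunctor B C) := homBicategory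

instance : Strict (StrictPseudofunctor B C) where
  id_comp α := TwoNatTrans.id_comp_aux α
  comp_id α := TwoNatTrans.comp_id_aux α
  assoc α β γ := TwoNatTrans.assoc_aux α β γ
  leftUnitor_eqToIso _ := rfl
  rightUnitor_eqToIso _ := rfl
  associator_eqToIso _ _ _ := rfl

@[ext]
theorem TwoNatTrans.hom_ext {F G : StrictPseudofunctor B C} {α β : F ⟶ G}
    (h : ∀ a, TwoNatTrans.app α a = TwoNatTrans.app β a) : α = β :=
  TwoNatTrans.ext (funext h)

@[simp]
theorem TwoNatTrans.id_app (F : StrictPseudofunctor B C) (a : B) :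
    TwoNatTrans.app (𝟙 F) a = 𝟙 (F.obj a) := rfl

@[simp]
theorem TwoNatTrans.comp_app {F G H : StrictPseudofunctor B C} (α : F ⟶ G) (β : G ⟶ H) (a : B) :
    TwoNatTrans.app (α ≫ β) a = TwoNatTrans.app α a ≫ TwoNatTrans.app β a := rfl

@[ext]
theorem Modif.hom_ext {F G : StrictPseudofunctor B C} {α β : F ⟶ G} {Γ Λ : α ⟶ β}
    (h : ∀ a, Modif.app Γ a = Modif.app Λ a) : Γ = Λ :=
  Modif.ext (funext h)

@[simp]
theorem Modif.id_app {F G : StrictPseudofunctor B C} (α : F ⟶ G) (a : B) :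
    Modif.app (𝟙 α) a = 𝟙 (TwoNatTrans.app α a) := rfl

@[simp]
theorem Modif.comp_app {F G : StrictPseudofunctor B C} {α β γ : F ⟶ G}
    (Γ : α ⟶ β) (Λ : β ⟶ γ) (a : B) :
    Modif.app (Γ ≫ Λ) a = Modif.app Γ a ≫ Modif.app Λ a := rfl

@[simp]
theorem Modif.whiskerLeft_app {F G H : StrictPseudofunctor B C} (α : F ⟶ G) {β γ : G ⟶ H}
    (Γ : β ⟶ γ) (a : B) :
    Modif.app (α ◁ Γ) a = TwoNatTrans.app α a ◁ Modif.app Γ a := rfl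

@[simp]
theorem Modif.whiskerRight_app {F G H : StrictPseudofunctor B C} {α β : F ⟶ G} (Γ : α ⟶ β)
    (γ : G ⟶ H) (a : B) :
    Modif.app (Γ ▷ γ) a = Modif.app Γ a ▷ TwoNatTrans.app γ a := rfl

theorem Modif.app_conj {F G : StrictPseudofunctor B C} {α β γ δ : F ⟶ G} (h : α = β)
    (Γ : β ⟶ γ) (h' : γ = δ) (a : B) :
    Modif.app (eqToHom h ≫ Γ ≫ eqToHom h') a =
      eqToHom (by rw [h]) ≫ Modif.app Γ a ≫ eqToHom (by rw [h']) := by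
  subst h h'
  rw [eqToHom_refl, eqToHom_refl, Category.id_comp, Category.comp_id, eqToHom_refl,
    eqToHom_refl, Category.id_comp, Category.comp_id]

end TwoFunctors

section Basics

variable {B : Type u₁} [Bicategory.{w₁, v₁} B] {C : Type u₂} [Bicategory.{w₂, v₂} C]

theorem op2_eqToHom {a b : B} {f g : a ⟶ b} (h : f = g) :
    Bicategory.Opposite.op2 (eqToHom h) = eqToHom (congrArg Quiver.Hom.op h) := by
  subst h; rfl

instance [Strict B] : Strict Bᵒᵖ where
  id_comp _ := Quiver.Hom.unop_inj (Strict.comp_id _)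
  comp_id _ := Quiver.Hom.unop_inj (Strict.id_comp _)
  assoc _ _ _ := Quiver.Hom.unop_inj (Strict.assoc _ _ _).symm
  leftUnitor_eqToIso f := by
    apply Iso.ext
    refine (congrArg Bicategory.Opposite.op2
      (congrArg Iso.hom (Strict.rightUnitor_eqToIso f.unop))).trans ?_
    simp only [eqToIso.hom, op2_eqToHom]
  rightUnitor_eqToIso f := by
    apply Iso.ext
    refine (congrArg Bicategory.Opposite.op2
      (congrArg Iso.hom (Strict.leftUnitor_eqToIso f.unop))).trans ?_
    simp only [eqToIso.hom, op2_eqToHom]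
  associator_eqToIso f g h := by
    apply Iso.ext
    refine (congrArg Bicategory.Opposite.op2
      (congrArg Iso.inv (Strict.associator_eqToIso h.unop g.unop f.unop))).trans ?_
    simp only [eqToIso.inv, op2_eqToHom]
    rfl

/-- A functor is an isomorphism of categories if it has a strict inverse functor. -/
def IsIsoCat {X : Type u₁} [Category.{v₁} X] {Y : Type u₂} [Category.{v₂} Y] (F : X ⥤ Y) : Prop :=
  ∃ G : Y ⥤ X, F ⋙ G = 𝟭 X ∧ G ⋙ F = 𝟭 Y

/-- 2-filtered 2-categories: nonempty, any two objects map to a common object, parallel 1-cells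
become isomorphic after composing with some 1-cell, and parallel 2-cells become equal after
whiskering with some 1-cell. -/
structure IsTwoFiltered (I : Type u₁) [Bicategory.{w₁, v₁} I] : Prop where
  nonempty : Nonempty I
  cocone (i j : I) : ∃ k : I, Nonempty (i ⟶ k) ∧ Nonempty (j ⟶ k)
  cocone_map {i j : I} (f g : i ⟶ j) : ∃ (k : I) (h : j ⟶ k), Nonempty (f ≫ h ≅ g ≫ h)
  cocone_map₂ {i j : I} {f g : i ⟶ j} (α β : f ⟶ g) : ∃ (k : I) (h : j ⟶ k), α ▷ h = β ▷ h

/-- `F` is a 2-equivalence: there is a 2-functor `G` together with invertible 2-natural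
transformations between the composites and the identities. -/
def IsTwoEquivalence [Strict B] [Strict C] (F : StrictPseudofunctor B C) : Prop :=
  ∃ G : StrictPseudofunctor C B,
    (∃ (α : G.comp F ⟶ StrictPseudofunctor.id C) (β : StrictPseudofunctor.id C ⟶ G.comp F),
      α ≫ β = 𝟙 _ ∧ β ≫ α = 𝟙 _) ∧
    (∃ (α : F.comp G ⟶ StrictPseudofunctor.id B) (β : StrictPseudofunctor.id B ⟶ F.comp G),
      α ≫ β = 𝟙 _ ∧ β ≫ α = 𝟙 _)

end Basics

section PseudoLimits

open scoped Pseudofunctor.StrongTrans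

variable {J : Type u₁} [Bicategory.{w₁, v₁} J] [Strict J]
  {A : Type u₂} [Bicategory.{w₂, v₂} A] [Strict A]

variable (J) in
/-- The constant 2-functor with value `L`. -/
def const (L : A) : StrictPseudofunctor J A :=
  StrictPseudofunctor.mk''
    { obj := fun _ => L
      map := fun _ => 𝟙 L
      map₂ := fun _ => 𝟙 (𝟙 L)
      map_id := fun _ => rfl
      map_comp := fun _ _ => (Strict.id_comp _).symm
      map₂_whisker_left := by intros; simp
      map₂_whisker_right := by intros; simp }

/-- A pseudo-cone with vertex `L` over the pseudofunctor `X`: a pseudonatural transformation from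
the constant 2-functor at `L` to `X`. -/
abbrev PseudoCone (X : J ⥤ᵖ A) (L : A) := (const J L).toPseudofunctor ⟶ X

theorem constTrans_aux₁ {K L : A} (f : K ⟶ L) :
    𝟙 (𝟙 K) ▷ f ≫ (λ_ f).hom ≫ (ρ_ f).inv = ((λ_ f).hom ≫ (ρ_ f).inv) ≫ f ◁ 𝟙 (𝟙 L) := by
  simp

theorem constTrans_aux₂ {K L : A} (f : K ⟶ L) :
    ((λ_ f).hom ≫ (ρ_ f).inv) ≫ f ◁ eqToHom rfl =
      eqToHom rfl ▷ f ≫ (λ_ f).hom ≫ (ρ_ f).inv := by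
  simp

theorem constTrans_aux₃ {K L : A} (f : K ⟶ L) :
    ((λ_ f).hom ≫ (ρ_ f).inv) ≫ f ◁ eqToHom (Strict.id_comp (𝟙 L)).symm =
      eqToHom (Strict.id_comp (𝟙 K)).symm ▷ f ≫ (α_ _ _ _).hom ≫
        𝟙 K ◁ ((λ_ f).hom ≫ (ρ_ f).inv) ≫ (α_ _ _ _).inv ≫
        ((λ_ f).hom ≫ (ρ_ f).inv) ▷ 𝟙 L ≫ (α_ _ _ _).hom := by
  simp [Strict.leftUnitor_eqToIso, Strict.rightUnitor_eqToIso, Strict.associator_eqToIso]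

variable (J) in
/-- The pseudonatural transformation between constant 2-functors given by `f`. -/
def constTrans {K L : A} (f : K ⟶ L) :
    (const J K).toPseudofunctor ⟶ (const J L).toPseudofunctor :=
  Pseudofunctor.StrongTrans.mk (fun _ => f) (fun _ => λ_ f ≪≫ (ρ_ f).symm)
    (fun η => constTrans_aux₁ f) (fun a => constTrans_aux₂ f) (fun u v => constTrans_aux₃ f)

theorem constModif_aux {K L : A} {f g : K ⟶ L} (μ : f ⟶ g) :
    𝟙 K ◁ μ ≫ (λ_ g).hom ≫ (ρ_ g).inv = ((λ_ f).hom ≫ (ρ_ f).inv) ≫ μ ▷ 𝟙 L := by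
  simp

variable (J) in
/-- The modification between transformations of constant 2-functors given by `μ`. -/
def constModif {K L : A} {f g : K ⟶ L} (μ : f ⟶ g) : constTrans J f ⟶ constTrans J g :=
  ⟨⟨fun _ => μ, fun _ => constModif_aux μ⟩⟩

/-- Composition of a pseudo-cone with 1-cells and 2-cells into its vertex. -/
def coneFunctor {X : J ⥤ᵖ A} {L : A} (π : PseudoCone X L) (K : A) : (K ⟶ L) ⥤ PseudoCone X K where
  obj f := constTrans J f ≫ π
  map μ := constModif J μ ▷ π
  map_id f := Pseudofunctor.StrongTrans.homCategory.ext fun _ => id_whiskerRight _ _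
  map_comp μ ν := Pseudofunctor.StrongTrans.homCategory.ext fun _ => comp_whiskerRight _ _ _

/-- `π` is a pseudo-limit cone: for each `K`, composition with `π` is an isomorphism between
the category of 1-cells `K ⟶ L` and the category of pseudo-cones over `X` with vertex `K`. -/
def IsPseudoLimit {X : J ⥤ᵖ A} {L : A} (π : PseudoCone X L) : Prop :=
  ∀ K : A, IsIsoCat (coneFunctor π K)

variable (A) in
/-- `A` is closed under small 2-cofiltered pseudo-limits. -/
def HasTwoCofilteredPseudoLimits : Prop :=
  ∀ (J : Type w) [Bicategory.{w, w} J] [Strict J], IsTwoFiltered J →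
    ∀ X : Jᵒᵖ ⥤ᵖ A, ∃ (L : A) (π : PseudoCone X L), IsPseudoLimit π

variable {D : Type u₃} [Bicategory.{w₃, v₃} D]

theorem mapCone_aux₁ (H : A ⥤ᵖ D) {a b c : A} {p : a ⟶ c} {q : a ⟶ b} {x y : b ⟶ c}
    (θ : x ⟶ y) (s : 𝟙 a ≫ p ⟶ q ≫ x) (t : 𝟙 a ≫ p ⟶ q ≫ y)
    (h : 𝟙 (𝟙 a) ▷ p ≫ t = s ≫ q ◁ θ) :
    𝟙 (𝟙 (H.obj a)) ▷ H.map p ≫ (λ_ (H.map p)).hom ≫ H.map₂ ((λ_ p).inv ≫ t) ≫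
        (H.mapComp q y).hom =
      ((λ_ (H.map p)).hom ≫ H.map₂ ((λ_ p).inv ≫ s) ≫ (H.mapComp q x).hom) ≫
        H.map q ◁ H.map₂ θ := by
  rw [id_whiskerRight, Category.id_comp t] at h
  subst h
  simp

theorem mapCone_aux₂ (H : A ⥤ᵖ D) {a b : A} {p : a ⟶ b} {x : b ⟶ b}
    (i : x ⟶ 𝟙 b) (s : 𝟙 a ≫ p ⟶ p ≫ x)
    (h : s ≫ p ◁ i = eqToHom rfl ▷ p ≫ (λ_ p).hom ≫ (ρ_ p).inv) :
    ((λ_ (H.map p)).hom ≫ H.map₂ ((λ_ p).inv ≫ s) ≫ (H.mapComp p x).hom) ≫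
        H.map p ◁ (H.map₂ i ≫ (H.mapId b).hom) =
      eqToHom rfl ▷ H.map p ≫ (λ_ (H.map p)).hom ≫ (ρ_ (H.map p)).inv := by
  have h' : (λ_ p).inv ≫ s ≫ p ◁ i = (ρ_ p).inv := by rw [h]; simp
  have h₂ : H.map₂ ((λ_ p).inv ≫ s) ≫ (H.mapComp p x).hom ≫ H.map p ◁ H.map₂ i =
      H.map₂ (ρ_ p).inv ≫ (H.mapComp p (𝟙 b)).hom := by
    rw [← h']
    simp
  have h₃ : H.map₂ (ρ_ p).inv ≫ (H.mapComp p (𝟙 b)).hom ≫ H.map p ◁ (H.mapId b).hom =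
      (ρ_ (H.map p)).inv := by
    rw [← cancel_epi (H.map₂ (ρ_ p).hom)]
    simp only [← PrelaxFunctor.map₂_comp_assoc, Iso.hom_inv_id, PrelaxFunctor.map₂_id]
    rw [Category.id_comp (_ : H.map (p ≫ 𝟙 b) ⟶ _), H.map₂_right_unitor]
    simp
  rw [whiskerLeft_comp, eqToHom_refl, id_whiskerRight, Category.id_comp (_ : 𝟙 _ ≫ H.map p ⟶ _)]
  simp only [Category.assoc]
  rw [reassoc_of% h₂, h₃]

variable [Strict D]

theorem mapCone_aux₃ (H : A ⥤ᵖ D) {a b c d : A} {p : a ⟶ d} {r : a ⟶ c} {q : a ⟶ b}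
    {x : b ⟶ c} {y : c ⟶ d} {z : b ⟶ d} (i : z ⟶ x ≫ y)
    (s : 𝟙 a ≫ p ⟶ q ≫ z) (s₁ : 𝟙 a ≫ r ⟶ q ≫ x) (s₂ : 𝟙 a ≫ p ⟶ r ≫ y)
    (h : s ≫ q ◁ i = eqToHom (Strict.id_comp (𝟙 a)).symm ▷ p ≫ (α_ _ _ _).hom ≫
      𝟙 a ◁ s₂ ≫ (α_ _ _ _).inv ≫ s₁ ▷ y ≫ (α_ _ _ _).hom) :
    ((λ_ (H.map p)).hom ≫ H.map₂ ((λ_ p).inv ≫ s) ≫ (H.mapComp q z).hom) ≫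
        H.map q ◁ (H.map₂ i ≫ (H.mapComp x y).hom) =
      eqToHom (Strict.id_comp (𝟙 (H.obj a))).symm ▷ H.map p ≫ (α_ _ _ _).hom ≫
        𝟙 (H.obj a) ◁ ((λ_ (H.map p)).hom ≫ H.map₂ ((λ_ p).inv ≫ s₂) ≫ (H.mapComp r y).hom) ≫
        (α_ _ _ _).inv ≫
        ((λ_ (H.map r)).hom ≫ H.map₂ ((λ_ r).inv ≫ s₁) ≫ (H.mapComp q x).hom) ▷ H.map y ≫
        (α_ _ _ _).hom := by
  obtain ⟨s, rfl⟩ : ∃ s' : p ⟶ q ≫ z, s = (λ_ p).hom ≫ s' := ⟨(λ_ p).inv ≫ s, by simp⟩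
  obtain ⟨s₁, rfl⟩ : ∃ s' : r ⟶ q ≫ x, s₁ = (λ_ r).hom ≫ s' := ⟨(λ_ r).inv ≫ s₁, by simp⟩
  obtain ⟨s₂, rfl⟩ : ∃ s' : p ⟶ r ≫ y, s₂ = (λ_ p).hom ≫ s' := ⟨(λ_ p).inv ≫ s₂, by simp⟩
  have h' : s ≫ q ◁ i = s₂ ≫ s₁ ▷ y ≫ (α_ _ _ _).hom := by
    have he : eqToHom (Strict.id_comp (𝟙 a)).symm = (λ_ (𝟙 a)).inv := by
      simp [Strict.leftUnitor_eqToIso]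
    rw [he] at h
    rw [← cancel_epi (λ_ p).hom]
    refine (Category.assoc (λ_ p).hom s (q ◁ i)).symm.trans (h.trans ?_)
    simp
  have h₂ : H.map₂ s ≫ (H.mapComp q z).hom ≫ H.map q ◁ H.map₂ i =
      H.map₂ s₂ ≫ H.map₂ (s₁ ▷ y) ≫ H.map₂ (α_ _ _ _).hom ≫ (H.mapComp q (x ≫ y)).hom := by
    simp only [← PrelaxFunctor.map₂_comp_assoc]
    rw [← h']
    simp
  have he : eqToHom (Strict.id_comp (𝟙 (H.obj a))).symm = (λ_ (𝟙 (H.obj a))).inv := by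
    simp [Strict.leftUnitor_eqToIso]
  rw [he]
  simp only [Iso.inv_hom_id_assoc, whiskerLeft_comp, Category.assoc]
  rw [reassoc_of% h₂]
  simp

/-- The image of a pseudo-cone under a 2-functor. -/
def mapCone (H : StrictPseudofunctor A D) {X : J ⥤ᵖ A} {L : A} (π : PseudoCone X L) :
    PseudoCone (X.comp H.toPseudofunctor) (H.obj L) :=
  Pseudofunctor.StrongTrans.mk (fun j => H.map (π.app j))
    (fun {i j} u => λ_ (H.map (π.app j)) ≪≫
      H.map₂Iso ((λ_ (π.app j)).symm ≪≫ π.naturality u) ≪≫ H.mapComp (π.app i) (X.map u))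
    (fun {i j u v} η => mapCone_aux₁ H.toPseudofunctor (X.map₂ η) (π.naturality u).hom
      (π.naturality v).hom (π.naturality_naturality η))
    (fun i => mapCone_aux₂ H.toPseudofunctor (X.mapId i).hom (π.naturality (𝟙 i)).hom
      (π.naturality_id i))
    (fun u v => mapCone_aux₃ H.toPseudofunctor (X.mapComp u v).hom (π.naturality (u ≫ v)).hom
      (π.naturality u).hom (π.naturality v).hom (π.naturality_comp u v))

/-- The 2-functor `H` preserves small 2-cofiltered pseudo-limits. -/
def PreservesTwoCofilteredPseudoLimits (H : StrictPseudofunctor A D) : Prop :=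
  ∀ (J : Type w) [Bicategory.{w, w} J] [Strict J], IsTwoFiltered J →
    ∀ (X : Jᵒᵖ ⥤ᵖ A) (L : A) (π : PseudoCone X L), IsPseudoLimit π → IsPseudoLimit (mapCone H π)

end PseudoLimits

section PseudoColimits

namespace PseudoColimit

variable {I : Type u₁} [Bicategory.{w₁, v₁} I] (F : StrictPseudofunctor I Cat.{v₂, u₂})

/-- The objects of the pseudo-colimit of `F`: pairs of an index `i` and an object of `F i`. -/
structure Obj where
  ix : I
  val : F.obj ix

variable {F}

/-- Formal composites of the generating morphisms of the pseudo-colimit of `F`: the morphisms of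
the categories `F i`, the transition morphisms `x ⟶ F u x`, and their formal inverses. -/
inductive Word : Obj F → Obj F → Type max u₁ v₁ u₂ v₂
  | id (a : Obj F) : Word a a
  | comp {a b c : Obj F} (p : Word a b) (q : Word b c) : Word a c
  | incl {i : I} {x y : F.obj i} (r : x ⟶ y) : Word ⟨i, x⟩ ⟨i, y⟩
  | tr {i j : I} (u : i ⟶ j) (x : F.obj i) : Word ⟨i, x⟩ ⟨j, (F.map u).toFunctor.obj x⟩
  | trInv {i j : I} (u : i ⟶ j) (x : F.obj i) : Word ⟨j, (F.map u).toFunctor.obj x⟩ ⟨i, x⟩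

/-- The congruence on formal composites generated by: the category laws, functoriality of the
inclusions of the `F i`, invertibility and naturality of the transition morphisms, and their
compatibility with identities, composition and 2-cells of `I`. -/
inductive Rel : ∀ {a b : Obj F}, Word a b → Word a b → Prop
  | refl {a b : Obj F} (p : Word a b) : Rel p p
  | symm {a b : Obj F} {p q : Word a b} : Rel p q → Rel q p
  | trans {a b : Obj F} {p q r : Word a b} : Rel p q → Rel q r → Rel p r
  | congr {a b c : Obj F} {p p' : Word a b} {q q' : Word b c} :
      Rel p p' → Rel q q' → Rel (p.comp q) (p'.comp q')
  | id_comp {a b : Obj F} (p : Word a b) : Rel ((Word.id a).comp p) p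
  | comp_id {a b : Obj F} (p : Word a b) : Rel (p.comp (Word.id b)) p
  | assoc {a b c d : Obj F} (p : Word a b) (q : Word b c) (r : Word c d) :
      Rel ((p.comp q).comp r) (p.comp (q.comp r))
  | incl_id {i : I} (x : F.obj i) : Rel (Word.incl (𝟙 x)) (Word.id ⟨i, x⟩)
  | incl_comp {i : I} {x y z : F.obj i} (r : x ⟶ y) (s : y ⟶ z) :
      Rel (Word.incl (r ≫ s)) ((Word.incl r).comp (Word.incl s))
  | tr_trInv {i j : I} (u : i ⟶ j) (x : F.obj i) :
      Rel ((Word.tr u x).comp (Word.trInv u x)) (Word.id ⟨i, x⟩)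
  | trInv_tr {i j : I} (u : i ⟶ j) (x : F.obj i) :
      Rel ((Word.trInv u x).comp (Word.tr u x)) (Word.id ⟨j, (F.map u).toFunctor.obj x⟩)
  | tr_naturality {i j : I} (u : i ⟶ j) {x y : F.obj i} (r : x ⟶ y) :
      Rel ((Word.incl r).comp (Word.tr u y))
        ((Word.tr u x).comp (Word.incl ((F.map u).toFunctor.map r)))
  | tr_id (i : I) (x : F.obj i) :
      Rel ((Word.tr (𝟙 i) x).comp (Word.incl ((F.mapId i).hom.toNatTrans.app x)))
        (Word.id ⟨i, x⟩)
  | tr_comp {i j k : I} (u : i ⟶ j) (v : j ⟶ k) (x : F.obj i) :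
      Rel ((Word.tr (u ≫ v) x).comp (Word.incl ((F.mapComp u v).hom.toNatTrans.app x)))
        ((Word.tr u x).comp (Word.tr v ((F.map u).toFunctor.obj x)))
  | tr_map₂ {i j : I} {u v : i ⟶ j} (η : u ⟶ v) (x : F.obj i) :
      Rel ((Word.tr u x).comp (Word.incl ((F.map₂ η).toNatTrans.app x))) (Word.tr v x)

instance : Category (Obj F) where
  Hom a b := Quot (Rel (a := a) (b := b))
  id a := Quot.mk _ (Word.id a)
  comp {a b c} p q := Quot.map₂ Word.comp
    (fun p _ _ h => Rel.congr (Rel.refl p) h) (fun _ _ q h => Rel.congr h (Rel.refl q)) p q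
  id_comp {a b} p := Quot.inductionOn p fun p => Quot.sound (Rel.id_comp p)
  comp_id {a b} p := Quot.inductionOn p fun p => Quot.sound (Rel.comp_id p)
  assoc {a b c d} p q r := Quot.inductionOn p fun p => Quot.inductionOn q fun q =>
    Quot.inductionOn r fun r => Quot.sound (Rel.assoc p q r)

variable (F)

/-- The inclusion of `F i` into the pseudo-colimit. -/
def incl (i : I) : F.obj i ⥤ Obj F where
  obj x := ⟨i, x⟩
  map r := Quot.mk _ (Word.incl r)
  map_id x := Quot.sound (Rel.incl_id x)
  map_comp r s := Quot.sound (Rel.incl_comp r s)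

/-- The transition isomorphism of the pseudo-colimit. -/
def tr {i j : I} (u : i ⟶ j) : incl F i ≅ (F.map u).toFunctor ⋙ incl F j :=
  NatIso.ofComponents
    (fun x =>
      { hom := Quot.mk _ (Word.tr u x)
        inv := Quot.mk _ (Word.trInv u x)
        hom_inv_id := Quot.sound (Rel.tr_trInv u x)
        inv_hom_id := Quot.sound (Rel.trInv_tr u x) })
    (fun r => Quot.sound (Rel.tr_naturality u r))

theorem tr_id (i : I) (x : F.obj i) :
    (tr F (𝟙 i)).hom.app x ≫ (incl F i).map ((F.mapId i).hom.toNatTrans.app x) =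
      𝟙 ((incl F i).obj x) :=
  Quot.sound (Rel.tr_id i x)

theorem tr_comp {i j k : I} (u : i ⟶ j) (v : j ⟶ k) (x : F.obj i) :
    (tr F (u ≫ v)).hom.app x ≫ (incl F k).map ((F.mapComp u v).hom.toNatTrans.app x) =
      (tr F u).hom.app x ≫ (tr F v).hom.app ((F.map u).toFunctor.obj x) :=
  Quot.sound (Rel.tr_comp u v x)

theorem tr_map₂ {i j : I} {u v : i ⟶ j} (η : u ⟶ v) (x : F.obj i) :
    (tr F u).hom.app x ≫ (incl F j).map ((F.map₂ η).toNatTrans.app x) = (tr F v).hom.app x :=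
  Quot.sound (Rel.tr_map₂ η x)

variable {F}

/-- A property of morphisms of the pseudo-colimit holds if it holds for the generators and is
stable under composition. -/
theorem hom_induction {P : ∀ {a b : Obj F}, (a ⟶ b) → Prop}
    (hcomp : ∀ {a b c : Obj F} (p : a ⟶ b) (q : b ⟶ c), P p → P q → P (p ≫ q))
    (hid : ∀ a : Obj F, P (𝟙 a))
    (hincl : ∀ {i : I} {x y : F.obj i} (r : x ⟶ y), P ((incl F i).map r))
    (htr : ∀ {i j : I} (u : i ⟶ j) (x : F.obj i), P ((tr F u).hom.app x))
    (htrInv : ∀ {i j : I} (u : i ⟶ j) (x : F.obj i), P ((tr F u).inv.app x))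
    {a b : Obj F} (p : a ⟶ b) : P p := by
  obtain ⟨w⟩ := p
  clear p
  induction w with
  | id a => exact hid a
  | comp p q hp hq => exact hcomp _ _ hp hq
  | incl r => exact hincl r
  | tr u x => exact htr u x
  | trInv u x => exact htrInv u x

theorem tr_square {i j : I} (u : i ⟶ j) {y y' : F.obj i} {z z' : F.obj j}
    (a : (F.map u).toFunctor.obj y ⟶ z) (b : z ⟶ z') (c : y ⟶ y')
    (d : (F.map u).toFunctor.obj y' ⟶ z') (h : a ≫ b = (F.map u).toFunctor.map c ≫ d) :
    ((tr F u).hom.app y ≫ (incl F j).map a) ≫ (incl F j).map b =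
      (incl F i).map c ≫ (tr F u).hom.app y' ≫ (incl F j).map d := by
  have h₁ := (tr F u).hom.naturality c
  rw [reassoc_of% h₁, Category.assoc, ← Functor.map_comp, h, Functor.map_comp]

section Desc

variable {E : Type u₃} [Category.{v₃} E] (D : ∀ i, F.obj i ⥤ E)
  (θ : ∀ {i j : I} (u : i ⟶ j), D i ≅ (F.map u).toFunctor ⋙ D j)

def descObj (a : Obj F) : E := (D a.ix).obj a.val

def descWord : ∀ {a b : Obj F}, Word a b → (descObj D a ⟶ descObj D b)
  | _, _, Word.id a => 𝟙 _
  | _, _, Word.comp p q => descWord p ≫ descWord q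
  | _, _, Word.incl r => (D _).map r
  | _, _, Word.tr u x => (θ u).hom.app x
  | _, _, Word.trInv u x => (θ u).inv.app x

/-- The functor out of the pseudo-colimit induced by a pseudo-cocone. -/
def desc (hid : ∀ (i : I) (x : F.obj i),
      (θ (𝟙 i)).hom.app x ≫ (D i).map ((F.mapId i).hom.toNatTrans.app x) = 𝟙 ((D i).obj x))
    (hcomp : ∀ {i j k : I} (u : i ⟶ j) (v : j ⟶ k) (x : F.obj i),
      (θ (u ≫ v)).hom.app x ≫ (D k).map ((F.mapComp u v).hom.toNatTrans.app x) =
        (θ u).hom.app x ≫ (θ v).hom.app ((F.map u).toFunctor.obj x))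
    (hmap₂ : ∀ {i j : I} {u v : i ⟶ j} (η : u ⟶ v) (x : F.obj i),
      (θ u).hom.app x ≫ (D j).map ((F.map₂ η).toNatTrans.app x) = (θ v).hom.app x) :
    Obj F ⥤ E where
  obj := descObj D
  map := Quot.lift (descWord D θ) (fun p q h => by
    induction h with
    | refl p => rfl
    | symm _ ih => exact ih.symm
    | trans _ _ ih ih' => exact ih.trans ih'
    | congr _ _ ih ih' => exact congrArg₂ (· ≫ ·) ih ih'
    | id_comp p => exact Category.id_comp _
    | comp_id p => exact Category.comp_id _
    | assoc p q r => exact Category.assoc _ _ _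
    | incl_id x => exact (D _).map_id x
    | incl_comp r s => exact (D _).map_comp r s
    | tr_trInv u x => exact (θ u).hom_inv_id_app x
    | trInv_tr u x => exact (θ u).inv_hom_id_app x
    | tr_naturality u r => exact (θ u).hom.naturality r
    | tr_id i x => exact hid i x
    | tr_comp u v x => exact hcomp u v x
    | tr_map₂ η x => exact hmap₂ η x)
  map_id _ := rfl
  map_comp {a b c} p q := Quot.inductionOn p fun p => Quot.inductionOn q fun q => rfl

end Desc

/-- Two functors out of the pseudo-colimit that agree on the inclusions and on the transition
morphisms are equal. -/
theorem functor_ext {E : Type u₃} [Category.{v₃} E] {P Q : Obj F ⥤ E}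
    (hobj : ∀ a, P.obj a = Q.obj a)
    (hincl : ∀ {i : I} {x y : F.obj i} (r : x ⟶ y),
      P.map ((incl F i).map r) ≍ Q.map ((incl F i).map r))
    (htr : ∀ {i j : I} (u : i ⟶ j) (x : F.obj i),
      P.map ((tr F u).hom.app x) ≍ Q.map ((tr F u).hom.app x)) : P = Q := by
  refine CategoryTheory.Functor.ext hobj fun a b p => ?_
  refine hom_induction (P := fun {a b} p =>
    P.map p = eqToHom (hobj _) ≫ Q.map p ≫ eqToHom (hobj _).symm) ?_ ?_
    (fun r => (conj_eqToHom_iff_heq _ _ (hobj _) (hobj _)).2 (hincl r))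
    (fun u x => (conj_eqToHom_iff_heq _ _ (hobj _) (hobj _)).2 (htr u x)) ?_ p
  · intro a b c p q hp hq
    simp [hp, hq]
  · intro a
    simp
  · intro i j u x
    have h := (conj_eqToHom_iff_heq _ _ (hobj _) (hobj _)).2 (htr u x)
    rw [← cancel_epi (P.map ((tr F u).hom.app x)), ← P.map_comp, Iso.hom_inv_id_app, h]
    simp [← Functor.map_comp_assoc]

theorem natural_inv {X : Type u₁} [Category.{v₁} X] {E : Type u₃} [Category.{v₃} E] {P Q : X ⥤ E}
    (t : ∀ a, P.obj a ⟶ Q.obj a) {a b : X} (e : a ≅ b)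
    (h : P.map e.hom ≫ t b = t a ≫ Q.map e.hom) : P.map e.inv ≫ t a = t b ≫ Q.map e.inv := by
  rw [← cancel_epi (P.map e.hom), ← P.map_comp_assoc, e.hom_inv_id, reassoc_of% h,
    ← Q.map_comp, e.hom_inv_id]
  simp

/-- A family of morphisms is natural if it is natural on the inclusions and on the transition
morphisms. -/
theorem natural_of {E : Type u₃} [Category.{v₃} E] {P Q : Obj F ⥤ E}
    (t : ∀ a, P.obj a ⟶ Q.obj a)
    (hincl : ∀ {i : I} {x y : F.obj i} (r : x ⟶ y),
      P.map ((incl F i).map r) ≫ t _ = t _ ≫ Q.map ((incl F i).map r))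
    (htr : ∀ {i j : I} (u : i ⟶ j) (x : F.obj i),
      P.map ((tr F u).hom.app x) ≫ t _ = t _ ≫ Q.map ((tr F u).hom.app x))
    {a b : Obj F} (p : a ⟶ b) : P.map p ≫ t b = t a ≫ Q.map p := by
  refine hom_induction (P := fun {a b} p => P.map p ≫ t b = t a ≫ Q.map p) ?_ ?_ hincl htr ?_ p
  · intro a b c p q hp hq
    rw [P.map_comp, Q.map_comp, Category.assoc, hq, reassoc_of% hp]
  · intro a
    simp
  · intro i j u x
    exact natural_inv t ((tr F u).app x) (htr u x)

variable {G H : StrictPseudofunctor I Cat.{v₂, u₂}}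

theorem hom₂_congr_app {X Y : Cat.{v₂, u₂}} {P Q : X ⟶ Y} {η η' : P ⟶ Q} (h : η = η') (x : X) :
    η.toNatTrans.app x = η'.toNatTrans.app x := by
  rw [h]

theorem eqToHom_toNatTrans_app {X Y : Cat.{v₂, u₂}} {P Q : X ⟶ Y} (h : P = Q) (x : X) :
    (eqToHom h).toNatTrans.app x = eqToHom (by rw [h]) := by
  subst h; rfl

theorem naturality_obj (α : F ⟶ G) {i j : I} (u : i ⟶ j) (x : F.obj i) :
    (G.map u).toFunctor.obj ((TwoNatTrans.app α i).toFunctor.obj x) =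
      (TwoNatTrans.app α j).toFunctor.obj ((F.map u).toFunctor.obj x) :=
  congrArg (fun P => (Cat.Hom.toFunctor P).obj x) (TwoNatTrans.naturality α u).symm

/-- The transition isomorphisms `α x ⟶ G u (α x) = α (F u x)`. -/
def mapTr (α : F ⟶ G) {i j : I} (u : i ⟶ j) :
    (TwoNatTrans.app α i).toFunctor ⋙ incl G i ≅
      (F.map u).toFunctor ⋙ (TwoNatTrans.app α j).toFunctor ⋙ incl G j :=
  Functor.isoWhiskerLeft (TwoNatTrans.app α i).toFunctor (tr G u) ≪≫
    Functor.isoWhiskerRight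
      (eqToIso (congrArg Cat.Hom.toFunctor (TwoNatTrans.naturality α u).symm)) (incl G j)

theorem mapTr_hom_app (α : F ⟶ G) {i j : I} (u : i ⟶ j) (x : F.obj i) :
    (mapTr α u).hom.app x = (tr G u).hom.app ((TwoNatTrans.app α i).toFunctor.obj x) ≫
      (incl G j).map (eqToHom (naturality_obj α u x)) := by
  simp [mapTr]

theorem map_aux₁ (α : F ⟶ G) (i : I) (x : F.obj i) :
    eqToHom (naturality_obj α (𝟙 i) x) ≫
        (TwoNatTrans.app α i).toFunctor.map ((F.mapId i).hom.toNatTrans.app x) =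
      (G.mapId i).hom.toNatTrans.app ((TwoNatTrans.app α i).toFunctor.obj x) := by
  rw [F.mapId_eq_eqToIso, G.mapId_eq_eqToIso]
  simp only [eqToIso.hom, eqToHom_toNatTrans_app, eqToHom_map]
  exact eqToHom_trans _ _

theorem map_aux₂ (α : F ⟶ G) {i j k : I} (u : i ⟶ j) (v : j ⟶ k) (x : F.obj i) :
    eqToHom (naturality_obj α (u ≫ v) x) ≫
        (TwoNatTrans.app α k).toFunctor.map ((F.mapComp u v).hom.toNatTrans.app x) =
      (G.mapComp u v).hom.toNatTrans.app ((TwoNatTrans.app α i).toFunctor.obj x) ≫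
        (G.map v).toFunctor.map (eqToHom (naturality_obj α u x)) ≫
        eqToHom (naturality_obj α v ((F.map u).toFunctor.obj x)) := by
  rw [F.mapComp_eq_eqToIso, G.mapComp_eq_eqToIso]
  simp only [eqToIso.hom, eqToHom_toNatTrans_app, eqToHom_map, eqToHom_trans]

theorem map_aux₃ (α : F ⟶ G) {i j : I} {u v : i ⟶ j} (η : u ⟶ v) (x : F.obj i) :
    eqToHom (naturality_obj α u x) ≫
        (TwoNatTrans.app α j).toFunctor.map ((F.map₂ η).toNatTrans.app x) =
      (G.map₂ η).toNatTrans.app ((TwoNatTrans.app α i).toFunctor.obj x) ≫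
        eqToHom (naturality_obj α v x) := by
  have h := hom₂_congr_app (TwoNatTrans.naturality₂ α η) x
  simp only [Cat.Hom₂.comp_app, eqToHom_toNatTrans_app] at h
  have h' : (TwoNatTrans.app α j).toFunctor.map ((F.map₂ η).toNatTrans.app x) ≫
        eqToHom (naturality_obj α v x).symm =
      eqToHom (naturality_obj α u x).symm ≫
        (G.map₂ η).toNatTrans.app ((TwoNatTrans.app α i).toFunctor.obj x) := h
  rw [eqToHom_comp_iff, ← reassoc_of% h']
  simp

/-- The functor between pseudo-colimits induced by a 2-natural transformation. -/
def map (α : F ⟶ G) : Obj F ⥤ Obj G :=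
  desc (fun i => (TwoNatTrans.app α i).toFunctor ⋙ incl G i) (fun u => mapTr α u)
    (fun i x => by
      rw [mapTr_hom_app, Functor.comp_map, Category.assoc, ← Functor.map_comp, map_aux₁]
      exact tr_id G i _)
    (fun u v x => by
      rw [mapTr_hom_app, mapTr_hom_app, mapTr_hom_app, Functor.comp_map, Category.assoc,
        ← Functor.map_comp, map_aux₂, Functor.map_comp, reassoc_of% tr_comp G u v]
      simp)
    (fun η x => by
      rw [mapTr_hom_app, mapTr_hom_app, Functor.comp_map, Category.assoc,
        ← Functor.map_comp, map_aux₃, Functor.map_comp, reassoc_of% tr_map₂ G η])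

theorem map_incl (α : F ⟶ G) {i : I} {x y : F.obj i} (r : x ⟶ y) :
    (map α).map ((incl F i).map r) =
      (incl G i).map ((TwoNatTrans.app α i).toFunctor.map r) := rfl

theorem map_tr (α : F ⟶ G) {i j : I} (u : i ⟶ j) (x : F.obj i) :
    (map α).map ((tr F u).hom.app x) =
      (tr G u).hom.app ((TwoNatTrans.app α i).toFunctor.obj x) ≫
      (incl G j).map (eqToHom (naturality_obj α u x)) :=
  mapTr_hom_app α u x

theorem map_id (F : StrictPseudofunctor I Cat.{v₂, u₂}) : map (𝟙 F) = 𝟭 (Obj F) := by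
  refine functor_ext (fun a => rfl) (fun r => HEq.rfl) (fun u x => heq_of_eq ?_)
  refine (map_tr (𝟙 F) u x).trans ?_
  refine (congrArg (fun t => (tr F u).hom.app x ≫ t) ((incl F _).map_id _)).trans ?_
  exact Category.comp_id _

theorem map_comp_aux (β : G ⟶ H) {i j : I} (u : i ⟶ j) (y : G.obj i) {z : G.obj j}
    (k : (G.map u).toFunctor.obj y ⟶ z) (e) (h : e = eqToHom (naturality_obj β u y) ≫
      (TwoNatTrans.app β j).toFunctor.map k) :
    (map β).map ((tr G u).hom.app y ≫ (incl G j).map k) =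
      (tr H u).hom.app ((TwoNatTrans.app β i).toFunctor.obj y) ≫ (incl H j).map e := by
  refine ((map β).map_comp _ _).trans ((congrArg₂ (· ≫ ·) (map_tr β u y) (map_incl β k)).trans ?_)
  rw [h, Functor.map_comp]
  exact Category.assoc _ _ _

theorem map_comp_aux₂ (α : F ⟶ G) (β : G ⟶ H) {i j : I} (u : i ⟶ j) (x : F.obj i) (h) :
    eqToHom h = eqToHom (naturality_obj β u ((TwoNatTrans.app α i).toFunctor.obj x)) ≫
      (TwoNatTrans.app β j).toFunctor.map (eqToHom (naturality_obj α u x)) := by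
  rw [eqToHom_map, eqToHom_trans]

theorem map_comp (α : F ⟶ G) (β : G ⟶ H) : map (α ≫ β) = map α ⋙ map β := by
  refine functor_ext (fun a => rfl) (fun r => HEq.rfl) (fun u x => heq_of_eq ?_)
  exact (map_tr (α ≫ β) u x).trans ((congrArg (map β).map (map_tr α u x)).trans
    (map_comp_aux β u _ (eqToHom (naturality_obj α u x)) _ (map_comp_aux₂ α β u x _))).symm

theorem mapModif_aux {α β : F ⟶ G} (Γ : α ⟶ β) {i j : I} (u : i ⟶ j) (x : F.obj i) :
    eqToHom (naturality_obj α u x) ≫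
        (Modif.app Γ j).toNatTrans.app ((F.map u).toFunctor.obj x) =
      (G.map u).toFunctor.map ((Modif.app Γ i).toNatTrans.app x) ≫
        eqToHom (naturality_obj β u x) := by
  have h := hom₂_congr_app (Modif.naturality Γ u) x
  simp only [Cat.Hom₂.comp_app, eqToHom_toNatTrans_app] at h
  have h' : (Modif.app Γ j).toNatTrans.app ((F.map u).toFunctor.obj x) ≫
        eqToHom (naturality_obj β u x).symm =
      eqToHom (naturality_obj α u x).symm ≫
        (G.map u).toFunctor.map ((Modif.app Γ i).toNatTrans.app x) := h
  rw [eqToHom_comp_iff, ← reassoc_of% h']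
  simp

/-- The natural transformation between functors of pseudo-colimits induced by a modification. -/
def mapModif {α β : F ⟶ G} (Γ : α ⟶ β) : map α ⟶ map β where
  app a := (incl G a.ix).map ((Modif.app Γ a.ix).toNatTrans.app a.val)
  naturality a b p := by
    refine natural_of (P := map α) (Q := map β)
      (fun a => (incl G a.ix).map ((Modif.app Γ a.ix).toNatTrans.app a.val)) ?_ ?_ p
    · intro i x y r
      exact ((incl G i).map_comp _ _).symm.trans
        ((congrArg (incl G i).map ((Modif.app Γ i).toNatTrans.naturality r)).trans
          ((incl G i).map_comp _ _))
    · intro i j u x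
      rw [map_tr, map_tr]
      exact tr_square u _ _ _ _ (mapModif_aux Γ u x)

theorem app_conj {X Y : Cat.{v₂, u₂}} {P P' Q Q' : X ⟶ Y} (η : P ⟶ Q) (h : P' = P) (h' : Q = Q')
    (x : X) : (eqToHom h ≫ η ≫ eqToHom h').toNatTrans.app x =
      eqToHom (by rw [h]) ≫ η.toNatTrans.app x ≫ eqToHom (by rw [h']) := by
  subst h h'
  simp

theorem conj_rfl {X : Type u₁} [Category.{v₁} X] {a b : X} (f : a ⟶ b) :
    eqToHom rfl ≫ f ≫ eqToHom rfl = f := by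
  simp

/-- The pseudo-colimit of category-valued 2-functors, as a 2-functor. -/
def _root_.TwoCat.pseudoColim (I : Type u₁) [Bicategory.{w₁, v₁} I] :
    StrictPseudofunctor (StrictPseudofunctor I Cat.{v₂, u₂})
      Cat.{max u₁ v₁ u₂ v₂, max u₁ u₂} :=
  StrictPseudofunctor.mk''
    { obj := fun F => Cat.of (Obj F)
      map := fun α => (map α).toCatHom
      map₂ := fun Γ => (mapModif Γ).toCatHom₂
      map₂_id := fun α => by
        apply Cat.Hom₂.ext
        ext a
        exact (incl _ _).map_id _
      map₂_comp := fun Γ Λ => by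
        apply Cat.Hom₂.ext
        ext a
        exact (incl _ _).map_comp _ _
      map_id := fun F => congrArg Functor.toCatHom (map_id F)
      map_comp := fun α β => congrArg Functor.toCatHom (map_comp α β)
      map₂_whisker_left := fun α β γ Γ => by
        apply Cat.Hom₂.ext
        ext a
        refine Eq.trans ?_ (app_conj ((map α).toCatHom ◁ (mapModif Γ).toCatHom₂)
          (congrArg Functor.toCatHom (map_comp α β))
          (congrArg Functor.toCatHom (map_comp α γ)).symm a).symm
        refine Eq.trans ?_ (conj_rfl _).symm
        rfl
      map₂_whisker_right := fun Γ γ => by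
        apply Cat.Hom₂.ext
        ext a
        refine Eq.trans ?_ (app_conj ((mapModif Γ).toCatHom₂ ▷ (map γ).toCatHom)
          (congrArg Functor.toCatHom (map_comp _ γ))
          (congrArg Functor.toCatHom (map_comp _ γ)).symm a).symm
        refine Eq.trans ?_ (conj_rfl _).symm
        rfl }

end PseudoColimit

end PseudoColimits

section HomDiagrams

open Opposite

variable {C : Type u} [Bicategory.{v₁, v₂} C]

theorem map₂_whiskerRight_strict {B : Type u₁} [Bicategory.{w₁, w₂} B] (X : StrictPseudofunctor B C)
    {a b c : B} {f g : a ⟶ b} (η : f ⟶ g) (k : b ⟶ c) :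
    X.map₂ (η ▷ k) = eqToHom (X.map_comp f k) ≫ X.map₂ η ▷ X.map k ≫
      eqToHom (X.map_comp g k).symm := by
  rw [X.map₂_whisker_right, X.mapComp_eq_eqToIso, X.mapComp_eq_eqToIso]
  rfl

theorem map₂_whiskerLeft_strict {B : Type u₁} [Bicategory.{w₁, w₂} B] (X : StrictPseudofunctor B C)
    {a b c : B} (k : a ⟶ b) {f g : b ⟶ c} (η : f ⟶ g) :
    X.map₂ (k ◁ η) = eqToHom (X.map_comp k f) ≫ X.map k ◁ X.map₂ η ≫
      eqToHom (X.map_comp k g).symm := by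
  rw [X.map₂_whisker_left, X.mapComp_eq_eqToIso, X.mapComp_eq_eqToIso]
  rfl

variable [Strict C]

theorem precomp_id (a d : C) : (precomp d (𝟙 a)).toCatHom = 𝟙 (Cat.of (a ⟶ d)) :=
  congrArg Functor.toCatHom (CategoryTheory.Functor.ext (fun h => Strict.id_comp h)
    (fun _ _ η => id_whiskerLeft' η))

theorem precomp_comp {a b c : C} (f : a ⟶ b) (g : b ⟶ c) (d : C) :
    (precomp d (f ≫ g)).toCatHom = (precomp d g).toCatHom ≫ (precomp d f).toCatHom :=
  congrArg Functor.toCatHom (CategoryTheory.Functor.ext (fun h => Strict.assoc f g h)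
    (fun _ _ η => comp_whiskerLeft' f g η))

theorem postcomp_id (a d : C) : (postcomp a (𝟙 d)).toCatHom = 𝟙 (Cat.of (a ⟶ d)) :=
  congrArg Functor.toCatHom (CategoryTheory.Functor.ext (fun h => Strict.comp_id h)
    (fun _ _ η => whiskerRight_id' η))

theorem postcomp_comp (a : C) {b c d : C} (g : b ⟶ c) (h : c ⟶ d) :
    (postcomp a (g ≫ h)).toCatHom = (postcomp a g).toCatHom ≫ (postcomp a h).toCatHom :=
  congrArg Functor.toCatHom (CategoryTheory.Functor.ext (fun f => (Strict.assoc f g h).symm)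
    (fun _ _ η => whiskerRight_comp' η g h))

theorem precomp_postcomp {a b c d : C} (f : a ⟶ b) (h : c ⟶ d) :
    (precomp c f).toCatHom ≫ (postcomp a h).toCatHom =
      (postcomp b h).toCatHom ≫ (precomp d f).toCatHom :=
  congrArg Functor.toCatHom (CategoryTheory.Functor.ext (fun g => Strict.assoc f g h)
    (fun _ _ η => whisker_assoc' f η h))

theorem whiskerRight_aux₁ {a b c d : C} {k : a ⟶ b} {f g : b ⟶ c} {p q : a ⟶ c} (ζ : p ⟶ q)
    (θ : f ⟶ g) (e : p = k ≫ f) (e' : k ≫ g = q) (h : c ⟶ d)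
    (w : ζ = eqToHom e ≫ k ◁ θ ≫ eqToHom e') :
    ζ ▷ h = eqToHom (by rw [e, Strict.assoc]) ≫ k ◁ θ ▷ h ≫
      eqToHom (by rw [← e', Strict.assoc]) := by
  subst e e'
  simp [w, Strict.associator_eqToIso]

theorem whiskerRight_aux₂ {a b c d : C} {f g : a ⟶ b} {k : b ⟶ c} {p q : a ⟶ c} (ζ : p ⟶ q)
    (θ : f ⟶ g) (e : p = f ≫ k) (e' : g ≫ k = q) (h : c ⟶ d)
    (w : ζ = eqToHom e ≫ θ ▷ k ≫ eqToHom e') :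
    ζ ▷ h = eqToHom (by rw [e, Strict.assoc]) ≫ θ ▷ (k ≫ h) ≫
      eqToHom (by rw [← e', Strict.assoc]) := by
  subst e e'
  simp [w, Strict.associator_eqToIso]

variable {I : Type u₁} [Bicategory.{w₁, w₂} I] [Strict I]

/-- The 2-functor `i ↦ C(X i, A)`. -/
def homDiagramObj (X : StrictPseudofunctor Iᵒᵖ C) (A : C) :
    StrictPseudofunctor I Cat.{v₁, v₂} :=
  StrictPseudofunctor.mk''
    { obj := fun i => Cat.of (X.obj (op i) ⟶ A)
      map := fun u => (precomp A (X.map u.op)).toCatHom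
      map₂ := fun η => ((precomposing _ _ A).map
        (X.map₂ (Bicategory.Opposite.op2 η))).toCatHom₂
      map₂_id := fun u => by
        apply Cat.Hom₂.ext
        ext h
        exact (congrArg (fun ζ => ζ ▷ h) (X.map₂_id u.op)).trans (id_whiskerRight _ _)
      map₂_comp := fun η θ => by
        apply Cat.Hom₂.ext
        ext h
        exact (congrArg (fun ζ => ζ ▷ h) (X.map₂_comp _ _)).trans (comp_whiskerRight _ _ _)
      map_id := fun i => (congrArg (fun f => (precomp A f).toCatHom) (X.map_id (op i))).trans
        (precomp_id _ _)
      map_comp := fun u v =>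
        (congrArg (fun f => (precomp A f).toCatHom) (X.map_comp v.op u.op)).trans
        (precomp_comp _ _ _)
      map₂_whisker_left := fun u v v' η => by
        apply Cat.Hom₂.ext
        ext h
        refine Eq.trans ?_ (PseudoColimit.app_conj _ _ _ h).symm
        exact whiskerRight_aux₂ _ _ _ _ h (map₂_whiskerRight_strict X _ _)
      map₂_whisker_right := fun η u => by
        apply Cat.Hom₂.ext
        ext h
        refine Eq.trans ?_ (PseudoColimit.app_conj _ _ _ h).symm
        exact whiskerRight_aux₁ _ _ _ _ h (map₂_whiskerLeft_strict X _ _) }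

theorem toNatTrans_comp_eqToHom_app {X Y : Cat.{v₂, u₂}} {P Q Q' : X ⟶ Y} (η : P ⟶ Q)
    (h : Q = Q') (x : X) :
    (η ≫ eqToHom h).toNatTrans.app x = η.toNatTrans.app x ≫ eqToHom (by rw [h]) := by
  subst h
  simp

theorem toNatTrans_eqToHom_comp_app {X Y : Cat.{v₂, u₂}} {P P' Q : X ⟶ Y} (h : P = P')
    (η : P' ⟶ Q) (x : X) :
    (eqToHom h ≫ η).toNatTrans.app x = eqToHom (by rw [h]) ≫ η.toNatTrans.app x := by
  subst h
  simp

theorem homDiagram_aux₁ {a b c d : C} {f f' : a ⟶ b} (η : f ⟶ f') (h : b ⟶ c) (g : c ⟶ d) :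
    η ▷ h ▷ g ≫ eqToHom (Strict.assoc f' h g) = eqToHom (Strict.assoc f h g) ≫ η ▷ (h ≫ g) := by
  rw [whiskerRight_comp']
  simp

theorem homDiagram_aux₂ {a b c d : C} (f : a ⟶ b) (h : b ⟶ c) {g g' : c ⟶ d} (γ : g ⟶ g') :
    (f ≫ h) ◁ γ ≫ eqToHom (Strict.assoc f h g') =
      eqToHom (Strict.assoc f h g) ≫ f ◁ h ◁ γ := by
  rw [comp_whiskerLeft']
  simp

theorem homDiagram_aux₃ {a b c d : C} (f : a ⟶ b) (h : b ⟶ c) {g g' : c ⟶ d} (γ : g ⟶ g') :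
    f ◁ h ◁ γ = eqToHom (Strict.assoc f h g).symm ≫ (f ≫ h) ◁ γ ≫
      eqToHom (Strict.assoc f h g') := by
  rw [comp_whiskerLeft']
  simp

theorem homDiagram_aux₄ {a b c d : C} (f : a ⟶ b) {h h' : b ⟶ c} (γ : h ⟶ h') (g : c ⟶ d) :
    f ◁ γ ▷ g = eqToHom (Strict.assoc f h g).symm ≫ (f ◁ γ) ▷ g ≫
      eqToHom (Strict.assoc f h' g) := by
  rw [whisker_assoc']
  simp

/-- The 2-natural transformation `C(X i, A) ⟶ C(X i, B)` given by composition with `g`. -/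
def homDiagramMap (X : StrictPseudofunctor Iᵒᵖ C) {A B : C} (g : A ⟶ B) :
    homDiagramObj X A ⟶ homDiagramObj X B :=
  TwoNatTrans.mk (fun i => (postcomp (X.obj (op i)) g).toCatHom)
    (fun u => precomp_postcomp _ _)
    (fun η => by
      apply Cat.Hom₂.ext
      ext h
      refine (toNatTrans_comp_eqToHom_app _ _ h).trans
        (Eq.trans ?_ (toNatTrans_eqToHom_comp_app _ _ h).symm)
      exact homDiagram_aux₁ _ h g)

/-- The modification induced by a 2-cell `γ : f ⟶ g`. -/
def homDiagramMap₂ (X : StrictPseudofunctor Iᵒᵖ C) {A B : C} {f g : A ⟶ B} (γ : f ⟶ g) :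
    homDiagramMap X f ⟶ homDiagramMap X g :=
  Modif.mk (fun i => ((postcomposing (X.obj (op i)) A B).map γ).toCatHom₂)
    (fun u => by
      apply Cat.Hom₂.ext
      ext h
      refine (toNatTrans_comp_eqToHom_app _ _ h).trans
        (Eq.trans ?_ (toNatTrans_eqToHom_comp_app _ _ h).symm)
      exact homDiagram_aux₂ _ h γ)

theorem modif_app_app_conj {J : Type u₁} [Bicategory.{w₁, v₁} J]
    {F G : StrictPseudofunctor J Cat.{v₂, u₂}} {α β γ δ : F ⟶ G} (h : α = β)
    (Γ : β ⟶ γ) (h' : γ = δ) (a : J) (x : F.obj a) :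
    (Modif.app (eqToHom h ≫ Γ ≫ eqToHom h') a).toNatTrans.app x =
      eqToHom (by rw [h]) ≫ (Modif.app Γ a).toNatTrans.app x ≫ eqToHom (by rw [h']) := by
  subst h h'
  rw [eqToHom_refl, eqToHom_refl, Category.id_comp, Category.comp_id, eqToHom_refl,
    eqToHom_refl, Category.id_comp, Category.comp_id]

/-- For a 2-functor `X` on `Iᵒᵖ`, the 2-functor sending `A` to `i ↦ C(X i, A)`. -/
def homDiagram (X : StrictPseudofunctor Iᵒᵖ C) :
    StrictPseudofunctor C (StrictPseudofunctor I Cat.{v₁, v₂}) :=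
  StrictPseudofunctor.mk''
    { obj := homDiagramObj X
      map := homDiagramMap X
      map₂ := homDiagramMap₂ X
      map₂_id := fun f => by
        refine Modif.hom_ext fun i => ?_
        apply Cat.Hom₂.ext
        ext h
        exact whiskerLeft_id _ _
      map₂_comp := fun η θ => by
        refine Modif.hom_ext fun i => ?_
        apply Cat.Hom₂.ext
        ext h
        exact whiskerLeft_comp _ _ _
      map_id := fun A => TwoNatTrans.hom_ext fun i => postcomp_id _ _
      map_comp := fun f g => TwoNatTrans.hom_ext fun i => postcomp_comp _ _ _
      map₂_whisker_left := fun f g g' η => by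
        refine Modif.hom_ext fun i => ?_
        apply Cat.Hom₂.ext
        ext h
        refine Eq.trans ?_ (modif_app_app_conj _ _ _ i h).symm
        exact homDiagram_aux₃ h f η
      map₂_whisker_right := fun η g => by
        refine Modif.hom_ext fun i => ?_
        apply Cat.Hom₂.ext
        ext h
        refine Eq.trans ?_ (modif_app_app_conj _ _ _ i h).symm
        exact homDiagram_aux₄ h η g }

end HomDiagrams

section Composition

variable {B : Type u₁} [Bicategory.{w₁, v₁} B] {A : Type u} [Bicategory.{w, v₃} A]
  {C : Type u₂} [Bicategory.{w₂, v₂} C] [Strict C]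

theorem map₂_eqToHom_comp_eqToHom {D : Type u₃} [Bicategory.{w₃, v₃} D]
    (P : StrictPseudofunctor C D) {a b : C} {f g : a ⟶ b} (h : f = g) :
    P.map₂ (eqToHom h) = eqToHom (congrArg P.map h) := by
  subst h
  exact P.map₂_id f

/-- Precomposition with a 2-functor `H`, as a 2-functor. -/
def precompose [Strict A] (H : StrictPseudofunctor A B) (C : Type u₂) [Bicategory.{w₂, v₂} C]
    [Strict C] : StrictPseudofunctor (StrictPseudofunctor B C) (StrictPseudofunctor A C) :=
  StrictPseudofunctor.mk''
    { obj := fun F => H.comp F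
      map := fun α => TwoNatTrans.mk (fun a => TwoNatTrans.app α (H.obj a))
        (fun f => TwoNatTrans.naturality α (H.map f))
        (fun η => TwoNatTrans.naturality₂ α (H.map₂ η))
      map₂ := fun Γ => Modif.mk (fun a => Modif.app Γ (H.obj a))
        (fun f => Modif.naturality Γ (H.map f))
      map_id := fun F => rfl
      map_comp := fun α β => rfl
      map₂_id := fun α => rfl
      map₂_comp := fun Γ Λ => rfl
      map₂_whisker_left := fun α β γ Γ => by
        refine Modif.hom_ext fun a => ?_
        refine Eq.trans ?_ (Modif.app_conj _ _ _ a).symm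
        exact (PseudoColimit.conj_rfl _).symm
      map₂_whisker_right := fun Γ γ => by
        refine Modif.hom_ext fun a => ?_
        refine Eq.trans ?_ (Modif.app_conj _ _ _ a).symm
        exact (PseudoColimit.conj_rfl _).symm }

variable {D : Type u₃} [Bicategory.{w₃, v₃} D]

theorem postcompose_aux₁ (P : StrictPseudofunctor C D) {a b c d : C} {f f' : a ⟶ b} {k : b ⟶ d}
    {l : a ⟶ c} {m m' : c ⟶ d} (η : f ⟶ f') (θ : m ⟶ m') (h : f ≫ k = l ≫ m)
    (h' : f' ≫ k = l ≫ m') (e : η ▷ k ≫ eqToHom h' = eqToHom h ≫ l ◁ θ) :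
    P.map₂ η ▷ P.map k ≫ eqToHom (by rw [← P.map_comp, h', P.map_comp]) =
      eqToHom (by rw [← P.map_comp, h, P.map_comp]) ≫ P.map l ◁ P.map₂ θ := by
  have e' := congrArg (fun t => P.map₂ t) e
  simp only [PrelaxFunctor.map₂_comp, map₂_eqToHom_comp_eqToHom, map₂_whiskerRight_strict,
    map₂_whiskerLeft_strict] at e'
  simpa using eqToHom (P.map_comp _ _).symm ≫= e' =≫ eqToHom (P.map_comp _ _)

theorem postcompose_aux₂ (P : StrictPseudofunctor C D) {a b c d : C} {f : a ⟶ b} {k k' : b ⟶ d}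
    {l l' : a ⟶ c} {m : c ⟶ d} (η : k ⟶ k') (θ : l ⟶ l') (h : f ≫ k = l ≫ m)
    (h' : f ≫ k' = l' ≫ m) (e : f ◁ η ≫ eqToHom h' = eqToHom h ≫ θ ▷ m) :
    P.map f ◁ P.map₂ η ≫ eqToHom (by rw [← P.map_comp, h', P.map_comp]) =
      eqToHom (by rw [← P.map_comp, h, P.map_comp]) ≫ P.map₂ θ ▷ P.map m := by
  have e' := congrArg (fun t => P.map₂ t) e
  simp only [PrelaxFunctor.map₂_comp, map₂_eqToHom_comp_eqToHom, map₂_whiskerRight_strict,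
    map₂_whiskerLeft_strict] at e'
  simpa using eqToHom (P.map_comp _ _).symm ≫= e' =≫ eqToHom (P.map_comp _ _)

variable [Strict D]

/-- The composite of a 2-natural transformation with a 2-functor `P`. -/
def postcomposeMap (P : StrictPseudofunctor C D) {F G : StrictPseudofunctor B C} (α : F ⟶ G) :
    F.comp P ⟶ G.comp P :=
  TwoNatTrans.mk (fun a => P.map (TwoNatTrans.app α a))
    (fun f => (P.map_comp _ _).symm.trans
      ((congrArg P.map (TwoNatTrans.naturality α f)).trans (P.map_comp _ _)))
    (fun η => postcompose_aux₁ P _ _ _ _ (TwoNatTrans.naturality₂ α η))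

/-- The composite of a modification with a 2-functor `P`. -/
def postcomposeMap₂ (P : StrictPseudofunctor C D) {F G : StrictPseudofunctor B C} {α β : F ⟶ G}
    (Γ : α ⟶ β) : postcomposeMap P α ⟶ postcomposeMap P β :=
  Modif.mk (fun a => P.map₂ (Modif.app Γ a))
    (fun f => postcompose_aux₂ P _ _ _ _ (Modif.naturality Γ f))

theorem postcomposeMap_id (P : StrictPseudofunctor C D) (F : StrictPseudofunctor B C) :
    postcomposeMap P (𝟙 F) = 𝟙 (F.comp P) :=
  TwoNatTrans.hom_ext fun a => P.map_id _

theorem postcomposeMap_comp (P : StrictPseudofunctor C D) {F G H : StrictPseudofunctor B C}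
    (α : F ⟶ G) (β : G ⟶ H) :
    postcomposeMap P (α ≫ β) = postcomposeMap P α ≫ postcomposeMap P β :=
  TwoNatTrans.hom_ext fun a => P.map_comp _ _

theorem postcomposeMap₂_id (P : StrictPseudofunctor C D) {F G : StrictPseudofunctor B C}
    (α : F ⟶ G) : postcomposeMap₂ P (𝟙 α) = 𝟙 (postcomposeMap P α) :=
  Modif.hom_ext fun a => P.map₂_id _

theorem postcomposeMap₂_comp (P : StrictPseudofunctor C D) {F G : StrictPseudofunctor B C}
    {α β γ : F ⟶ G} (Γ : α ⟶ β) (Λ : β ⟶ γ) :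
    postcomposeMap₂ P (Γ ≫ Λ) = postcomposeMap₂ P Γ ≫ postcomposeMap₂ P Λ :=
  Modif.hom_ext fun a => P.map₂_comp _ _

theorem postcomposeMap₂_eqToHom (P : StrictPseudofunctor C D) {F G : StrictPseudofunctor B C}
    {α β : F ⟶ G} (h : α = β) :
    postcomposeMap₂ P (eqToHom h) = eqToHom (congrArg (postcomposeMap P) h) := by
  subst h
  exact postcomposeMap₂_id P α

theorem postcomposeMap₂_whiskerLeft (P : StrictPseudofunctor C D)
    {F G H : StrictPseudofunctor B C} (α : F ⟶ G) {β γ : G ⟶ H} (Γ : β ⟶ γ) :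
    postcomposeMap₂ P (α ◁ Γ) = eqToHom (postcomposeMap_comp P α β) ≫
      postcomposeMap P α ◁ postcomposeMap₂ P Γ ≫ eqToHom (postcomposeMap_comp P α γ).symm := by
  refine Modif.hom_ext fun a => ?_
  refine Eq.trans ?_ (Modif.app_conj _ _ _ a).symm
  exact map₂_whiskerLeft_strict P _ _

theorem postcomposeMap₂_whiskerRight (P : StrictPseudofunctor C D)
    {F G H : StrictPseudofunctor B C} {α β : F ⟶ G} (Γ : α ⟶ β) (γ : G ⟶ H) :
    postcomposeMap₂ P (Γ ▷ γ) = eqToHom (postcomposeMap_comp P α γ) ≫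
      postcomposeMap₂ P Γ ▷ postcomposeMap P γ ≫ eqToHom (postcomposeMap_comp P β γ).symm := by
  refine Modif.hom_ext fun a => ?_
  refine Eq.trans ?_ (Modif.app_conj _ _ _ a).symm
  exact map₂_whiskerRight_strict P _ _

end Composition

section Pro

open Opposite

variable (C : Type u) [Bicategory.{w, w} C] [Strict C]

/-- A 2-pro-object of `C`: a 2-functor on the opposite of a small 2-filtered 2-category. -/
structure ProObj where
  I : Type w
  [bicategory : Bicategory.{w, w} I]
  [strict : Strict I]
  isTwoFiltered : IsTwoFiltered I
  X : StrictPseudofunctor Iᵒᵖ C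

attribute [instance] ProObj.bicategory ProObj.strict

variable {C}

/-- The 2-functor `C → Cat` given by the pseudo-colimit of the representable 2-functors
`C(X i, -)`. -/
def ProObj.L (P : ProObj.{w} C) : StrictPseudofunctor C Cat.{w, w} :=
  (homDiagram P.X).comp (pseudoColim P.I)

variable (C) in
/-- The 2-category of 2-pro-objects: a 1-cell `P ⟶ Q` is a 2-natural transformation
`Q.L ⟶ P.L`, and a 2-cell is a modification. -/
abbrev Pro := InducedBicategory (StrictPseudofunctor C Cat.{w, w})ᵒᵖ
  (fun P : ProObj.{w} C => op P.L)

/-- The one-point 2-category. -/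
abbrev Pt := LocallyDiscrete (Discrete PUnit.{w + 1})

theorem isTwoFiltered_pt : IsTwoFiltered Pt.{w} where
  nonempty := ⟨⟨⟨PUnit.unit⟩⟩⟩
  cocone i j := ⟨i, ⟨𝟙 _⟩, ⟨⟨eqToHom (Subsingleton.elim _ _)⟩⟩⟩
  cocone_map {i j} f g := ⟨j, 𝟙 _, by
    obtain rfl : f = g := Discrete.ext (Subsingleton.elim _ _)
    exact ⟨Iso.refl _⟩⟩
  cocone_map₂ {i j f g} α β := ⟨j, 𝟙 _, by
    obtain rfl : α = β := Subsingleton.elim _ _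
    rfl⟩

/-- The 2-pro-object indexed by the one-point 2-category with value `A`. -/
def ProObj.const (A : C) : ProObj.{w} C where
  I := Pt.{w}
  isTwoFiltered := isTwoFiltered_pt
  X := TwoCat.const Pt.{w}ᵒᵖ A

section

variable (J : Type w) [Bicategory.{w, w} J] [Strict J]

theorem constPre_aux₁ {A B : C} (f : A ⟶ B) (D : C) :
    (precomp D (𝟙 B)).toCatHom ≫ (precomp D f).toCatHom =
      (precomp D f).toCatHom ≫ (precomp D (𝟙 A)).toCatHom := by
  rw [precomp_id, precomp_id, Strict.comp_id, Strict.id_comp]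

theorem constPre_aux₂ {A B D : C} (f : A ⟶ B) (h : B ⟶ D) :
    f ◁ 𝟙 (𝟙 B) ▷ h ≫ eqToHom (by rw [Strict.id_comp, Strict.id_comp]) =
      eqToHom (by rw [Strict.id_comp, Strict.id_comp]) ≫ 𝟙 (𝟙 A) ▷ (f ≫ h) := by
  simp

theorem constPre_aux₃ {A B D : C} {f g : A ⟶ B} (θ : f ⟶ g) (h : B ⟶ D) :
    θ ▷ (𝟙 B ≫ h) ≫ eqToHom (by rw [Strict.id_comp, Strict.id_comp]) =
      eqToHom (by rw [Strict.id_comp, Strict.id_comp]) ≫ 𝟙 A ◁ θ ▷ h := by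
  rw [id_whiskerLeft', whiskerRight_congr θ (Strict.id_comp h)]
  simp only [Category.assoc, eqToHom_trans, eqToHom_trans_assoc]

theorem constPre_aux₄ {A B D D' : C} (f : A ⟶ B) (h : B ⟶ D) {k k' : D ⟶ D'} (γ : k ⟶ k') :
    f ◁ h ◁ γ ≫ eqToHom (Strict.assoc f h k').symm =
      eqToHom (Strict.assoc f h k).symm ≫ (f ≫ h) ◁ γ := by
  rw [comp_whiskerLeft']
  simp

theorem constPre_aux₅ {A B D D' : C} {f g : A ⟶ B} (θ : f ⟶ g) (h : B ⟶ D) (k : D ⟶ D') :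
    θ ▷ (h ≫ k) ≫ eqToHom (Strict.assoc g h k).symm =
      eqToHom (Strict.assoc f h k).symm ≫ θ ▷ h ▷ k := by
  rw [whiskerRight_comp']
  simp

/-- Precomposition with `f : A ⟶ B`, as a 2-natural transformation between diagrams of
hom-categories into `D`. -/
def constPreApp {A B : C} (f : A ⟶ B) (D : C) :
    (homDiagram (const Jᵒᵖ B)).obj D ⟶ (homDiagram (const Jᵒᵖ A)).obj D :=
  TwoNatTrans.mk (fun _ => (precomp D f).toCatHom)
    (fun _ => constPre_aux₁ f D)
    (fun _ => by
      apply Cat.Hom₂.ext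
      ext h
      refine (toNatTrans_comp_eqToHom_app _ _ h).trans
        (Eq.trans ?_ (toNatTrans_eqToHom_comp_app _ _ h).symm)
      exact constPre_aux₂ f h)

theorem constPre_naturality {A B : C} (f : A ⟶ B) {D D' : C} (k : D ⟶ D') :
    (homDiagram (const Jᵒᵖ B)).map k ≫ constPreApp J f D' =
      constPreApp J f D ≫ (homDiagram (const Jᵒᵖ A)).map k :=
  TwoNatTrans.hom_ext fun _ => (precomp_postcomp f k).symm

theorem modif_comp_eqToHom_app_app {J : Type u₁} [Bicategory.{w₁, v₁} J]
    {F G : StrictPseudofunctor J Cat.{v₂, u₂}} {α β γ : F ⟶ G} (Γ : α ⟶ β) (h : β = γ)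
    (a : J) (x : F.obj a) :
    (Modif.app (Γ ≫ eqToHom h) a).toNatTrans.app x =
      (Modif.app Γ a).toNatTrans.app x ≫ eqToHom (by rw [h]) := by
  subst h
  rw [eqToHom_refl, Category.comp_id, eqToHom_refl, Category.comp_id]

theorem modif_eqToHom_comp_app_app {J : Type u₁} [Bicategory.{w₁, v₁} J]
    {F G : StrictPseudofunctor J Cat.{v₂, u₂}} {α β γ : F ⟶ G} (h : α = β) (Γ : β ⟶ γ)
    (a : J) (x : F.obj a) :
    (Modif.app (eqToHom h ≫ Γ) a).toNatTrans.app x =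
      eqToHom (by rw [h]) ≫ (Modif.app Γ a).toNatTrans.app x := by
  subst h
  rw [eqToHom_refl, Category.id_comp, eqToHom_refl, Category.id_comp]

theorem constPre_naturality₂ {A B : C} (f : A ⟶ B) {D D' : C} {k k' : D ⟶ D'} (γ : k ⟶ k') :
    (homDiagram (const Jᵒᵖ B)).map₂ γ ▷ constPreApp J f D' ≫
        eqToHom (constPre_naturality J f k') =
      eqToHom (constPre_naturality J f k) ≫
        constPreApp J f D ◁ (homDiagram (const Jᵒᵖ A)).map₂ γ := by
  refine Modif.hom_ext fun i => ?_
  apply Cat.Hom₂.ext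
  ext h
  refine (modif_comp_eqToHom_app_app _ _ i h).trans
    (Eq.trans ?_ (modif_eqToHom_comp_app_app _ _ i h).symm)
  exact constPre_aux₄ f h γ

/-- Precomposition with `f : A ⟶ B`, as a 2-natural transformation. -/
def constPre {A B : C} (f : A ⟶ B) :
    homDiagram (const Jᵒᵖ B) ⟶ homDiagram (const Jᵒᵖ A) :=
  TwoNatTrans.mk (constPreApp J f) (fun k => constPre_naturality J f k)
    (fun γ => constPre_naturality₂ J f γ)

/-- The modification between precomposition 2-natural transformations into `D` induced by a
2-cell. -/
def constPreApp₂ {A B : C} {f g : A ⟶ B} (θ : f ⟶ g) (D : C) :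
    TwoNatTrans.app (constPre J f) D ⟶ TwoNatTrans.app (constPre J g) D :=
  Modif.mk (fun _ => ((precomposing A B D).map θ).toCatHom₂)
    (fun _ => by
      apply Cat.Hom₂.ext
      ext h
      refine (toNatTrans_comp_eqToHom_app _ _ h).trans
        (Eq.trans ?_ (toNatTrans_eqToHom_comp_app _ _ h).symm)
      exact constPre_aux₃ θ h)

theorem constPre₂_naturality {A B : C} {f g : A ⟶ B} (θ : f ⟶ g) {D D' : C} (k : D ⟶ D') :
    (homDiagram (const Jᵒᵖ B)).map k ◁ constPreApp₂ J θ D' ≫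
        eqToHom (TwoNatTrans.naturality (constPre J g) k) =
      eqToHom (TwoNatTrans.naturality (constPre J f) k) ≫
        constPreApp₂ J θ D ▷ (homDiagram (const Jᵒᵖ A)).map k := by
  refine Modif.hom_ext fun i => ?_
  apply Cat.Hom₂.ext
  ext h
  refine (modif_comp_eqToHom_app_app _ _ i h).trans
    (Eq.trans ?_ (modif_eqToHom_comp_app_app _ _ i h).symm)
  exact constPre_aux₅ θ h k

/-- The modification between precomposition 2-natural transformations induced by a 2-cell. -/
def constPre₂ {A B : C} {f g : A ⟶ B} (θ : f ⟶ g) : constPre J f ⟶ constPre J g :=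
  Modif.mk (constPreApp₂ J θ) (fun k => constPre₂_naturality J θ k)

theorem constPre_id (A : C) : constPre J (𝟙 A) = 𝟙 (homDiagram (const Jᵒᵖ A)) :=
  TwoNatTrans.hom_ext fun D => TwoNatTrans.hom_ext fun _ => precomp_id A D

theorem constPre_comp {A B D : C} (f : A ⟶ B) (g : B ⟶ D) :
    constPre J (f ≫ g) = constPre J g ≫ constPre J f :=
  TwoNatTrans.hom_ext fun K => TwoNatTrans.hom_ext fun _ => precomp_comp f g K

theorem constPre₂_id {A B : C} (f : A ⟶ B) : constPre₂ J (𝟙 f) = 𝟙 (constPre J f) := by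
  refine Modif.hom_ext fun D => Modif.hom_ext fun i => ?_
  apply Cat.Hom₂.ext
  ext h
  exact id_whiskerRight f h

theorem constPre₂_comp {A B : C} {f g k : A ⟶ B} (θ : f ⟶ g) (χ : g ⟶ k) :
    constPre₂ J (θ ≫ χ) = constPre₂ J θ ≫ constPre₂ J χ := by
  refine Modif.hom_ext fun D => Modif.hom_ext fun i => ?_
  apply Cat.Hom₂.ext
  ext h
  exact comp_whiskerRight θ χ h

theorem modif_app_app_app_conj {K : Type u₃} [Bicategory.{w₂, w₃} K] {J : Type u₁}
    [Bicategory.{w₁, v₁} J]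
    {F G : StrictPseudofunctor K (StrictPseudofunctor J Cat.{v₂, u₂})} {α β γ δ : F ⟶ G}
    (h : α = β) (Γ : β ⟶ γ) (h' : γ = δ) (D : K) (a : J) (x : (F.obj D).obj a) :
    (Modif.app (Modif.app (eqToHom h ≫ Γ ≫ eqToHom h') D) a).toNatTrans.app x =
      eqToHom (by rw [h]) ≫ (Modif.app (Modif.app Γ D) a).toNatTrans.app x ≫
        eqToHom (by rw [h']) := by
  subst h h'
  rw [eqToHom_refl, eqToHom_refl, Category.id_comp, Category.comp_id, eqToHom_refl,
    eqToHom_refl, Category.id_comp, Category.comp_id]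

theorem constPre₂_aux₁ {A B D K : C} (f : A ⟶ B) {g g' : B ⟶ D} (η : g ⟶ g') (h : D ⟶ K) :
    (f ◁ η) ▷ h = eqToHom (Strict.assoc f g h) ≫ f ◁ η ▷ h ≫
      eqToHom (Strict.assoc f g' h).symm :=
  whisker_assoc' f η h

theorem constPre₂_aux₂ {A B D K : C} {f f' : A ⟶ B} (η : f ⟶ f') (g : B ⟶ D) (h : D ⟶ K) :
    η ▷ g ▷ h = eqToHom (Strict.assoc f g h) ≫ η ▷ (g ≫ h) ≫
      eqToHom (Strict.assoc f' g h).symm := by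
  rw [whiskerRight_comp']
  simp

theorem constPre₂_whiskerLeft {A B D : C} (f : A ⟶ B) {g g' : B ⟶ D} (η : g ⟶ g') :
    constPre₂ J (f ◁ η) = eqToHom (constPre_comp J f g) ≫ constPre₂ J η ▷ constPre J f ≫
      eqToHom (constPre_comp J f g').symm := by
  refine Modif.hom_ext fun K => Modif.hom_ext fun i => ?_
  apply Cat.Hom₂.ext
  ext h
  refine Eq.trans ?_ (modif_app_app_app_conj _ _ _ K i h).symm
  exact constPre₂_aux₁ f η h

theorem constPre₂_whiskerRight {A B D : C} {f f' : A ⟶ B} (η : f ⟶ f') (g : B ⟶ D) :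
    constPre₂ J (η ▷ g) = eqToHom (constPre_comp J f g) ≫ constPre J g ◁ constPre₂ J η ≫
      eqToHom (constPre_comp J f' g).symm := by
  refine Modif.hom_ext fun K => Modif.hom_ext fun i => ?_
  apply Cat.Hom₂.ext
  ext h
  refine Eq.trans ?_ (modif_app_app_app_conj _ _ _ K i h).symm
  exact constPre₂_aux₂ η g h

end

/-- The 2-natural transformation induced by precomposition with `f` on the pseudo-colimits over
the one-point 2-category. -/
def toProMap {A B : C} (f : A ⟶ B) : (ProObj.const B).L ⟶ (ProObj.const A).L :=
  postcomposeMap (pseudoColim Pt.{w}) (constPre Pt.{w} f)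

/-- The modification induced by a 2-cell on the pseudo-colimits over the one-point 2-category. -/
def toProMap₂ {A B : C} {f g : A ⟶ B} (θ : f ⟶ g) : toProMap f ⟶ toProMap g :=
  postcomposeMap₂ (pseudoColim Pt.{w}) (constPre₂ Pt.{w} θ)

theorem toProMap_id (A : C) : toProMap (𝟙 A) = 𝟙 (ProObj.const A).L :=
  (congrArg (postcomposeMap (pseudoColim Pt.{w})) (constPre_id Pt.{w} A)).trans
    (postcomposeMap_id _ _)

theorem toProMap_comp {A B D : C} (f : A ⟶ B) (g : B ⟶ D) :
    toProMap (f ≫ g) = toProMap g ≫ toProMap f :=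
  (congrArg (postcomposeMap (pseudoColim Pt.{w})) (constPre_comp Pt.{w} f g)).trans
    (postcomposeMap_comp _ _ _)

theorem toProMap₂_id {A B : C} (f : A ⟶ B) : toProMap₂ (𝟙 f) = 𝟙 (toProMap f) :=
  (congrArg (postcomposeMap₂ (pseudoColim Pt.{w})) (constPre₂_id Pt.{w} f)).trans
    (postcomposeMap₂_id _ _)

theorem toProMap₂_comp {A B : C} {f g k : A ⟶ B} (θ : f ⟶ g) (χ : g ⟶ k) :
    toProMap₂ (θ ≫ χ) = toProMap₂ θ ≫ toProMap₂ χ :=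
  (congrArg (postcomposeMap₂ (pseudoColim Pt.{w})) (constPre₂_comp Pt.{w} θ χ)).trans
    (postcomposeMap₂_comp _ _ _)

theorem postcomposeMap₂_conj_whiskerRight {A : Type u₁} [Bicategory.{w₁, v₁} A] {B : Type u₂}
    [Bicategory.{w₂, v₂} B] [Strict B] {D : Type u₃} [Bicategory.{w₃, v₃} D] [Strict D]
    (P : StrictPseudofunctor B D) {F G H : StrictPseudofunctor A B} {α β : F ⟶ G} {γ : G ⟶ H}
    {σ τ : F ⟶ H} (Γ : α ⟶ β) (Λ : σ ⟶ τ) (h : σ = α ≫ γ) (h' : τ = β ≫ γ)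
    (e : Λ = eqToHom h ≫ Γ ▷ γ ≫ eqToHom h'.symm)
    (k : postcomposeMap P σ = postcomposeMap P α ≫ postcomposeMap P γ)
    (k' : postcomposeMap P τ = postcomposeMap P β ≫ postcomposeMap P γ) :
    postcomposeMap₂ P Λ = eqToHom k ≫ postcomposeMap₂ P Γ ▷ postcomposeMap P γ ≫
      eqToHom k'.symm := by
  subst h h'
  rw [eqToHom_refl, eqToHom_refl, Category.id_comp (Γ ▷ γ ≫ _), Category.comp_id (Γ ▷ γ)] at e
  subst e
  exact postcomposeMap₂_whiskerRight P Γ γ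

theorem postcomposeMap₂_conj_whiskerLeft {A : Type u₁} [Bicategory.{w₁, v₁} A] {B : Type u₂}
    [Bicategory.{w₂, v₂} B] [Strict B] {D : Type u₃} [Bicategory.{w₃, v₃} D] [Strict D]
    (P : StrictPseudofunctor B D) {F G H : StrictPseudofunctor A B} {α : F ⟶ G} {β γ : G ⟶ H}
    {σ τ : F ⟶ H} (Γ : β ⟶ γ) (Λ : σ ⟶ τ) (h : σ = α ≫ β) (h' : τ = α ≫ γ)
    (e : Λ = eqToHom h ≫ α ◁ Γ ≫ eqToHom h'.symm)
    (k : postcomposeMap P σ = postcomposeMap P α ≫ postcomposeMap P β)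
    (k' : postcomposeMap P τ = postcomposeMap P α ≫ postcomposeMap P γ) :
    postcomposeMap₂ P Λ = eqToHom k ≫ postcomposeMap P α ◁ postcomposeMap₂ P Γ ≫
      eqToHom k'.symm := by
  subst h h'
  rw [eqToHom_refl, eqToHom_refl, Category.id_comp (α ◁ Γ ≫ _), Category.comp_id (α ◁ Γ)] at e
  subst e
  exact postcomposeMap₂_whiskerLeft P α Γ

theorem whiskerRight_transport {B : Type u₂}
    [Bicategory.{w₂, v₂} B] [Strict B]
    (P : StrictPseudofunctor B Cat.{w, w}) {F G H : StrictPseudofunctor C B} {α β : F ⟶ G} {γ : G ⟶ H}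
    {σ τ : F ⟶ H} (Γ : α ⟶ β) (Λ : σ ⟶ τ) (h : σ = α ≫ γ) (h' : τ = β ≫ γ)
    (e : Λ = eqToHom h ≫ Γ ▷ γ ≫ eqToHom h'.symm) {F' G' H' : StrictPseudofunctor C Cat.{w, w}}
    (hF : F.comp P = F') (hG : G.comp P = G') (hH : H.comp P = H') {α' β' : F' ⟶ G'} {γ' : G' ⟶ H'} {σ' τ' : F' ⟶ H'}
    (hα : postcomposeMap P α ≍ α') (hβ : postcomposeMap P β ≍ β')
    (hγ : postcomposeMap P γ ≍ γ') (hσ : postcomposeMap P σ ≍ σ') (hτ : postcomposeMap P τ ≍ τ')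
    (Γ' : α' ⟶ β') (Λ' : σ' ⟶ τ') (hΓ : postcomposeMap₂ P Γ ≍ Γ')
    (hΛ : postcomposeMap₂ P Λ ≍ Λ') (k : σ' = α' ≫ γ') (k' : τ' = β' ≫ γ') :
    Λ' = eqToHom k ≫ Γ' ▷ γ' ≫ eqToHom k'.symm := by
  subst hF hG hH
  cases hα
  cases hβ
  cases hγ
  cases hσ
  cases hτ
  cases hΓ
  cases hΛ
  exact postcomposeMap₂_conj_whiskerRight P Γ Λ h h' e k k'

theorem whiskerLeft_transport {B : Type u₂}
    [Bicategory.{w₂, v₂} B] [Strict B]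
    (P : StrictPseudofunctor B Cat.{w, w}) {F G H : StrictPseudofunctor C B} {γ : F ⟶ G} {α β : G ⟶ H}
    {σ τ : F ⟶ H} (Γ : α ⟶ β) (Λ : σ ⟶ τ) (h : σ = γ ≫ α) (h' : τ = γ ≫ β)
    (e : Λ = eqToHom h ≫ γ ◁ Γ ≫ eqToHom h'.symm) {F' G' H' : StrictPseudofunctor C Cat.{w, w}}
    (hF : F.comp P = F') (hG : G.comp P = G') (hH : H.comp P = H') {γ' : F' ⟶ G'} {α' β' : G' ⟶ H'} {σ' τ' : F' ⟶ H'}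
    (hα : postcomposeMap P α ≍ α') (hβ : postcomposeMap P β ≍ β')
    (hγ : postcomposeMap P γ ≍ γ') (hσ : postcomposeMap P σ ≍ σ') (hτ : postcomposeMap P τ ≍ τ')
    (Γ' : α' ⟶ β') (Λ' : σ' ⟶ τ') (hΓ : postcomposeMap₂ P Γ ≍ Γ')
    (hΛ : postcomposeMap₂ P Λ ≍ Λ') (k : σ' = γ' ≫ α') (k' : τ' = γ' ≫ β') :
    Λ' = eqToHom k ≫ γ' ◁ Γ' ≫ eqToHom k'.symm := by
  subst hF hG hH
  cases hα
  cases hβ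
  cases hγ
  cases hσ
  cases hτ
  cases hΓ
  cases hΛ
  exact postcomposeMap₂_conj_whiskerLeft P Γ Λ h h' e k k'

theorem toProMap₂_whiskerLeft {A B D : C} (f : A ⟶ B) {g g' : B ⟶ D} (η : g ⟶ g') :
    toProMap₂ (f ◁ η) = eqToHom (toProMap_comp f g) ≫ toProMap₂ η ▷ toProMap f ≫
      eqToHom (toProMap_comp f g').symm :=
  whiskerRight_transport (F' := (ProObj.const D).L) (G' := (ProObj.const B).L)
    (H' := (ProObj.const A).L) (α' := toProMap g) (β' := toProMap g') (γ' := toProMap f)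
    (σ' := toProMap (f ≫ g)) (τ' := toProMap (f ≫ g')) (pseudoColim Pt.{w}) (constPre₂ Pt.{w} η)
    (constPre₂ Pt.{w} (f ◁ η)) (constPre_comp Pt.{w} f g) (constPre_comp Pt.{w} f g')
    (constPre₂_whiskerLeft Pt.{w} f η) rfl rfl rfl HEq.rfl HEq.rfl HEq.rfl HEq.rfl HEq.rfl
    (toProMap₂ η) (toProMap₂ (f ◁ η)) HEq.rfl HEq.rfl (toProMap_comp f g) (toProMap_comp f g')

theorem toProMap₂_whiskerRight {A B D : C} {f f' : A ⟶ B} (η : f ⟶ f') (g : B ⟶ D) :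
    toProMap₂ (η ▷ g) = eqToHom (toProMap_comp f g) ≫ toProMap g ◁ toProMap₂ η ≫
      eqToHom (toProMap_comp f' g).symm :=
  whiskerLeft_transport (F' := (ProObj.const D).L) (G' := (ProObj.const B).L)
    (H' := (ProObj.const A).L) (α' := toProMap f) (β' := toProMap f') (γ' := toProMap g)
    (σ' := toProMap (f ≫ g)) (τ' := toProMap (f' ≫ g)) (pseudoColim Pt.{w}) (constPre₂ Pt.{w} η)
    (constPre₂ Pt.{w} (η ▷ g)) (constPre_comp Pt.{w} f g) (constPre_comp Pt.{w} f' g)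
    (constPre₂_whiskerRight Pt.{w} η g) rfl rfl rfl HEq.rfl HEq.rfl HEq.rfl HEq.rfl HEq.rfl
    (toProMap₂ η) (toProMap₂ (η ▷ g)) HEq.rfl HEq.rfl (toProMap_comp f g) (toProMap_comp f' g)

theorem induced_conj_hom {K : Type u₂} [Bicategory.{w₂, v₂} K] {P : Type u₃} {L : P → K}
    {a b : InducedBicategory K L} {f f' g g' : a ⟶ b} (h : f = f') (Γ : f' ⟶ g') (h' : g' = g)
    (k : f.hom = f'.hom) (k' : g'.hom = g.hom) :
    (eqToHom h ≫ Γ ≫ eqToHom h').hom = eqToHom k ≫ Γ.hom ≫ eqToHom k' := by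
  subst h h'
  simp

theorem op2_conj {K : Type u₂} [Bicategory.{w₂, v₂} K] {a b : K} {f f' g g' : a ⟶ b}
    (h : f = f') (Γ : f' ⟶ g') (h' : g' = g) :
    Bicategory.Opposite.op2 (eqToHom h ≫ Γ ≫ eqToHom h') =
      eqToHom (congrArg Quiver.Hom.op h) ≫ Bicategory.Opposite.op2 Γ ≫
        eqToHom (congrArg Quiver.Hom.op h') := by
  subst h h'
  simp

/-- A contravariant 2-functor into `K`, reversing 1-cells but not 2-cells, as a 2-functor into a
full sub-2-category of the opposite of `K`. -/
def toInducedOp {P : Type u₃} (L : P → StrictPseudofunctor C Cat.{w, w}) (o : C → P)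
    (m : ∀ {a b : C}, (a ⟶ b) → (L (o b) ⟶ L (o a)))
    (m₂ : ∀ {a b : C} {f g : a ⟶ b}, (f ⟶ g) → (m f ⟶ m g))
    (m_id : ∀ a : C, m (𝟙 a) = 𝟙 (L (o a)))
    (m_comp : ∀ {a b c : C} (f : a ⟶ b) (g : b ⟶ c), m (f ≫ g) = m g ≫ m f)
    (m₂_id : ∀ {a b : C} (f : a ⟶ b), m₂ (𝟙 f) = 𝟙 (m f))
    (m₂_comp : ∀ {a b : C} {f g h : a ⟶ b} (η : f ⟶ g) (θ : g ⟶ h),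
      m₂ (η ≫ θ) = m₂ η ≫ m₂ θ)
    (m₂_whiskerLeft : ∀ {a b c : C} (f : a ⟶ b) {g g' : b ⟶ c} (η : g ⟶ g'),
      m₂ (f ◁ η) = eqToHom (m_comp f g) ≫ m₂ η ▷ m f ≫ eqToHom (m_comp f g').symm)
    (m₂_whiskerRight : ∀ {a b c : C} {f f' : a ⟶ b} (η : f ⟶ f') (g : b ⟶ c),
      m₂ (η ▷ g) = eqToHom (m_comp f g) ≫ m g ◁ m₂ η ≫ eqToHom (m_comp f' g).symm) :
    StrictPseudofunctor C (InducedBicategory (StrictPseudofunctor C Cat.{w, w})ᵒᵖ (fun p : P => op (L p))) :=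
  StrictPseudofunctor.mk''
    { obj := o
      map := fun f => InducedBicategory.mkHom (m f).op
      map₂ := fun η => InducedBicategory.mkHom₂ (Bicategory.Opposite.op2 (m₂ η))
      map_id := fun a => InducedBicategory.hom_ext (congrArg Quiver.Hom.op (m_id a))
      map_comp := fun f g => InducedBicategory.hom_ext (congrArg Quiver.Hom.op (m_comp f g))
      map₂_id := fun f => InducedBicategory.hom₂_ext
        (congrArg Bicategory.Opposite.op2 (m₂_id f))
      map₂_comp := fun η θ => InducedBicategory.hom₂_ext
        (congrArg Bicategory.Opposite.op2 (m₂_comp η θ))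
      map₂_whisker_left := fun f _ _ η => by
        apply InducedBicategory.hom₂_ext
        exact (congrArg Bicategory.Opposite.op2 (m₂_whiskerLeft f η)).trans
          ((op2_conj _ _ _).trans (induced_conj_hom (K := (StrictPseudofunctor C Cat.{w, w})ᵒᵖ)
            (L := fun p : P => op (L p)) _ _ _ _ _).symm)
      map₂_whisker_right := fun η g => by
        apply InducedBicategory.hom₂_ext
        exact (congrArg Bicategory.Opposite.op2 (m₂_whiskerRight η g)).trans
          ((op2_conj _ _ _).trans (induced_conj_hom (K := (StrictPseudofunctor C Cat.{w, w})ᵒᵖ)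
            (L := fun p : P => op (L p)) _ _ _ _ _).symm) }

variable (C)

/-- The canonical 2-functor from `C` to its 2-category of 2-pro-objects. -/
def toPro : StrictPseudofunctor C (Pro.{w} C) :=
  toInducedOp (@ProObj.L C _ _) (@ProObj.const C _ _) (@toProMap C _ _) (@toProMap₂ C _ _)
    (@toProMap_id C _ _) (@toProMap_comp C _ _) (@toProMap₂_id C _ _) (@toProMap₂_comp C _ _)
    (@toProMap₂_whiskerLeft C _ _) (@toProMap₂_whiskerRight C _ _)

variable (E : Type u₂) [Bicategory.{w₂, v₂} E] [Strict E]

/-- The full sub-2-category of `Hom(2-Pro(C), E)` on the 2-functors that preserve small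
2-cofiltered pseudo-limits. -/
abbrev HomPlus := InducedBicategory (StrictPseudofunctor (Pro.{w} C) E)
  (Subtype.val : {H : StrictPseudofunctor (Pro.{w} C) E //
    PreservesTwoCofilteredPseudoLimits.{w} H} → StrictPseudofunctor (Pro.{w} C) E)

/-- Precomposition with the canonical 2-functor `C → 2-Pro(C)`. -/
def restrict : StrictPseudofunctor (HomPlus.{w} C E) (StrictPseudofunctor C E) :=
  (InducedBicategory.forget).comp (precompose (toPro C) E)

end Pro

end TwoCat

/-!
The proof reads 2-pro-objects through cones with weights. A cone over a 2-functor `F : C → E` with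
weight `P : C → Cat` and vertex `K` is a 2-natural transformation `P ⟶ E(K, F -)` (`WCone`); it is
universal if composition with it is an isomorphism of categories `E(K', K) ≅ WCone P F K'` for every
`K'` (`WCone.Universal`).

If the weight is a pseudo-colimit of weights `P j`, and a diagram `Y` in `E` represents the cones
with weights `P j`, then cones with weight `colim P` are the same as pseudo-cones over `Y`, and the
universal ones are the pseudo-limit cones (`ConeSystem.Corr.universal_iff`). This is used twice.

* For a 2-pro-object `X`, the weight `L_X` is the pseudo-colimit of the 2-functors `C(X i, -)`,
  whose cones over `F` are represented by `F (X i)`. So a universal cone over `F` with weight `L_X`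
  is a pseudo-limit of `F X`: it exists if `E` is closed under 2-cofiltered pseudo-limits
  (`exists_universal`), and a 2-functor that preserves these preserves it
  (`PreservesTwoCofilteredPseudoLimits.push_universal`).
* By the Yoneda lemma, `2-Pro(C)(X, c D) = Hom(L_{cD}, L_X) ≅ L_X D`. The inverse of this
  isomorphism is a cone `κ_X` over `c` with weight `L_X` and vertex `X`, and it is universal because
  `2-Pro(C)(Z, X) = Hom(L_X, L_Z)` by definition (`kappa_universal`). So every diagram `Z` of
  2-pro-objects represents the diagram of weights `j ↦ L_{Z j}`, and its pseudo-limit cones are the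
  universal cones over `c` with weight the pseudo-colimit of the `L_{Z j}`.

Hence a 2-functor `H` on `2-Pro(C)` that preserves 2-cofiltered pseudo-limits sends each `κ_X` to a
universal cone. The converse (`preserves_of_push_kappa`) needs that the pseudo-colimit of the
weights of a 2-cofiltered diagram of 2-pro-objects is again of the form `L_W`, up to isomorphism and
not only up to equivalence. To see this, call a 2-functor `T : C → Cat` flat on a family of elements
if the family generates the objects of all the categories `T A` freely, and if the 2-category of
elements of `T` is 2-cofiltered, with witnesses in the family (`FlatOn`). The 2-functor `L_X` is
flat on the identities of the `X i`, and flatness passes to 2-filtered pseudo-colimits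
(`FlatOn.psColimit`); the latter rests on the description of the morphisms of a 2-filtered
pseudo-colimit of categories by representatives (`PsColimit.exists_ofPre`,
`PsColimit.exists_map_eq`). Conversely, if `T` is flat then its generators are the objects of a
2-filtered 2-category, and they form a 2-pro-object whose 2-functor is isomorphic to `T`
(`Gen.compare_invertible`).

The theorem follows. A 2-natural transformation `α : H ⟶ H'` satisfies `α_X ≫ H' κ_X = H κ_X ≫ α_c`,
so if the cones `H' κ_X` are universal then `α` and the modifications between such `α` are
determined by their restrictions to `C`, and every 2-natural transformation or modification over `C`
extends. This makes `c^*` an isomorphism on hom-categories (`restrict_isIsoCat`). A 2-functor `F` on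
`C` extends to `2-Pro(C)` by sending `X` to the vertex of a universal cone over `F` with weight
`L_X`; the extension restricts to `F` up to an invertible 2-natural transformation, and it preserves
the universality of the `κ_X` (`exists_extension`). A 2-functor that is an isomorphism on
hom-categories and surjective on objects up to invertible 1-cells is a 2-equivalence
(`isTwoEquivalence_of_isIsoCat`).
-/

/-! ### Equality of morphisms up to equality of endpoints -/

namespace TwoCat

universe a₁ a₂ b₁ b₂ c₁ c₂

/-- Equality of two morphisms whose sources and targets are only propositionally equal. Modulo this
relation, the coherence 2-cells of a strict bicategory are identities and the transports `eqToHom`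
may be dropped. -/
inductive HomEq {X : Type u₁} [Category.{v₁} X] : ∀ {a b c d : X}, (a ⟶ b) → (c ⟶ d) → Prop
  | refl {a b : X} (f : a ⟶ b) : HomEq f f

infix:50 " ≈ₕ " => HomEq

namespace HomEq

section

variable {X : Type u₁} [Category.{v₁} X] {Y : Type u₂} [Category.{v₂} Y]

theorem symm {a b c d : X} {f : a ⟶ b} {g : c ⟶ d} (h : f ≈ₕ g) : g ≈ₕ f := by
  cases h; exact .refl _

theorem trans {a b c d e k : X} {f : a ⟶ b} {g : c ⟶ d} {l : e ⟶ k} (h : f ≈ₕ g) (h' : g ≈ₕ l) :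
    f ≈ₕ l := by
  cases h; exact h'

theorem of_eq {a b : X} {f g : a ⟶ b} (h : f = g) : f ≈ₕ g := by
  cases h; exact .refl _

theorem heq {a b c d : X} {f : a ⟶ b} {g : c ⟶ d} (h : f ≈ₕ g) : f ≍ g := by
  cases h; exact HEq.rfl

theorem eq {a b : X} {f g : a ⟶ b} (h : f ≈ₕ g) : f = g := eq_of_heq h.heq

theorem src {a b c d : X} {f : a ⟶ b} {g : c ⟶ d} (h : f ≈ₕ g) : a = c := by
  cases h; exact Eq.refl _

theorem tgt {a b c d : X} {f : a ⟶ b} {g : c ⟶ d} (h : f ≈ₕ g) : b = d := by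
  cases h; exact Eq.refl _

theorem comp {a b c a' b' c' : X} {f : a ⟶ b} {g : b ⟶ c} {f' : a' ⟶ b'} {g' : b' ⟶ c'}
    (h : f ≈ₕ f') (h' : g ≈ₕ g') : f ≫ g ≈ₕ f' ≫ g' := by
  cases h; cases h'; exact .refl _

theorem eqToHom_comp {a b c : X} (h : a = b) (f : b ⟶ c) : eqToHom h ≫ f ≈ₕ f := by
  subst h; simpa using .refl f

theorem comp_eqToHom {a b c : X} (f : a ⟶ b) (h : b = c) : f ≫ eqToHom h ≈ₕ f := by
  subst h; simpa using .refl f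

theorem conj {a b c d : X} (h : a = b) (f : b ⟶ c) (h' : c = d) :
    eqToHom h ≫ f ≫ eqToHom h' ≈ₕ f := by
  subst h h'; simpa using .refl f

theorem eqToHom_id {a b c : X} (h : a = b) (h' : a = c) : eqToHom h ≈ₕ 𝟙 c := by
  subst h h'; exact .refl _

theorem eqToIso_hom {a b : X} (h : a = b) : (eqToIso h).hom ≈ₕ 𝟙 b := by
  subst h; exact .refl _

theorem eqToIso_inv {a b : X} (h : a = b) : (eqToIso h).inv ≈ₕ 𝟙 b := by
  subst h; exact .refl _

theorem id {a b : X} (h : a = b) : 𝟙 a ≈ₕ 𝟙 b := by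
  subst h; exact .refl _

theorem id_comp {a b c d e : X} {f : a ⟶ b} {g : b ⟶ c} {k : d ⟶ e} (h : f ≈ₕ 𝟙 b)
    (h' : g ≈ₕ k) : f ≫ g ≈ₕ k := by
  cases h; rw [Category.id_comp]; exact h'

theorem comp_id {a b c d e : X} {f : a ⟶ b} {g : b ⟶ c} {k : d ⟶ e} (h : f ≈ₕ k)
    (h' : g ≈ₕ 𝟙 b) : f ≫ g ≈ₕ k := by
  cases h'; rw [Category.comp_id]; exact h

/-- Two morphisms that agree up to equality of endpoints differ by transport. -/
theorem eq_conj {a b c d : X} {f : a ⟶ b} {g : c ⟶ d} (h : f ≈ₕ g) :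
    f = eqToHom h.src ≫ g ≫ eqToHom h.tgt.symm := by
  cases h; simp

theorem map (F : X ⥤ Y) {a b c d : X} {f : a ⟶ b} {g : c ⟶ d} (h : f ≈ₕ g) :
    F.map f ≈ₕ F.map g := by
  cases h; exact .refl _

theorem map_congr {F G : X ⥤ Y} (e : F = G) {a b c d : X} {f : a ⟶ b} {g : c ⟶ d} (h : f ≈ₕ g) :
    F.map f ≈ₕ G.map g := by
  cases e; cases h; exact .refl _

theorem app {F G : X ⥤ Y} (t : F ⟶ G) {a b : X} (h : a = b) : t.app a ≈ₕ t.app b := by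
  cases h; exact .refl _

theorem inv {a b c d : X} {f : a ≅ b} {g : c ≅ d} (h : f.hom ≈ₕ g.hom) : f.inv ≈ₕ g.inv := by
  obtain rfl := h.src
  obtain rfl := h.tgt
  obtain rfl : f = g := Iso.ext h.eq
  exact .refl _

theorem functor_ext {F G : X ⥤ Y} (h : ∀ a, F.obj a = G.obj a)
    (h' : ∀ {a b : X} (f : a ⟶ b), F.map f ≈ₕ G.map f) : F = G :=
  CategoryTheory.Functor.ext h fun _ _ f => (h' f).eq_conj

end

section

variable {B : Type u₁} [Bicategory.{w₁, v₁} B]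

theorem whiskerLeft {a b c : B} {k k' : a ⟶ b} (e : k = k') {f g f' g' : b ⟶ c} {η : f ⟶ g}
    {η' : f' ⟶ g'} (h : η ≈ₕ η') : k ◁ η ≈ₕ k' ◁ η' := by
  cases e; cases h; exact .refl _

theorem whiskerRight {a b c : B} {f g f' g' : a ⟶ b} {η : f ⟶ g}
    {η' : f' ⟶ g'} (h : η ≈ₕ η') {k k' : b ⟶ c} (e : k = k') : η ▷ k ≈ₕ η' ▷ k' := by
  cases e; cases h; exact .refl _

variable [Strict B]

theorem comp_whiskerLeft {a b c d : B} (f : a ⟶ b) (g : b ⟶ c) {h h' : c ⟶ d} (η : h ⟶ h') :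
    (f ≫ g) ◁ η ≈ₕ f ◁ g ◁ η := by
  rw [comp_whiskerLeft']; exact conj _ _ _

theorem whiskerRight_comp {a b c d : B} {f f' : a ⟶ b} (η : f ⟶ f') (g : b ⟶ c) (h : c ⟶ d) :
    η ▷ (g ≫ h) ≈ₕ η ▷ g ▷ h := by
  rw [whiskerRight_comp']; exact conj _ _ _

theorem whisker_assoc {a b c d : B} (f : a ⟶ b) {g g' : b ⟶ c} (η : g ⟶ g') (h : c ⟶ d) :
    (f ◁ η) ▷ h ≈ₕ f ◁ η ▷ h := by
  rw [whisker_assoc']; exact conj _ _ _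

theorem id_whiskerLeft {a b : B} {f g : a ⟶ b} (η : f ⟶ g) : 𝟙 a ◁ η ≈ₕ η := by
  rw [id_whiskerLeft']; exact conj _ _ _

theorem whiskerRight_id {a b : B} {f g : a ⟶ b} (η : f ⟶ g) : η ▷ 𝟙 b ≈ₕ η := by
  rw [whiskerRight_id']; exact conj _ _ _

theorem associator_hom {a b c d : B} (f : a ⟶ b) (g : b ⟶ c) (h : c ⟶ d) :
    (α_ f g h).hom ≈ₕ 𝟙 (f ≫ g ≫ h) := by
  rw [Strict.associator_eqToIso]; exact eqToIso_hom _

theorem associator_inv {a b c d : B} (f : a ⟶ b) (g : b ⟶ c) (h : c ⟶ d) :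
    (α_ f g h).inv ≈ₕ 𝟙 (f ≫ g ≫ h) := by
  rw [Strict.associator_eqToIso]; exact eqToIso_inv _

theorem rightUnitor_inv {a b : B} (f : a ⟶ b) : (ρ_ f).inv ≈ₕ 𝟙 f := by
  rw [Strict.rightUnitor_eqToIso]; exact eqToIso_inv _

end

section

variable {B : Type u₁} [Bicategory.{w₁, v₁} B] {D : Type u₂} [Bicategory.{w₂, v₂} D]

theorem map₂ (F : StrictPseudofunctor B D) {a b : B} {f g f' g' : a ⟶ b} {η : f ⟶ g}
    {η' : f' ⟶ g'} (h : η ≈ₕ η') : F.map₂ η ≈ₕ F.map₂ η' := by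
  cases h; exact .refl _

theorem map₂_whiskerLeft (F : StrictPseudofunctor B D) {a b c : B} (k : a ⟶ b) {f g : b ⟶ c}
    (η : f ⟶ g) : F.map₂ (k ◁ η) ≈ₕ F.map k ◁ F.map₂ η := by
  rw [map₂_whiskerLeft_strict]; exact conj _ _ _

theorem map₂_whiskerRight (F : StrictPseudofunctor B D) {a b c : B} {f g : a ⟶ b}
    (η : f ⟶ g) (k : b ⟶ c) : F.map₂ (η ▷ k) ≈ₕ F.map₂ η ▷ F.map k := by
  rw [map₂_whiskerRight_strict]; exact conj _ _ _

theorem mapComp_hom (F : StrictPseudofunctor B D) {a b c : B} (f : a ⟶ b) (g : b ⟶ c) :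
    (F.mapComp f g).hom ≈ₕ 𝟙 (F.map f ≫ F.map g) := by
  rw [F.mapComp_eq_eqToIso]; exact eqToIso_hom _

theorem mapId_hom (F : StrictPseudofunctor B D) (a : B) : (F.mapId a).hom ≈ₕ 𝟙 (𝟙 (F.obj a)) := by
  rw [F.mapId_eq_eqToIso]; exact eqToIso_hom _

theorem twoNatTrans_naturality₂ {F G : StrictPseudofunctor B D} (α : TwoNatTrans F G) {a b : B}
    {f g : a ⟶ b} (η : f ⟶ g) : F.map₂ η ▷ α.app b ≈ₕ α.app a ◁ G.map₂ η :=
  (comp_eqToHom _ _).symm.trans ((of_eq (α.naturality₂ η)).trans (eqToHom_comp _ _))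

theorem modif_naturality {F G : StrictPseudofunctor B D} {α β : TwoNatTrans F G} (Γ : Modif α β)
    {a b : B} (f : a ⟶ b) : F.map f ◁ Γ.app b ≈ₕ Γ.app a ▷ G.map f :=
  (comp_eqToHom _ _).symm.trans ((of_eq (Γ.naturality f)).trans (eqToHom_comp _ _))

/-- Converse of `twoNatTrans_naturality₂` and `modif_naturality`: equality up to endpoints gives
the commutative square with transports. -/
theorem square {X : Type u₁} [Category.{v₁} X] {a b a' b' : X} {f : a ⟶ b} {f' : a' ⟶ b'}
    (h : f ≈ₕ f') (e : b = b') (e' : a = a') : f ≫ eqToHom e = eqToHom e' ≫ f' := by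
  cases h; simp

theorem conj_eq {X : Type u₁} [Category.{v₁} X] {a b a' b' : X} {f : a ⟶ b} {f' : a' ⟶ b'}
    (h : f ≈ₕ f') (e : a = a') (e' : b' = b) : f = eqToHom e ≫ f' ≫ eqToHom e' := by
  cases h; simp

end

end HomEq

section IsoCat

variable {X : Type u₁} [Category.{v₁} X] {Y : Type u₂} [Category.{v₂} Y]

theorem HomEq.of_map {F : X ⥤ Y} [F.Faithful] {x x' z z' : X} {f : x ⟶ x'} {g : z ⟶ z'}
    (h : x = z) (h' : x' = z') (e : F.map f ≈ₕ F.map g) : f ≈ₕ g := by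
  subst h h'
  exact .of_eq (F.map_injective e.eq)

/-- A functor is an isomorphism of categories if and only if it is fully faithful and bijective on
objects. -/
theorem isIsoCat_iff (F : X ⥤ Y) :
    IsIsoCat F ↔ Function.Bijective F.obj ∧ F.Full ∧ F.Faithful := by
  constructor
  · rintro ⟨G, h, h'⟩
    have e (x : X) : G.obj (F.obj x) = x := congrArg (fun K => K.obj x) h
    have e' (y : Y) : F.obj (G.obj y) = y := congrArg (fun K => K.obj y) h'
    have m {x x' : X} (f : x ⟶ x') : G.map (F.map f) ≈ₕ f := HomEq.map_congr h (.refl f)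
    have m' {x x' : Y} (f : x ⟶ x') : F.map (G.map f) ≈ₕ f := HomEq.map_congr h' (.refl f)
    have faithful : F.Faithful := ⟨fun {x x'} f g hfg => by
      exact ((m f).symm.trans ((HomEq.of_eq (by rw [hfg])).trans (m g))).eq⟩
    refine ⟨⟨fun x x' hx => ?_, fun y => ⟨G.obj y, e' y⟩⟩, ⟨fun {x x'} f => ?_⟩, faithful⟩
    · rw [← e x, hx, e]
    · refine ⟨eqToHom (e x).symm ≫ G.map f ≫ eqToHom (e x'), HomEq.eq ?_⟩
      exact (HomEq.map F (HomEq.conj _ _ _)).trans (m' f)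
  · rintro ⟨hb, hf, hf'⟩
    let r := fun y => Classical.choose (hb.2 y)
    have hr (y) : F.obj (r y) = y := Classical.choose_spec (hb.2 y)
    refine ⟨{ obj := r
              map := fun {y y'} f => F.preimage (eqToHom (hr y) ≫ f ≫ eqToHom (hr y').symm)
              map_id := fun y => F.map_injective (by simp)
              map_comp := fun f g => F.map_injective (by simp) }, ?_, ?_⟩
    · refine HomEq.functor_ext (fun x => hb.1 (hr _)) fun {x x'} f => ?_
      refine HomEq.of_map (F := F) (hb.1 (hr _)) (hb.1 (hr _)) ?_
      dsimp
      rw [F.map_preimage]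
      exact HomEq.conj _ _ _
    · refine HomEq.functor_ext (fun y => hr y) fun {y y'} f => ?_
      dsimp
      rw [F.map_preimage]
      exact HomEq.conj _ _ _

variable {A : Type u₃} [Category.{v₃} A]

/-- Two functors out of the same category are simultaneously isomorphisms of categories, if their
targets are related by a one-to-one correspondence of objects and of morphisms under which they
match. -/
theorem isIsoCat_iff_of_correspondence (F : A ⥤ X) (G : A ⥤ Y) (R : X → Y → Prop)
    (R₂ : ∀ {x x' : X} {y y' : Y}, (x ⟶ x') → (y ⟶ y') → Prop)
    (ex : ∀ x, ∃ y, R x y) (ex' : ∀ y, ∃ x, R x y)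
    (uniq : ∀ {x y y'}, R x y → R x y' → y = y') (uniq' : ∀ {x x' y}, R x y → R x' y → x = x')
    (ex₂ : ∀ {x x' y y'}, R x y → R x' y' → ∀ m : x ⟶ x', ∃ n : y ⟶ y', R₂ m n)
    (ex₂' : ∀ {x x' y y'}, R x y → R x' y' → ∀ n : y ⟶ y', ∃ m : x ⟶ x', R₂ m n)
    (uniq₂ : ∀ {x x' y y'}, R x y → R x' y' → ∀ {m : x ⟶ x'} {n n' : y ⟶ y'},
      R₂ m n → R₂ m n' → n = n')
    (uniq₂' : ∀ {x x' y y'}, R x y → R x' y' → ∀ {m m' : x ⟶ x'} {n : y ⟶ y'},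
      R₂ m n → R₂ m' n → m = m')
    (h : ∀ a, R (F.obj a) (G.obj a))
    (h₂ : ∀ {a b : A} (f : a ⟶ b), R₂ (F.map f) (G.map f)) : IsIsoCat F ↔ IsIsoCat G := by
  rw [isIsoCat_iff, isIsoCat_iff]
  constructor
  · rintro ⟨hb, hf, hf'⟩
    refine ⟨⟨fun a b hab => hb.1 (uniq' (h a) (hab ▸ h b)), fun y => ?_⟩,
      ⟨fun {a b} n => ?_⟩, ⟨fun {a b} f g hfg => ?_⟩⟩
    · obtain ⟨x, hx⟩ := ex' y
      obtain ⟨a, rfl⟩ := hb.2 x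
      exact ⟨a, uniq (h a) hx⟩
    · obtain ⟨m, hm⟩ := ex₂' (h a) (h b) n
      obtain ⟨f, rfl⟩ := F.map_surjective m
      exact ⟨f, uniq₂ (h a) (h b) (h₂ f) hm⟩
    · exact F.map_injective (uniq₂' (h a) (h b) (h₂ f) (hfg ▸ h₂ g))
  · rintro ⟨hb, hf, hf'⟩
    refine ⟨⟨fun a b hab => hb.1 (uniq (h a) (hab ▸ h b)), fun x => ?_⟩,
      ⟨fun {a b} m => ?_⟩, ⟨fun {a b} f g hfg => ?_⟩⟩
    · obtain ⟨y, hy⟩ := ex x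
      obtain ⟨a, rfl⟩ := hb.2 y
      exact ⟨a, uniq' (h a) hy⟩
    · obtain ⟨n, hn⟩ := ex₂ (h a) (h b) m
      obtain ⟨f, rfl⟩ := G.map_surjective n
      exact ⟨f, uniq₂' (h a) (h b) (h₂ f) hn⟩
    · exact G.map_injective (uniq₂ (h a) (h b) (h₂ f) (hfg ▸ h₂ g))

end IsoCat

end TwoCat

/-! ### Category-valued 2-functors and weighted cones -/

namespace TwoCat

universe a₁ a₂ b₁ b₂ c₁ c₂

section Het

variable {C : Type u} [Bicategory.{w₃, v₃} C]

/-- The action of a category-valued 2-functor on an object, along a 1-cell. -/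
abbrev act (P : StrictPseudofunctor C Cat.{a₁, b₁}) {D D' : C} (f : D ⟶ D') (x : P.obj D) :
    P.obj D' :=
  (P.map f).toFunctor.obj x

/-- The action of a category-valued 2-functor on a morphism, along a 1-cell. -/
abbrev actMap (P : StrictPseudofunctor C Cat.{a₁, b₁}) {D D' : C} (f : D ⟶ D') {x y : P.obj D}
    (r : x ⟶ y) : act P f x ⟶ act P f y :=
  (P.map f).toFunctor.map r

/-- The action of a category-valued 2-functor on an object, along a 2-cell. -/
abbrev act₂ (P : StrictPseudofunctor C Cat.{a₁, b₁}) {D D' : C} {f g : D ⟶ D'} (η : f ⟶ g)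
    (x : P.obj D) : act P f x ⟶ act P g x :=
  (P.map₂ η).toNatTrans.app x

section

variable (P : StrictPseudofunctor C Cat.{a₁, b₁})

theorem act_id {D : C} (x : P.obj D) : act P (𝟙 D) x = x :=
  congrArg (fun t => (Cat.Hom.toFunctor t).obj x) (P.map_id D)

theorem act_comp {D D' D'' : C} (f : D ⟶ D') (g : D' ⟶ D'') (x : P.obj D) :
    act P (f ≫ g) x = act P g (act P f x) :=
  congrArg (fun t => (Cat.Hom.toFunctor t).obj x) (P.map_comp f g)

theorem actMap_congr {D D' : C} {f g : D ⟶ D'} (h : f = g) {x y z t : P.obj D} {r : x ⟶ y}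
    {s : z ⟶ t} (e : r ≈ₕ s) : actMap P f r ≈ₕ actMap P g s := by
  cases h; cases e; exact .refl _

theorem actMap_id {D : C} {x y : P.obj D} (r : x ⟶ y) : actMap P (𝟙 D) r ≈ₕ r :=
  HomEq.map_congr (congrArg Cat.Hom.toFunctor (P.map_id D)) (.refl r)

theorem actMap_comp {D D' D'' : C} (f : D ⟶ D') (g : D' ⟶ D'') {x y : P.obj D} (r : x ⟶ y) :
    actMap P (f ≫ g) r ≈ₕ actMap P g (actMap P f r) :=
  HomEq.map_congr (congrArg Cat.Hom.toFunctor (P.map_comp f g)) (.refl r)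

theorem toNatTrans_congr {X Y : Cat.{a₁, b₁}} {f g f' g' : X ⟶ Y} {η : f ⟶ g} {η' : f' ⟶ g'}
    (h : η ≈ₕ η') {x y : X} (e : x = y) : η.toNatTrans.app x ≈ₕ η'.toNatTrans.app y := by
  cases h; cases e; exact .refl _

theorem act₂_congr {D D' : C} {f g f' g' : D ⟶ D'} {η : f ⟶ g} {η' : f' ⟶ g'} (h : η ≈ₕ η')
    {x y : P.obj D} (e : x = y) : act₂ P η x ≈ₕ act₂ P η' y :=
  toNatTrans_congr (HomEq.map₂ P h) e

theorem act₂_id {D D' : C} (f : D ⟶ D') (x : P.obj D) : act₂ P (𝟙 f) x = 𝟙 (act P f x) := by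
  have := congrArg (fun t => t.toNatTrans.app x) (P.map₂_id f)
  exact this

theorem act₂_comp {D D' : C} {f g h : D ⟶ D'} (η : f ⟶ g) (θ : g ⟶ h) (x : P.obj D) :
    act₂ P (η ≫ θ) x = act₂ P η x ≫ act₂ P θ x := by
  have := congrArg (fun t => t.toNatTrans.app x) (P.map₂_comp η θ)
  exact this

theorem act₂_whiskerLeft {D D' D'' : C} (k : D ⟶ D') {f g : D' ⟶ D''} (η : f ⟶ g) (x : P.obj D) :
    act₂ P (k ◁ η) x ≈ₕ act₂ P η (act P k x) :=
  toNatTrans_congr (HomEq.map₂_whiskerLeft P k η) (Eq.refl x)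

theorem act₂_whiskerRight {D D' D'' : C} {f g : D ⟶ D'} (η : f ⟶ g) (k : D' ⟶ D'') (x : P.obj D) :
    act₂ P (η ▷ k) x ≈ₕ actMap P k (act₂ P η x) :=
  toNatTrans_congr (HomEq.map₂_whiskerRight P η k) (Eq.refl x)

theorem act₂_naturality {D D' : C} {f g : D ⟶ D'} (η : f ⟶ g) {x y : P.obj D} (r : x ⟶ y) :
    actMap P f r ≫ act₂ P η y = act₂ P η x ≫ actMap P g r :=
  (P.map₂ η).toNatTrans.naturality r

end

/-- A 2-natural transformation between category-valued 2-functors whose values may lie in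
different universes. -/
structure HetTrans (P : StrictPseudofunctor C Cat.{a₁, b₁}) (Q : StrictPseudofunctor C Cat.{a₂, b₂})
    where
  app (D : C) : P.obj D ⥤ Q.obj D
  obj_nat {D D' : C} (f : D ⟶ D') (x : P.obj D) :
    (app D').obj (act P f x) = act Q f ((app D).obj x)
  map_nat {D D' : C} (f : D ⟶ D') {x y : P.obj D} (r : x ⟶ y) :
    (app D').map (actMap P f r) ≈ₕ actMap Q f ((app D).map r)
  nat₂ {D D' : C} {f g : D ⟶ D'} (η : f ⟶ g) (x : P.obj D) :
    (app D').map (act₂ P η x) ≈ₕ act₂ Q η ((app D).obj x)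

namespace HetTrans

variable {P : StrictPseudofunctor C Cat.{a₁, b₁}} {Q : StrictPseudofunctor C Cat.{a₂, b₂}}

theorem ext {φ ψ : HetTrans P Q} (h : ∀ D, φ.app D = ψ.app D) : φ = ψ := by
  cases φ; cases ψ
  obtain rfl := funext h
  rfl

/-- A modification between transformations of category-valued 2-functors. -/
structure Hom (φ ψ : HetTrans P Q) where
  app (D : C) : φ.app D ⟶ ψ.app D
  nat {D D' : C} (f : D ⟶ D') (x : P.obj D) :
    (app D').app (act P f x) ≈ₕ actMap Q f ((app D).app x)

instance : Category (HetTrans P Q) where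
  Hom φ ψ := Hom φ ψ
  id φ := ⟨fun D => 𝟙 _, fun f x =>
    (HomEq.id (φ.obj_nat f x)).trans (.of_eq ((Q.map f).toFunctor.map_id _).symm)⟩
  comp m n := ⟨fun D => m.app D ≫ n.app D, fun f x =>
    (HomEq.comp (m.nat f x) (n.nat f x)).trans (.of_eq ((Q.map f).toFunctor.map_comp _ _).symm)⟩

theorem hom_ext {φ ψ : HetTrans P Q} {m n : φ ⟶ ψ} (h : ∀ D x, (m.app D).app x = (n.app D).app x) :
    m = n := by
  obtain ⟨m, _⟩ := m
  obtain ⟨n, _⟩ := n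
  obtain rfl : m = n := funext fun D => NatTrans.ext (funext (h D))
  rfl

theorem map_congr {φ ψ : HetTrans P Q} (h : φ = ψ) {D : C} {x y x' y' : P.obj D} {r : x ⟶ y}
    {s : x' ⟶ y'} (e : r ≈ₕ s) : (φ.app D).map r ≈ₕ (ψ.app D).map s := by
  cases h; cases e; exact .refl _

theorem obj_congr {φ ψ : HetTrans P Q} (h : φ = ψ) {D : C} {x y : P.obj D} (e : x = y) :
    (φ.app D).obj x = (ψ.app D).obj y := by
  cases h; cases e; rfl

/-- Restriction of a transformation along a transformation of the sources. -/
def comp {P' : StrictPseudofunctor C Cat.{c₁, c₂}} (α : HetTrans P' P) (φ : HetTrans P Q) :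
    HetTrans P' Q where
  app D := α.app D ⋙ φ.app D
  obj_nat f x := (congrArg (φ.app _).obj (α.obj_nat f x)).trans (φ.obj_nat f _)
  map_nat f _ _ r := (HomEq.map (φ.app _) (α.map_nat f r)).trans (φ.map_nat f _)
  nat₂ η x := (HomEq.map (φ.app _) (α.nat₂ η x)).trans (φ.nat₂ η _)

/-- Restriction of a modification along a transformation of the sources. -/
def compHom {P' : StrictPseudofunctor C Cat.{c₁, c₂}} (α : HetTrans P' P) {φ ψ : HetTrans P Q}
    (m : φ ⟶ ψ) : α.comp φ ⟶ α.comp ψ :=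
  Hom.mk (fun D => (α.app D).whiskerLeft (Hom.app m D)) fun f x =>
    (HomEq.app _ (α.obj_nat f x)).trans (Hom.nat m f _)

end HetTrans

end Het

section

variable {C : Type u} [Bicategory.{w₃, v₃} C]
  {P Q R : StrictPseudofunctor C Cat.{a₁, b₁}}

theorem TwoNatTrans.app_obj_nat (α : P ⟶ Q) {D D' : C} (f : D ⟶ D') (x : P.obj D) :
    (TwoNatTrans.app α D').toFunctor.obj (act P f x) =
      act Q f ((TwoNatTrans.app α D).toFunctor.obj x) :=
  congrArg (fun t => (Cat.Hom.toFunctor t).obj x) (TwoNatTrans.naturality α f)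

/-- A 2-natural transformation between category-valued 2-functors, elementwise. -/
def TwoNatTrans.toHet (α : P ⟶ Q) : HetTrans P Q where
  app D := (TwoNatTrans.app α D).toFunctor
  obj_nat f x := congrArg (fun t => (Cat.Hom.toFunctor t).obj x) (TwoNatTrans.naturality α f)
  map_nat f _ _ r :=
    HomEq.map_congr (congrArg Cat.Hom.toFunctor (TwoNatTrans.naturality α f)) (.refl r)
  nat₂ η x := toNatTrans_congr (HomEq.twoNatTrans_naturality₂ α η) (Eq.refl x)

theorem HomEq.cat_ext {X Y : Cat.{a₁, b₁}} {f g : X ⟶ Y} {η θ : f ⟶ g}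
    (h : ∀ x, η.toNatTrans.app x = θ.toNatTrans.app x) : η = θ := by
  apply Cat.Hom₂.ext
  ext x
  exact h x

/-- An elementwise 2-natural transformation, as a 1-cell of `Hom(C, Cat)`. -/
def HetTrans.toTwo (α : HetTrans P Q) : P ⟶ Q :=
  TwoNatTrans.mk (fun D => (α.app D).toCatHom)
    (fun f => congrArg Functor.toCatHom (HomEq.functor_ext (α.obj_nat f) (α.map_nat f)))
    (fun η => HomEq.cat_ext fun x => by
      refine (toNatTrans_comp_eqToHom_app _ _ x).trans
        (Eq.trans ?_ (toNatTrans_eqToHom_comp_app _ _ x).symm)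
      exact (α.nat₂ η x).square _ _)

/-- A modification between category-valued 2-functors, elementwise. -/
def Modif.toHet {α β : P ⟶ Q} (Γ : α ⟶ β) : TwoNatTrans.toHet α ⟶ TwoNatTrans.toHet β :=
  HetTrans.Hom.mk (fun D => (Modif.app Γ D).toNatTrans) fun f x =>
    toNatTrans_congr (HomEq.modif_naturality Γ f) (Eq.refl x)

/-- An elementwise modification, as a 2-cell of `Hom(C, Cat)`. -/
def HetTrans.Hom.toTwo {α β : P ⟶ Q} (m : TwoNatTrans.toHet α ⟶ TwoNatTrans.toHet β) : α ⟶ β :=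
  Modif.mk (fun D => (HetTrans.Hom.app m D).toCatHom₂) fun f => HomEq.cat_ext fun x => by
    refine (toNatTrans_comp_eqToHom_app _ _ x).trans
      (Eq.trans ?_ (toNatTrans_eqToHom_comp_app _ _ x).symm)
    exact (HetTrans.Hom.nat m f x).square _ _

end

section Cones

variable {E : Type u₁} [Bicategory.{w₁, v₁} E] [Strict E]

/-- The 2-functor `E(K, -)`. -/
def corep (K : E) : StrictPseudofunctor E Cat.{w₁, v₁} :=
  StrictPseudofunctor.mk''
    { obj := fun V => Cat.of (K ⟶ V)
      map := fun g => (postcomp K g).toCatHom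
      map₂ := fun γ => ((postcomposing K _ _).map γ).toCatHom₂
      map₂_id := fun f => HomEq.cat_ext fun h => Bicategory.whiskerLeft_id h f
      map₂_comp := fun η θ => HomEq.cat_ext fun h => Bicategory.whiskerLeft_comp h η θ
      map_id := fun A => postcomp_id _ _
      map_comp := fun f g => postcomp_comp _ _ _
      map₂_whisker_left := fun f g g' η => HomEq.cat_ext fun h => by
        refine Eq.trans ?_ (PseudoColimit.app_conj _ _ _ h).symm
        exact homDiagram_aux₃ h f η
      map₂_whisker_right := fun η g => HomEq.cat_ext fun h => by
        refine Eq.trans ?_ (PseudoColimit.app_conj _ _ _ h).symm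
        exact homDiagram_aux₄ h η g }

variable {C : Type u} [Bicategory.{w₃, v₃} C]
  {P : StrictPseudofunctor C Cat.{a₁, b₁}} {F : StrictPseudofunctor C E}

/-- A cone over `F` with weight `P` and vertex `K`: a 2-natural transformation
`P ⟶ E(K, F -)`. -/
abbrev WCone (P : StrictPseudofunctor C Cat.{a₁, b₁}) (F : StrictPseudofunctor C E) (K : E) :=
  HetTrans P (F.comp (corep K))

namespace WCone

/-- The 1-cell of a weighted cone at an element of the weight. -/
abbrev leg {K : E} (φ : WCone P F K) {D : C} (x : P.obj D) : K ⟶ F.obj D := (φ.app D).obj x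

/-- The 2-cell of a weighted cone at a morphism of the weight. -/
abbrev leg₂ {K : E} (φ : WCone P F K) {D : C} {x y : P.obj D} (r : x ⟶ y) : φ.leg x ⟶ φ.leg y :=
  (φ.app D).map r

/-- The component of a morphism of weighted cones at an element of the weight. -/
abbrev homLeg {K : E} {φ ψ : WCone P F K} (m : φ ⟶ ψ) {D : C} (x : P.obj D) :
    φ.leg x ⟶ ψ.leg x :=
  (HetTrans.Hom.app m D).app x

/-- Precomposition of a weighted cone with 1-cells and 2-cells into its vertex. -/
def pre {V : E} (φ : WCone P F V) (K : E) : (K ⟶ V) ⥤ WCone P F K where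
  obj k :=
    { app := fun D => φ.app D ⋙ precomp _ k
      obj_nat := fun {D D'} f x => by
        refine (congrArg (fun t => k ≫ t) (φ.obj_nat f x)).trans ?_
        exact (Strict.assoc _ _ _).symm
      map_nat := fun {D D'} f {x y} r => by
        refine (HomEq.whiskerLeft rfl (φ.map_nat f r)).trans ?_
        exact (HomEq.whisker_assoc _ _ _).symm
      nat₂ := fun {D D' f g} η x => by
        refine (HomEq.whiskerLeft rfl (φ.nat₂ η x)).trans ?_
        exact (HomEq.comp_whiskerLeft _ _ _).symm }
  map μ := HetTrans.Hom.mk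
    (fun D =>
      { app := fun x => μ ▷ φ.leg x
        naturality := fun x y r => whisker_exchange _ _ })
    (fun {D D'} f x => by
      refine (HomEq.whiskerRight (.refl μ) (φ.obj_nat f x)).trans ?_
      exact HomEq.whiskerRight_comp _ _ _)
  map_id k := HetTrans.hom_ext fun D x => id_whiskerRight _ _
  map_comp μ ν := HetTrans.hom_ext fun D x => comp_whiskerRight _ _ _

/-- A weighted cone is universal if composition with it is an isomorphism of categories, for every
source. -/
def Universal {V : E} (φ : WCone P F V) : Prop := ∀ K, IsIsoCat (φ.pre K)

variable {V : E} {φ : WCone P F V}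

theorem Universal.bijective (h : φ.Universal) (K : E) : Function.Bijective (φ.pre K).obj :=
  ((isIsoCat_iff _).1 (h K)).1

theorem Universal.full (h : φ.Universal) (K : E) : (φ.pre K).Full :=
  ((isIsoCat_iff _).1 (h K)).2.1

theorem Universal.faithful (h : φ.Universal) (K : E) : (φ.pre K).Faithful :=
  ((isIsoCat_iff _).1 (h K)).2.2

theorem Universal.cell_ext (h : φ.Universal) {K : E} {k l : K ⟶ V} {μ ν : k ⟶ l}
    (e : ∀ (D : C) (x : P.obj D), μ ▷ φ.leg x = ν ▷ φ.leg x) : μ = ν := by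
  have := h.faithful K
  exact (φ.pre K).map_injective (HetTrans.hom_ext e)

theorem Universal.ext (h : φ.Universal) {K : E} {k l : K ⟶ V}
    (e : ∀ (D : C) (x : P.obj D), k ≫ φ.leg x = l ≫ φ.leg x)
    (e' : ∀ (D : C) {x y : P.obj D} (r : x ⟶ y), k ◁ φ.leg₂ r ≈ₕ l ◁ φ.leg₂ r) : k = l :=
  (h.bijective K).1 (HetTrans.ext fun D => HomEq.functor_ext (e D) (e' D))

/-- 2-cells into the vertex of a universal cone may be compared on the legs, even if their 1-cells
are only propositionally equal. -/
theorem Universal.cell_homEq (h : φ.Universal) {K : E} {k l k' l' : K ⟶ V} {μ : k ⟶ l}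
    {ν : k' ⟶ l'} (hk : k = k') (hl : l = l')
    (e : ∀ (D : C) (x : P.obj D), μ ▷ φ.leg x ≈ₕ ν ▷ φ.leg x) : μ ≈ₕ ν := by
  subst hk hl
  exact .of_eq (h.cell_ext fun D x => (e D x).eq)

/-- The image of a weighted cone under a 2-functor. -/
def push {E' : Type u₂} [Bicategory.{w₂, v₂} E'] [Strict E'] (H : StrictPseudofunctor E E')
    {K : E} (φ : WCone P F K) : WCone P (F.comp H) (H.obj K) where
  app D :=
    { obj := fun x => H.map (φ.leg x)
      map := fun r => H.map₂ (φ.leg₂ r)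
      map_id := fun x => by
        have := (φ.app D).map_id x
        exact (congrArg (fun t => H.map₂ t) this).trans (H.map₂_id _)
      map_comp := fun r s => by
        have := (φ.app D).map_comp r s
        exact (congrArg (fun t => H.map₂ t) this).trans (H.map₂_comp _ _) }
  obj_nat f x := (congrArg H.map (φ.obj_nat f x)).trans (H.map_comp _ _)
  map_nat f _ _ r := (HomEq.map₂ H (φ.map_nat f r)).trans (HomEq.map₂_whiskerRight H _ _)
  nat₂ η x := (HomEq.map₂ H (φ.nat₂ η x)).trans (HomEq.map₂_whiskerLeft H _ _)

end WCone

end Cones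

end TwoCat

/-! ### Pseudo-colimits of categories by generators -/

namespace TwoCat

universe a₁ a₂ b₁ b₂ c₁ c₂

namespace Ps

variable {J : Type u} [Bicategory.{w, v₁} J] (Φ : J ⥤ᵖ Cat.{a₁, b₁})

/-- The action of a category-valued pseudofunctor on an object. -/
abbrev obj {i j : J} (u : i ⟶ j) (x : Φ.obj i) : Φ.obj j := (Φ.map u).toFunctor.obj x

/-- The action of a category-valued pseudofunctor on a morphism. -/
abbrev map {i j : J} (u : i ⟶ j) {x y : Φ.obj i} (r : x ⟶ y) : obj Φ u x ⟶ obj Φ u y :=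
  (Φ.map u).toFunctor.map r

/-- The action of a 2-cell on an object. -/
abbrev cell {i j : J} {u v : i ⟶ j} (η : u ⟶ v) (x : Φ.obj i) : obj Φ u x ⟶ obj Φ v x :=
  (Φ.map₂ η).toNatTrans.app x

/-- The composition constraint at an object. -/
def comp {i j k : J} (u : i ⟶ j) (v : j ⟶ k) (x : Φ.obj i) :
    obj Φ (u ≫ v) x ≅ obj Φ v (obj Φ u x) :=
  (Cat.Hom.toNatIso (Φ.mapComp u v)).app x

/-- The unit constraint at an object. -/
def unit (i : J) (x : Φ.obj i) : obj Φ (𝟙 i) x ≅ x :=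
  (Cat.Hom.toNatIso (Φ.mapId i)).app x

theorem cell_id {i j : J} (u : i ⟶ j) (x : Φ.obj i) : cell Φ (𝟙 u) x = 𝟙 _ :=
  congrArg (fun t => t.toNatTrans.app x) (Φ.map₂_id u)

theorem cell_comp {i j : J} {u v t : i ⟶ j} (η : u ⟶ v) (θ : v ⟶ t) (x : Φ.obj i) :
    cell Φ (η ≫ θ) x = cell Φ η x ≫ cell Φ θ x :=
  congrArg (fun t => t.toNatTrans.app x) (Φ.map₂_comp η θ)

/-- The action of an invertible 2-cell on an object. -/
@[simps]
def cellIso {i j : J} {u v : i ⟶ j} (η : u ≅ v) (x : Φ.obj i) : obj Φ u x ≅ obj Φ v x where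
  hom := cell Φ η.hom x
  inv := cell Φ η.inv x
  hom_inv_id := by rw [← cell_comp, Iso.hom_inv_id, cell_id]
  inv_hom_id := by rw [← cell_comp, Iso.inv_hom_id, cell_id]

theorem cell_naturality {i j : J} {u v : i ⟶ j} (η : u ⟶ v) {x y : Φ.obj i} (r : x ⟶ y) :
    map Φ u r ≫ cell Φ η y = cell Φ η x ≫ map Φ v r :=
  (Φ.map₂ η).toNatTrans.naturality r

theorem comp_naturality {i j k : J} (u : i ⟶ j) (v : j ⟶ k) {x y : Φ.obj i} (r : x ⟶ y) :
    map Φ (u ≫ v) r ≫ (comp Φ u v y).hom = (comp Φ u v x).hom ≫ map Φ v (map Φ u r) :=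
  (Φ.mapComp u v).hom.toNatTrans.naturality r

theorem comp_inv_naturality {i j k : J} (u : i ⟶ j) (v : j ⟶ k) {x y : Φ.obj i} (r : x ⟶ y) :
    map Φ v (map Φ u r) ≫ (comp Φ u v y).inv = (comp Φ u v x).inv ≫ map Φ (u ≫ v) r := by
  rw [Iso.comp_inv_eq, Category.assoc, Iso.eq_inv_comp, comp_naturality]

theorem unit_naturality (i : J) {x y : Φ.obj i} (r : x ⟶ y) :
    map Φ (𝟙 i) r ≫ (unit Φ i y).hom = (unit Φ i x).hom ≫ r :=
  (Φ.mapId i).hom.toNatTrans.naturality r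

theorem cell_whiskerLeft {i j k : J} (u : i ⟶ j) {v v' : j ⟶ k} (η : v ⟶ v') (x : Φ.obj i) :
    cell Φ (u ◁ η) x ≫ (comp Φ u v' x).hom = (comp Φ u v x).hom ≫ cell Φ η (obj Φ u x) := by
  have h := congrArg (fun t => t.toNatTrans.app x) (Φ.map₂_whisker_left u η)
  have h' : cell Φ (u ◁ η) x =
    (comp Φ u v x).hom ≫ cell Φ η (obj Φ u x) ≫ (comp Φ u v' x).inv := h
  rw [h']
  simp

theorem cell_whiskerRight {i j k : J} {u u' : i ⟶ j} (η : u ⟶ u') (v : j ⟶ k) (x : Φ.obj i) :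
    cell Φ (η ▷ v) x ≫ (comp Φ u' v x).hom = (comp Φ u v x).hom ≫ map Φ v (cell Φ η x) := by
  have h := congrArg (fun t => t.toNatTrans.app x) (Φ.map₂_whisker_right η v)
  have h' : cell Φ (η ▷ v) x =
    (comp Φ u v x).hom ≫ map Φ v (cell Φ η x) ≫ (comp Φ u' v x).inv := h
  rw [h']
  simp

theorem comp_assoc {i j k l : J} (u : i ⟶ j) (v : j ⟶ k) (t : k ⟶ l) (x : Φ.obj i) :
    (comp Φ (u ≫ v) t x).hom ≫ map Φ t (comp Φ u v x).hom =
      cell Φ (α_ u v t).hom x ≫ (comp Φ u (v ≫ t) x).hom ≫ (comp Φ v t (obj Φ u x)).hom := by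
  have h := congrArg (fun t => t.toNatTrans.app x) (Φ.map₂_associator u v t)
  have h' : cell Φ (α_ u v t).hom x = (comp Φ (u ≫ v) t x).hom ≫ map Φ t (comp Φ u v x).hom ≫
      𝟙 _ ≫ (comp Φ v t (obj Φ u x)).inv ≫ (comp Φ u (v ≫ t) x).inv := h
  rw [h']
  simp

theorem cell_leftUnitor {i j : J} (u : i ⟶ j) (x : Φ.obj i) :
    cell Φ (λ_ u).hom x = (comp Φ (𝟙 i) u x).hom ≫ map Φ u (unit Φ i x).hom := by
  have h := congrArg (fun t => t.toNatTrans.app x) (Φ.map₂_left_unitor u)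
  have h' : cell Φ (λ_ u).hom x =
      (comp Φ (𝟙 i) u x).hom ≫ map Φ u (unit Φ i x).hom ≫ 𝟙 _ := h
  rw [h', Category.comp_id]

theorem cell_rightUnitor {i j : J} (u : i ⟶ j) (x : Φ.obj i) :
    cell Φ (ρ_ u).hom x = (comp Φ u (𝟙 j) x).hom ≫ (unit Φ j (obj Φ u x)).hom := by
  have h := congrArg (fun t => t.toNatTrans.app x) (Φ.map₂_right_unitor u)
  have h' : cell Φ (ρ_ u).hom x =
      (comp Φ u (𝟙 j) x).hom ≫ (unit Φ j (obj Φ u x)).hom ≫ 𝟙 _ := h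
  rw [h', Category.comp_id]

end Ps

/-- A pseudo-colimit cocone under a category-valued pseudofunctor, described by generators: the
inclusions are jointly bijective on objects, and the morphisms are generated by the images of the
inclusions and the transition isomorphisms. -/
structure PsColimit {J : Type w} [Bicategory.{w, w} J] (Φ : J ⥤ᵖ Cat.{w, w}) (𝓣 : Type w)
    [Category.{w} 𝓣] where
  incl (j : J) : Φ.obj j ⥤ 𝓣
  tr {i j : J} (u : i ⟶ j) (x : Φ.obj i) : (incl i).obj x ≅ (incl j).obj (Ps.obj Φ u x)
  tr_naturality {i j : J} (u : i ⟶ j) {x y : Φ.obj i} (r : x ⟶ y) :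
    (incl i).map r ≫ (tr u y).hom = (tr u x).hom ≫ (incl j).map (Ps.map Φ u r)
  tr_id (i : J) (x : Φ.obj i) : (tr (𝟙 i) x).hom ≫ (incl i).map (Ps.unit Φ i x).hom = 𝟙 _
  tr_comp {i j k : J} (u : i ⟶ j) (v : j ⟶ k) (x : Φ.obj i) :
    (tr (u ≫ v) x).hom ≫ (incl k).map (Ps.comp Φ u v x).hom =
      (tr u x).hom ≫ (tr v (Ps.obj Φ u x)).hom
  tr_cell {i j : J} {u v : i ⟶ j} (η : u ⟶ v) (x : Φ.obj i) :
    (tr u x).hom ≫ (incl j).map (Ps.cell Φ η x) = (tr v x).hom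
  bijective : Function.Bijective fun p : Σ j, Φ.obj j => (incl p.1).obj p.2
  induction {Pr : ∀ {a b : 𝓣}, (a ⟶ b) → Prop}
    (hcomp : ∀ {a b c : 𝓣} (p : a ⟶ b) (q : b ⟶ c), Pr p → Pr q → Pr (p ≫ q))
    (hid : ∀ a : 𝓣, Pr (𝟙 a))
    (hincl : ∀ {i : J} {x y : Φ.obj i} (r : x ⟶ y), Pr ((incl i).map r))
    (htr : ∀ {i j : J} (u : i ⟶ j) (x : Φ.obj i), Pr (tr u x).hom)
    (htrInv : ∀ {i j : J} (u : i ⟶ j) (x : Φ.obj i), Pr (tr u x).inv)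
    {a b : 𝓣} (p : a ⟶ b) : Pr p

namespace PsColimit

variable {J : Type w} [Bicategory.{w, w} J] {Φ : J ⥤ᵖ Cat.{w, w}} {𝓣 : Type w}
    [Category.{w} 𝓣]

/-- The universal property of a pseudo-colimit, for functors to categories in given universes. -/
def HasDesc (c : PsColimit Φ 𝓣) : Prop :=
  ∀ (𝓔 : Type b₁) [Category.{a₁} 𝓔] (D : ∀ j, Φ.obj j ⥤ 𝓔)
    (θ : ∀ {i j : J} (u : i ⟶ j) (x : Φ.obj i), (D i).obj x ≅ (D j).obj (Ps.obj Φ u x)),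
    (∀ {i j : J} (u : i ⟶ j) {x y : Φ.obj i} (r : x ⟶ y),
      (D i).map r ≫ (θ u y).hom = (θ u x).hom ≫ (D j).map (Ps.map Φ u r)) →
    (∀ (i : J) (x : Φ.obj i), (θ (𝟙 i) x).hom ≫ (D i).map (Ps.unit Φ i x).hom = 𝟙 _) →
    (∀ {i j k : J} (u : i ⟶ j) (v : j ⟶ k) (x : Φ.obj i),
      (θ (u ≫ v) x).hom ≫ (D k).map (Ps.comp Φ u v x).hom =
        (θ u x).hom ≫ (θ v (Ps.obj Φ u x)).hom) →
    (∀ {i j : J} {u v : i ⟶ j} (η : u ⟶ v) (x : Φ.obj i),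
      (θ u x).hom ≫ (D j).map (Ps.cell Φ η x) = (θ v x).hom) →
    ∃ Ψ : 𝓣 ⥤ 𝓔, (∀ j, c.incl j ⋙ Ψ = D j) ∧
      ∀ {i j : J} (u : i ⟶ j) (x : Φ.obj i), Ψ.map (c.tr u x).hom ≈ₕ (θ u x).hom

variable (c : PsColimit Φ 𝓣)

theorem exists_rep (a : 𝓣) : ∃ (j : J) (x : Φ.obj j), (c.incl j).obj x = a := by
  obtain ⟨⟨j, x⟩, h⟩ := c.bijective.2 a
  exact ⟨j, x, h⟩

theorem rep_inj {i j : J} {x : Φ.obj i} {y : Φ.obj j} (h : (c.incl i).obj x = (c.incl j).obj y) :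
    (⟨i, x⟩ : Σ j, Φ.obj j) = ⟨j, y⟩ :=
  c.bijective.1 h

theorem tr_naturality_inv {i j : J} (u : i ⟶ j) {x y : Φ.obj i} (r : x ⟶ y) :
    (c.incl j).map (Ps.map Φ u r) ≫ (c.tr u y).inv = (c.tr u x).inv ≫ (c.incl i).map r := by
  rw [Iso.comp_inv_eq, Category.assoc, Iso.eq_inv_comp, tr_naturality]

/-- Two functors out of a pseudo-colimit agree if they agree on generators. -/
theorem functor_ext {𝓔 : Type b₁} [Category.{a₁} 𝓔] {Ψ Ψ' : 𝓣 ⥤ 𝓔}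
    (h : ∀ j, c.incl j ⋙ Ψ = c.incl j ⋙ Ψ')
    (h' : ∀ {i j : J} (u : i ⟶ j) (x : Φ.obj i), Ψ.map (c.tr u x).hom ≈ₕ Ψ'.map (c.tr u x).hom) :
    Ψ = Ψ' := by
  refine HomEq.functor_ext (fun a => ?_) fun {a b} p => ?_
  · obtain ⟨j, x, rfl⟩ := c.exists_rep a
    exact congrArg (fun K => K.obj x) (h j)
  · refine c.induction (Pr := fun {a b} p => Ψ.map p ≈ₕ Ψ'.map p) ?_ ?_ ?_ (fun u x => h' u x) ?_ p
    · intro a b c p q hp hq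
      rw [Functor.map_comp, Functor.map_comp]
      exact hp.comp hq
    · intro a
      rw [Ψ.map_id, Ψ'.map_id]
      obtain ⟨j, x, rfl⟩ := c.exists_rep a
      exact .id (congrArg (fun K => K.obj x) (h j))
    · intro i x y r
      exact HomEq.map_congr (h i) (.refl r)
    · intro i j u x
      exact HomEq.inv (f := Ψ.mapIso (c.tr u x)) (g := Ψ'.mapIso (c.tr u x)) (h' u x)

/-- A family of morphisms between the values of two functors out of a pseudo-colimit is natural if
it is natural on generators. -/
theorem natural_of {𝓔 : Type b₁} [Category.{a₁} 𝓔] {Ψ Ψ' : 𝓣 ⥤ 𝓔}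
    (t : ∀ a, Ψ.obj a ⟶ Ψ'.obj a)
    (h : ∀ {i : J} {x y : Φ.obj i} (r : x ⟶ y),
      Ψ.map ((c.incl i).map r) ≫ t _ = t _ ≫ Ψ'.map ((c.incl i).map r))
    (h' : ∀ {i j : J} (u : i ⟶ j) (x : Φ.obj i),
      Ψ.map (c.tr u x).hom ≫ t _ = t _ ≫ Ψ'.map (c.tr u x).hom) {a b : 𝓣} (p : a ⟶ b) :
    Ψ.map p ≫ t b = t a ≫ Ψ'.map p := by
  refine c.induction (Pr := fun {a b} p => Ψ.map p ≫ t b = t a ≫ Ψ'.map p) ?_ ?_ h h' ?_ p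
  · intro a b c p q hp hq
    rw [Functor.map_comp, Functor.map_comp, Category.assoc, hq, reassoc_of% hp]
  · intro a
    simp
  · intro i j u x
    exact PseudoColimit.natural_inv t (c.tr u x) (h' u x)

end PsColimit

end TwoCat

/-! ### Representatives of morphisms of a 2-filtered pseudo-colimit -/

namespace TwoCat

namespace IsTwoFiltered

variable {J : Type u} [Bicategory.{w, v₁} J]

theorem span (h : IsTwoFiltered J) {i j k : J} (u : i ⟶ j) (v : i ⟶ k) :
    ∃ (l : J) (a : j ⟶ l) (b : k ⟶ l), Nonempty (u ≫ a ≅ v ≫ b) := by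
  obtain ⟨m, ⟨a⟩, ⟨b⟩⟩ := h.cocone j k
  obtain ⟨l, t, ⟨e⟩⟩ := h.cocone_map (u ≫ a) (v ≫ b)
  exact ⟨l, a ≫ t, b ≫ t, ⟨(α_ _ _ _).symm ≪≫ e ≪≫ α_ _ _ _⟩⟩

/-- Every 2-cell of a 2-filtered 2-category becomes invertible after whiskering with some 1-cell. -/
theorem exists_isIso (h : IsTwoFiltered J) {i j : J} {u v : i ⟶ j} (η : u ⟶ v) :
    ∃ (l : J) (t : j ⟶ l), IsIso (η ▷ t) := by
  -- After whiskering with `s`, the 2-cell `γ` goes back. It becomes a left inverse of `η` after a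
  -- further whiskering with `t`, and a right inverse as well after one with `t'`.
  obtain ⟨k, s, ⟨γ⟩⟩ := h.cocone_map v u
  obtain ⟨l, t, e⟩ := h.cocone_map₂ (η ▷ s ≫ γ.hom) (𝟙 _)
  obtain ⟨m, t', e'⟩ := h.cocone_map₂ ((γ.hom ≫ η ▷ s) ▷ t) (𝟙 _)
  have e₁ : (η ▷ s) ▷ t ≫ γ.hom ▷ t = 𝟙 _ := by simpa using e
  have e₂ : ((γ.hom ▷ t) ≫ (η ▷ s) ▷ t) ▷ t' = 𝟙 _ := by simpa using e'
  have : IsIso (((η ▷ s) ▷ t) ▷ t') := by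
    refine ⟨(γ.hom ▷ t) ▷ t', ?_, ?_⟩
    · rw [← comp_whiskerRight, e₁, id_whiskerRight]
    · rw [← comp_whiskerRight, e₂]
  refine ⟨m, s ≫ t ≫ t', ?_⟩
  have e₃ : η ▷ (s ≫ t ≫ t') = ((α_ u s (t ≫ t')).inv ≫ (α_ (u ≫ s) t t').inv) ≫
      (((η ▷ s) ▷ t) ▷ t') ≫ ((α_ (v ≫ s) t t').hom ≫ (α_ v s (t ≫ t')).hom) := by
    simp
  rw [e₃]
  infer_instance

end IsTwoFiltered

namespace Ps

variable {J : Type u} [Bicategory.{w, v₁} J] (Φ : J ⥤ᵖ Cat.{w₁, u₁})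

/-- Comparison of the action of `u'` with the successive actions of `u` and `t`, for an
invertible 2-cell `u' ≅ u ≫ t`. -/
def lam {i k l : J} {u : i ⟶ k} {u' : i ⟶ l} (t : k ⟶ l) (a : u' ≅ u ≫ t) (x : Φ.obj i) :
    obj Φ u' x ≅ obj Φ t (obj Φ u x) :=
  cellIso Φ a x ≪≫ comp Φ u t x

/-- The extension of a morphism `u x ⟶ v y` along a 1-cell `t`. -/
def ext {i j k l : J} {u : i ⟶ k} {v : j ⟶ k} {u' : i ⟶ l} {v' : j ⟶ l} {x : Φ.obj i}
    {y : Φ.obj j} (r : obj Φ u x ⟶ obj Φ v y) (t : k ⟶ l) (a : u' ≅ u ≫ t) (b : v' ≅ v ≫ t) :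
    obj Φ u' x ⟶ obj Φ v' y :=
  (lam Φ t a x).hom ≫ map Φ t r ≫ (lam Φ t b y).inv

variable {i j k l m : J} {u : i ⟶ k} {v : j ⟶ k} {x x' : Φ.obj i} {y y' : Φ.obj j}

theorem lam_naturality {u' : i ⟶ l} (t : k ⟶ l) (a : u' ≅ u ≫ t) (r : x ⟶ x') :
    map Φ u' r ≫ (lam Φ t a x').hom = (lam Φ t a x).hom ≫ map Φ t (map Φ u r) := by
  simp only [lam, Iso.trans_hom, cellIso_hom, Category.assoc,
    reassoc_of% (cell_naturality (Φ := Φ)),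
    comp_naturality]

/-- Comparisons along `t` and `t'` compose to the comparison along `t ≫ t'`. -/
theorem lam_lam {u' : i ⟶ l} {u'' : i ⟶ m} (t : k ⟶ l) (a : u' ≅ u ≫ t) (t' : l ⟶ m)
    (a' : u'' ≅ u' ≫ t') (x : Φ.obj i) :
    (lam Φ t' a' x).hom ≫ map Φ t' (lam Φ t a x).hom =
      (lam Φ (t ≫ t') (a' ≪≫ whiskerRightIso a t' ≪≫ α_ u t t') x).hom ≫
        (comp Φ t t' (obj Φ u x)).hom := by
  simp only [lam, Iso.trans_hom, cellIso_hom, Category.assoc, whiskerRightIso_hom, cell_comp,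
    Functor.map_comp]
  rw [← reassoc_of% (cell_whiskerRight (Φ := Φ)), comp_assoc]

theorem lam_cell {u' : i ⟶ l} {t t' : k ⟶ l} (γ : t ≅ t') (a : u' ≅ u ≫ t) (x : Φ.obj i) :
    (lam Φ t' (a ≪≫ whiskerLeftIso u γ) x).hom =
      (lam Φ t a x).hom ≫ cell Φ γ.hom (obj Φ u x) := by
  simp only [lam, Iso.trans_hom, cellIso_hom, Category.assoc, whiskerLeftIso_hom, cell_comp,
    cell_whiskerLeft]

theorem ext_comp {u' : i ⟶ l} {v' : j ⟶ l} (r : obj Φ u x ⟶ obj Φ v y) (t : k ⟶ l)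
    (a : u' ≅ u ≫ t) (b : v' ≅ v ≫ t) :
    ext Φ r t a b ≫ (lam Φ t b y).hom = (lam Φ t a x).hom ≫ map Φ t r := by
  simp [ext]

/-- The characterization of extensions, since the comparison is an isomorphism. -/
theorem ext_eq {u' : i ⟶ l} {v' : j ⟶ l} {r : obj Φ u x ⟶ obj Φ v y} {t : k ⟶ l}
    {a : u' ≅ u ≫ t} {b : v' ≅ v ≫ t} {f : obj Φ u' x ⟶ obj Φ v' y}
    (h : f ≫ (lam Φ t b y).hom = (lam Φ t a x).hom ≫ map Φ t r) : ext Φ r t a b = f := by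
  rw [← cancel_mono (lam Φ t b y).hom, ext_comp, h]

theorem ext_ext {u' : i ⟶ l} {v' : j ⟶ l} {u'' : i ⟶ m} {v'' : j ⟶ m}
    (r : obj Φ u x ⟶ obj Φ v y) (t : k ⟶ l) (a : u' ≅ u ≫ t) (b : v' ≅ v ≫ t) (t' : l ⟶ m)
    (a' : u'' ≅ u' ≫ t') (b' : v'' ≅ v' ≫ t') :
    ext Φ (ext Φ r t a b) t' a' b' = ext Φ r (t ≫ t') (a' ≪≫ whiskerRightIso a t' ≪≫ α_ u t t')
      (b' ≪≫ whiskerRightIso b t' ≪≫ α_ v t t') := by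
  symm
  apply ext_eq
  rw [← cancel_mono (comp Φ t t' (obj Φ v y)).hom, Category.assoc, Category.assoc, ← lam_lam,
    reassoc_of% (ext_comp (Φ := Φ)), ← Functor.map_comp, ext_comp, comp_naturality,
    Functor.map_comp,
    reassoc_of% lam_lam]

theorem ext_cell {u' : i ⟶ l} {v' : j ⟶ l} (r : obj Φ u x ⟶ obj Φ v y) {t t' : k ⟶ l}
    (γ : t ≅ t') (a : u' ≅ u ≫ t) (b : v' ≅ v ≫ t) :
    ext Φ r t' (a ≪≫ whiskerLeftIso u γ) (b ≪≫ whiskerLeftIso v γ) = ext Φ r t a b := by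
  apply ext_eq
  rw [lam_cell, lam_cell, reassoc_of% (ext_comp (Φ := Φ)), Category.assoc, cell_naturality]

theorem ext_comp_map {u' : i ⟶ l} {v' : j ⟶ l} (r : obj Φ u x ⟶ obj Φ v y) (t : k ⟶ l)
    (a : u' ≅ u ≫ t) (b : v' ≅ v ≫ t) (s : y ⟶ y') :
    ext Φ (r ≫ map Φ v s) t a b = ext Φ r t a b ≫ map Φ v' s := by
  apply ext_eq
  rw [Category.assoc, lam_naturality, reassoc_of% (ext_comp (Φ := Φ))]
  exact congrArg _ ((Φ.map t).toFunctor.map_comp r (map Φ v s)).symm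

theorem lam_id (u : i ⟶ k) (x : Φ.obj i) :
    (lam Φ (𝟙 k) (ρ_ u).symm x).hom ≫ (unit Φ k (obj Φ u x)).hom = 𝟙 _ := by
  simp only [lam, Iso.trans_hom, cellIso_hom, Category.assoc, ← cell_rightUnitor]
  rw [← cell_comp]
  simp [cell_id]

theorem ext_id (r : obj Φ u x ⟶ obj Φ v y) : ext Φ r (𝟙 k) (ρ_ u).symm (ρ_ v).symm = r := by
  apply ext_eq
  rw [← cancel_mono (unit Φ k (obj Φ v y)).hom, Category.assoc, lam_id, Category.assoc,
    unit_naturality, reassoc_of% lam_id, Category.comp_id]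

theorem ext_factor {u' : i ⟶ l} {v' : j ⟶ l} {u'' : i ⟶ m} {v'' : j ⟶ m}
    (r : obj Φ u x ⟶ obj Φ v y) (t : k ⟶ l) (a : u' ≅ u ≫ t) (b : v' ≅ v ≫ t) (t' : l ⟶ m)
    (a' : u'' ≅ u ≫ t ≫ t') (b' : v'' ≅ v ≫ t ≫ t') :
    ext Φ r (t ≫ t') a' b' = ext Φ (ext Φ r t a b) t'
      (a' ≪≫ (whiskerRightIso a t' ≪≫ α_ u t t').symm)
      (b' ≪≫ (whiskerRightIso b t' ≪≫ α_ v t t').symm) := by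
  rw [ext_ext]
  congr 1 <;> simp

/-- The comparison of the actions of `v'` and of `s ≫ v`, followed by an extension, in terms of the
comparison for `v`. -/
theorem lam_precomp {n : J} (s : n ⟶ j) (z : Φ.obj n) (t : k ⟶ l) {v' : j ⟶ l} (b : v' ≅ v ≫ t) :
    (lam Φ t (whiskerLeftIso s b ≪≫ (α_ s v t).symm) z).hom ≫ map Φ t (comp Φ s v z).hom =
      (comp Φ s v' z).hom ≫ (lam Φ t b (obj Φ s z)).hom := by
  simp only [lam, Iso.trans_hom, cellIso_hom, Category.assoc, cell_comp, whiskerLeftIso_hom,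
    comp_assoc, Iso.symm_hom]
  have h : cell Φ (α_ s v t).inv z ≫ cell Φ (α_ s v t).hom z = 𝟙 _ :=
    (cellIso Φ (α_ s v t) z).inv_hom_id
  rw [reassoc_of% h, reassoc_of% (cell_whiskerLeft (Φ := Φ))]

theorem ext_precomp {n : J} (s : n ⟶ j) {z : Φ.obj n} {u' : i ⟶ l} {v' : j ⟶ l}
    (r : obj Φ u x ⟶ obj Φ v (obj Φ s z)) (t : k ⟶ l) (a : u' ≅ u ≫ t) (b : v' ≅ v ≫ t) :
    ext Φ (r ≫ (comp Φ s v z).inv) t a (whiskerLeftIso s b ≪≫ (α_ s v t).symm) =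
      ext Φ r t a b ≫ (comp Φ s v' z).inv := by
  apply ext_eq
  have h := lam_precomp Φ s z t b
  rw [← Iso.inv_comp_eq] at h
  rw [Category.assoc, ← cancel_mono (map Φ t (comp Φ s v z).hom), Category.assoc, Category.assoc,
    Category.assoc, h, ext_comp, ← Functor.map_comp, Category.assoc, Iso.inv_hom_id,
    Category.comp_id]

/-- A morphism `u x ⟶ v y` at some stage `k`, representing a morphism `x ⟶ y` of the
pseudo-colimit. -/
structure Pre (i : J) (x : Φ.obj i) (j : J) (y : Φ.obj j) where
  k : J
  u : i ⟶ k
  v : j ⟶ k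
  r : obj Φ u x ⟶ obj Φ v y

variable {Φ}

/-- Two representatives are equivalent if they have a common extension. -/
def Pre.Rel (p q : Pre Φ i x j y) : Prop :=
  ∃ (l : J) (u : i ⟶ l) (v : j ⟶ l) (t : p.k ⟶ l) (t' : q.k ⟶ l) (a : u ≅ p.u ≫ t)
    (b : v ≅ p.v ≫ t) (a' : u ≅ q.u ≫ t') (b' : v ≅ q.v ≫ t'),
    ext Φ p.r t a b = ext Φ q.r t' a' b'

theorem Pre.rel_equivalence (h : IsTwoFiltered J) : Equivalence (@Pre.Rel J _ Φ i j x y) where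
  refl p := ⟨_, _, _, 𝟙 _, 𝟙 _, (ρ_ _).symm, (ρ_ _).symm, (ρ_ _).symm, (ρ_ _).symm, rfl⟩
  symm := by
    rintro p q ⟨l, u, v, t, t', a, b, a', b', e⟩
    exact ⟨l, u, v, t', t, a', b', a, b, e.symm⟩
  trans := by
    rintro p q r ⟨l, u, v, t, t', a, b, a', b', e⟩ ⟨l₂, u₂, v₂, t₂, t₂', a₂, b₂, a₂', b₂', e₂⟩
    obtain ⟨m, s, s', ⟨γ⟩⟩ := h.span t' t₂
    have h₁ := ext_ext Φ p.r t a b s (Iso.refl _) (Iso.refl _)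
    have h₂ := ext_ext Φ q.r t' a' b' s (Iso.refl _) (Iso.refl _)
    rw [← ext_cell Φ q.r γ, ext_factor Φ q.r t₂ a₂ b₂ s', e₂, ext_ext Φ r.r t₂' a₂' b₂' s'] at h₂
    exact ⟨m, u ≫ s, v ≫ s, t ≫ s, t₂' ≫ s', _, _, _, _,
      h₁.symm.trans ((congrArg (fun f => ext Φ f s _ _) e).trans h₂)⟩

theorem Pre.rel_ext (p : Pre Φ i x j y) {l : J} {u : i ⟶ l} {v : j ⟶ l} (t : p.k ⟶ l)
    (a : u ≅ p.u ≫ t) (b : v ≅ p.v ≫ t) : p.Rel ⟨l, u, v, ext Φ p.r t a b⟩ :=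
  ⟨l, u, v, t, 𝟙 l, a, b, (ρ_ _).symm, (ρ_ _).symm, (ext_id Φ _).symm⟩

end Ps

end TwoCat

/-! ### Germs, and the morphisms of a 2-filtered pseudo-colimit -/

namespace TwoCat

namespace Ps

variable {J : Type w} [Bicategory.{w, w} J] {Φ : J ⥤ᵖ Cat.{w, w}} (h : IsTwoFiltered J)

/-- The setoid of representatives of morphisms of the pseudo-colimit. -/
def preSetoid (i : J) (x : Φ.obj i) (j : J) (y : Φ.obj j) : Setoid (Pre Φ i x j y) :=
  ⟨Pre.Rel, Pre.rel_equivalence h⟩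

/-- Germs of morphisms from a fixed object `x`, as a functor on each category of the diagram. -/
def germ {i : J} (x : Φ.obj i) (j : J) : Φ.obj j ⥤ Type w where
  obj y := Quotient (preSetoid h i x j y)
  map {y y'} s := ↾(Quotient.map (fun p => ⟨p.k, p.u, p.v, p.r ≫ map Φ p.v s⟩) (by
    rintro p q ⟨l, u, v, t, t', a, b, a', b', e⟩
    refine ⟨l, u, v, t, t', a, b, a', b', ?_⟩
    dsimp only
    rw [ext_comp_map, ext_comp_map, e]))
  map_id y := by
    ext p
    induction p using Quotient.inductionOn with | _ p =>
    refine congrArg (Quotient.mk _) ?_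
    dsimp only
    have : p.r ≫ map Φ p.v (𝟙 y) = p.r := by
      rw [map, CategoryTheory.Functor.map_id, Category.comp_id]
    rw [this]
  map_comp {y y' y''} s s' := by
    ext p
    induction p using Quotient.inductionOn with | _ p =>
    refine congrArg (Quotient.mk _) ?_
    dsimp only
    have : p.r ≫ map Φ p.v (s ≫ s') = (p.r ≫ map Φ p.v s) ≫ map Φ p.v s' := by
      rw [map, Functor.map_comp, Category.assoc]
    rw [this]

variable {i : J} (x : Φ.obj i)

/-- The transition map of germs, by composition with a 1-cell of the index 2-category. -/
def germTr {j j' : J} (t : j ⟶ j') (y : Φ.obj j) :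
    (germ h x j').obj (obj Φ t y) → (germ h x j).obj y :=
  Quotient.map (fun p => ⟨p.k, p.u, t ≫ p.v, p.r ≫ (comp Φ t p.v y).inv⟩) (by
    rintro p q ⟨l, u, v, s, s', a, b, a', b', e⟩
    refine ⟨l, u, t ≫ v, s, s', a, whiskerLeftIso t b ≪≫ (α_ t p.v s).symm, a',
      whiskerLeftIso t b' ≪≫ (α_ t q.v s').symm, ?_⟩
    dsimp only
    rw [ext_precomp, ext_precomp, e])

theorem germTr_naturality {j j' : J} (t : j ⟶ j') {y y' : Φ.obj j} (s : y ⟶ y')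
    (p : (germ h x j').obj (obj Φ t y)) :
    germTr h x t y' ((germ h x j').map (map Φ t s) p) =
      (germ h x j).map s (germTr h x t y p) := by
  induction p using Quotient.inductionOn with | _ p =>
  refine congrArg (Quotient.mk _) ?_
  have : (p.r ≫ map Φ p.v (map Φ t s)) ≫ (comp Φ t p.v y').inv =
      (p.r ≫ (comp Φ t p.v y).inv) ≫ map Φ (t ≫ p.v) s := by
    rw [Category.assoc, Category.assoc, comp_inv_naturality]
  dsimp only
  rw [this]

/-- The equation of 2-cells behind the injectivity of the transition maps of germs. -/
theorem germ_aux {j j' k k' l m n : J} {v : j ⟶ l} (t : j ⟶ j') (p : j' ⟶ k) (q : j' ⟶ k')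
    (s : k ⟶ l) (s' : k' ⟶ l) (b : v ≅ (t ≫ p) ≫ s) (b' : v ≅ (t ≫ q) ≫ s') (f : l ⟶ m)
    (γ : (p ≫ s) ≫ f ≅ (q ≫ s') ≫ f) (g : m ⟶ n)
    (hg : (t ◁ γ.hom) ▷ g = ((α_ _ _ _).inv ≫
      ((α_ t p s).inv ≫ b.inv ≫ b'.hom ≫ (α_ t q s').hom) ▷ f ≫ (α_ _ _ _).hom) ▷ g) :
    whiskerLeftIso t (whiskerLeftIso p (α_ s f g).symm ≪≫ (α_ p (s ≫ f) g).symm ≪≫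
        whiskerRightIso (α_ p s f).symm g ≪≫ whiskerRightIso γ g ≪≫
        whiskerRightIso (α_ q s' f) g ≪≫ α_ q (s' ≫ f) g ≪≫ whiskerLeftIso q (α_ s' f g)) ≪≫
          (α_ t q (s' ≫ f ≫ g)).symm =
      ((whiskerLeftIso t (Iso.refl (p ≫ s ≫ f ≫ g)) ≪≫ (α_ t p (s ≫ f ≫ g)).symm) ≪≫
        (whiskerRightIso b (f ≫ g) ≪≫ α_ _ _ _).symm) ≪≫ whiskerRightIso b' (f ≫ g) ≪≫
          α_ _ _ _ := by
  ext
  have hg' : t ◁ γ.hom ▷ g = (α_ _ _ _).inv ≫ ((t ◁ γ.hom) ▷ g) ≫ (α_ _ _ _).hom := by simp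
  simp only [Iso.trans_hom, whiskerLeftIso_hom, whiskerRightIso_hom, Iso.symm_hom,
    Iso.refl_hom, whiskerLeft_comp, hg', hg, Iso.trans_inv, whiskerRightIso_inv]
  bicategory

/-- The transition maps of germs are bijective, so that germs form a pseudo-cocone of functors to
types: injectivity uses `cocone_map` and `cocone_map₂`, surjectivity that spans in a 2-filtered
2-category may be completed. -/
theorem germTr_bijective {j j' : J} (t : j ⟶ j') (y : Φ.obj j) :
    Function.Bijective (germTr h x t y) := by
  constructor
  · intro p q e
    induction p using Quotient.inductionOn with | _ p =>
    induction q using Quotient.inductionOn with | _ q =>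
    obtain ⟨l, u, v, s, s', a, b, a', b', e⟩ := Quotient.exact e
    dsimp only at b b' e
    -- An isomorphism `γ` between the two 1-cells that need to be compared exists after a further
    -- extension `f`, and it restricts to the given one after yet another extension `g`.
    obtain ⟨m, f, ⟨γ⟩⟩ := h.cocone_map (p.v ≫ s) (q.v ≫ s')
    obtain ⟨n, g, hg⟩ := h.cocone_map₂ (t ◁ γ.hom)
      ((α_ _ _ _).inv ≫ ((α_ t p.v s).inv ≫ b.inv ≫ b'.hom ≫ (α_ t q.v s').hom) ▷ f ≫
        (α_ _ _ _).hom)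
    let β : p.v ≫ s ≫ f ≫ g ≅ q.v ≫ s' ≫ f ≫ g :=
      whiskerLeftIso p.v (α_ s f g).symm ≪≫ (α_ p.v (s ≫ f) g).symm ≪≫
        whiskerRightIso (α_ p.v s f).symm g ≪≫ whiskerRightIso γ g ≪≫
        whiskerRightIso (α_ q.v s' f) g ≪≫ α_ q.v (s' ≫ f) g ≪≫ whiskerLeftIso q.v (α_ s' f g)
    let B : t ≫ p.v ≫ s ≫ f ≫ g ≅ v ≫ f ≫ g :=
      (whiskerLeftIso t (Iso.refl _) ≪≫ (α_ t p.v (s ≫ f ≫ g)).symm) ≪≫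
        (whiskerRightIso b (f ≫ g) ≪≫ α_ _ _ _).symm
    refine Quotient.sound ⟨n, u ≫ f ≫ g, p.v ≫ s ≫ f ≫ g, s ≫ f ≫ g, s' ≫ f ≫ g,
      whiskerRightIso a (f ≫ g) ≪≫ α_ _ _ _, Iso.refl _,
      whiskerRightIso a' (f ≫ g) ≪≫ α_ _ _ _, β, ?_⟩
    have e₁ := congrArg (fun r => ext Φ r (f ≫ g) (Iso.refl _) B) e
    rw [ext_ext, ext_ext] at e₁
    rw [← cancel_mono (comp Φ t (p.v ≫ s ≫ f ≫ g) y).inv, ← ext_precomp, ← ext_precomp]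
    convert e₁ using 2
    · simp
    · simp [B]
    · simp
    · exact germ_aux t p.v q.v s s' b b' f γ g hg
  · intro p
    induction p using Quotient.inductionOn with | _ p =>
    obtain ⟨m, a, b, ⟨γ⟩⟩ := h.span p.v t
    refine ⟨Quotient.mk _ ⟨m, p.u ≫ a, b, ext Φ p.r a (Iso.refl _) γ.symm ≫ (comp Φ t b y).hom⟩, ?_⟩
    refine Quotient.sound ((Pre.rel_equivalence h).symm ?_)
    have := p.rel_ext a (Iso.refl _) γ.symm
    simpa using this

/-- A representative is equivalent to its composite with any 2-cell of the index 2-category, since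
such 2-cells become invertible. -/
theorem Pre.rel_cell (h : IsTwoFiltered J) {i j k : J} {x : Φ.obj i} {y : Φ.obj j} {u : i ⟶ k}
    {v v' : j ⟶ k} (r : obj Φ u x ⟶ obj Φ v y) (θ : v ⟶ v') (r' : obj Φ u x ⟶ obj Φ v' y)
    (e : r ≫ cell Φ θ y = r') : Pre.Rel (Φ := Φ) ⟨k, u, v, r⟩ ⟨k, u, v', r'⟩ := by
  obtain ⟨l, t, ht⟩ := h.exists_isIso θ
  refine ⟨l, u ≫ t, v ≫ t, t, t, Iso.refl _, Iso.refl _, Iso.refl _, asIso (θ ▷ t), ?_⟩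
  symm
  apply ext_eq
  dsimp only
  have h₁ : (lam Φ t (asIso (θ ▷ t)) y).hom =
      (lam Φ t (Iso.refl (v ≫ t)) y).hom ≫ map Φ t (cell Φ θ y) := by
    simp only [lam, Iso.trans_hom, cellIso_hom, asIso_hom, cell_whiskerRight, Iso.refl_hom, cell_id,
      Category.id_comp]
  rw [h₁, reassoc_of% (ext_comp (Φ := Φ)), ← e]
  exact congrArg _ ((Φ.map t).toFunctor.map_comp r (cell Φ θ y)).symm

theorem germTr_id {j : J} (y : Φ.obj j) (p : (germ h x j).obj (obj Φ (𝟙 j) y)) :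
    germTr h x (𝟙 j) y p = (germ h x j).map (unit Φ j y).hom p := by
  induction p using Quotient.inductionOn with | _ p =>
  refine Quotient.sound (Pre.rel_cell h _ (λ_ p.v).hom _ ?_)
  rw [cell_leftUnitor, Category.assoc, Iso.inv_hom_id_assoc]

theorem germTr_comp {j k l : J} (s : j ⟶ k) (t : k ⟶ l) (y : Φ.obj j)
    (p : (germ h x l).obj (obj Φ (s ≫ t) y)) :
    germTr h x (s ≫ t) y p =
      germTr h x s y (germTr h x t (obj Φ s y) ((germ h x l).map (comp Φ s t y).hom p)) := by
  induction p using Quotient.inductionOn with | _ p =>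
  refine Quotient.sound (Pre.rel_cell h _ (α_ s t p.v).hom _ ?_)
  have e := comp_assoc Φ s t p.v y
  rw [← Iso.eq_inv_comp] at e
  rw [← cancel_mono (comp Φ s (t ≫ p.v) y).hom, ← cancel_mono (comp Φ t p.v (obj Φ s y)).hom]
  simp only [Category.assoc, Iso.inv_hom_id, Category.comp_id]
  rw [← e]

theorem germTr_cell {j k : J} {s t : j ⟶ k} (η : s ⟶ t) (y : Φ.obj j)
    (p : (germ h x k).obj (obj Φ s y)) :
    germTr h x s y p = germTr h x t y ((germ h x k).map (cell Φ η y) p) := by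
  induction p using Quotient.inductionOn with | _ p =>
  refine Quotient.sound (Pre.rel_cell h _ (η ▷ p.v) _ ?_)
  rw [← cancel_mono (comp Φ t p.v y).hom]
  simp only [Category.assoc, Iso.inv_hom_id, Category.comp_id]
  rw [cell_whiskerRight, Iso.inv_hom_id_assoc]

end Ps

namespace PsColimit

open Ps

variable {J : Type w} [Bicategory.{w, w} J] {Φ : J ⥤ᵖ Cat.{w, w}} {𝓣 : Type w}
    [Category.{w} 𝓣] (c : PsColimit Φ 𝓣)

/-- The morphism of the pseudo-colimit given by a representative. -/
def ofPre {i j : J} {x : Φ.obj i} {y : Φ.obj j} (p : Pre Φ i x j y) :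
    (c.incl i).obj x ⟶ (c.incl j).obj y :=
  (c.tr p.u x).hom ≫ (c.incl p.k).map p.r ≫ (c.tr p.v y).inv

theorem tr_lam {i k l : J} {u : i ⟶ k} {u' : i ⟶ l} (t : k ⟶ l) (a : u' ≅ u ≫ t) (x : Φ.obj i) :
    (c.tr u' x).hom ≫ (c.incl l).map (lam Φ t a x).hom =
      (c.tr u x).hom ≫ (c.tr t (obj Φ u x)).hom := by
  simp only [lam, Iso.trans_hom, cellIso_hom]
  rw [Functor.map_comp, ← Category.assoc, c.tr_cell, c.tr_comp]

theorem ofPre_ext {i j : J} {x : Φ.obj i} {y : Φ.obj j} (p : Pre Φ i x j y) {l : J} {u' : i ⟶ l}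
    {v' : j ⟶ l} (t : p.k ⟶ l) (a : u' ≅ p.u ≫ t) (b : v' ≅ p.v ≫ t) :
    c.ofPre ⟨l, u', v', ext Φ p.r t a b⟩ = c.ofPre p := by
  have h₁ := c.tr_lam t a x
  have h₂ := c.tr_lam t b y
  rw [← Iso.eq_inv_comp] at h₂
  rw [ofPre, ← Category.assoc, Iso.comp_inv_eq, ← cancel_mono ((c.incl l).map (lam Φ t b y).hom),
    Category.assoc, ← Functor.map_comp, ext_comp, Functor.map_comp, reassoc_of% h₁,
    ← c.tr_naturality, ofPre, Category.assoc, h₂]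
  simp

/-- Every morphism of the pseudo-colimit of a diagram indexed by a 2-filtered 2-category has a
representative at some stage. -/
theorem exists_ofPre (h : IsTwoFiltered J) {a b : 𝓣} (m : a ⟶ b) :
    ∀ (i : J) (x : Φ.obj i) (j : J) (y : Φ.obj j), (c.incl i).obj x = a → (c.incl j).obj y = b →
      ∃ p : Pre Φ i x j y, c.ofPre p ≈ₕ m := by
  refine c.induction (Pr := fun {a b} m => ∀ (i : J) (x : Φ.obj i) (j : J) (y : Φ.obj j),
    (c.incl i).obj x = a → (c.incl j).obj y = b → ∃ p : Pre Φ i x j y, c.ofPre p ≈ₕ m)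
    ?_ ?_ ?_ ?_ ?_ m
  · rintro a b d m n hm hn i x k z rfl rfl
    obtain ⟨j, y, rfl⟩ := c.exists_rep b
    obtain ⟨p, hp⟩ := hm i x j y rfl rfl
    obtain ⟨q, hq⟩ := hn j y k z rfl rfl
    obtain rfl := hp.eq
    obtain rfl := hq.eq
    obtain ⟨l, s, t, ⟨γ⟩⟩ := h.span p.v q.u
    have e₁ := c.ofPre_ext p s (Iso.refl _) (Iso.refl _)
    have e₂ := c.ofPre_ext q t γ (Iso.refl _)
    refine ⟨⟨l, _, _, ext Φ p.r s (Iso.refl _) (Iso.refl _) ≫ ext Φ q.r t γ (Iso.refl _)⟩,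
      .of_eq ?_⟩
    rw [← e₁, ← e₂]
    simp [ofPre]
  · rintro a i x j y rfl hy
    obtain ⟨rfl, hxy⟩ := Sigma.mk.inj (c.rep_inj hy)
    obtain rfl := eq_of_heq hxy
    exact ⟨⟨_, 𝟙 _, 𝟙 _, 𝟙 _⟩, .of_eq (by simp [ofPre])⟩
  · rintro j y y' r i x k z hx hz
    obtain ⟨rfl, hxy⟩ := Sigma.mk.inj (c.rep_inj hx)
    obtain rfl := eq_of_heq hxy
    obtain ⟨rfl, hxy⟩ := Sigma.mk.inj (c.rep_inj hz)
    obtain rfl := eq_of_heq hxy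
    refine ⟨⟨_, 𝟙 _, 𝟙 _, map Φ (𝟙 _) r⟩, .of_eq ?_⟩
    rw [ofPre, ← reassoc_of% c.tr_naturality, Iso.hom_inv_id, Category.comp_id]
  · rintro j k u y i x l z hx hz
    obtain ⟨rfl, hxy⟩ := Sigma.mk.inj (c.rep_inj hx)
    obtain rfl := eq_of_heq hxy
    obtain ⟨rfl, hxy⟩ := Sigma.mk.inj (c.rep_inj hz)
    obtain rfl := eq_of_heq hxy
    refine ⟨⟨_, u, 𝟙 _, (unit Φ _ _).inv⟩, .of_eq ?_⟩
    have := c.tr_id _ (obj Φ u x)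
    rw [ofPre, ← cancel_mono (c.tr (𝟙 l) (obj Φ u x)).hom,
      ← cancel_mono ((c.incl l).map (unit Φ l (obj Φ u x)).hom)]
    simp [this, ← Functor.map_comp]
  · rintro j k u y i x l z hx hz
    obtain ⟨rfl, hxy⟩ := Sigma.mk.inj (c.rep_inj hx)
    obtain rfl := eq_of_heq hxy
    obtain ⟨rfl, hxy⟩ := Sigma.mk.inj (c.rep_inj hz)
    obtain rfl := eq_of_heq hxy
    refine ⟨⟨_, 𝟙 _, u, (unit Φ _ _).hom⟩, .of_eq ?_⟩
    have := c.tr_id _ (obj Φ u z)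
    rw [ofPre, reassoc_of% this]

/-- Parallel morphisms at one stage that become equal in the pseudo-colimit already agree at some
later stage. This is tested on the functor of germs out of the source. -/
theorem exists_map_eq (h : IsTwoFiltered J) (hc : HasDesc.{w, w, w + 1} c) {i : J} {x y : Φ.obj i}
    {r s : x ⟶ y} (e : (c.incl i).map r = (c.incl i).map s) :
    ∃ (k : J) (t : i ⟶ k), map Φ t r = map Φ t s := by
  -- The functors of germs out of `x` induce a functor `Ψ` on the pseudo-colimit.
  obtain ⟨Ψ, hΨ, -⟩ := hc (Type w) (fun j => germ h x j)
    (fun u z => ((Equiv.ofBijective _ (germTr_bijective h x u z)).toIso).symm)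
    (fun u z z' r => by
      rw [Iso.symm_hom, Iso.symm_hom, Iso.comp_inv_eq, Category.assoc, Iso.eq_inv_comp]
      ext p
      exact (germTr_naturality h x u r p).symm)
    (fun j z => by
      rw [Iso.symm_hom, Iso.inv_comp_eq]
      ext p
      exact (germTr_id h x z p).symm)
    (fun u v z => by
      rw [Iso.symm_hom, Iso.symm_hom, Iso.symm_hom, Iso.inv_comp_eq]
      rw [← Category.assoc, Iso.eq_comp_inv, Iso.eq_comp_inv]
      ext p
      exact (germTr_comp h x u v z p).symm)
    (fun {j k u v} η z => by
      rw [Iso.symm_hom, Iso.symm_hom, Iso.inv_comp_eq, Iso.eq_comp_inv]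
      ext p
      exact (germTr_cell h x η z p).symm)
  have e' : (germ h x i).map r = (germ h x i).map s := by
    rw [← hΨ i]
    exact congrArg Ψ.map e
  -- The germ of the identity of `x` is sent by `Ψ` to the germs of `r` and of `s`.
  have e'' := congrArg (fun t => t (Quotient.mk (preSetoid h i x i x) ⟨i, 𝟙 i, 𝟙 i, 𝟙 _⟩)) e'
  obtain ⟨l, u, v, t, t', a, b, a', b', e₃⟩ := Quotient.exact e''
  dsimp only at a b a' b' e₃
  rw [Category.id_comp, Category.id_comp] at e₃
  have key : ∀ (t : i ⟶ l) (a : u ≅ 𝟙 i ≫ t) (b : v ≅ 𝟙 i ≫ t) (r : x ⟶ y),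
      ext Φ (map Φ (𝟙 i) r) t a b = cell Φ (a ≪≫ b.symm).hom x ≫ map Φ v r := by
    intro t a b r
    apply ext_eq
    have : cell Φ b.inv x ≫ cell Φ b.hom x = 𝟙 _ := (cellIso Φ b x).inv_hom_id
    rw [Category.assoc, lam_naturality]
    simp only [lam, Iso.trans_hom, cellIso_hom, Category.assoc, cell_comp, Iso.symm_hom,
      reassoc_of% this]
  rw [key, key] at e₃
  -- The germs agree up to two isomorphisms `u ≅ v`, which coincide after composition with `g`.
  obtain ⟨m, g, hg⟩ := h.cocone_map₂ (a ≪≫ b.symm).hom (a' ≪≫ b'.symm).hom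
  refine ⟨m, v ≫ g, ?_⟩
  have e₄ := congrArg (map Φ g) e₃
  have e₅ : ∀ (θ : u ≅ v) (r : x ⟶ y), map Φ g (cell Φ θ.hom x ≫ map Φ v r) =
      (comp Φ u g x).inv ≫ cell Φ (θ.hom ▷ g) x ≫ map Φ (v ≫ g) r ≫ (comp Φ v g y).hom := by
    intro θ r
    rw [comp_naturality, reassoc_of% (cell_whiskerRight (Φ := Φ)), Iso.inv_hom_id_assoc]
    exact (Φ.map g).toFunctor.map_comp _ _
  have : IsIso (cell Φ ((a' ≪≫ b'.symm).hom ▷ g) x) :=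
    (cellIso Φ (whiskerRightIso (a' ≪≫ b'.symm) g) x).isIso_hom
  rw [e₅, e₅, hg, cancel_epi, cancel_epi, cancel_mono] at e₄
  exact e₄

end PsColimit

end TwoCat

/-! ### Pseudo-cones by legs and 2-cells -/

namespace TwoCat

section

open scoped Pseudofunctor.StrongTrans

namespace PseudoCone

variable {J : Type u₁} [Bicategory.{w₁, v₁} J] [Strict J]
  {A : Type u₂} [Bicategory.{w₂, v₂} A] [Strict A] {X : J ⥤ᵖ A} {K L : A}

/-- The 1-cells of a pseudo-cone. -/
abbrev leg (p : PseudoCone X K) (i : J) : K ⟶ X.obj i :=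
  Pseudofunctor.StrongTrans.app p i

/-- The structural 2-cells of a pseudo-cone. -/
def sq (p : PseudoCone X K) {i j : J} (u : i ⟶ j) : 𝟙 K ≫ p.leg j ≅ p.leg i ≫ X.map u :=
  p.naturality u

theorem sq_naturality (p : PseudoCone X K) {i j : J} {u v : i ⟶ j} (η : u ⟶ v) :
    (p.sq u).hom ≫ p.leg i ◁ X.map₂ η = (p.sq v).hom := by
  have h : 𝟙 (𝟙 K) ▷ p.leg j ≫ (p.sq v).hom = (p.sq u).hom ≫ p.leg i ◁ X.map₂ η :=
    p.naturality_naturality η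
  rw [← h, id_whiskerRight]
  exact Category.id_comp _

theorem sq_id (p : PseudoCone X K) (i : J) :
    (p.sq (𝟙 i)).hom ≫ p.leg i ◁ (X.mapId i).hom = (λ_ (p.leg i)).hom ≫ (ρ_ (p.leg i)).inv := by
  have h : (p.sq (𝟙 i)).hom ≫ p.leg i ◁ (X.mapId i).hom =
    𝟙 _ ▷ p.leg i ≫ (λ_ (p.leg i)).hom ≫ (ρ_ (p.leg i)).inv := p.naturality_id i
  rw [h, id_whiskerRight]
  exact Category.id_comp _

theorem sq_comp (p : PseudoCone X K) {i j k : J} (u : i ⟶ j) (v : j ⟶ k) :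
    (p.sq (u ≫ v)).hom ≫ p.leg i ◁ (X.mapComp u v).hom =
      (λ_ (𝟙 K)).inv ▷ p.leg k ≫ (α_ _ _ _).hom ≫ 𝟙 K ◁ (p.sq v).hom ≫
        (α_ _ _ _).inv ≫ (p.sq u).hom ▷ X.map v ≫ (α_ _ _ _).hom := by
  have h : (p.sq (u ≫ v)).hom ≫ p.leg i ◁ (X.mapComp u v).hom =
    eqToHom (Strict.id_comp (𝟙 K)).symm ▷ p.leg k ≫ (α_ _ _ _).hom ≫ 𝟙 K ◁ (p.sq v).hom ≫
      (α_ _ _ _).inv ≫ (p.sq u).hom ▷ X.map v ≫ (α_ _ _ _).hom := p.naturality_comp u v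
  have he : eqToHom (Strict.id_comp (𝟙 K)).symm = (λ_ (𝟙 K)).inv := by
    simp [Strict.leftUnitor_eqToIso]
  rwa [he] at h

/-- The structural 2-cells of a pseudo-cone, without the identity 1-cell of the vertex. -/
def cell (p : PseudoCone X K) {i j : J} (u : i ⟶ j) : p.leg j ≅ p.leg i ≫ X.map u :=
  (λ_ (p.leg j)).symm ≪≫ p.sq u

theorem cell_naturality (p : PseudoCone X K) {i j : J} {u v : i ⟶ j} (η : u ⟶ v) :
    (p.cell u).hom ≫ p.leg i ◁ X.map₂ η = (p.cell v).hom := by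
  simp only [cell, Iso.trans_hom, Category.assoc, sq_naturality]

theorem cell_id (p : PseudoCone X K) (i : J) :
    (p.cell (𝟙 i)).hom ≫ p.leg i ◁ (X.mapId i).hom = (ρ_ (p.leg i)).inv := by
  simp only [cell, Iso.trans_hom, Category.assoc, sq_id, Iso.symm_hom, Iso.inv_hom_id_assoc]

theorem cell_comp (p : PseudoCone X K) {i j k : J} (u : i ⟶ j) (v : j ⟶ k) :
    (p.cell (u ≫ v)).hom ≫ p.leg i ◁ (X.mapComp u v).hom =
      (p.cell v).hom ≫ (p.cell u).hom ▷ X.map v ≫ (α_ _ _ _).hom := by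
  simp only [cell, Iso.trans_hom, Category.assoc, sq_comp, Iso.symm_hom]
  simp

/-- Construction of a pseudo-cone from 1-cells and invertible 2-cells. -/
def ofCells (leg : ∀ i, K ⟶ X.obj i) (cell : ∀ {i j : J} (u : i ⟶ j), leg j ≅ leg i ≫ X.map u)
    (nat : ∀ {i j : J} {u v : i ⟶ j} (η : u ⟶ v), (cell u).hom ≫ leg i ◁ X.map₂ η = (cell v).hom)
    (id : ∀ i, (cell (𝟙 i)).hom ≫ leg i ◁ (X.mapId i).hom = (ρ_ (leg i)).inv)
    (comp : ∀ {i j k : J} (u : i ⟶ j) (v : j ⟶ k),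
      (cell (u ≫ v)).hom ≫ leg i ◁ (X.mapComp u v).hom =
        (cell v).hom ≫ (cell u).hom ▷ X.map v ≫ (α_ _ _ _).hom) : PseudoCone X K :=
  Pseudofunctor.StrongTrans.mk leg (fun {i j} u => λ_ (leg j) ≪≫ cell u)
    (fun {i j u v} η => by
      have h : 𝟙 (𝟙 K) ▷ leg j ≫ (λ_ (leg j) ≪≫ cell v).hom =
          (λ_ (leg j) ≪≫ cell u).hom ≫ leg i ◁ X.map₂ η := by
        simp only [Iso.trans_hom, Category.assoc, nat, id_whiskerRight, Category.id_comp]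
      exact h)
    (fun i => by
      have h : (λ_ (leg i) ≪≫ cell (𝟙 i)).hom ≫ leg i ◁ (X.mapId i).hom =
          𝟙 (𝟙 K) ▷ leg i ≫ (λ_ (leg i)).hom ≫ (ρ_ (leg i)).inv := by
        simp only [Iso.trans_hom, Category.assoc, id, id_whiskerRight, Category.id_comp]
      exact h)
    (fun {i j k} u v => by
      have he : eqToHom (Strict.id_comp (𝟙 K)).symm = (λ_ (𝟙 K)).inv := by
        simp [Strict.leftUnitor_eqToIso]
      have h : (λ_ (leg k) ≪≫ cell (u ≫ v)).hom ≫ leg i ◁ (X.mapComp u v).hom =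
          eqToHom (Strict.id_comp (𝟙 K)).symm ▷ leg k ≫ (α_ _ _ _).hom ≫
            𝟙 K ◁ (λ_ (leg k) ≪≫ cell v).hom ≫ (α_ _ _ _).inv ≫
              (λ_ (leg j) ≪≫ cell u).hom ▷ X.map v ≫ (α_ _ _ _).hom := by
        rw [he]
        simp only [Iso.trans_hom, Category.assoc, comp]
        simp
      exact h)

theorem sq_ofCells (leg : ∀ i, K ⟶ X.obj i)
    (cell : ∀ {i j : J} (u : i ⟶ j), leg j ≅ leg i ≫ X.map u) (nat id comp) {i j : J} (u : i ⟶ j) :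
    (ofCells leg @cell nat id comp).sq u = λ_ (leg j) ≪≫ cell u := rfl

theorem cell_ofCells (leg : ∀ i, K ⟶ X.obj i)
    (cell : ∀ {i j : J} (u : i ⟶ j), leg j ≅ leg i ≫ X.map u) (nat id comp) {i j : J} (u : i ⟶ j) :
    (ofCells leg @cell nat id comp).cell u = cell u := by
  rw [PseudoCone.cell, sq_ofCells]
  exact Iso.symm_self_id_assoc _ _

theorem ext {p q : PseudoCone X K} (h : ∀ i, p.leg i = q.leg i)
    (h' : ∀ {i j : J} (u : i ⟶ j), (p.cell u).hom ≈ₕ (q.cell u).hom) : p = q := by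
  obtain ⟨l, n, _, _, _⟩ := p
  obtain ⟨l', n', _, _, _⟩ := q
  obtain rfl : l = l' := funext h
  have : @n = @n' := by
    funext i j u
    have e := (h' u).eq
    exact Iso.ext ((cancel_epi (λ_ (l j)).inv).1 e)
  cases this
  rfl

/-- The components of a morphism of pseudo-cones. -/
abbrev homLeg {p q : PseudoCone X K} (m : p ⟶ q) (i : J) : p.leg i ⟶ q.leg i := m.as.app i

theorem homLeg_naturality {p q : PseudoCone X K} (m : p ⟶ q) {i j : J} (u : i ⟶ j) :
    homLeg m j ≫ (q.cell u).hom = (p.cell u).hom ≫ homLeg m i ▷ X.map u := by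
  have h : 𝟙 K ◁ homLeg m j ≫ (q.sq u).hom = (p.sq u).hom ≫ homLeg m i ▷ X.map u :=
    m.as.naturality u
  simp only [cell, Iso.trans_hom, Iso.symm_hom, Category.assoc, ← h]
  simp

/-- Construction of a morphism of pseudo-cones. -/
def homOfLegs {p q : PseudoCone X K} (m : ∀ i, p.leg i ⟶ q.leg i)
    (nat : ∀ {i j : J} (u : i ⟶ j), m j ≫ (q.cell u).hom = (p.cell u).hom ≫ m i ▷ X.map u) :
    p ⟶ q :=
  ⟨⟨m, fun {i j} u => by
    have h := nat u
    simp only [cell, Iso.trans_hom, Iso.symm_hom, Category.assoc] at h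
    have h' : 𝟙 K ◁ m j ≫ (q.sq u).hom = (p.sq u).hom ≫ m i ▷ X.map u := by
      rw [← cancel_epi (λ_ (p.leg j)).inv, ← h]
      simp
    exact h'⟩⟩

theorem coneFunctor_cell {L : A} (π : PseudoCone X L) (k : K ⟶ L) {i j : J} (u : i ⟶ j) :
    (PseudoCone.cell ((coneFunctor π K).obj k) u).hom ≈ₕ k ◁ (π.cell u).hom := by
  have h : (PseudoCone.cell ((coneFunctor π K).obj k) u).hom =
      k ◁ (π.cell u).hom ≫ (α_ _ _ _).inv := by
    have h' : (PseudoCone.cell ((coneFunctor π K).obj k) u).hom =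
        (λ_ (k ≫ π.leg j)).inv ≫ (α_ _ _ _).inv ≫ ((λ_ k).hom ≫ (ρ_ k).inv) ▷ π.leg j ≫
          (α_ _ _ _).hom ≫ k ◁ (π.sq u).hom ≫ (α_ _ _ _).inv := rfl
    rw [h']
    simp [cell]
    rfl
  rw [h]
  exact HomEq.comp_id (.refl _) ((HomEq.associator_inv _ _ _).trans (.id rfl))

theorem mapCone_cell {D : Type u₃} [Bicategory.{w₃, v₃} D] [Strict D] (H : StrictPseudofunctor A D)
    (π : PseudoCone X L) {i j : J} (u : i ⟶ j) :
    (PseudoCone.cell (mapCone H π) u).hom ≈ₕ H.map₂ (π.cell u).hom := by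
  have h : (PseudoCone.cell (mapCone H π) u).hom =
      H.map₂ (π.cell u).hom ≫ (H.mapComp _ _).hom := by
    have h' : (PseudoCone.cell (mapCone H π) u).hom =
        (λ_ (H.map (π.leg j))).inv ≫ (λ_ (H.map (π.leg j))).hom ≫
          H.map₂ ((λ_ (π.leg j)).inv ≫ (π.sq u).hom) ≫ (H.mapComp _ _).hom := rfl
    rw [h', Iso.inv_hom_id_assoc]
    rfl
  rw [h]
  exact HomEq.comp_id (.refl _) ((HomEq.mapComp_hom _ _ _).trans (.id (H.map_comp _ _).symm))

end PseudoCone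

end

end TwoCat

/-! ### Cones weighted by a pseudo-colimit -/

namespace TwoCat

section

open Opposite

open scoped Pseudofunctor.StrongTrans

variable {C : Type u} [Bicategory.{w₃, v₃} C] {J : Type w} [Bicategory.{w, w} J]

/-- Evaluation at an object, as a 2-functor. -/
def evaluation (D : C) : StrictPseudofunctor (StrictPseudofunctor C Cat.{w, w}) Cat.{w, w} :=
  StrictPseudofunctor.mk''
    { obj := fun T => T.obj D
      map := fun α => TwoNatTrans.app α D
      map₂ := fun Γ => Modif.app Γ D
      map_id := fun _ => rfl
      map_comp := fun _ _ => rfl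
      map₂_whisker_left := fun f g h η => (PseudoColimit.conj_rfl _).symm
      map₂_whisker_right := fun η f => (PseudoColimit.conj_rfl _).symm }

/-- The value at an object of a diagram of category-valued 2-functors. -/
abbrev evalAt (P : J ⥤ᵖ StrictPseudofunctor C Cat.{w, w}) (D : C) : J ⥤ᵖ Cat.{w, w} :=
  P.comp (evaluation D).toPseudofunctor

theorem unit_evalAt (P : J ⥤ᵖ StrictPseudofunctor C Cat.{w, w}) (D : C) (i : J)
    (x : (P.obj i).obj D) :
    (Ps.unit (evalAt P D) i x).hom = (Modif.app (P.mapId i).hom D).toNatTrans.app x :=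
  Category.comp_id ((Modif.app (P.mapId i).hom D).toNatTrans.app x)

theorem comp_evalAt (P : J ⥤ᵖ StrictPseudofunctor C Cat.{w, w}) (D : C) {i j k : J} (u : i ⟶ j)
    (v : j ⟶ k) (x : (P.obj i).obj D) :
    (Ps.comp (evalAt P D) u v x).hom = (Modif.app (P.mapComp u v).hom D).toNatTrans.app x :=
  Category.comp_id ((Modif.app (P.mapComp u v).hom D).toNatTrans.app x)

/-- A pointwise pseudo-colimit cocone with strictly 2-natural inclusions and transitions. -/
structure PsCocone (P : J ⥤ᵖ StrictPseudofunctor C Cat.{w, w})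
    (T : StrictPseudofunctor C Cat.{w, w}) where
  at' (D : C) : PsColimit (evalAt P D) (T.obj D)
  obj_nat (j : J) {D D' : C} (f : D ⟶ D') (x : (P.obj j).obj D) :
    ((at' D').incl j).obj (act (P.obj j) f x) = act T f (((at' D).incl j).obj x)
  map_nat (j : J) {D D' : C} (f : D ⟶ D') {x y : (P.obj j).obj D} (r : x ⟶ y) :
    ((at' D').incl j).map (actMap (P.obj j) f r) ≈ₕ actMap T f (((at' D).incl j).map r)
  nat₂ (j : J) {D D' : C} {f g : D ⟶ D'} (η : f ⟶ g) (x : (P.obj j).obj D) :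
    ((at' D').incl j).map (act₂ (P.obj j) η x) ≈ₕ act₂ T η (((at' D).incl j).obj x)
  tr_nat {i j : J} (u : i ⟶ j) {D D' : C} (f : D ⟶ D') (x : (P.obj i).obj D) :
    ((at' D').tr u (act (P.obj i) f x)).hom ≈ₕ actMap T f ((at' D).tr u x).hom

/-- The inclusions of a pseudo-cocone, as transformations. -/
def PsCocone.incl {P : J ⥤ᵖ StrictPseudofunctor C Cat.{w, w}}
    {T : StrictPseudofunctor C Cat.{w, w}} (c : PsCocone P T) (j : J) : HetTrans (P.obj j) T where
  app D := (c.at' D).incl j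
  obj_nat := c.obj_nat j
  map_nat := c.map_nat j
  nat₂ := c.nat₂ j

variable {E : Type u₁} [Bicategory.{w₁, v₁} E] [Strict E]

/-- A diagram `Y` in `E` that is represented termwise by a diagram `P` of weights: a compatible
family of weighted cones over `F`. -/
structure ConeSystem (P : J ⥤ᵖ StrictPseudofunctor C Cat.{w, w}) (F : StrictPseudofunctor C E)
    (Y : Jᵒᵖ ⥤ᵖ E) where
  lam (j : J) : WCone (P.obj j) F (Y.obj (op j))
  leg_map {i j : J} (u : i ⟶ j) {D : C} (x : (P.obj i).obj D) :
    (lam j).leg (Ps.obj (evalAt P D) u x) = Y.map u.op ≫ (lam i).leg x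
  leg₂_map {i j : J} (u : i ⟶ j) {D : C} {x y : (P.obj i).obj D} (r : x ⟶ y) :
    (lam j).leg₂ (Ps.map (evalAt P D) u r) ≈ₕ Y.map u.op ◁ (lam i).leg₂ r
  leg₂_cell {i j : J} {u v : i ⟶ j} (η : u ⟶ v) {D : C} (x : (P.obj i).obj D) :
    (lam j).leg₂ (Ps.cell (evalAt P D) η x) ≈ₕ
      Y.map₂ (Bicategory.Opposite.op2 η) ▷ (lam i).leg x
  leg₂_unit (i : J) {D : C} (x : (P.obj i).obj D) :
    (lam i).leg₂ (Ps.unit (evalAt P D) i x).hom ≈ₕ (Y.mapId (op i)).hom ▷ (lam i).leg x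
  leg₂_comp {i j k : J} (u : i ⟶ j) (v : j ⟶ k) {D : C} (x : (P.obj i).obj D) :
    (lam k).leg₂ (Ps.comp (evalAt P D) u v x).hom ≈ₕ (Y.mapComp v.op u.op).hom ▷ (lam i).leg x

namespace ConeSystem

variable [Strict J] {P : J ⥤ᵖ StrictPseudofunctor C Cat.{w, w}} {F : StrictPseudofunctor C E}
    {Y : Jᵒᵖ ⥤ᵖ E} {T : StrictPseudofunctor C Cat.{w, w}}

/-- A weighted cone over `F` with weight the pseudo-colimit `T` of `P` corresponds to a
pseudo-cone over `Y`. -/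
structure Corr (S : ConeSystem P F Y) (c : PsCocone P T) {K : E} (ψ : WCone T F K)
    (p : PseudoCone Y K) : Prop where
  leg (j : J) {D : C} (x : (P.obj j).obj D) :
    ψ.leg (((c.at' D).incl j).obj x) = p.leg (op j) ≫ (S.lam j).leg x
  leg₂ (j : J) {D : C} {x y : (P.obj j).obj D} (r : x ⟶ y) :
    ψ.leg₂ (((c.at' D).incl j).map r) ≈ₕ p.leg (op j) ◁ (S.lam j).leg₂ r
  tr {i j : J} (u : i ⟶ j) {D : C} (x : (P.obj i).obj D) :
    ψ.leg₂ ((c.at' D).tr u x).hom ≈ₕ (p.cell u.op).hom ▷ (S.lam i).leg x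

/-- A morphism of weighted cones corresponds to a morphism of pseudo-cones. -/
def Corr₂ (S : ConeSystem P F Y) (c : PsCocone P T) {K : E} {ψ ψ' : WCone T F K}
    {p p' : PseudoCone Y K} (m : ψ ⟶ ψ') (n : p ⟶ p') : Prop :=
  ∀ (j : J) {D : C} (x : (P.obj j).obj D),
    WCone.homLeg m (((c.at' D).incl j).obj x) ≈ₕ PseudoCone.homLeg n (op j) ▷ (S.lam j).leg x

theorem Corr.pre {S : ConeSystem P F Y} {c : PsCocone P T} {V : E} {φ : WCone T F V}
    {π : PseudoCone Y V} (h : S.Corr c φ π) {K : E} (k : K ⟶ V) :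
    S.Corr c ((φ.pre K).obj k) ((coneFunctor π K).obj k) where
  leg j D x := (congrArg (fun t => k ≫ t) (h.leg j x)).trans (Strict.assoc _ _ _).symm
  leg₂ j D x y r := (HomEq.whiskerLeft rfl (h.leg₂ j r)).trans (HomEq.comp_whiskerLeft _ _ _).symm
  tr u D x := (HomEq.whiskerLeft rfl (h.tr u x)).trans
    ((HomEq.whisker_assoc _ _ _).symm.trans
      (HomEq.whiskerRight (PseudoCone.coneFunctor_cell π k u.op).symm rfl))

theorem Corr₂.pre {S : ConeSystem P F Y} {c : PsCocone P T} {V : E} {φ : WCone T F V}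
    {π : PseudoCone Y V} (h : S.Corr c φ π) {K : E} {k l : K ⟶ V} (μ : k ⟶ l) :
    S.Corr₂ c ((φ.pre K).map μ) ((coneFunctor π K).map μ) :=
  fun j D x => (HomEq.whiskerRight (.refl μ) (h.leg j x)).trans (HomEq.whiskerRight_comp _ _ _)

theorem Corr.unique_cone {S : ConeSystem P F Y} {c : PsCocone P T}
    (hU : ∀ j, (S.lam j).Universal) {K : E} {ψ : WCone T F K}
    {p p' : PseudoCone Y K} (h : S.Corr c ψ p) (h' : S.Corr c ψ p') : p = p' := by
  have e : ∀ i, p.leg i = p'.leg i := fun i => (hU i.unop).ext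
    (fun D x => (h.leg i.unop x).symm.trans (h'.leg i.unop x))
    (fun D x y r => (h.leg₂ i.unop r).symm.trans (h'.leg₂ i.unop r))
  refine PseudoCone.ext e fun {i j} u => (hU j.unop).cell_homEq (e j) ?_
    fun D x => (h.tr u.unop x).symm.trans (h'.tr u.unop x)
  rw [e i]

theorem Corr.unique_wcone {S : ConeSystem P F Y} {c : PsCocone P T} {K : E} {ψ ψ' : WCone T F K}
    {p : PseudoCone Y K} (h : S.Corr c ψ p) (h' : S.Corr c ψ' p) : ψ = ψ' := by
  refine HetTrans.ext fun D => (c.at' D).functor_ext (fun j => ?_) fun u x =>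
    (h.tr u x).trans (h'.tr u x).symm
  exact HomEq.functor_ext (fun x => (h.leg j x).trans (h'.leg j x).symm)
    fun r => (h.leg₂ j r).trans (h'.leg₂ j r).symm

end ConeSystem

end

end TwoCat

/-! ### The correspondence of weighted cones and pseudo-cones -/

namespace TwoCat

universe a₁ b₁

section

open Opposite

open scoped Pseudofunctor.StrongTrans

section

variable {C : Type u} [Bicategory.{w₃, v₃} C] {E : Type u₁} [Bicategory.{w₁, v₁} E] [Strict E]
  {P : StrictPseudofunctor C Cat.{a₁, b₁}} {F : StrictPseudofunctor C E}

theorem WCone.Universal.exists_hom {V : E} {φ : WCone P F V} (h : φ.Universal) {K : E} {k l : K ⟶ V}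
    {α β : WCone P F K} (hk : (φ.pre K).obj k = α) (hl : (φ.pre K).obj l = β) (m : α ⟶ β) :
    ∃ μ : k ⟶ l, ∀ {D : C} (x : P.obj D), μ ▷ φ.leg x ≈ₕ WCone.homLeg m x := by
  subst hk hl
  have := h.full K
  obtain ⟨μ, rfl⟩ := (φ.pre K).map_surjective m
  exact ⟨μ, fun x => .refl _⟩

theorem WCone.Universal.exists_iso {V : E} {φ : WCone P F V} (h : φ.Universal) {K : E} {k l : K ⟶ V}
    {α β : WCone P F K} (hk : (φ.pre K).obj k = α) (hl : (φ.pre K).obj l = β) (m : α ≅ β) :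
    ∃ μ : k ≅ l, ∀ {D : C} (x : P.obj D), μ.hom ▷ φ.leg x ≈ₕ WCone.homLeg m.hom x := by
  subst hk hl
  have := h.full K
  have := h.faithful K
  refine ⟨(φ.pre K).preimageIso m, fun {D} x => ?_⟩
  have e : (φ.pre K).map ((φ.pre K).preimageIso m).hom = m.hom := by simp
  exact .of_eq (congrArg (fun t => WCone.homLeg t x) e)

end

variable {C : Type u} [Bicategory.{w₃, v₃} C] {J : Type w} [Bicategory.{w, w} J]
  {E : Type u₁} [Bicategory.{w₁, v₁} E] [Strict E]
  {P : J ⥤ᵖ StrictPseudofunctor C Cat.{w, w}} {F : StrictPseudofunctor C E}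
  {Y : Jᵒᵖ ⥤ᵖ E} {T : StrictPseudofunctor C Cat.{w, w}}

/-- The transition isomorphisms of a pseudo-cocone, after composition with a weighted cone. -/
def PsCocone.trIso (c : PsCocone P T) {K : E} (ψ : WCone T F K) {i j : J} (u : i ⟶ j) :
    (c.incl i).comp ψ ≅ (TwoNatTrans.toHet (P.map u)).comp ((c.incl j).comp ψ) where
  hom := HetTrans.Hom.mk
    (fun D => { app := fun x => ψ.leg₂ ((c.at' D).tr u x).hom
                naturality := fun x y r => by
                  have h := congrArg (ψ.app D).map ((c.at' D).tr_naturality u r)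
                  exact ((ψ.app D).map_comp _ _).symm.trans (h.trans ((ψ.app D).map_comp _ _)) })
    (fun f x => (HomEq.map (ψ.app _) (c.tr_nat u f x)).trans (ψ.map_nat f _))
  inv := HetTrans.Hom.mk
    (fun D => { app := fun x => ψ.leg₂ ((c.at' D).tr u x).inv
                naturality := fun x y r => by
                  have h := congrArg (ψ.app D).map ((c.at' D).tr_naturality_inv u r)
                  exact ((ψ.app D).map_comp _ _).symm.trans (h.trans ((ψ.app D).map_comp _ _)) })
    (fun {D D'} f x => (HomEq.map (ψ.app _) (HomEq.inv (f := (c.at' D').tr u (act (P.obj i) f x))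
      (g := (T.map f).toFunctor.mapIso ((c.at' D).tr u x)) (c.tr_nat u f x))).trans
        (ψ.map_nat f _))
  hom_inv_id := HetTrans.hom_ext fun D x => by
    refine ((ψ.app D).map_comp _ _).symm.trans ?_
    exact (congrArg (ψ.app D).map ((c.at' D).tr u x).hom_inv_id).trans ((ψ.app D).map_id _)
  inv_hom_id := HetTrans.hom_ext fun D x => by
    refine ((ψ.app D).map_comp _ _).symm.trans ?_
    exact (congrArg (ψ.app D).map ((c.at' D).tr u x).inv_hom_id).trans ((ψ.app D).map_id _)

namespace ConeSystem

variable [Strict J] {S : ConeSystem P F Y} {c : PsCocone P T}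

theorem Corr.pre_leg {K : E} {ψ : WCone T F K} {p : PseudoCone Y K} (h : S.Corr c ψ p) (j : J) :
    ((S.lam j).pre K).obj (p.leg (op j)) = (c.incl j).comp ψ :=
  HetTrans.ext fun D => HomEq.functor_ext (fun x => (h.leg j x).symm)
    fun r => (h.leg₂ j r).symm

variable (S c)

/-- The pseudo-cone of a weighted cone: its legs and 2-cells come from the universality of the cones
with weights `P j`, and its equations may be tested on the elements of the weights. -/
theorem exists_cone (hU : ∀ j, (S.lam j).Universal) {K : E} (ψ : WCone T F K) :
    ∃ p, S.Corr c ψ p := by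
  choose p hp using fun j => ((hU j).bijective K).2 ((c.incl j).comp ψ)
  have e (j : J) {D : C} (x : (P.obj j).obj D) :
      ψ.leg (((c.at' D).incl j).obj x) = p j ≫ (S.lam j).leg x :=
    HetTrans.obj_congr (hp j).symm rfl
  have e' (j : J) {D : C} {x y : (P.obj j).obj D} (r : x ⟶ y) :
      ψ.leg₂ (((c.at' D).incl j).map r) ≈ₕ p j ◁ (S.lam j).leg₂ r :=
    HetTrans.map_congr (hp j).symm (.refl r)
  have hu {i j : J} (u : i ⟶ j) : ((S.lam i).pre K).obj (p j ≫ Y.map u.op) =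
      (TwoNatTrans.toHet (P.map u)).comp ((c.incl j).comp ψ) :=
    HetTrans.ext fun D => HomEq.functor_ext
      (fun x => (Strict.assoc _ _ _).trans ((congrArg (fun t => p j ≫ t) (S.leg_map u x).symm).trans
        (e j _).symm))
      fun r => (HomEq.comp_whiskerLeft _ _ _).trans
        ((HomEq.whiskerLeft rfl (S.leg₂_map u r).symm).trans (e' j _).symm)
  choose cell hc using fun {i j : J} (u : i ⟶ j) =>
    (hU i).exists_iso (hp i) (hu u) (c.trIso ψ u)
  have hc' {i j : J} (u : i ⟶ j) {D : C} (x : (P.obj i).obj D) :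
      (cell u).hom ▷ (S.lam i).leg x ≈ₕ ψ.leg₂ ((c.at' D).tr u x).hom := hc u x
  have nat {i j : J} {u v : i ⟶ j} (η : u ⟶ v) :
      (cell u).hom ≫ p j ◁ Y.map₂ (Bicategory.Opposite.op2 η) = (cell v).hom := by
    refine (hU i).cell_ext fun D x => HomEq.eq ?_
    rw [comp_whiskerRight]
    refine ((hc' u x).comp ((HomEq.whisker_assoc _ _ _).trans
      ((HomEq.whiskerLeft rfl (S.leg₂_cell η x).symm).trans (e' j _).symm))).trans ?_
    refine (HomEq.of_eq ?_).trans (hc' v x).symm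
    rw [← (c.at' D).tr_cell η x]
    exact ((ψ.app D).map_comp _ _).symm
  have id (i : J) : (cell (𝟙 i)).hom ≫ p i ◁ (Y.mapId (op i)).hom = (ρ_ (p i)).inv := by
    refine (hU i).cell_ext fun D x => HomEq.eq ?_
    rw [comp_whiskerRight]
    refine ((hc' (𝟙 i) x).comp ((HomEq.whisker_assoc _ _ _).trans
      ((HomEq.whiskerLeft rfl (S.leg₂_unit i x).symm).trans (e' i _).symm))).trans ?_
    refine (HomEq.of_eq (((ψ.app D).map_comp _ _).symm.trans
      (congrArg (ψ.app D).map ((c.at' D).tr_id i x)))).trans ?_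
    refine (HomEq.of_eq ((ψ.app D).map_id _)).trans ?_
    refine HomEq.symm ((HomEq.whiskerRight (HomEq.rightUnitor_inv _) rfl).trans ?_)
    rw [id_whiskerRight]
    exact .id (e i x).symm
  have comp {i j k : J} (u : i ⟶ j) (v : j ⟶ k) :
      (cell (u ≫ v)).hom ≫ p k ◁ (Y.mapComp v.op u.op).hom =
        (cell u).hom ≫ (cell v).hom ▷ Y.map u.op ≫ (α_ _ _ _).hom := by
    refine (hU i).cell_ext fun D x => HomEq.eq ?_
    rw [comp_whiskerRight, comp_whiskerRight, comp_whiskerRight]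
    refine ((hc' (u ≫ v) x).comp ((HomEq.whisker_assoc _ _ _).trans
      ((HomEq.whiskerLeft rfl (S.leg₂_comp u v x).symm).trans (e' k _).symm))).trans ?_
    refine (HomEq.of_eq (((ψ.app D).map_comp _ _).symm.trans
      ((congrArg (ψ.app D).map ((c.at' D).tr_comp u v x)).trans ((ψ.app D).map_comp _ _)))).trans ?_
    refine (hc' u x).symm.comp ?_
    refine HomEq.symm (HomEq.comp_id (((HomEq.whiskerRight_comp _ _ _).symm.trans
      (HomEq.whiskerRight (.refl _) (S.leg_map u x).symm)).trans (hc' v _)) ?_)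
    refine (HomEq.whiskerRight (HomEq.associator_hom _ _ _) rfl).trans ?_
    rw [id_whiskerRight]
    exact .id (by simp only [Strict.assoc])
  refine ⟨PseudoCone.ofCells (fun i => p i.unop) (fun {i j} u => cell u.unop)
    (fun η => nat η.unop2) (fun i => id i.unop) (fun u v => comp v.unop u.unop), ?_⟩
  exact ⟨fun j D x => e j x, fun j D x y r => e' j r, fun {i j} u D x => by
    refine (hc' u x).symm.trans (HomEq.whiskerRight (.of_eq ?_) rfl)
    exact (congrArg Iso.hom (PseudoCone.cell_ofCells (X := Y) (fun i => p i.unop)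
      (fun {i j} u => cell u.unop) _ _ _ u.op)).symm⟩

/-- The comparison 2-cells of a pseudo-cone, on the elements of the weights. -/
def theta {K : E} (p : PseudoCone Y K) {i j : J} (u : i ⟶ j) {D : C} (x : (P.obj i).obj D) :
    p.leg (op i) ≫ (S.lam i).leg x ≅ p.leg (op j) ≫ (S.lam j).leg (Ps.obj (evalAt P D) u x) :=
  whiskerRightIso (p.cell u.op) ((S.lam i).leg x) ≪≫
    eqToIso (by rw [Strict.assoc, S.leg_map])

theorem theta_hom {K : E} (p : PseudoCone Y K) {i j : J} (u : i ⟶ j) {D : C}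
    (x : (P.obj i).obj D) : (S.theta p u x).hom ≈ₕ (p.cell u.op).hom ▷ (S.lam i).leg x :=
  HomEq.comp_eqToHom _ (by rw [Strict.assoc, S.leg_map])

/-- The components of the weighted cone of a pseudo-cone, by the universal property of the
pseudo-colimit. -/
theorem exists_functor (hd : ∀ D, PsColimit.HasDesc.{w, w₁, v₁} (c.at' D)) {K : E}
    (p : PseudoCone Y K) (D : C) : ∃ Ψ : T.obj D ⥤ (K ⟶ F.obj D),
      (∀ j, (c.at' D).incl j ⋙ Ψ = (((S.lam j).pre K).obj (p.leg (op j))).app D) ∧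
      ∀ {i j : J} (u : i ⟶ j) (x : (P.obj i).obj D),
        Ψ.map ((c.at' D).tr u x).hom ≈ₕ (S.theta p u x).hom := by
  refine hd D (K ⟶ F.obj D) (fun j => (((S.lam j).pre K).obj (p.leg (op j))).app D)
    (fun {i j} u x => S.theta p u x) ?_ ?_ ?_ ?_
  · intro i j u x y r
    change p.leg (op i) ◁ (S.lam i).leg₂ r ≫ (S.theta p u y).hom =
      (S.theta p u x).hom ≫ p.leg (op j) ◁ (S.lam j).leg₂ (Ps.map (evalAt P D) u r)
    refine HomEq.eq ?_
    refine ((HomEq.refl _).comp (S.theta_hom p u y)).trans ?_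
    refine HomEq.trans (.of_eq (whisker_exchange _ _)) ((S.theta_hom p u x).comp
      ((HomEq.whiskerLeft rfl (S.leg₂_map u r)).trans (HomEq.comp_whiskerLeft _ _ _).symm)).symm
  · intro i x
    refine HomEq.eq (((S.theta_hom p _ x).comp ((HomEq.whiskerLeft rfl (S.leg₂_unit i x)).trans
      (HomEq.whisker_assoc _ _ _).symm)).trans ?_)
    refine (HomEq.of_eq ((comp_whiskerRight _ _ _).symm.trans
      (congrArg (fun t => t ▷ (S.lam i).leg x) (p.cell_id (op i))))).trans ?_
    refine (HomEq.whiskerRight (HomEq.rightUnitor_inv _) rfl).trans ?_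
    rw [id_whiskerRight]
    exact .refl _
  · intro i j k u v x
    refine HomEq.eq (((S.theta_hom p _ x).comp ((HomEq.whiskerLeft rfl (S.leg₂_comp u v x)).trans
      (HomEq.whisker_assoc _ _ _).symm)).trans ?_)
    refine (HomEq.of_eq ((comp_whiskerRight _ _ _).symm.trans
      (congrArg (fun t => t ▷ (S.lam i).leg x) (p.cell_comp v.op u.op)))).trans ?_
    rw [comp_whiskerRight, comp_whiskerRight]
    refine (S.theta_hom p u x).symm.comp ?_
    refine HomEq.comp_id (((HomEq.whiskerRight_comp _ _ _).symm.trans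
      (HomEq.whiskerRight (.refl _) (S.leg_map u x).symm)).trans (S.theta_hom p v _).symm) ?_
    refine (HomEq.whiskerRight (HomEq.associator_hom _ _ _) rfl).trans ?_
    rw [id_whiskerRight]
    exact .id (by simp only [Strict.assoc])
  · intro i j u v η x
    refine HomEq.eq (((S.theta_hom p _ x).comp ((HomEq.whiskerLeft rfl (S.leg₂_cell η x)).trans
      (HomEq.whisker_assoc _ _ _).symm)).trans ?_)
    refine (HomEq.of_eq ((comp_whiskerRight _ _ _).symm.trans
      (congrArg (fun t => t ▷ (S.lam i).leg x)
        (p.cell_naturality (Bicategory.Opposite.op2 η))))).trans ?_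
    exact (S.theta_hom p v x).symm

/-- The weighted cone of a pseudo-cone. -/
theorem exists_wcone (hd : ∀ D, PsColimit.HasDesc.{w, w₁, v₁} (c.at' D)) {K : E}
    (p : PseudoCone Y K) : ∃ ψ, S.Corr c ψ p := by
  choose Ψ hΨ hΨ' using S.exists_functor c hd p
  have e {D : C} (j : J) (x : (P.obj j).obj D) :
      (Ψ D).obj (((c.at' D).incl j).obj x) = p.leg (op j) ≫ (S.lam j).leg x :=
    congrArg (fun t => t.obj x) (hΨ D j)
  have e' {D : C} (j : J) {x y : (P.obj j).obj D} (r : x ⟶ y) :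
      (Ψ D).map (((c.at' D).incl j).map r) ≈ₕ p.leg (op j) ◁ (S.lam j).leg₂ r :=
    HomEq.map_congr (hΨ D j) (.refl r)
  have e'' {D : C} {i j : J} (u : i ⟶ j) (x : (P.obj i).obj D) :
      (Ψ D).map ((c.at' D).tr u x).hom ≈ₕ (p.cell u.op).hom ▷ (S.lam i).leg x :=
    (hΨ' D u x).trans (S.theta_hom p u x)
  have key {D D' : C} (f : D ⟶ D') :
      (T.map f).toFunctor ⋙ Ψ D' = Ψ D ⋙ postcomp K (F.map f) := by
    refine (c.at' D).functor_ext (fun j => HomEq.functor_ext (fun x => ?_) fun r => ?_)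
      fun u x => ?_
    · refine (congrArg (Ψ D').obj (c.obj_nat j f x).symm).trans ((e j _).trans ?_)
      refine (congrArg (fun t => p.leg (op j) ≫ t) ((S.lam j).obj_nat f x)).trans ?_
      exact (Strict.assoc _ _ _).symm.trans (congrArg (fun t => t ≫ F.map f) (e j x).symm)
    · refine (HomEq.map (Ψ D') (c.map_nat j f r).symm).trans ((e' j _).trans ?_)
      refine (HomEq.whiskerLeft rfl ((S.lam j).map_nat f r)).trans ?_
      exact (HomEq.whisker_assoc _ _ _).symm.trans (HomEq.whiskerRight (e' j r).symm rfl)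
    · refine (HomEq.map (Ψ D') (c.tr_nat u f x).symm).trans ((e'' u _).trans ?_)
      refine (HomEq.whiskerRight (.refl _) ((S.lam _).obj_nat f x)).trans ?_
      exact (HomEq.whiskerRight_comp _ _ _).trans (HomEq.whiskerRight (e'' u x).symm rfl)
  refine ⟨⟨Ψ, fun f x => congrArg (fun t => t.obj x) (key f),
    fun f x y r => HomEq.map_congr (key f) (.refl r), fun {D D' f g} η x => ?_⟩, ?_⟩
  · obtain ⟨j, y, rfl⟩ := (c.at' D).exists_rep x
    refine (HomEq.map (Ψ D') (c.nat₂ j η y).symm).trans ((e' j _).trans ?_)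
    refine (HomEq.whiskerLeft rfl ((S.lam j).nat₂ η y)).trans ?_
    exact (HomEq.comp_whiskerLeft _ _ _).symm.trans (HomEq.whiskerLeft (e j y).symm (.refl _))
  · exact ⟨fun j D x => e j x, fun j D x y r => e' j r, fun u D x => e'' u x⟩

theorem Corr₂.exists_right (hU : ∀ j, (S.lam j).Universal) {K : E} {ψ ψ' : WCone T F K}
    {p p' : PseudoCone Y K} (h : S.Corr c ψ p) (h' : S.Corr c ψ' p') (m : ψ ⟶ ψ') :
    ∃ n : p ⟶ p', S.Corr₂ c m n := by
  choose n hn using fun j =>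
    (hU j).exists_hom (h.pre_leg j) (h'.pre_leg j) (HetTrans.compHom (c.incl j) m)
  refine ⟨PseudoCone.homOfLegs (fun i => n i.unop) fun {i j} u =>
    (hU j.unop).cell_ext fun D x => HomEq.eq ?_, fun j D x => (hn j x).symm⟩
  rw [comp_whiskerRight, comp_whiskerRight]
  refine ((hn _ x).comp (h'.tr u.unop x).symm).trans (HomEq.trans (.of_eq ?_)
    ((h.tr u.unop x).comp ((hn _ _).symm.trans ((HomEq.whiskerRight (.refl _)
      (S.leg_map u.unop x)).trans (HomEq.whiskerRight_comp _ _ _)))))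
  exact ((HetTrans.Hom.app m D).naturality _).symm

theorem Corr₂.exists_left {K : E} {ψ ψ' : WCone T F K}
    {p p' : PseudoCone Y K} (h : S.Corr c ψ p) (h' : S.Corr c ψ' p') (n : p ⟶ p') :
    ∃ m : ψ ⟶ ψ', S.Corr₂ c m n := by
  have ex {D : C} (a : T.obj D) : ∃ t : ψ.leg a ⟶ ψ'.leg a, ∀ (j : J) (x : (P.obj j).obj D),
      ((c.at' D).incl j).obj x = a → t ≈ₕ PseudoCone.homLeg n (op j) ▷ (S.lam j).leg x := by
    obtain ⟨j, x, rfl⟩ := (c.at' D).exists_rep a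
    refine ⟨eqToHom (h.leg j x) ≫ PseudoCone.homLeg n (op j) ▷ (S.lam j).leg x ≫
      eqToHom (h'.leg j x).symm, fun j' x' hx => ?_⟩
    obtain ⟨rfl, hxx⟩ := Sigma.mk.inj ((c.at' D).rep_inj hx)
    obtain rfl := eq_of_heq hxx
    exact HomEq.conj _ _ _
  choose t ht using @ex
  refine ⟨HetTrans.Hom.mk (fun D => ⟨fun a => t a, fun a b r => ?_⟩) fun {D D'} f a => ?_,
    fun j D x => ht _ j x rfl⟩
  · refine (c.at' D).natural_of (Ψ := ψ.app D) (Ψ' := ψ'.app D) (fun a => t a) ?_ ?_ r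
    · intro i x y r
      refine HomEq.eq (((h.leg₂ i r).comp (ht _ i y rfl)).trans (HomEq.trans (.of_eq ?_)
        ((ht _ i x rfl).comp (h'.leg₂ i r)).symm))
      exact whisker_exchange _ _
    · intro i j u x
      refine HomEq.eq (((h.tr u x).comp ((ht _ j _ rfl).trans ((HomEq.whiskerRight (.refl _)
        (S.leg_map u x)).trans (HomEq.whiskerRight_comp _ _ _)))).trans (HomEq.trans (.of_eq ?_)
          ((ht _ i x rfl).comp (h'.tr u x)).symm))
      rw [← comp_whiskerRight, ← comp_whiskerRight, PseudoCone.homLeg_naturality]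
  · obtain ⟨j, x, rfl⟩ := (c.at' D).exists_rep a
    refine (ht _ j _ (c.obj_nat j f x)).trans ?_
    refine (HomEq.whiskerRight (.refl _) ((S.lam j).obj_nat f x)).trans ?_
    exact (HomEq.whiskerRight_comp _ _ _).trans (HomEq.whiskerRight (ht _ j x rfl).symm rfl)

variable {S c}

theorem Corr₂.unique_right (hU : ∀ j, (S.lam j).Universal) {K : E} {ψ ψ' : WCone T F K}
    {p p' : PseudoCone Y K} {m : ψ ⟶ ψ'} {n n' : p ⟶ p'}
    (h : S.Corr₂ c m n) (h' : S.Corr₂ c m n') : n = n' :=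
  Pseudofunctor.StrongTrans.homCategory.ext fun i => (hU i.unop).cell_ext fun D x =>
    ((h i.unop x).symm.trans (h' i.unop x)).eq

theorem Corr₂.unique_left {K : E} {ψ ψ' : WCone T F K}
    {p p' : PseudoCone Y K} {m m' : ψ ⟶ ψ'} {n : p ⟶ p'}
    (h : S.Corr₂ c m n) (h' : S.Corr₂ c m' n) : m = m' := by
  refine HetTrans.hom_ext fun D a => ?_
  obtain ⟨j, x, rfl⟩ := (c.at' D).exists_rep a
  exact ((h j x).trans (h' j x).symm).eq

/-- A weighted cone whose weight is a pseudo-colimit is universal if and only if the corresponding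
pseudo-cone is a pseudo-limit cone. -/
theorem Corr.universal_iff (hU : ∀ j, (S.lam j).Universal)
    (hd : ∀ D, PsColimit.HasDesc.{w, w₁, v₁} (c.at' D)) {V : E} {φ : WCone T F V}
    {π : PseudoCone Y V} (h : S.Corr c φ π) : φ.Universal ↔ IsPseudoLimit π := by
  refine forall_congr' fun K => isIsoCat_iff_of_correspondence _ _
    (fun ψ p => S.Corr c ψ p) (fun m n => S.Corr₂ c m n)
    (fun ψ => S.exists_cone c hU ψ) (fun p => S.exists_wcone c hd p)
    (fun h h' => h.unique_cone hU h') (fun h h' => h.unique_wcone h')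
    (fun h h' m => Corr₂.exists_right S c hU h h' m)
    (fun h h' m => Corr₂.exists_left S c h h' m)
    (fun _ _ _ _ _ e e' => Corr₂.unique_right hU e e')
    (fun _ _ _ _ _ e e' => Corr₂.unique_left e e')
    (fun k => h.pre k) (fun μ => Corr₂.pre h μ)

variable {E' : Type u₂} [Bicategory.{w₂, v₂} E'] [Strict E'] (H : StrictPseudofunctor E E')

/-- The image of a system of weighted cones under a 2-functor. -/
def push (S : ConeSystem P F Y) : ConeSystem P (F.comp H) (Y.comp H.toPseudofunctor) where
  lam j := (S.lam j).push H
  leg_map u D x := (congrArg H.map (S.leg_map u x)).trans (H.map_comp _ _)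
  leg₂_map u D x y r := (HomEq.map₂ H (S.leg₂_map u r)).trans (HomEq.map₂_whiskerLeft H _ _)
  leg₂_cell η D x := (HomEq.map₂ H (S.leg₂_cell η x)).trans (HomEq.map₂_whiskerRight H _ _)
  leg₂_unit i D x := (HomEq.map₂ H (S.leg₂_unit i x)).trans
    ((HomEq.map₂_whiskerRight H _ _).trans (HomEq.whiskerRight
      (HomEq.comp_id (.refl _) ((HomEq.mapId_hom H _).trans (.id (H.map_id _).symm))).symm rfl))
  leg₂_comp u v D x := (HomEq.map₂ H (S.leg₂_comp u v x)).trans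
    ((HomEq.map₂_whiskerRight H _ _).trans (HomEq.whiskerRight
      (HomEq.comp_id (.refl _) ((HomEq.mapComp_hom H _ _).trans
        (.id (H.map_comp _ _).symm))).symm rfl))

theorem Corr.push {K : E} {ψ : WCone T F K} {p : PseudoCone Y K} (h : S.Corr c ψ p) :
    (S.push H).Corr c (ψ.push H) (mapCone H p) where
  leg j D x := (congrArg H.map (h.leg j x)).trans (H.map_comp _ _)
  leg₂ j D x y r := (HomEq.map₂ H (h.leg₂ j r)).trans (HomEq.map₂_whiskerLeft H _ _)
  tr u D x := (HomEq.map₂ H (h.tr u x)).trans ((HomEq.map₂_whiskerRight H _ _).trans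
    (HomEq.whiskerRight (PseudoCone.mapCone_cell H p u.op).symm rfl))

end ConeSystem

end

end TwoCat

/-! ### The pointwise pseudo-colimit -/

namespace TwoCat

universe a₁ b₁

theorem PsColimit.tr_congr {J : Type w} [Bicategory.{w, w} J] {Φ : J ⥤ᵖ Cat.{w, w}} {𝓣 : Type w}
    [Category.{w} 𝓣] (c : PsColimit Φ 𝓣) {i j : J} (u : i ⟶ j) {x y : Φ.obj i} (h : x = y) :
    (c.tr u x).hom ≈ₕ (c.tr u y).hom := by
  cases h
  exact .refl _

/-- The objects of the pseudo-colimit of a category-valued pseudofunctor. -/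
structure PsObj {J : Type w} [Bicategory.{w, w} J] (Φ : J ⥤ᵖ Cat.{w, w}) where
  ix : J
  val : Φ.obj ix

namespace PsObj

variable {J : Type w} [Bicategory.{w, w} J] {Φ : J ⥤ᵖ Cat.{w, w}}

/-- Formal composites of the generating morphisms of the pseudo-colimit. -/
inductive Word : PsObj Φ → PsObj Φ → Type w
  | id (a : PsObj Φ) : Word a a
  | comp {a b c : PsObj Φ} (p : Word a b) (q : Word b c) : Word a c
  | incl {i : J} {x y : Φ.obj i} (r : x ⟶ y) : Word ⟨i, x⟩ ⟨i, y⟩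
  | tr {i j : J} (u : i ⟶ j) (x : Φ.obj i) : Word ⟨i, x⟩ ⟨j, Ps.obj Φ u x⟩
  | trInv {i j : J} (u : i ⟶ j) (x : Φ.obj i) : Word ⟨j, Ps.obj Φ u x⟩ ⟨i, x⟩

/-- The defining relations between formal composites. -/
inductive Rel : ∀ {a b : PsObj Φ}, Word a b → Word a b → Prop
  | refl {a b : PsObj Φ} (p : Word a b) : Rel p p
  | symm {a b : PsObj Φ} {p q : Word a b} : Rel p q → Rel q p
  | trans {a b : PsObj Φ} {p q r : Word a b} : Rel p q → Rel q r → Rel p r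
  | congr {a b c : PsObj Φ} {p p' : Word a b} {q q' : Word b c} :
      Rel p p' → Rel q q' → Rel (p.comp q) (p'.comp q')
  | id_comp {a b : PsObj Φ} (p : Word a b) : Rel ((Word.id a).comp p) p
  | comp_id {a b : PsObj Φ} (p : Word a b) : Rel (p.comp (Word.id b)) p
  | assoc {a b c d : PsObj Φ} (p : Word a b) (q : Word b c) (r : Word c d) :
      Rel ((p.comp q).comp r) (p.comp (q.comp r))
  | incl_id {i : J} (x : Φ.obj i) : Rel (Word.incl (𝟙 x)) (Word.id ⟨i, x⟩)
  | incl_comp {i : J} {x y z : Φ.obj i} (r : x ⟶ y) (s : y ⟶ z) :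
      Rel (Word.incl (r ≫ s)) ((Word.incl r).comp (Word.incl s))
  | tr_trInv {i j : J} (u : i ⟶ j) (x : Φ.obj i) :
      Rel ((Word.tr u x).comp (Word.trInv u x)) (Word.id ⟨i, x⟩)
  | trInv_tr {i j : J} (u : i ⟶ j) (x : Φ.obj i) :
      Rel ((Word.trInv u x).comp (Word.tr u x)) (Word.id ⟨j, Ps.obj Φ u x⟩)
  | tr_naturality {i j : J} (u : i ⟶ j) {x y : Φ.obj i} (r : x ⟶ y) :
      Rel ((Word.incl r).comp (Word.tr u y)) ((Word.tr u x).comp (Word.incl (Ps.map Φ u r)))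
  | tr_id (i : J) (x : Φ.obj i) :
      Rel ((Word.tr (𝟙 i) x).comp (Word.incl (Ps.unit Φ i x).hom)) (Word.id ⟨i, x⟩)
  | tr_comp {i j k : J} (u : i ⟶ j) (v : j ⟶ k) (x : Φ.obj i) :
      Rel ((Word.tr (u ≫ v) x).comp (Word.incl (Ps.comp Φ u v x).hom))
        ((Word.tr u x).comp (Word.tr v (Ps.obj Φ u x)))
  | tr_cell {i j : J} {u v : i ⟶ j} (η : u ⟶ v) (x : Φ.obj i) :
      Rel ((Word.tr u x).comp (Word.incl (Ps.cell Φ η x))) (Word.tr v x)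

instance : Category (PsObj Φ) where
  Hom a b := Quot (Rel (a := a) (b := b))
  id a := Quot.mk _ (Word.id a)
  comp {a b c} p q := Quot.map₂ Word.comp
    (fun p _ _ h => Rel.congr (Rel.refl p) h) (fun _ _ q h => Rel.congr h (Rel.refl q)) p q
  id_comp {a b} p := Quot.inductionOn p fun p => Quot.sound (Rel.id_comp p)
  comp_id {a b} p := Quot.inductionOn p fun p => Quot.sound (Rel.comp_id p)
  assoc {a b c d} p q r := Quot.inductionOn p fun p => Quot.inductionOn q fun q =>
    Quot.inductionOn r fun r => Quot.sound (Rel.assoc p q r)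

variable (Φ)

/-- The pseudo-colimit of a category-valued pseudofunctor. -/
def colimit : PsColimit Φ (PsObj Φ) where
  incl j :=
    { obj := fun x => ⟨j, x⟩
      map := fun r => Quot.mk _ (Word.incl r)
      map_id := fun x => Quot.sound (Rel.incl_id x)
      map_comp := fun r s => Quot.sound (Rel.incl_comp r s) }
  tr u x :=
    { hom := Quot.mk _ (Word.tr u x)
      inv := Quot.mk _ (Word.trInv u x)
      hom_inv_id := Quot.sound (Rel.tr_trInv u x)
      inv_hom_id := Quot.sound (Rel.trInv_tr u x) }
  tr_naturality u _ _ r := Quot.sound (Rel.tr_naturality u r)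
  tr_id i x := Quot.sound (Rel.tr_id i x)
  tr_comp u v x := Quot.sound (Rel.tr_comp u v x)
  tr_cell η x := Quot.sound (Rel.tr_cell η x)
  bijective := ⟨fun p q h => by
    obtain ⟨i, x⟩ := p
    obtain ⟨j, y⟩ := q
    have h' : (⟨i, x⟩ : PsObj Φ) = ⟨j, y⟩ := h
    cases h'
    rfl, fun a => ⟨⟨a.ix, a.val⟩, rfl⟩⟩
  induction {Pr} hcomp hid hincl htr htrInv a b p := by
    obtain ⟨w⟩ := p
    clear p
    induction w with
    | id a => exact hid a
    | comp p q hp hq => exact hcomp _ _ hp hq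
    | incl r => exact hincl r
    | tr u x => exact htr u x
    | trInv u x => exact htrInv u x

variable {Φ}

section Desc

variable {𝓔 : Type b₁} [Category.{a₁} 𝓔] (D : ∀ j, Φ.obj j ⥤ 𝓔)
  (θ : ∀ {i j : J} (u : i ⟶ j) (x : Φ.obj i), (D i).obj x ≅ (D j).obj (Ps.obj Φ u x))

/-- The value on a formal composite of the functor induced by a pseudo-cocone. -/
def descWord : ∀ {a b : PsObj Φ}, Word a b → ((D a.ix).obj a.val ⟶ (D b.ix).obj b.val)
  | _, _, Word.id a => 𝟙 _
  | _, _, Word.comp p q => descWord p ≫ descWord q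
  | _, _, Word.incl r => (D _).map r
  | _, _, Word.tr u x => (θ u x).hom
  | _, _, Word.trInv u x => (θ u x).inv

/-- The functor out of the pseudo-colimit induced by a pseudo-cocone. -/
def desc (hnat : ∀ {i j : J} (u : i ⟶ j) {x y : Φ.obj i} (r : x ⟶ y),
      (D i).map r ≫ (θ u y).hom = (θ u x).hom ≫ (D j).map (Ps.map Φ u r))
    (hid : ∀ (i : J) (x : Φ.obj i), (θ (𝟙 i) x).hom ≫ (D i).map (Ps.unit Φ i x).hom = 𝟙 _)
    (hcomp : ∀ {i j k : J} (u : i ⟶ j) (v : j ⟶ k) (x : Φ.obj i),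
      (θ (u ≫ v) x).hom ≫ (D k).map (Ps.comp Φ u v x).hom =
        (θ u x).hom ≫ (θ v (Ps.obj Φ u x)).hom)
    (hcell : ∀ {i j : J} {u v : i ⟶ j} (η : u ⟶ v) (x : Φ.obj i),
      (θ u x).hom ≫ (D j).map (Ps.cell Φ η x) = (θ v x).hom) : PsObj Φ ⥤ 𝓔 where
  obj a := (D a.ix).obj a.val
  map := Quot.lift (descWord D θ) (fun p q h => by
    induction h with
    | refl p => rfl
    | symm _ ih => exact ih.symm
    | trans _ _ ih ih' => exact ih.trans ih'
    | congr _ _ ih ih' => exact congrArg₂ (· ≫ ·) ih ih'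
    | id_comp p => exact Category.id_comp _
    | comp_id p => exact Category.comp_id _
    | assoc p q r => exact Category.assoc _ _ _
    | incl_id x => exact (D _).map_id x
    | incl_comp r s => exact (D _).map_comp r s
    | tr_trInv u x => exact (θ u x).hom_inv_id
    | trInv_tr u x => exact (θ u x).inv_hom_id
    | tr_naturality u r => exact hnat u r
    | tr_id i x => exact hid i x
    | tr_comp u v x => exact hcomp u v x
    | tr_cell η x => exact hcell η x)
  map_id _ := rfl
  map_comp {a b c} p q := Quot.inductionOn p fun p => Quot.inductionOn q fun q => rfl

end Desc

theorem hasDesc : PsColimit.HasDesc.{w, a₁, b₁} (colimit Φ) :=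
  fun 𝓔 _ D θ hnat hid hcomp hcell =>
    ⟨desc D @θ @hnat hid @hcomp @hcell, fun j => rfl, fun u x => .refl _⟩

end PsObj

section Pointwise

variable {C : Type u} [Bicategory.{w₃, v₃} C] {J : Type w} [Bicategory.{w, w} J]
  (P : J ⥤ᵖ StrictPseudofunctor C Cat.{w, w})

/-- The inclusion into the pointwise pseudo-colimit. -/
abbrev pwIncl (D : C) (j : J) : (P.obj j).obj D ⥤ PsObj (evalAt P D) :=
  (PsObj.colimit (evalAt P D)).incl j

/-- The transition isomorphisms of the pointwise pseudo-colimit. -/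
abbrev pwTr (D : C) {i j : J} (u : i ⟶ j) (x : (P.obj i).obj D) :
    (pwIncl P D i).obj x ≅ (pwIncl P D j).obj (Ps.obj (evalAt P D) u x) :=
  (PsObj.colimit (evalAt P D)).tr u x

/-- The transition isomorphisms of the pointwise pseudo-colimit, after the action of a 1-cell. -/
def pwTheta {D D' : C} (f : D ⟶ D') {i j : J} (u : i ⟶ j) (x : (P.obj i).obj D) :
    (pwIncl P D' i).obj (act (P.obj i) f x) ≅
      (pwIncl P D' j).obj (act (P.obj j) f (Ps.obj (evalAt P D) u x)) :=
  pwTr P D' u (act (P.obj i) f x) ≪≫ eqToIso (congrArg (pwIncl P D' j).obj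
    (TwoNatTrans.app_obj_nat (P.map u) f x))

theorem pwTheta_hom {D D' : C} (f : D ⟶ D') {i j : J} (u : i ⟶ j) (x : (P.obj i).obj D) :
    (pwTheta P f u x).hom ≈ₕ (pwTr P D' u (act (P.obj i) f x)).hom :=
  HomEq.comp_eqToHom _ (congrArg (pwIncl P D' j).obj (TwoNatTrans.app_obj_nat (P.map u) f x))

theorem actMap_unit {D D' : C} (f : D ⟶ D') (i : J) (x : (P.obj i).obj D) :
    (Ps.unit (evalAt P D') i (act (P.obj i) f x)).hom ≈ₕ
      actMap (P.obj i) f (Ps.unit (evalAt P D) i x).hom := by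
  rw [unit_evalAt, unit_evalAt]
  exact HetTrans.Hom.nat (Modif.toHet (P.mapId i).hom) f x

theorem actMap_comp' {D D' : C} (f : D ⟶ D') {i j k : J} (u : i ⟶ j) (v : j ⟶ k)
    (x : (P.obj i).obj D) :
    (Ps.comp (evalAt P D') u v (act (P.obj i) f x)).hom ≈ₕ
      actMap (P.obj k) f (Ps.comp (evalAt P D) u v x).hom := by
  rw [comp_evalAt, comp_evalAt]
  exact HetTrans.Hom.nat (Modif.toHet (P.mapComp u v).hom) f x

theorem actMap_cell {D D' : C} (f : D ⟶ D') {i j : J} {u v : i ⟶ j} (η : u ⟶ v)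
    (x : (P.obj i).obj D) :
    Ps.cell (evalAt P D') η (act (P.obj i) f x) ≈ₕ
      actMap (P.obj j) f (Ps.cell (evalAt P D) η x) :=
  HetTrans.Hom.nat (Modif.toHet (P.map₂ η)) f x

/-- The action of a 1-cell on the pointwise pseudo-colimit. -/
def pwMap {D D' : C} (f : D ⟶ D') : PsObj (evalAt P D) ⥤ PsObj (evalAt P D') :=
  PsObj.desc (fun j => ((P.obj j).map f).toFunctor ⋙ pwIncl P D' j)
    (fun u x => pwTheta P f u x)
    (fun {i j} u {x y} r => by
      change (pwIncl P D' i).map (actMap (P.obj i) f r) ≫ (pwTheta P f u y).hom =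
        (pwTheta P f u x).hom ≫ (pwIncl P D' j).map (actMap (P.obj j) f (Ps.map (evalAt P D) u r))
      refine HomEq.eq (((HomEq.refl _).comp (pwTheta_hom P f u y)).trans (HomEq.trans (.of_eq
        ((PsObj.colimit (evalAt P D')).tr_naturality u (actMap (P.obj i) f r)))
        ((pwTheta_hom P f u x).symm.comp (HomEq.map _ ?_))))
      exact (TwoNatTrans.toHet (P.map u)).map_nat f r)
    (fun i x => by
      change (pwTheta P f (𝟙 i) x).hom ≫
        (pwIncl P D' i).map (actMap (P.obj i) f (Ps.unit (evalAt P D) i x).hom) = 𝟙 _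
      refine HomEq.eq (((pwTheta_hom P f _ x).comp (HomEq.map _ (actMap_unit P f i x).symm)).trans
        (.of_eq ?_))
      exact (PsObj.colimit (evalAt P D')).tr_id i _)
    (fun {i j k} u v x => by
      change (pwTheta P f (u ≫ v) x).hom ≫
        (pwIncl P D' k).map (actMap (P.obj k) f (Ps.comp (evalAt P D) u v x).hom) =
          (pwTheta P f u x).hom ≫ (pwTheta P f v (Ps.obj (evalAt P D) u x)).hom
      refine HomEq.eq (((pwTheta_hom P f _ x).comp
        (HomEq.map _ (actMap_comp' P f u v x).symm)).trans (HomEq.trans (.of_eq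
          ((PsObj.colimit (evalAt P D')).tr_comp u v _)) ((pwTheta_hom P f u x).symm.comp
            (((PsObj.colimit (evalAt P D')).tr_congr v
              (TwoNatTrans.app_obj_nat (P.map u) f x)).trans
                (pwTheta_hom P f v (Ps.obj (evalAt P D) u x)).symm)))))
    (fun {i j u v} η x => by
      change (pwTheta P f u x).hom ≫
        (pwIncl P D' j).map (actMap (P.obj j) f (Ps.cell (evalAt P D) η x)) =
          (pwTheta P f v x).hom
      exact HomEq.eq (((pwTheta_hom P f u x).comp (HomEq.map _ (actMap_cell P f η x).symm)).trans
        (HomEq.trans (.of_eq ((PsObj.colimit (evalAt P D')).tr_cell η _))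
          (pwTheta_hom P f v x).symm)))

theorem pwMap_tr {D D' : C} (f : D ⟶ D') {i j : J} (u : i ⟶ j) (x : (P.obj i).obj D) :
    (pwMap P f).map (pwTr P D u x).hom ≈ₕ (pwTr P D' u (act (P.obj i) f x)).hom :=
  pwTheta_hom P f u x

/-- The action of a 2-cell on the pointwise pseudo-colimit. -/
def pwMap₂ {D D' : C} {f g : D ⟶ D'} (η : f ⟶ g) : pwMap P f ⟶ pwMap P g where
  app a := (pwIncl P D' a.ix).map (act₂ (P.obj a.ix) η a.val)
  naturality a b p := by
    refine (PsObj.colimit (evalAt P D)).natural_of (Ψ := pwMap P f) (Ψ' := pwMap P g)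
      (fun a => (pwIncl P D' a.ix).map (act₂ (P.obj a.ix) η a.val)) ?_ ?_ p
    · intro i x y r
      exact ((pwIncl P D' i).map_comp _ _).symm.trans ((congrArg (pwIncl P D' i).map
        (act₂_naturality (P.obj i) η r)).trans ((pwIncl P D' i).map_comp _ _))
    · intro i j u x
      refine HomEq.eq (((pwMap_tr P f u x).comp (HomEq.map (pwIncl P D' j)
        ((TwoNatTrans.toHet (P.map u)).nat₂ η x).symm)).trans (HomEq.trans (.of_eq ?_)
          ((HomEq.refl _).comp (pwMap_tr P g u x).symm)))
      exact ((PsObj.colimit (evalAt P D')).tr_naturality u _).symm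

variable [Strict C]

/-- The pointwise pseudo-colimit of a diagram of category-valued 2-functors. -/
def pwColim : StrictPseudofunctor C Cat.{w, w} :=
  StrictPseudofunctor.mk''
    { obj := fun D => Cat.of (PsObj (evalAt P D))
      map := fun f => (pwMap P f).toCatHom
      map₂ := fun η => (pwMap₂ P η).toCatHom₂
      map₂_id := fun {D D'} f => HomEq.cat_ext fun a => by
        refine (congrArg (pwIncl P D' a.ix).map (act₂_id (P.obj a.ix) f a.val)).trans ?_
        exact (pwIncl P D' a.ix).map_id _
      map₂_comp := fun {D D' _ _ _} η θ => HomEq.cat_ext fun a => by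
        refine (congrArg (pwIncl P D' a.ix).map (act₂_comp (P.obj a.ix) η θ a.val)).trans ?_
        exact (pwIncl P D' a.ix).map_comp _ _
      map_id := fun D => congrArg Functor.toCatHom
        ((PsObj.colimit (evalAt P D)).functor_ext
          (fun j => HomEq.functor_ext
            (fun x => congrArg (pwIncl P D j).obj (act_id (P.obj j) x))
            (fun r => HomEq.map (pwIncl P D j) (actMap_id (P.obj j) r)))
          fun {i j} u x => (pwMap_tr P (𝟙 D) u x).trans
            (PsColimit.tr_congr _ u (act_id (P.obj i) x)))
      map_comp := fun {D D' D''} f g => congrArg Functor.toCatHom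
        ((PsObj.colimit (evalAt P D)).functor_ext
          (fun j => HomEq.functor_ext
            (fun x => congrArg (pwIncl P D'' j).obj (act_comp (P.obj j) f g x))
            (fun r => HomEq.map (pwIncl P D'' j) (actMap_comp (P.obj j) f g r)))
          fun {i j} u x => (pwMap_tr P (f ≫ g) u x).trans (HomEq.trans
            (PsColimit.tr_congr _ u (act_comp (P.obj i) f g x))
              ((HomEq.map (pwMap P g) (pwMap_tr P f u x)).trans
              (pwMap_tr P g u _)).symm))
      map₂_whisker_left := fun {D D' D''} f g h η => HomEq.cat_ext fun a => by
        refine Eq.trans ?_ (PseudoColimit.app_conj _ _ _ a).symm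
        exact (HomEq.map (pwIncl P D'' a.ix) (act₂_whiskerLeft (P.obj a.ix) f η a.val)).conj_eq _ _
      map₂_whisker_right := fun {D D' D'' _ _} η f => HomEq.cat_ext fun a => by
        refine Eq.trans ?_ (PseudoColimit.app_conj _ _ _ a).symm
        exact (HomEq.map (pwIncl P D'' a.ix)
          (act₂_whiskerRight (P.obj a.ix) η f a.val)).conj_eq _ _ }

/-- The pointwise pseudo-colimit cocone. -/
def pwCocone : PsCocone P (pwColim P) where
  at' D := PsObj.colimit (evalAt P D)
  obj_nat j _ _ f x := rfl
  map_nat j _ _ f _ _ r := .refl _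
  nat₂ j _ _ _ _ η x := .refl _
  tr_nat u _ _ f x := (pwMap_tr P f u x).symm

end Pointwise

end TwoCat

/-! ### Invertible transformations and the Yoneda lemma -/

namespace TwoCat

universe a₁ a₂ a₃ b₁ b₂ b₃

section IsoCat

variable {X : Type u₁} [Category.{v₁} X] {Y : Type u₂} [Category.{v₂} Y] {Z : Type u₃}
  [Category.{v₃} Z]

theorem IsIsoCat.comp {F : X ⥤ Y} {G : Y ⥤ Z} (hF : IsIsoCat F) (hG : IsIsoCat G) :
    IsIsoCat (F ⋙ G) := by
  obtain ⟨F', h₁, h₂⟩ := hF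
  obtain ⟨G', h₃, h₄⟩ := hG
  refine ⟨G' ⋙ F', ?_, ?_⟩
  · exact (congrArg (fun t => F ⋙ t ⋙ F') h₃).trans h₁
  · exact (congrArg (fun t => G' ⋙ t ⋙ G) h₂).trans h₄

theorem IsIsoCat.of_comp_right {F : X ⥤ Y} {G : Y ⥤ Z} (hG : IsIsoCat G)
    (h : IsIsoCat (F ⋙ G)) : IsIsoCat F := by
  obtain ⟨G', h₃, h₄⟩ := hG
  have : F = (F ⋙ G) ⋙ G' := (congrArg (fun t => F ⋙ t) h₃).symm
  rw [this]
  exact h.comp ⟨G, h₄, h₃⟩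

theorem IsIsoCat.bijective {F : X ⥤ Y} (h : IsIsoCat F) : Function.Bijective F.obj :=
  ((isIsoCat_iff _).1 h).1

theorem IsIsoCat.full {F : X ⥤ Y} (h : IsIsoCat F) : F.Full := ((isIsoCat_iff _).1 h).2.1

theorem IsIsoCat.faithful {F : X ⥤ Y} (h : IsIsoCat F) : F.Faithful := ((isIsoCat_iff _).1 h).2.2

end IsoCat

namespace HetTrans

variable {C : Type u} [Bicategory.{w₃, v₃} C] {P : StrictPseudofunctor C Cat.{a₁, b₁}}
  {Q : StrictPseudofunctor C Cat.{a₂, b₂}} {R : StrictPseudofunctor C Cat.{a₃, b₃}}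

theorem hom_homEq {φ ψ φ' ψ' : HetTrans P Q} {m : φ ⟶ ψ} {n : φ' ⟶ ψ'} (h : φ = φ') (h' : ψ = ψ')
    (e : ∀ D x, (Hom.app m D).app x ≈ₕ (Hom.app n D).app x) : m ≈ₕ n := by
  subst h h'
  exact .of_eq (hom_ext fun D x => (e D x).eq)

/-- A transformation is invertible if its components are isomorphisms of categories. -/
def Invertible (φ : HetTrans P Q) : Prop := ∀ D, IsIsoCat (φ.app D)

theorem Invertible.exists_inverse {φ : HetTrans P Q} (h : φ.Invertible) :
    ∃ φ' : HetTrans Q P, (∀ D, φ.app D ⋙ φ'.app D = 𝟭 _) ∧ ∀ D, φ'.app D ⋙ φ.app D = 𝟭 _ := by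
  choose inv h₁ h₂ using h
  have e₁ : ∀ D x, (inv D).obj ((φ.app D).obj x) = x := fun D x =>
    congrArg (fun t => Functor.obj t x) (h₁ D)
  have e₂ : ∀ D x, (φ.app D).obj ((inv D).obj x) = x := fun D x =>
    congrArg (fun t => Functor.obj t x) (h₂ D)
  have m₁ : ∀ D {x y} (r : x ⟶ y), (inv D).map ((φ.app D).map r) ≈ₕ r := fun D x y r =>
    HomEq.map_congr (h₁ D) (.refl r)
  have m₂ : ∀ D {x y} (r : x ⟶ y), (φ.app D).map ((inv D).map r) ≈ₕ r := fun D x y r =>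
    HomEq.map_congr (h₂ D) (.refl r)
  refine ⟨{ app := inv, obj_nat := ?_, map_nat := ?_, nat₂ := ?_ }, h₁, h₂⟩
  · intro D D' f x
    rw [← e₁ D' (act P f ((inv D).obj x)), φ.obj_nat, e₂]
  · intro D D' f x y r
    exact ((m₁ D' _).symm.trans (HomEq.map (inv D') ((φ.map_nat f _).trans
      (actMap_congr Q rfl (m₂ D r))))).symm
  · intro D D' f g η x
    exact ((m₁ D' _).symm.trans (HomEq.map (inv D') ((φ.nat₂ η _).trans
      (act₂_congr Q (.refl η) (e₂ D x))))).symm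

/-- Restriction along a transformation, as a functor. -/
def precomp (α : HetTrans P Q) (R : StrictPseudofunctor C Cat.{a₃, b₃}) :
    HetTrans Q R ⥤ HetTrans P R where
  obj φ := α.comp φ
  map m := α.compHom m

theorem Invertible.precomp {α : HetTrans P Q} (h : α.Invertible) : IsIsoCat (α.precomp R) := by
  obtain ⟨β, h₁, h₂⟩ := h.exists_inverse
  have o₁ : ∀ φ : HetTrans Q R, β.comp (α.comp φ) = φ := fun φ =>
    HetTrans.ext fun D => congrArg (fun t => t ⋙ φ.app D) (h₂ D)
  have o₂ : ∀ φ : HetTrans P R, α.comp (β.comp φ) = φ := fun φ =>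
    HetTrans.ext fun D => congrArg (fun t => t ⋙ φ.app D) (h₁ D)
  refine ⟨β.precomp R, HomEq.functor_ext o₁ fun {φ ψ} m => ?_,
    HomEq.functor_ext o₂ fun {φ ψ} m => ?_⟩
  · exact hom_homEq (o₁ _) (o₁ _) fun D x =>
      HomEq.app (Hom.app m D) (congrArg (fun t => Functor.obj t x) (h₂ D))
  · exact hom_homEq (o₂ _) (o₂ _) fun D x =>
      HomEq.app (Hom.app m D) (congrArg (fun t => Functor.obj t x) (h₁ D))

/-- Composition with a transformation, as a functor. -/
def postcomp (P : StrictPseudofunctor C Cat.{a₁, b₁}) (β : HetTrans Q R) :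
    HetTrans P Q ⥤ HetTrans P R where
  obj φ := φ.comp β
  map m := Hom.mk (fun D => (CategoryTheory.Functor.whiskerRight (Hom.app m D) (β.app D)))
    fun f x => (HomEq.map (β.app _) (Hom.nat m f x)).trans (β.map_nat f _)
  map_id φ := hom_ext fun D x => (β.app D).map_id _
  map_comp m n := hom_ext fun D x => (β.app D).map_comp _ _

theorem Invertible.postcomp {β : HetTrans Q R} (h : β.Invertible) : IsIsoCat (postcomp P β) := by
  obtain ⟨β', h₁, h₂⟩ := h.exists_inverse
  have o₁ : ∀ φ : HetTrans P Q, (φ.comp β).comp β' = φ := fun φ =>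
    HetTrans.ext fun D => congrArg (fun t => φ.app D ⋙ t) (h₁ D)
  have o₂ : ∀ φ : HetTrans P R, (φ.comp β').comp β = φ := fun φ =>
    HetTrans.ext fun D => congrArg (fun t => φ.app D ⋙ t) (h₂ D)
  refine ⟨HetTrans.postcomp P β', HomEq.functor_ext o₁ fun {φ ψ} m => ?_,
    HomEq.functor_ext o₂ fun {φ ψ} m => ?_⟩
  · exact hom_homEq (o₁ _) (o₁ _) fun D x => HomEq.map_congr (h₁ D) (.refl _)
  · exact hom_homEq (o₂ _) (o₂ _) fun D x => HomEq.map_congr (h₂ D) (.refl _)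

end HetTrans

section Yoneda

variable {E : Type u₁} [Bicategory.{w₁, v₁} E] [Strict E]

theorem corep_ext {A : E} {R : StrictPseudofunctor E Cat.{a₂, b₂}} {φ ψ : HetTrans (corep A) R}
    (h : (φ.app A).obj (𝟙 A) = (ψ.app A).obj (𝟙 A)) : φ = ψ := by
  have o : ∀ (φ : HetTrans (corep A) R) {D : E} (f : A ⟶ D),
      (φ.app D).obj f = act R f ((φ.app A).obj (𝟙 A)) := fun φ D f =>
    (congrArg (φ.app D).obj (Strict.id_comp f).symm).trans (φ.obj_nat f (𝟙 A))
  have m : ∀ (φ : HetTrans (corep A) R) {D : E} {f g : A ⟶ D} (r : f ⟶ g),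
      (φ.app D).map r ≈ₕ act₂ R r ((φ.app A).obj (𝟙 A)) := fun φ D f g r =>
    (HomEq.map (φ.app D) (HomEq.id_whiskerLeft r).symm).trans (φ.nat₂ r (𝟙 A))
  refine HetTrans.ext fun D => HomEq.functor_ext (fun f => ?_) fun r => ?_
  · rw [o φ f, o ψ f, h]
  · exact (m φ r).trans ((act₂_congr R (.refl r) h).trans (m ψ r).symm)

/-- Evaluation of a transformation out of `E(A, -)` at the identity of `A`. -/
def yonedaEval (A : E) (R : StrictPseudofunctor E Cat.{a₂, b₂}) :
    HetTrans (corep A) R ⥤ R.obj A where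
  obj φ := (φ.app A).obj (𝟙 A)
  map m := (HetTrans.Hom.app m A).app (𝟙 A)

/-- The transformation out of `E(A, -)` with a given value at the identity. -/
def corepDesc (A : E) (R : StrictPseudofunctor E Cat.{a₂, b₂}) (x : R.obj A) :
    HetTrans (corep A) R where
  app D :=
    { obj := fun f => act R f x
      map := fun r => act₂ R r x
      map_id := fun f => act₂_id R f x
      map_comp := fun r s => act₂_comp R r s x }
  obj_nat f g := act_comp R _ _ _
  map_nat f _ _ r := act₂_whiskerRight R r f x
  nat₂ η f := act₂_whiskerLeft R _ η x

/-- The Yoneda lemma, as an isomorphism of categories. -/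
theorem yonedaEval_isIsoCat (A : E) (R : StrictPseudofunctor E Cat.{a₂, b₂}) :
    IsIsoCat (yonedaEval A R) := by
  refine (isIsoCat_iff _).2 ⟨⟨fun φ ψ h => corep_ext h, fun x => ⟨corepDesc A R x, act_id R x⟩⟩,
    ⟨?_⟩, ⟨?_⟩⟩
  · intro φ ψ t
    have o : ∀ (φ : HetTrans (corep A) R) {D : E} (f : A ⟶ D),
        act R f ((φ.app A).obj (𝟙 A)) = (φ.app D).obj f := fun φ D f =>
      (φ.obj_nat f (𝟙 A)).symm.trans (congrArg (φ.app D).obj (Strict.id_comp f))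
    have m : ∀ (φ : HetTrans (corep A) R) {D : E} {f g : A ⟶ D} (r : f ⟶ g),
        (φ.app D).map r ≈ₕ act₂ R r ((φ.app A).obj (𝟙 A)) := fun φ D f g r =>
      (HomEq.map (φ.app D) (HomEq.id_whiskerLeft r).symm).trans (φ.nat₂ r (𝟙 A))
    let c : ∀ {D : E} (f : A ⟶ D), (φ.app D).obj f ⟶ (ψ.app D).obj f := fun {D} f =>
      eqToHom (o φ f).symm ≫ actMap R f t ≫ eqToHom (o ψ f)
    have hc : ∀ {D : E} (f : A ⟶ D), c f ≈ₕ actMap R f t := fun {D} f =>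
      HomEq.conj (o φ f).symm _ (o ψ f)
    refine ⟨HetTrans.Hom.mk (fun D => ⟨fun f => c f, fun f g r => ?_⟩) fun {D D'} f g => ?_, ?_⟩
    · exact HomEq.eq (((m φ r).comp (hc g)).trans ((HomEq.of_eq (act₂_naturality R r t).symm).trans
        ((hc f).comp (m ψ r)).symm))
    · exact (hc _).trans ((actMap_comp R g f t).trans (actMap_congr R rfl (hc g).symm))
    · exact HomEq.eq ((hc (𝟙 A)).trans (actMap_id R t))
  · intro φ ψ m n h
    have k : ∀ (m : φ ⟶ ψ) {D : E} (f : A ⟶ D), (HetTrans.Hom.app m D).app f ≈ₕ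
        actMap R f ((yonedaEval A R).map m) := fun m D f =>
      (HomEq.app (HetTrans.Hom.app m D) (Strict.id_comp f).symm).trans (HetTrans.Hom.nat m f (𝟙 A))
    exact HetTrans.hom_ext fun D f => HomEq.eq ((k m f).trans
      ((actMap_congr R rfl (.of_eq h)).trans (k n f).symm))

variable {C : Type u} [Bicategory.{w₃, v₃} C] [Strict C]

/-- The action of a 2-functor `F` on the 1-cells out of `A`, as a cone over `F`. -/
def yo (F : StrictPseudofunctor C E) (A : C) : WCone (corep A) F (F.obj A) where
  app D :=
    { obj := fun f => F.map f
      map := fun r => F.map₂ r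
      map_id := fun f => F.map₂_id f
      map_comp := fun r s => F.map₂_comp r s }
  obj_nat f g := F.map_comp g f
  map_nat f _ _ r := HomEq.map₂_whiskerRight F r f
  nat₂ η f := HomEq.map₂_whiskerLeft F f η

theorem yo_universal (F : StrictPseudofunctor C E) (A : C) : (yo F A).Universal := by
  intro K
  refine IsIsoCat.of_comp_right (yonedaEval_isIsoCat A (F.comp (corep K))) ?_
  have : (yo F A).pre K ⋙ yonedaEval A (F.comp (corep K)) = 𝟭 _ := by
    refine HomEq.functor_ext (fun k => ?_) fun {k l} μ => ?_
    · exact (congrArg (fun t => k ≫ t) (F.map_id A)).trans (Strict.comp_id k)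
    · exact (HomEq.whiskerRight (.refl μ) (F.map_id A)).trans (HomEq.whiskerRight_id μ)
  rw [this]
  exact ⟨𝟭 _, rfl, rfl⟩

end Yoneda

end TwoCat

/-! ### Cones weighted by the 2-functor of a 2-pro-object -/

namespace TwoCat

universe a₁ b₁

section

open Opposite

variable {C : Type u} [Bicategory.{w, w} C] [Strict C]

/-- Precomposition with a 1-cell, as a transformation of corepresentable 2-functors. -/
def corepMap {A B : C} (f : A ⟶ B) : corep B ⟶ corep A :=
  HetTrans.toTwo
    { app := fun D => Bicategory.precomp D f
      obj_nat := fun g h => (Strict.assoc f h g).symm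
      map_nat := fun g _ _ r => (HomEq.whisker_assoc f r g).symm
      nat₂ := fun η h => (HomEq.comp_whiskerLeft f h η).symm }

/-- The modification of corepresentable 2-functors given by a 2-cell. -/
def corepMap₂ {A B : C} {f g : A ⟶ B} (η : f ⟶ g) : corepMap f ⟶ corepMap g :=
  HetTrans.Hom.toTwo (HetTrans.Hom.mk (fun D => (precomposing A B D).map η) fun k h =>
    HomEq.whiskerRight_comp η h k)

variable {I : Type w} [Bicategory.{w, w} I] [Strict I]

/-- The diagram of corepresentable 2-functors `i ↦ C(X i, -)`. -/
def yonedaDiagram (X : StrictPseudofunctor Iᵒᵖ C) :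
    StrictPseudofunctor I (StrictPseudofunctor C Cat.{w, w}) :=
  StrictPseudofunctor.mk''
    { obj := fun i => corep (X.obj (op i))
      map := fun u => corepMap (X.map u.op)
      map₂ := fun η => corepMap₂ (X.map₂ (Bicategory.Opposite.op2 η))
      map₂_id := fun u => Modif.hom_ext fun D => HomEq.cat_ext fun h =>
        (congrArg (fun ζ => ζ ▷ h) (X.map₂_id u.op)).trans (id_whiskerRight _ _)
      map₂_comp := fun η θ => Modif.hom_ext fun D => HomEq.cat_ext fun h =>
        (congrArg (fun ζ => ζ ▷ h) (X.map₂_comp _ _)).trans (comp_whiskerRight _ _ _)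
      map_id := fun i => TwoNatTrans.hom_ext fun D =>
        (congrArg (fun f => (Bicategory.precomp D f).toCatHom) (X.map_id (op i))).trans
          (precomp_id _ _)
      map_comp := fun u v => TwoNatTrans.hom_ext fun D =>
        (congrArg (fun f => (Bicategory.precomp D f).toCatHom) (X.map_comp v.op u.op)).trans
          (precomp_comp _ _ _)
      map₂_whisker_left := fun u v v' η => Modif.hom_ext fun D => HomEq.cat_ext fun h => by
        refine Eq.trans ?_ (modif_app_app_conj _ _ _ D h).symm
        exact HomEq.conj_eq ((HomEq.whiskerRight (HomEq.map₂_whiskerRight X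
          (Bicategory.Opposite.op2 η) u.op) rfl).trans (HomEq.whiskerRight_comp _ _ _).symm) _ _
      map₂_whisker_right := fun η u => Modif.hom_ext fun D => HomEq.cat_ext fun h => by
        refine Eq.trans ?_ (modif_app_app_conj _ _ _ D h).symm
        exact HomEq.conj_eq ((HomEq.whiskerRight (HomEq.map₂_whiskerLeft X u.op
          (Bicategory.Opposite.op2 η)) rfl).trans (HomEq.whisker_assoc _ _ _)) _ _ }

theorem Modif.app_homEq_id {B : Type u₁} [Bicategory.{w₁, v₁} B] {D : Type u₂}
    [Bicategory.{w₂, v₂} D] [Strict D] {F G : StrictPseudofunctor B D} {α β γ : F ⟶ G}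
    {Γ : α ⟶ β} (h : Γ ≈ₕ 𝟙 γ) (a : B) : Modif.app Γ a ≈ₕ 𝟙 (TwoNatTrans.app γ a) := by
  cases h; exact .refl _

theorem toNatTrans_homEq_id {X Y : Cat.{a₁, b₁}} {f g h : X ⟶ Y} {η : f ⟶ g} (e : η ≈ₕ 𝟙 h)
    (x : X) : η.toNatTrans.app x ≈ₕ 𝟙 (h.toFunctor.obj x) := by
  cases e; exact .refl _

theorem unit_yoneda (X : StrictPseudofunctor Iᵒᵖ C) (D : C) (i : I) (x : X.obj (op i) ⟶ D) :
    (Ps.unit (evalAt (yonedaDiagram X).toPseudofunctor D) i x).hom ≈ₕ 𝟙 x :=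
  (HomEq.of_eq (unit_evalAt (yonedaDiagram X).toPseudofunctor D i x)).trans
    (toNatTrans_homEq_id (Modif.app_homEq_id (HomEq.mapId_hom (yonedaDiagram X) i) D) x)

theorem comp_yoneda (X : StrictPseudofunctor Iᵒᵖ C) (D : C) {i j k : I} (u : i ⟶ j) (v : j ⟶ k)
    (x : X.obj (op i) ⟶ D) :
    (Ps.comp (evalAt (yonedaDiagram X).toPseudofunctor D) u v x).hom ≈ₕ
      𝟙 (X.map v.op ≫ X.map u.op ≫ x) :=
  (HomEq.of_eq (comp_evalAt (yonedaDiagram X).toPseudofunctor D u v x)).trans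
    (toNatTrans_homEq_id (Modif.app_homEq_id (HomEq.mapComp_hom (yonedaDiagram X) u v) D) x)

/-- The 2-functor of a 2-pro-object is the pseudo-colimit of corepresentable 2-functors. -/
def proPsColimit (X : StrictPseudofunctor Iᵒᵖ C) (D : C) :
    PsColimit (evalAt (yonedaDiagram X).toPseudofunctor D)
      (PseudoColimit.Obj ((homDiagram X).obj D)) where
  incl j := PseudoColimit.incl ((homDiagram X).obj D) j
  tr u x := (PseudoColimit.tr ((homDiagram X).obj D) u).app x
  tr_naturality u _ _ r := (PseudoColimit.tr ((homDiagram X).obj D) u).hom.naturality r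
  tr_id i x := by
    refine Eq.trans ?_ (PseudoColimit.tr_id ((homDiagram X).obj D) i x)
    refine congrArg (fun t => (PseudoColimit.tr ((homDiagram X).obj D) (𝟙 i)).hom.app x ≫
      (PseudoColimit.incl ((homDiagram X).obj D) i).map t) (HomEq.eq ?_)
    exact (unit_yoneda X D i x).trans (toNatTrans_homEq_id
      (HomEq.mapId_hom ((homDiagram X).obj D) i) x).symm
  tr_comp {i j k} u v x := by
    refine Eq.trans ?_ (PseudoColimit.tr_comp ((homDiagram X).obj D) u v x)
    refine congrArg (fun t => (PseudoColimit.tr ((homDiagram X).obj D) (u ≫ v)).hom.app x ≫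
      (PseudoColimit.incl ((homDiagram X).obj D) k).map t) (HomEq.eq ?_)
    exact (comp_yoneda X D u v x).trans (toNatTrans_homEq_id
      (HomEq.mapComp_hom ((homDiagram X).obj D) u v) x).symm
  tr_cell η x := PseudoColimit.tr_map₂ ((homDiagram X).obj D) η x
  bijective := ⟨fun p q h => by
    obtain ⟨i, x⟩ := p
    obtain ⟨j, y⟩ := q
    have h' : (⟨i, x⟩ : PseudoColimit.Obj ((homDiagram X).obj D)) = ⟨j, y⟩ := h
    cases h'
    rfl, fun a => ⟨⟨a.ix, a.val⟩, rfl⟩⟩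
  induction {Pr} hcomp hid hincl htr htrInv a b p :=
    PseudoColimit.hom_induction (P := Pr) hcomp hid hincl htr htrInv p

theorem proPsColimit_hasDesc (X : StrictPseudofunctor Iᵒᵖ C) (D : C) :
    PsColimit.HasDesc.{w, a₁, b₁} (proPsColimit X D) := by
  intro 𝓔 _ Ds θ hnat hid hcomp hcell
  refine ⟨PseudoColimit.desc Ds (fun {i j} u => NatIso.ofComponents (fun x => θ u x)
    (fun r => hnat u r)) (fun i x => ?_) (fun {i j k} u v x => ?_) (fun η x => hcell η x),
    fun j => rfl, fun u x => .refl _⟩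
  · refine Eq.trans ?_ (hid i x)
    refine congrArg (fun t => (θ (𝟙 i) x).hom ≫ (Ds i).map t) (HomEq.eq ?_)
    exact (toNatTrans_homEq_id (HomEq.mapId_hom ((homDiagram X).obj D) i) x).trans
      (unit_yoneda X D i x).symm
  · refine Eq.trans ?_ (hcomp u v x)
    refine congrArg (fun t => (θ (u ≫ v) x).hom ≫ (Ds k).map t) (HomEq.eq ?_)
    exact (toNatTrans_homEq_id (HomEq.mapComp_hom ((homDiagram X).obj D) u v) x).trans
      (comp_yoneda X D u v x).symm

/-- The pseudo-colimit cocone of corepresentable 2-functors under the 2-functor of a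
2-pro-object. -/
def proCocone (X : StrictPseudofunctor Iᵒᵖ C) :
    PsCocone (yonedaDiagram X).toPseudofunctor ((homDiagram X).comp (pseudoColim I)) where
  at' D := proPsColimit X D
  obj_nat j _ _ f x := rfl
  map_nat j _ _ f _ _ r := .refl _
  nat₂ j _ _ _ _ η x := .refl _
  tr_nat u _ _ f x := by
    refine (HomEq.comp_id (.refl _) ?_).symm.trans
      (HomEq.of_eq (PseudoColimit.map_tr ((homDiagram X).map f) u x).symm)
    exact (HomEq.of_eq (eqToHom_map _ _)).trans (HomEq.eqToHom_id _ rfl)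

variable {E : Type u₁} [Bicategory.{w₁, v₁} E] [Strict E]

/-- The diagram `F X` is represented termwise by the diagram of corepresentable 2-functors. -/
def proSystem (X : StrictPseudofunctor Iᵒᵖ C) (F : StrictPseudofunctor C E) :
    ConeSystem (yonedaDiagram X).toPseudofunctor F (X.comp F).toPseudofunctor where
  lam j := yo F (X.obj (op j))
  leg_map u _ x := F.map_comp _ _
  leg₂_map u _ _ _ r := HomEq.map₂_whiskerLeft F _ r
  leg₂_cell η _ x := HomEq.map₂_whiskerRight F _ x
  leg₂_unit i _ x := (HomEq.map₂ F (unit_yoneda X _ i x)).trans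
    (((HomEq.of_eq (F.map₂_id x)).trans (HomEq.id (Strict.id_comp _).symm)).trans
      ((HomEq.of_eq (id_whiskerRight _ _).symm).trans (HomEq.whiskerRight
        (HomEq.mapId_hom (X.comp F) (op i)).symm rfl)))
  leg₂_comp u v _ x := (HomEq.map₂ F (comp_yoneda X _ u v x)).trans
    (((HomEq.of_eq (F.map₂_id _)).trans (HomEq.id (by
      refine (F.map_comp _ _).trans ((congrArg (fun t => _ ≫ t) (F.map_comp _ _)).trans ?_)
      exact (Strict.assoc _ _ _).symm))).trans
      ((HomEq.of_eq (id_whiskerRight _ _).symm).trans (HomEq.whiskerRight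
        (HomEq.mapComp_hom (X.comp F) v.op u.op).symm rfl)))

theorem proSystem_universal (X : StrictPseudofunctor Iᵒᵖ C) (F : StrictPseudofunctor C E) (j : I) :
    ((proSystem X F).lam j).Universal :=
  yo_universal F (X.obj (op j))

/-- If `E` has small 2-cofiltered pseudo-limits, there is a universal cone over `F` whose weight is
the 2-functor of a 2-pro-object. -/
theorem exists_universal (hE : HasTwoCofilteredPseudoLimits.{w} E) (X : ProObj.{w} C)
    (F : StrictPseudofunctor C E) : ∃ (V : E) (φ : WCone X.L F V), φ.Universal := by
  obtain ⟨V, π, hπ⟩ := hE X.I X.isTwoFiltered (X.X.comp F).toPseudofunctor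
  obtain ⟨ψ, hψ⟩ := (proSystem X.X F).exists_wcone (proCocone X.X)
    (fun D => proPsColimit_hasDesc X.X D) π
  exact ⟨V, ψ, (hψ.universal_iff (proSystem_universal X.X F)
    (fun D => proPsColimit_hasDesc X.X D)).2 hπ⟩

/-- A 2-functor that preserves small 2-cofiltered pseudo-limits preserves universal cones whose
weight is the 2-functor of a 2-pro-object. -/
theorem PreservesTwoCofilteredPseudoLimits.push_universal {E' : Type u₂} [Bicategory.{w₂, v₂} E']
    [Strict E'] {H : StrictPseudofunctor E E'} (hH : PreservesTwoCofilteredPseudoLimits.{w} H)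
    (X : ProObj.{w} C) {F : StrictPseudofunctor C E} {V : E} {φ : WCone X.L F V}
    (hφ : φ.Universal) : (φ.push H).Universal := by
  obtain ⟨π, hπ⟩ := (proSystem X.X F).exists_cone (proCocone X.X) (proSystem_universal X.X F) φ
  have h₁ := (hπ.universal_iff (proSystem_universal X.X F)
    (fun D => proPsColimit_hasDesc X.X D)).1 hφ
  have h₂ := hH X.I X.isTwoFiltered _ _ _ h₁
  exact ((hπ.push H).universal_iff (fun j => yo_universal (F.comp H) (X.X.obj (op j)))
    (fun D => proPsColimit_hasDesc X.X D)).2 h₂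

end

end TwoCat

/-! ### The canonical cone of a 2-pro-object -/

namespace TwoCat

universe a₁ b₁

section

open Opposite

variable {C : Type u} [Bicategory.{w, w} C] [Strict C]

/-- The object of the one-point 2-category. -/
abbrev star : Pt.{w} := ⟨⟨PUnit.unit⟩⟩

/-- The inclusion of `C(A, -)` into the 2-functor of the constant 2-pro-object at `A`. -/
def constIncl (A : C) : HetTrans (corep A) (ProObj.const.{w} A).L :=
  (proCocone (ProObj.const.{w} A).X).incl star

theorem pt_hom {i j : Pt.{w}} (u : i ⟶ j) : u = 𝟙 star :=
  Discrete.ext (Subsingleton.elim _ _)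

/-- The 2-functor of the constant 2-pro-object at `A` is isomorphic to `C(A, -)`: over the one-point
2-category the transition isomorphisms of the pseudo-colimit are identities. -/
theorem constIncl_invertible (A : C) : (constIncl.{w} A).Invertible := by
  intro D
  let X := (ProObj.const.{w} A).X
  let c := proPsColimit X D
  have htr : ∀ (x : A ⟶ D), (c.tr (𝟙 star) x).hom ≈ₕ 𝟙 ((c.incl star).obj x) := fun x =>
    (HomEq.comp_id (.refl _) ((HomEq.map (c.incl star) (unit_yoneda X D star x)).trans
      ((HomEq.of_eq ((c.incl star).map_id x)).trans
        (HomEq.id (congrArg (c.incl star).obj (Strict.id_comp x).symm))))).symm.trans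
      (.of_eq (c.tr_id star x))
  refine (isIsoCat_iff _).2 ⟨⟨fun x y h => ?_, fun a => ?_⟩, ⟨fun {x y} p => ?_⟩,
    ⟨fun {x y} r s h => ?_⟩⟩
  · exact eq_of_heq (Sigma.mk.inj (c.rep_inj (i := star) (j := star) h)).2
  · obtain ⟨j, x, h⟩ := c.exists_rep a
    exact ⟨x, h⟩
  · have key : ∀ {a b : PseudoColimit.Obj ((homDiagram X).obj D)} (p : a ⟶ b),
        ∃ (x y : A ⟶ D) (r : x ⟶ y), (c.incl star).map r ≈ₕ p := by
      refine c.induction (Pr := fun {a b} p => ∃ (x y : A ⟶ D) (r : x ⟶ y),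
        (c.incl star).map r ≈ₕ p) ?_ ?_ ?_ ?_ ?_
      · rintro a b d p q ⟨x, y, r, h⟩ ⟨x', y', r', h'⟩
        have e : y = x' := eq_of_heq (Sigma.mk.inj (c.rep_inj (i := star) (j := star)
          (h.tgt.trans h'.src.symm))).2
        subst e
        exact ⟨x, y', r ≫ r', (HomEq.of_eq ((c.incl star).map_comp r r')).trans (h.comp h')⟩
      · intro a
        obtain ⟨j, x, rfl⟩ := c.exists_rep a
        exact ⟨x, x, 𝟙 x, .of_eq ((c.incl star).map_id x)⟩
      · intro i x y r
        exact ⟨x, y, r, .refl _⟩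
      · intro i j u x
        obtain rfl := pt_hom u
        exact ⟨x, x, 𝟙 x, (HomEq.of_eq ((c.incl star).map_id x)).trans (htr x).symm⟩
      · intro i j u x
        obtain rfl := pt_hom u
        exact ⟨x, x, 𝟙 x, (HomEq.of_eq ((c.incl star).map_id x)).trans
          (HomEq.inv (f := Iso.refl _) (htr x).symm)⟩
    obtain ⟨x', y', r, h⟩ := key p
    have e : x' = x := eq_of_heq (Sigma.mk.inj (c.rep_inj (i := star) (j := star) h.src)).2
    have e' : y' = y := eq_of_heq (Sigma.mk.inj (c.rep_inj (i := star) (j := star) h.tgt)).2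
    subst e e'
    exact ⟨r, h.eq⟩
  · obtain ⟨Ψ, hΨ, -⟩ := proPsColimit_hasDesc.{w} X D (A ⟶ D) (fun j => 𝟭 (A ⟶ D))
      (fun u x => eqToIso (Strict.id_comp x).symm)
      (fun u x y r => (HomEq.id_whiskerLeft r).symm.square (Strict.id_comp y).symm
        (Strict.id_comp x).symm)
      (fun i x => HomEq.eq ((HomEq.eqToHom_comp (Strict.id_comp x).symm _).trans
        (unit_yoneda X D i x)))
      (fun u v x => HomEq.eq ((HomEq.eqToHom_comp (Strict.id_comp x).symm _).trans
        ((comp_yoneda X D u v x).trans ((HomEq.eqToHom_comp (Strict.id_comp x).symm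
          (eqToHom (Strict.id_comp (𝟙 A ≫ x)).symm)).trans (HomEq.eqToHom_id _
            (Strict.id_comp (𝟙 A ≫ x)).symm)).symm)))
      (fun η x => HomEq.eq ((HomEq.comp_id (HomEq.refl _) ((HomEq.of_eq
        (id_whiskerRight _ _)).trans (HomEq.id rfl)))))
    have k : ∀ {x y : A ⟶ D} (r : x ⟶ y), Ψ.map ((c.incl star).map r) ≈ₕ r := fun {x y} r =>
      HomEq.map_congr (hΨ star) (.refl r)
    exact ((k r).symm.trans ((HomEq.of_eq (congrArg Ψ.map h)).trans (k s))).eq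

/-- The 1-cells between 2-pro-objects, as transformations. -/
def proHomFunctor (X Y : Pro.{w} C) : (X ⟶ Y) ⥤ HetTrans (ProObj.L Y) (ProObj.L X) where
  obj β := TwoNatTrans.toHet β.hom.unop
  map Γ := Modif.toHet Γ.hom.unop2

theorem proHomFunctor_isIsoCat (X Y : Pro.{w} C) : IsIsoCat (proHomFunctor X Y) :=
  ⟨{ obj := fun φ => InducedBicategory.mkHom φ.toTwo.op
     map := fun {φ ψ} m => InducedBicategory.mkHom₂ (Bicategory.Opposite.op2
       (HetTrans.Hom.toTwo (α := φ.toTwo) (β := ψ.toTwo) m)) }, rfl, rfl⟩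

/-- Evaluation of a 1-cell `X ⟶ c D` at the identity of `D`. -/
def proEval (X : Pro.{w} C) : HetTrans ((toPro C).comp (corep X)) (ProObj.L X) where
  app D := proHomFunctor X ((toPro C).obj D) ⋙ (constIncl D).precomp _ ⋙ yonedaEval D _
  obj_nat {D D'} f β :=
    (congrArg ((TwoNatTrans.toHet β.hom.unop).app D').obj (congrArg ((constIncl D).app D').obj
      ((Strict.comp_id f).trans (Strict.id_comp f).symm))).trans
        ((TwoNatTrans.toHet β.hom.unop).obj_nat f (((constIncl D).app D).obj (𝟙 D)))
  map_nat {D D'} f β β' Γ :=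
    (HomEq.app (HetTrans.Hom.app (Modif.toHet Γ.hom.unop2) D') (congrArg ((constIncl D).app D').obj
      ((Strict.comp_id f).trans (Strict.id_comp f).symm))).trans
        (HetTrans.Hom.nat (Modif.toHet Γ.hom.unop2) f (((constIncl D).app D).obj (𝟙 D)))
  nat₂ {D D' f g} η β :=
    (HomEq.map ((TwoNatTrans.toHet β.hom.unop).app D') (HomEq.map ((constIncl D).app D')
      ((HomEq.whiskerRight_id η).trans (HomEq.id_whiskerLeft η).symm))).trans
        ((TwoNatTrans.toHet β.hom.unop).nat₂ η (((constIncl D).app D).obj (𝟙 D)))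

theorem proEval_invertible (X : Pro.{w} C) : (proEval X).Invertible := fun D =>
  (proHomFunctor_isIsoCat _ _).comp ((constIncl_invertible D).precomp.comp
    (yonedaEval_isIsoCat _ _))

theorem exists_kappa (X : Pro.{w} C) : ∃ κ : WCone (ProObj.L X) (toPro C) X,
    (∀ D, (proEval X).app D ⋙ κ.app D = 𝟭 _) ∧ ∀ D, κ.app D ⋙ (proEval X).app D = 𝟭 _ :=
  (proEval_invertible X).exists_inverse

/-- The canonical cone over `C → 2-Pro(C)` with vertex `X`, whose weight is the 2-functor of `X`. -/
noncomputable def kappa (X : Pro.{w} C) : WCone (ProObj.L X) (toPro C) X := (exists_kappa X).choose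

theorem kappa_proEval (X : Pro.{w} C) (D : C) : (kappa X).app D ⋙ (proEval X).app D = 𝟭 _ :=
  (exists_kappa X).choose_spec.2 D

/-- Up to the isomorphism `2-Pro(C)(K, c D) ≅ L_K D`, composition with the canonical cone of `X` is
the tautological isomorphism `2-Pro(C)(K, X) = Hom(L_X, L_K)`. -/
theorem kappa_universal (X : Pro.{w} C) : (kappa X).Universal := by
  intro K
  refine IsIsoCat.of_comp_right (proEval_invertible K).postcomp ?_
  have : (kappa X).pre K ⋙ HetTrans.postcomp (ProObj.L X) (proEval K) = proHomFunctor K X := by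
    have o : ∀ α : K ⟶ X, ((kappa X).pre K ⋙ HetTrans.postcomp (ProObj.L X) (proEval K)).obj α =
        (proHomFunctor K X).obj α := fun α => by
      refine HetTrans.ext fun D => HomEq.functor_ext (fun x => ?_) fun {x y} r => ?_
      · exact congrArg ((TwoNatTrans.toHet α.hom.unop).app D).obj
          (congrArg (fun t => Functor.obj t x) (kappa_proEval X D))
      · exact HomEq.map ((TwoNatTrans.toHet α.hom.unop).app D)
          (HomEq.map_congr (kappa_proEval X D) (.refl r))
    refine HomEq.functor_ext o fun {α β} μ => HetTrans.hom_homEq (o α) (o β) fun D x => ?_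
    exact HomEq.app (HetTrans.Hom.app (Modif.toHet μ.hom.unop2) D)
      (congrArg (fun t => Functor.obj t x) (kappa_proEval X D))
  rw [this]
  exact proHomFunctor_isIsoCat K X

end

end TwoCat

/-! ### Flat category-valued 2-functors -/

namespace TwoCat

universe a₁ b₁

section

variable {C : Type u} [Bicategory.{w₃, v₃} C]

/-- The family of elements `x k` of `T` freely generates the objects of `T`, and `T` is flat: its
2-category of elements is 2-cofiltered, in a form where the new elements are generators. -/
structure FlatOn (T : StrictPseudofunctor C Cat.{a₁, b₁}) {K : Type u₁} (D : K → C)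
    (x : ∀ k, T.obj (D k)) : Prop where
  nonempty : Nonempty K
  bijective (A : C) : Function.Bijective fun p : Σ k, (D k ⟶ A) => act T p.2 (x p.1)
  cocone {A B : C} (y : T.obj A) (z : T.obj B) : ∃ (k : K) (f : D k ⟶ A) (g : D k ⟶ B),
    Nonempty (act T f (x k) ≅ y) ∧ Nonempty (act T g (x k) ≅ z)
  lift {A B : C} {f g : A ⟶ B} (y : T.obj A) (r : act T f y ⟶ act T g y) :
    ∃ (k : K) (h : D k ⟶ A) (θ : act T h (x k) ≅ y) (η : h ≫ f ⟶ h ≫ g),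
      act₂ T η (x k) ≈ₕ actMap T f θ.hom ≫ r ≫ actMap T g θ.inv
  eq {A B : C} {f g : A ⟶ B} {η η' : f ⟶ g} (y : T.obj A) (e : act₂ T η y = act₂ T η' y) :
    ∃ (k : K) (h : D k ⟶ A), Nonempty (act T h (x k) ≅ y) ∧ h ◁ η = h ◁ η'

/-- The 2-functor `C(A, -)` is flat on the identity of `A`. -/
theorem FlatOn.corep [Strict C] (A : C) :
    FlatOn (corep A) (fun _ : PUnit.{u₁ + 1} => A) (fun _ => 𝟙 A) where
  nonempty := ⟨⟨⟩⟩
  bijective B := ⟨fun p q h => by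
    obtain ⟨⟨⟩, f⟩ := p
    obtain ⟨⟨⟩, g⟩ := q
    obtain rfl : f = g := (Strict.id_comp f).symm.trans (Eq.trans h (Strict.id_comp g))
    rfl, fun f => ⟨⟨⟨⟩, f⟩, Strict.id_comp f⟩⟩
  cocone y z := ⟨⟨⟩, y, z, ⟨eqToIso (Strict.id_comp y)⟩, ⟨eqToIso (Strict.id_comp z)⟩⟩
  lift {B B' f g} y r := by
    refine ⟨⟨⟩, y, eqToIso (Strict.id_comp y), r, ?_⟩
    refine (HomEq.id_whiskerLeft r).trans
      (HomEq.symm (HomEq.id_comp ?_ (HomEq.comp_id (.refl r) ?_)))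
    · exact (HomEq.whiskerRight (HomEq.eqToIso_hom (Strict.id_comp y)) rfl).trans
        (.of_eq (id_whiskerRight y f))
    · exact (HomEq.whiskerRight (HomEq.eqToIso_inv (Strict.id_comp y)) rfl).trans
        ((HomEq.of_eq (id_whiskerRight y g)).trans (.refl _))
  eq {B B' f g η η'} y e := ⟨⟨⟩, y, ⟨eqToIso (Strict.id_comp y)⟩, e⟩

end

section

variable {C : Type u} [Bicategory.{w₃, v₃} C] {J : Type w} [Bicategory.{w, w} J]
  {P : J ⥤ᵖ StrictPseudofunctor C Cat.{w, w}} {T : StrictPseudofunctor C Cat.{w, w}}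

/-- An isomorphism in a term of the diagram, as an isomorphism in the pseudo-colimit. -/
def PsCocone.isoOf (c : PsCocone P T) {j l : J} (u : j ⟶ l) {A B : C} (h : B ⟶ A)
    {y : (P.obj j).obj A} {x : (P.obj l).obj B}
    (θ : act (P.obj l) h x ≅ Ps.obj (evalAt P A) u y) :
    act T h (((c.at' B).incl l).obj x) ≅ ((c.at' A).incl j).obj y :=
  eqToIso (c.obj_nat l h x).symm ≪≫ ((c.at' A).incl l).mapIso θ ≪≫ ((c.at' A).tr u y).symm

theorem PsCocone.isoOf_hom (c : PsCocone P T) {j l : J} (u : j ⟶ l) {A B B' : C} (h : B ⟶ A)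
    {y : (P.obj j).obj A} {x : (P.obj l).obj B}
    (θ : act (P.obj l) h x ≅ Ps.obj (evalAt P A) u y) (f : A ⟶ B')
    (e : act (P.obj l) f (Ps.obj (evalAt P A) u y) =
      Ps.obj (evalAt P B') u (act (P.obj j) f y)) :
    actMap T f (c.isoOf u h θ).hom ≈ₕ ((c.at' B').incl l).map (actMap (P.obj l) f θ.hom) ≫
      eqToHom (congrArg ((c.at' B').incl l).obj e) ≫ ((c.at' B').tr u (act (P.obj j) f y)).inv := by
  have h₁ : (c.isoOf u h θ).hom ≈ₕ ((c.at' A).incl l).map θ.hom ≫ ((c.at' A).tr u y).inv :=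
    HomEq.eqToHom_comp (c.obj_nat l h x).symm _
  refine (actMap_congr T rfl h₁).trans ((HomEq.of_eq ((T.map f).toFunctor.map_comp _ _)).trans
    (HomEq.comp (c.map_nat l f θ.hom).symm ?_))
  refine HomEq.trans ?_ (HomEq.eqToHom_comp _ _).symm
  exact HomEq.inv (f := (T.map f).toFunctor.mapIso ((c.at' A).tr u y)) (c.tr_nat u f y).symm

theorem PsCocone.isoOf_inv (c : PsCocone P T) {j l : J} (u : j ⟶ l) {A B B' : C} (h : B ⟶ A)
    {y : (P.obj j).obj A} {x : (P.obj l).obj B}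
    (θ : act (P.obj l) h x ≅ Ps.obj (evalAt P A) u y) (f : A ⟶ B')
    (e : Ps.obj (evalAt P B') u (act (P.obj j) f y) =
      act (P.obj l) f (Ps.obj (evalAt P A) u y)) :
    actMap T f (c.isoOf u h θ).inv ≈ₕ ((c.at' B').tr u (act (P.obj j) f y)).hom ≫
      eqToHom (congrArg ((c.at' B').incl l).obj e) ≫
        ((c.at' B').incl l).map (actMap (P.obj l) f θ.inv) := by
  have h₁ : (c.isoOf u h θ).inv ≈ₕ ((c.at' A).tr u y).hom ≫ ((c.at' A).incl l).map θ.inv :=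
    (HomEq.of_eq (Category.assoc _ _ _)).trans
      ((HomEq.refl _).comp (HomEq.comp_eqToHom _ (c.obj_nat l h x)))
  refine (actMap_congr T rfl h₁).trans ((HomEq.of_eq ((T.map f).toFunctor.map_comp _ _)).trans
    (HomEq.comp (c.tr_nat u f y).symm ?_))
  exact (c.map_nat l f θ.inv).symm.trans (HomEq.eqToHom_comp _ _).symm

theorem map_comp_conj_comp {X : Type u₁} [Category.{v₁} X] {Y : Type u₂} [Category.{v₂} Y]
    (F : X ⥤ Y) {x₁ x₂ x₃ x₄ x₅ x₆ : X} (f : x₁ ⟶ x₂) (h : x₂ = x₃) (g : x₃ ⟶ x₄) (h' : x₄ = x₅)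
    (k : x₅ ⟶ x₆) : F.map f ≫ eqToHom (congrArg F.obj h) ≫ F.map g ≫
      eqToHom (congrArg F.obj h') ≫ F.map k = F.map (f ≫ (eqToHom h ≫ g ≫ eqToHom h') ≫ k) := by
  subst h h'
  simp

/-- A pseudo-colimit of flat 2-functors, over a 2-filtered 2-category, is flat. -/
theorem FlatOn.psColimit (hJ : IsTwoFiltered J) (c : PsCocone P T)
    (hd : ∀ A, PsColimit.HasDesc.{w, w, w + 1} (c.at' A)) {K : J → Type u₁}
    {D : ∀ j, K j → C} {x : ∀ j k, (P.obj j).obj (D j k)}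
    (hP : ∀ j, FlatOn (P.obj j) (D j) (x j)) :
    FlatOn T (fun p : Σ j, K j => D p.1 p.2)
      (fun p => ((c.at' (D p.1 p.2)).incl p.1).obj (x p.1 p.2)) where
  nonempty := by
    obtain ⟨j⟩ := hJ.nonempty
    obtain ⟨k⟩ := (hP j).nonempty
    exact ⟨⟨j, k⟩⟩
  bijective A := by
    refine ⟨fun p q h => ?_, fun y => ?_⟩
    · obtain ⟨⟨i, k⟩, f⟩ := p
      obtain ⟨⟨j, l⟩, g⟩ := q
      have h' := (c.at' A).rep_inj ((c.obj_nat i f _).trans (Eq.trans h (c.obj_nat j g _).symm))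
      obtain rfl : i = j := congrArg Sigma.fst h'
      have h'' := ((hP i).bijective A).1 (a₁ := ⟨k, f⟩) (a₂ := ⟨l, g⟩)
        (eq_of_heq (Sigma.mk.inj h').2)
      cases h''
      rfl
    · obtain ⟨j, y, rfl⟩ := (c.at' A).exists_rep y
      obtain ⟨⟨k, f⟩, rfl⟩ := ((hP j).bijective A).2 y
      exact ⟨⟨⟨j, k⟩, f⟩, (c.obj_nat j f _).symm⟩
  cocone {A B} y z := by
    obtain ⟨i, y, rfl⟩ := (c.at' A).exists_rep y
    obtain ⟨j, z, rfl⟩ := (c.at' B).exists_rep z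
    obtain ⟨l, ⟨u⟩, ⟨v⟩⟩ := hJ.cocone i j
    obtain ⟨k, f, g, ⟨θ⟩, ⟨ξ⟩⟩ := (hP l).cocone (Ps.obj (evalAt P A) u y) (Ps.obj (evalAt P B) v z)
    exact ⟨⟨l, k⟩, f, g, ⟨c.isoOf u f θ⟩, ⟨c.isoOf v g ξ⟩⟩
  lift {A B f g} y r := by
    obtain ⟨j, y, rfl⟩ := (c.at' A).exists_rep y
    -- A representative of `r` may be chosen with the same 1-cell `U` at both ends, so that `P U y`
    -- is an element of `P l` to which the flatness of `P l` applies.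
    obtain ⟨⟨k, u, v, s⟩, hs⟩ := (c.at' B).exists_ofPre hJ r j (act (P.obj j) f y) j
      (act (P.obj j) g y) (c.obj_nat j f y) (c.obj_nat j g y)
    obtain ⟨l, t, ⟨e⟩⟩ := hJ.cocone_map u v
    have hs' := (HomEq.of_eq ((c.at' B).ofPre_ext ⟨k, u, v, s⟩ t (Iso.refl (u ≫ t)) e)).trans hs
    generalize Ps.ext (evalAt P B) s t (Iso.refl (u ≫ t)) e = s' at hs'
    generalize u ≫ t = U at s' hs'
    have ef := TwoNatTrans.app_obj_nat (P.map U) f y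
    have eg := TwoNatTrans.app_obj_nat (P.map U) g y
    obtain ⟨k, h, θ, η, hη⟩ := (hP l).lift (f := f) (g := g) (Ps.obj (evalAt P A) U y)
      (eqToHom ef.symm ≫ s' ≫ eqToHom eg)
    refine ⟨⟨l, k⟩, h, c.isoOf U h θ, η, ?_⟩
    have h₁ := HomEq.map ((c.at' B).incl l) hη
    refine (c.nat₂ l η _).symm.trans (h₁.trans (HomEq.symm ?_))
    refine ((c.isoOf_hom U h θ f ef.symm).comp
      (hs'.symm.comp (c.isoOf_inv U h θ g eg))).trans (.of_eq ?_)
    refine Eq.trans ?_ (map_comp_conj_comp ((c.at' B).incl l) _ ef.symm s' eg _)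
    simp only [PsColimit.ofPre, Category.assoc, Iso.inv_hom_id_assoc]
    rfl
  eq {A B f g η η'} y e := by
    obtain ⟨j, y, rfl⟩ := (c.at' A).exists_rep y
    have e' : ((c.at' B).incl j).map (act₂ (P.obj j) η y) =
        ((c.at' B).incl j).map (act₂ (P.obj j) η' y) :=
      HomEq.eq ((c.nat₂ j η y).trans ((HomEq.of_eq e).trans (c.nat₂ j η' y).symm))
    -- The equality of the two actions on `y` holds already at some stage `l`.
    obtain ⟨l, t, ht⟩ := (c.at' B).exists_map_eq hJ (hd B) e'
    have ht' : act₂ (P.obj l) η (Ps.obj (evalAt P A) t y) =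
        act₂ (P.obj l) η' (Ps.obj (evalAt P A) t y) :=
      HomEq.eq (((TwoNatTrans.toHet (P.map t)).nat₂ η y).symm.trans ((HomEq.of_eq ht).trans
        ((TwoNatTrans.toHet (P.map t)).nat₂ η' y)))
    obtain ⟨k, h, ⟨θ⟩, hh⟩ := (hP l).eq _ ht'
    exact ⟨⟨l, k⟩, h, ⟨c.isoOf t h θ⟩, hh⟩

end

end TwoCat

/-! ### The 2-category of generators of a category-valued 2-functor -/

namespace TwoCat

universe a₁ b₁

/-- For a 2-category to be 2-filtered, the 2-cells that connect parallel 1-cells need not be assumed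
invertible: they become so after whiskering, by the condition on parallel 2-cells. -/
theorem IsTwoFiltered.of_cells {I : Type u} [Bicategory.{w, v₁} I] (h₀ : Nonempty I)
    (h₁ : ∀ i j : I, ∃ k : I, Nonempty (i ⟶ k) ∧ Nonempty (j ⟶ k))
    (h₂ : ∀ {i j : I} (f g : i ⟶ j), ∃ (k : I) (h : j ⟶ k), Nonempty (f ≫ h ⟶ g ≫ h))
    (h₃ : ∀ {i j : I} {f g : i ⟶ j} (α β : f ⟶ g), ∃ (k : I) (h : j ⟶ k), α ▷ h = β ▷ h) :
    IsTwoFiltered I where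
  nonempty := h₀
  cocone := h₁
  cocone_map₂ := h₃
  cocone_map {i j} f g := by
    obtain ⟨k, h, ⟨η⟩⟩ := h₂ f g
    -- After `h ≫ t`, there are 2-cells in both directions. Their composites become identities after
    -- whiskering with `s` and `r`.
    obtain ⟨l, t, ⟨θ⟩⟩ := h₂ (g ≫ h) (f ≫ h)
    obtain ⟨m, s, hs⟩ := h₃ (η ▷ t ≫ θ) (𝟙 _)
    obtain ⟨n, r, hr⟩ := h₃ ((θ ≫ η ▷ t) ▷ s) (𝟙 _)
    refine ⟨n, ((h ≫ t) ≫ s) ≫ r, ⟨?_⟩⟩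
    have e : ∀ f : i ⟶ j, f ≫ ((h ≫ t) ≫ s) ≫ r ≅ (((f ≫ h) ≫ t) ≫ s) ≫ r := fun f =>
      (α_ _ _ _).symm ≪≫ whiskerRightIso ((α_ _ _ _).symm ≪≫
        whiskerRightIso (α_ _ _ _).symm s) r
    refine e f ≪≫ ⟨η ▷ t ▷ s ▷ r, θ ▷ s ▷ r, ?_, ?_⟩ ≪≫ (e g).symm
    · rw [← comp_whiskerRight, ← comp_whiskerRight, hs, id_whiskerRight, id_whiskerRight]
    · rw [← comp_whiskerRight, ← comp_whiskerRight, hr, id_whiskerRight]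

section

variable {C : Type u} [Bicategory.{w, w} C] [Strict C]

/-- The index 2-category of the generators of a category-valued 2-functor. -/
structure Gen (T : StrictPseudofunctor C Cat.{w, w}) {K : Type w} (D : K → C)
    (x : ∀ k, T.obj (D k)) where
  ix : K

namespace Gen

variable {T : StrictPseudofunctor C Cat.{w, w}} {K : Type w} {D : K → C} {x : ∀ k, T.obj (D k)}

/-- A 1-cell of generators: a 1-cell of `C` in the opposite direction, together with an isomorphism
between the generator of the source and the image of the generator of the target. -/
structure Hom (a b : Gen T D x) where
  f : D b.ix ⟶ D a.ix
  θ : act T f (x b.ix) ≅ x a.ix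

theorem Hom.ext {a b : Gen T D x} {u v : Hom a b} (h : u.f = v.f) (h' : u.θ.hom ≈ₕ v.θ.hom) :
    u = v := by
  obtain ⟨f, θ⟩ := u
  obtain ⟨g, ξ⟩ := v
  obtain rfl : f = g := h
  obtain rfl : θ = ξ := Iso.ext h'.eq
  rfl

/-- A 2-cell of generators: a 2-cell of `C` that is compatible with the isomorphisms. -/
@[ext]
structure Hom₂ {a b : Gen T D x} (u v : Hom a b) where
  η : u.f ⟶ v.f
  w : act₂ T η (x b.ix) ≫ v.θ.hom = u.θ.hom

instance : CategoryStruct (Gen T D x) where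
  Hom := Hom
  id a := ⟨𝟙 _, eqToIso (act_id T _)⟩
  comp u v := ⟨v.f ≫ u.f, eqToIso (act_comp T _ _ _) ≪≫ (T.map u.f).toFunctor.mapIso v.θ ≪≫ u.θ⟩

instance (a b : Gen T D x) : Category (a ⟶ b) where
  Hom := Hom₂
  id u := ⟨𝟙 _, by
    rw [act₂_id]
    exact Category.id_comp _⟩
  comp m n := ⟨m.η ≫ n.η, by rw [act₂_comp, Category.assoc, n.w, m.w]⟩
  id_comp m := Hom₂.ext (Category.id_comp _)
  comp_id m := Hom₂.ext (Category.comp_id _)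
  assoc m n p := Hom₂.ext (Category.assoc _ _ _)

theorem id_θ (a : Gen T D x) : (Hom.θ (𝟙 a)).hom ≈ₕ 𝟙 (x a.ix) :=
  HomEq.eqToIso_hom (act_id T (x a.ix))

theorem comp_θ {a b c : Gen T D x} (u : a ⟶ b) (v : b ⟶ c) :
    (Hom.θ (u ≫ v)).hom ≈ₕ actMap T u.f v.θ.hom ≫ u.θ.hom :=
  HomEq.eqToHom_comp (act_comp T v.f u.f (x c.ix)) _

theorem id_comp' {a b : Gen T D x} (u : a ⟶ b) : 𝟙 a ≫ u = u :=
  Hom.ext (Strict.comp_id u.f) ((comp_θ _ _).trans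
    (HomEq.comp_id (actMap_id T u.θ.hom)
      ((id_θ a).trans (HomEq.id (act_id T (x a.ix)).symm))))

theorem comp_id' {a b : Gen T D x} (u : a ⟶ b) : u ≫ 𝟙 b = u :=
  Hom.ext (Strict.id_comp u.f) ((comp_θ _ _).trans
    (HomEq.id_comp ((actMap_congr T rfl (id_θ b)).trans
      (.of_eq ((T.map u.f).toFunctor.map_id _))) (.refl _)))

theorem assoc' {a b c d : Gen T D x} (u : a ⟶ b) (v : b ⟶ c) (t : c ⟶ d) :
    (u ≫ v) ≫ t = u ≫ v ≫ t := by
  refine Hom.ext (Strict.assoc t.f v.f u.f).symm ?_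
  refine (comp_θ _ _).trans
    (HomEq.trans (HomEq.comp (actMap_comp T v.f u.f t.θ.hom) (comp_θ u v)) ?_)
  refine HomEq.trans ?_ (comp_θ u (v ≫ t)).symm
  refine HomEq.trans ?_ (HomEq.comp (actMap_congr T rfl (comp_θ v t).symm) (.refl _))
  refine .of_eq ((Category.assoc _ _ _).symm.trans ?_)
  exact congrArg (fun s => s ≫ u.θ.hom) ((T.map u.f).toFunctor.map_comp _ _).symm

theorem conj_η {a b : Gen T D x} {u v u' v' : a ⟶ b} (h : u = u') (m : u' ⟶ v') (h' : v' = v) :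
    Hom₂.η (eqToHom h ≫ m ≫ eqToHom h') =
      eqToHom (congrArg Hom.f h) ≫ m.η ≫ eqToHom (congrArg Hom.f h') := by
  subst h h'
  rw [eqToHom_refl, eqToHom_refl, Category.id_comp, Category.comp_id, eqToHom_refl, eqToHom_refl,
    Category.id_comp, Category.comp_id]

/-- The whiskering of 2-cells of generators by a 1-cell on the left. -/
def whiskerLeft' {a b c : Gen T D x} (u : a ⟶ b) {v v' : b ⟶ c} (m : v ⟶ v') : u ≫ v ⟶ u ≫ v' :=
  Hom₂.mk (m.η ▷ u.f) (HomEq.eq (((act₂_whiskerRight T m.η u.f (x c.ix)).comp (comp_θ u v')).trans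
    (HomEq.trans (.of_eq ((Category.assoc _ _ _).symm.trans (congrArg (fun s => s ≫ u.θ.hom)
      (((T.map u.f).toFunctor.map_comp _ _).symm.trans
        (congrArg (fun s => actMap T u.f s) m.w))))) (comp_θ u v).symm)))

/-- The whiskering of 2-cells of generators by a 1-cell on the right. -/
def whiskerRight' {a b c : Gen T D x} {u u' : a ⟶ b} (m : u ⟶ u') (v : b ⟶ c) : u ≫ v ⟶ u' ≫ v :=
  Hom₂.mk (v.f ◁ m.η) (HomEq.eq (((act₂_whiskerLeft T v.f m.η (x c.ix)).comp (comp_θ u' v)).trans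
    (HomEq.trans (.of_eq (by
      refine (Category.assoc _ _ _).symm.trans ((congrArg (fun s => s ≫ u'.θ.hom)
        (act₂_naturality T m.η v.θ.hom).symm).trans ((Category.assoc _ _ _).trans ?_))
      exact congrArg (fun s => actMap T u.f v.θ.hom ≫ s) m.w)) (comp_θ u v).symm)))

theorem whiskerLeft'_eqToHom {a b c : Gen T D x} (u : a ⟶ b) {v v' : b ⟶ c} (h : v = v') :
    whiskerLeft' u (eqToHom h) = eqToHom (congrArg (fun t => u ≫ t) h) := by
  subst h
  exact Hom₂.ext (id_whiskerRight _ _)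

theorem whiskerRight'_eqToHom {a b c : Gen T D x} {u u' : a ⟶ b} (h : u = u') (v : b ⟶ c) :
    whiskerRight' (eqToHom h) v = eqToHom (congrArg (fun t => t ≫ v) h) := by
  subst h
  exact Hom₂.ext (whiskerLeft_id _ _)

theorem pentagon' {a b c d e : Gen T D x} (u : a ⟶ b) (v : b ⟶ c) (t : c ⟶ d) (s : d ⟶ e) :
    whiskerRight' (eqToHom (assoc' u v t)) s ≫ eqToHom (assoc' u (v ≫ t) s) ≫
      whiskerLeft' u (eqToHom (assoc' v t s)) =
    eqToHom (assoc' (u ≫ v) t s) ≫ eqToHom (assoc' u v (t ≫ s)) := by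
  rw [whiskerRight'_eqToHom, whiskerLeft'_eqToHom]
  simp only [eqToHom_trans]

theorem triangle' {a b c : Gen T D x} (u : a ⟶ b) (v : b ⟶ c) :
    eqToHom (assoc' u (𝟙 b) v) ≫ whiskerLeft' u (eqToHom (id_comp' v)) =
      whiskerRight' (eqToHom (comp_id' u)) v := by
  rw [whiskerRight'_eqToHom, whiskerLeft'_eqToHom, eqToHom_trans]

instance : Bicategory (Gen T D x) where
  whiskerLeft := whiskerLeft'
  whiskerRight := whiskerRight'
  associator u v t := eqToIso (assoc' u v t)
  leftUnitor u := eqToIso (id_comp' u)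
  rightUnitor u := eqToIso (comp_id' u)
  whiskerLeft_id u v := Hom₂.ext (id_whiskerRight _ _)
  whiskerLeft_comp u _ _ _ m n := Hom₂.ext (comp_whiskerRight _ _ _)
  id_whiskerLeft m := Hom₂.ext ((HomEq.conj_eq (HomEq.whiskerRight_id (Hom₂.η m)) _ _).trans
    (conj_η (id_comp' _) m (id_comp' _).symm).symm)
  comp_whiskerLeft u v _ _ m := Hom₂.ext ((HomEq.conj_eq
    (HomEq.whiskerRight_comp (Hom₂.η m) v.f u.f) _ _).trans
      (conj_η (assoc' u v _) (whiskerLeft' u (whiskerLeft' v m)) (assoc' u v _).symm).symm)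
  id_whiskerRight u v := Hom₂.ext (whiskerLeft_id _ _)
  comp_whiskerRight m n v := Hom₂.ext (whiskerLeft_comp _ _ _)
  whiskerRight_id m := Hom₂.ext ((HomEq.conj_eq (HomEq.id_whiskerLeft (Hom₂.η m)) _ _).trans
    (conj_η (comp_id' _) m (comp_id' _).symm).symm)
  whiskerRight_comp m v t := Hom₂.ext ((HomEq.conj_eq
    (HomEq.comp_whiskerLeft t.f v.f (Hom₂.η m)) _ _).trans
      (conj_η (assoc' _ v t).symm (whiskerRight' (whiskerRight' m v) t) (assoc' _ v t)).symm)
  whisker_assoc u _ _ m t := Hom₂.ext ((HomEq.conj_eq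
    (HomEq.whisker_assoc t.f (Hom₂.η m) u.f).symm _ _).trans
      (conj_η (assoc' u _ t) (whiskerLeft' u (whiskerRight' m t)) (assoc' u _ t).symm).symm)
  whisker_exchange m n := Hom₂.ext (whisker_exchange (Hom₂.η n) (Hom₂.η m)).symm
  pentagon u v t s := pentagon' u v t s
  triangle u v := triangle' u v

instance : Strict (Gen T D x) where
  id_comp u := id_comp' u
  comp_id u := comp_id' u
  assoc u v t := assoc' u v t
  leftUnitor_eqToIso _ := rfl
  rightUnitor_eqToIso _ := rfl
  associator_eqToIso _ _ _ := rfl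

open Opposite

variable (T D x) in
/-- The 2-functor on the opposite of the 2-category of generators that sends a generator to the
object in which it lives. -/
def diagram : StrictPseudofunctor (Gen T D x)ᵒᵖ C :=
  StrictPseudofunctor.mk''
    { obj := fun a => D a.unop.ix
      map := fun u => u.unop.f
      map₂ := fun m => Hom₂.η m.unop2
      map_id := fun _ => rfl
      map_comp := fun _ _ => rfl
      map₂_whisker_left := fun _ _ _ _ => (PseudoColimit.conj_rfl _).symm
      map₂_whisker_right := fun _ _ => (PseudoColimit.conj_rfl _).symm }

/-- The generators of a flat 2-functor form a 2-filtered 2-category. -/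
theorem isTwoFiltered (h : FlatOn T D x) : IsTwoFiltered (Gen T D x) := by
  refine IsTwoFiltered.of_cells ?_ (fun a b => ?_) (fun {a b} u v => ?_) (fun {a b u v} m n => ?_)
  · obtain ⟨k⟩ := h.nonempty
    exact ⟨⟨k⟩⟩
  · obtain ⟨k, f, g, ⟨θ⟩, ⟨ξ⟩⟩ := h.cocone (x a.ix) (x b.ix)
    exact ⟨⟨k⟩, ⟨⟨f, θ⟩⟩, ⟨⟨g, ξ⟩⟩⟩
  · -- The isomorphism between the images of `x b` under `u.f` and `v.f` lifts to a 2-cell of `C`.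
    obtain ⟨k, t, θ, η, e⟩ := h.lift (x b.ix) (u.θ.hom ≫ v.θ.inv)
    refine ⟨⟨k⟩, ⟨t, θ⟩, ⟨Hom₂.mk η ?_⟩⟩
    refine HomEq.eq ((HomEq.comp e (comp_θ v (b := b) (c := ⟨k⟩) ⟨t, θ⟩)).trans
      (HomEq.trans (.of_eq ?_)
      (comp_θ u (b := b) (c := ⟨k⟩) ⟨t, θ⟩).symm))
    have h₁ : actMap T v.f θ.inv ≫ actMap T v.f θ.hom = 𝟙 _ :=
      ((T.map v.f).toFunctor.mapIso θ).inv_hom_id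
    simp only [Category.assoc, reassoc_of% h₁, Iso.inv_hom_id, Category.comp_id]
  · obtain ⟨k, t, ⟨θ⟩, e⟩ := h.eq (η := Hom₂.η m) (η' := Hom₂.η n) (x b.ix) (by
      rw [← cancel_mono v.θ.hom, Hom₂.w, Hom₂.w])
    exact ⟨⟨k⟩, ⟨t, θ⟩, Hom₂.ext e⟩

end Gen

end

end TwoCat

/-! ### Flat 2-functors come from 2-pro-objects -/

namespace TwoCat

section

variable {J : Type w} [Bicategory.{w, w} J] {Φ : J ⥤ᵖ Cat.{w, w}} {𝓣 : Type w} [Category.{w} 𝓣]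

theorem map_comp₅ {X : Type u} [Category.{v₁} X] {Y : Type u₁} [Category.{v₂} Y] (F : X ⥤ Y)
    {a b c d e f : X} (p : a ⟶ b) (q : b ⟶ c) (r : c ⟶ d) (s : d ⟶ e) (t : e ⟶ f) :
    F.map (p ≫ q ≫ r ≫ s ≫ t) = F.map p ≫ F.map q ≫ F.map r ≫ F.map s ≫ F.map t := by
  simp only [Functor.map_comp]

theorem map_cancel_isos {X : Type u} [Category.{v₁} X] {Y : Type u₁} [Category.{v₂} Y] (F : X ⥤ Y)
    {a b c d : X} (p : a ≅ b) (q : d ≅ c) {r s : b ⟶ c}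
    (h : F.map (p.hom ≫ r ≫ q.inv) = F.map (p.hom ≫ s ≫ q.inv)) : F.map r = F.map s := by
  simpa only [Functor.map_comp, ← Functor.mapIso_hom, ← Functor.mapIso_inv,
      cancel_epi, cancel_mono] using h

/-- Two representatives may be brought to a common index and common 1-cells into it. -/
theorem PsColimit.exists_common (hJ : IsTwoFiltered J) (c : PsColimit Φ 𝓣) {i j : J} {x : Φ.obj i}
    {y : Φ.obj j} (p q : Ps.Pre Φ i x j y) : ∃ (l : J) (u : i ⟶ l) (v : j ⟶ l)
      (r s : Ps.obj Φ u x ⟶ Ps.obj Φ v y), c.ofPre p = c.ofPre ⟨l, u, v, r⟩ ∧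
        c.ofPre q = c.ofPre ⟨l, u, v, s⟩ := by
  obtain ⟨m, s, t, ⟨e⟩⟩ := hJ.span p.u q.u
  obtain ⟨l, r, ⟨e'⟩⟩ := hJ.cocone_map (p.v ≫ s) (q.v ≫ t)
  exact ⟨l, p.u ≫ s ≫ r, p.v ≫ s ≫ r, _, _, (c.ofPre_ext p (s ≫ r) (Iso.refl _) (Iso.refl _)).symm,
    (c.ofPre_ext q (t ≫ r) ((α_ _ _ _).symm ≪≫ whiskerRightIso e r ≪≫ α_ _ _ _)
      ((α_ _ _ _).symm ≪≫ e' ≪≫ α_ _ _ _)).symm⟩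

end

section

open Opposite

variable {C : Type u} [Bicategory.{w, w} C] [Strict C]

namespace Gen

variable {T : StrictPseudofunctor C Cat.{w, w}} {K : Type w} {D : K → C} {x : ∀ k, T.obj (D k)}

variable (T D x) in
/-- The pseudo-colimit of the corepresentable 2-functors of the generators. -/
abbrev colim (A : C) :=
  proPsColimit (diagram (T := T) D x) A

variable (T D x) in
/-- The comparison of the generated 2-functor with `T` at a generator. -/
abbrev compareAt (A : C) (a : Gen T D x) : (D a.ix ⟶ A) ⥤ T.obj A :=
  (corepDesc (D a.ix) T (x a.ix)).app A

/-- The comparison isomorphisms at a 1-cell of generators. -/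
def compareIso {A : C} {a b : Gen T D x} (u : a ⟶ b) (k : D a.ix ⟶ A) :
    act T k (x a.ix) ≅ act T (Hom.f u ≫ k) (x b.ix) :=
  (T.map k).toFunctor.mapIso (Hom.θ u).symm ≪≫ eqToIso (act_comp T (Hom.f u) k (x b.ix)).symm

theorem compareIso_hom {A : C} {a b : Gen T D x} (u : a ⟶ b) (k : D a.ix ⟶ A) :
    (compareIso u k).hom ≈ₕ actMap T k (Hom.θ u).inv :=
  HomEq.comp_eqToHom _ (act_comp T (Hom.f u) k (x b.ix)).symm

theorem comp_θ_inv {a b c : Gen T D x} (u : a ⟶ b) (v : b ⟶ c) :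
    (Hom.θ (u ≫ v)).inv ≈ₕ u.θ.inv ≫ actMap T u.f v.θ.inv :=
  HomEq.inv (g := ((T.map u.f).toFunctor.mapIso v.θ ≪≫ u.θ)) (comp_θ u v)

/-- The actions of `T` on the generators form a pseudo-cocone under the categories `C(D a, A)`. -/
theorem exists_compare (A : C) :
    ∃ Ψ : PseudoColimit.Obj ((homDiagram (diagram (T := T) D x)).obj A) ⥤ T.obj A,
    (∀ a, (colim T D x A).incl a ⋙ Ψ = compareAt T D x A a) ∧
      ∀ {a b : Gen T D x} (u : a ⟶ b) (k : D a.ix ⟶ A),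
        Ψ.map ((colim T D x A).tr u k).hom ≈ₕ (compareIso u k).hom := by
  refine proPsColimit_hasDesc.{w} (diagram (T := T) D x) A (T.obj A) (compareAt T D x A) compareIso
    (fun {a b} u {k l} r => ?_) (fun a k => ?_) (fun {a b c} u v k => ?_) (fun {a b u v} m k => ?_)
  · exact HomEq.eq (((HomEq.refl (act₂ T r (x a.ix))).comp (compareIso_hom u l)).trans
      ((HomEq.of_eq (act₂_naturality T r (Hom.θ (a := a) (b := b) u).inv).symm).trans
        ((compareIso_hom u k).comp
          (act₂_whiskerLeft T (Hom.f (a := a) (b := b) u) r (x b.ix))).symm))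
  · have h₁ : (compareAt T D x A a).map (Ps.unit (evalAt (yonedaDiagram
        (diagram (T := T) D x)).toPseudofunctor A) a k).hom ≈ₕ 𝟙 (act T k (x a.ix)) :=
      (HomEq.map (compareAt T D x A a) (unit_yoneda (diagram (T := T) D x) A a k)).trans
        (.of_eq ((compareAt T D x A a).map_id k))
    have h₂ : (compareIso (𝟙 a) k).hom ≈ₕ 𝟙 (act T k (x a.ix)) :=
      (compareIso_hom (𝟙 a) k).trans ((actMap_congr T rfl (HomEq.eqToIso_inv
        (act_id T (x a.ix)))).trans (.of_eq ((T.map k).toFunctor.map_id _)))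
    exact HomEq.eq (HomEq.comp_id h₂ (h₁.trans (HomEq.id (congrArg (fun t => act T t (x a.ix))
      (Strict.id_comp k).symm))))
  · have h₁ : (compareAt T D x A c).map (Ps.comp (evalAt (yonedaDiagram
        (diagram (T := T) D x)).toPseudofunctor A) u v k).hom ≈ₕ
          𝟙 (act T (Hom.f v ≫ Hom.f u ≫ k) (x c.ix)) :=
      (HomEq.map (compareAt T D x A c) (comp_yoneda (diagram (T := T) D x) A u v k)).trans
        (.of_eq ((compareAt T D x A c).map_id _))
    refine HomEq.eq ((HomEq.comp_id (compareIso_hom (u ≫ v) k) (h₁.trans (HomEq.id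
      (congrArg (fun t => act T t (x c.ix)) (Strict.assoc (Hom.f v) (Hom.f u) k).symm)))).trans ?_)
    refine HomEq.trans ?_ ((compareIso_hom u k).comp ((compareIso_hom v (Hom.f u ≫ k)).trans
      (actMap_comp T (Hom.f u) k (Hom.θ v).inv))).symm
    exact (actMap_congr T rfl (comp_θ_inv u v)).trans (.of_eq ((T.map k).toFunctor.map_comp _ _))
  · have h₁ : (Hom.θ u).inv ≫ act₂ T (Hom₂.η m) (x b.ix) = (Hom.θ v).inv := by
      rw [Iso.inv_comp_eq, ← Hom₂.w m, Category.assoc, Iso.hom_inv_id, Category.comp_id]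
    refine HomEq.eq (((compareIso_hom u k).comp (act₂_whiskerRight T (Hom₂.η m) k (x b.ix))).trans
      (HomEq.trans (.of_eq ?_) (compareIso_hom v k).symm))
    exact ((T.map k).toFunctor.map_comp _ _).symm.trans (congrArg (fun t => actMap T k t) h₁)

variable (T D x) in
/-- The category-valued 2-functor represented by the diagram of the generators of `T`. -/
abbrev generated : StrictPseudofunctor C Cat.{w, w} :=
  (homDiagram (diagram (T := T) D x)).comp (pseudoColim (Gen T D x))

variable (T D x) in
/-- The comparison functor, given on objects by the action of `T` on generators. -/
noncomputable def compareApp (A : C) : (generated T D x).obj A ⥤ T.obj A :=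
  (exists_compare (T := T) (D := D) (x := x) A).choose

theorem incl_compareApp (A : C) (a : Gen T D x) :
    (colim T D x A).incl a ⋙ compareApp T D x A = compareAt T D x A a :=
  (exists_compare (T := T) (D := D) (x := x) A).choose_spec.1 a

theorem compareApp_obj {A : C} (a : Gen T D x) (k : D a.ix ⟶ A) :
    (compareApp T D x A).obj (((colim T D x A).incl a).obj k) = act T k (x a.ix) :=
  congrArg (fun t => Functor.obj t k) (incl_compareApp A a)

theorem compareApp_map {A : C} (a : Gen T D x) {k l : D a.ix ⟶ A} (r : k ⟶ l) :
    (compareApp T D x A).map (((colim T D x A).incl a).map r) ≈ₕ act₂ T r (x a.ix) :=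
  HomEq.map_congr (incl_compareApp A a) (.refl r)

theorem compareApp_tr {A : C} {a b : Gen T D x} (u : a ⟶ b) (k : D a.ix ⟶ A) :
    (compareApp T D x A).map ((colim T D x A).tr u k).hom ≈ₕ (compareIso u k).hom :=
  (exists_compare (T := T) (D := D) (x := x) A).choose_spec.2 u k

theorem map_comp_compareApp {A B : C} (f : A ⟶ B) :
    ((generated T D x).map f).toFunctor ⋙ compareApp T D x B =
      compareApp T D x A ⋙ (T.map f).toFunctor := by
  refine (colim T D x A).functor_ext (fun a => HomEq.functor_ext (fun k => ?_) fun {k l} r => ?_)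
    fun {a b} u k => ?_
  · exact (compareApp_obj a (k ≫ f)).trans ((act_comp T k f (x a.ix)).trans
      (congrArg (act T f) (compareApp_obj a k)).symm)
  · exact (compareApp_map a (r ▷ f)).trans ((act₂_whiskerRight T r f (x a.ix)).trans
      (actMap_congr T rfl (compareApp_map a r)).symm)
  · refine (HomEq.map (compareApp T D x B)
      ((proCocone (diagram (T := T) D x)).tr_nat u f k).symm).trans
        ((compareApp_tr u (k ≫ f)).trans ?_)
    refine (compareIso_hom u (k ≫ f)).trans ((actMap_comp T k f _).trans (actMap_congr T rfl ?_))
    exact (compareIso_hom u k).symm.trans (compareApp_tr u k).symm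

variable (T D x) in
/-- The comparison with `T` of the 2-functor represented by the diagram of its generators. -/
noncomputable def compare : HetTrans (generated T D x) T where
  app A := compareApp T D x A
  obj_nat f p := congrArg (fun t => Functor.obj t p) (map_comp_compareApp f)
  map_nat f _ _ r := HomEq.map_congr (map_comp_compareApp f) (.refl r)
  nat₂ {A B f g} η p := by
    obtain ⟨a, k, rfl⟩ := (colim T D x A).exists_rep p
    exact (compareApp_map a (k ◁ η)).trans ((act₂_whiskerLeft T k η (x a.ix)).trans
      (act₂_congr T (.refl η) (compareApp_obj a k).symm))

/-- The generators `x a` and `x b` are brought to a common generator, and the morphism between its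
images is lifted to a 2-cell of `C`. -/
theorem compare_full (h : FlatOn T D x) {A : C} {a b : Gen T D x} (k : D a.ix ⟶ A)
    (l : D b.ix ⟶ A) (r : act T k (x a.ix) ⟶ act T l (x b.ix)) :
    ∃ m : ((colim T D x A).incl a).obj k ⟶ ((colim T D x A).incl b).obj l,
      (compareApp T D x A).map m ≈ₕ r := by
  obtain ⟨c, f, g, ⟨θ⟩, ⟨ξ⟩⟩ := h.cocone (x a.ix) (x b.ix)
  let u : a ⟶ ⟨c⟩ := Hom.mk f θ
  let v : b ⟶ ⟨c⟩ := Hom.mk g ξ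
  obtain ⟨d, t, ζ, η, hη⟩ := h.lift (f := f ≫ k) (g := g ≫ l) (x c)
    ((compareIso u k).inv ≫ r ≫ (compareIso v l).hom)
  let s : (⟨c⟩ : Gen T D x) ⟶ ⟨d⟩ := Hom.mk t ζ
  let G := colim T D x A
  let Ψ := compareApp T D x A
  refine ⟨(G.tr u k).hom ≫ (G.tr s (f ≫ k)).hom ≫ (G.incl ⟨d⟩).map η ≫ (G.tr s (g ≫ l)).inv ≫
    (G.tr v l).inv, ?_⟩
  have inv : ∀ {a b : Gen T D x} (u : a ⟶ b) (k : D a.ix ⟶ A),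
      Ψ.map (G.tr u k).inv ≈ₕ (compareIso u k).inv := fun u k =>
    HomEq.inv (f := Ψ.mapIso (G.tr u k)) (compareApp_tr u k)
  have h₁ : act₂ T η (x d) ≈ₕ (compareIso s (f ≫ k)).inv ≫
      ((compareIso u k).inv ≫ r ≫ (compareIso v l).hom) ≫ (compareIso s (g ≫ l)).hom := by
    refine hη.trans (HomEq.comp ?_ (HomEq.comp (.refl _) (compareIso_hom s (g ≫ l)).symm))
    exact HomEq.inv (f := ((T.map (f ≫ k)).toFunctor.mapIso ζ).symm) (compareIso_hom s (f ≫ k)).symm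
  refine (HomEq.of_eq (?_ : _ = Ψ.map (G.tr u k).hom ≫ Ψ.map (G.tr s (f ≫ k)).hom ≫
    Ψ.map ((G.incl ⟨d⟩).map η) ≫ Ψ.map (G.tr s (g ≫ l)).inv ≫ Ψ.map (G.tr v l).inv)).trans ?_
  · exact map_comp₅ Ψ _ _ _ _ _
  · refine ((compareApp_tr u k).comp ((compareApp_tr s (f ≫ k)).comp
      (((compareApp_map ⟨d⟩ η).trans h₁).comp ((inv s (g ≫ l)).comp (inv v l))))).trans (.of_eq ?_)
    simp

/-- Two morphisms with the same image are represented at a common generator by two 2-cells of `C`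
with the same action, which agree at a further generator. -/
theorem compare_faithful (h : FlatOn T D x) {A : C} {a b : Gen T D x} {k : D a.ix ⟶ A}
    {l : D b.ix ⟶ A} {m n : ((colim T D x A).incl a).obj k ⟶ ((colim T D x A).incl b).obj l}
    (e : (compareApp T D x A).map m = (compareApp T D x A).map n) : m = n := by
  obtain ⟨p, hp⟩ := (colim T D x A).exists_ofPre (isTwoFiltered h) m a k b l rfl rfl
  obtain ⟨q, hq⟩ := (colim T D x A).exists_ofPre (isTwoFiltered h) n a k b l rfl rfl
  obtain rfl := hp.eq
  obtain rfl := hq.eq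
  obtain ⟨c, u, v, r, s, hr, hs⟩ := (colim T D x A).exists_common (isTwoFiltered h) p q
  rw [hr, hs] at e ⊢
  have e₁ : (compareApp T D x A).map (((colim T D x A).incl c).map r) =
      (compareApp T D x A).map (((colim T D x A).incl c).map s) :=
    map_cancel_isos (compareApp T D x A) _ _ e
  have e₂ : act₂ T r (x c.ix) = act₂ T s (x c.ix) :=
    HomEq.eq ((compareApp_map c r).symm.trans ((HomEq.of_eq e₁).trans (compareApp_map c s)))
  obtain ⟨d, t, ⟨ζ⟩, ht⟩ := h.eq (x c.ix) e₂
  have e₃ : ((colim T D x A).incl c).map r = ((colim T D x A).incl c).map s := by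
    let z : c ⟶ ⟨d⟩ := Hom.mk t ζ
    rw [← cancel_mono ((colim T D x A).tr z _).hom, PsColimit.tr_naturality,
      PsColimit.tr_naturality]
    exact congrArg (fun t => ((colim T D x A).tr z _).hom ≫ ((colim T D x A).incl ⟨d⟩).map t) ht
  simp only [PsColimit.ofPre, e₃]

/-- The 2-functor represented by the generators of a flat 2-functor `T` is isomorphic to `T`. -/
theorem compare_invertible (h : FlatOn T D x) : (compare T D x).Invertible := by
  intro A
  refine (isIsoCat_iff _).2 ⟨⟨fun p q e => ?_, fun y => ?_⟩, ⟨fun {p q} r => ?_⟩,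
    ⟨fun {p q} m n e => ?_⟩⟩
  · obtain ⟨a, k, rfl⟩ := (colim T D x A).exists_rep p
    obtain ⟨b, l, rfl⟩ := (colim T D x A).exists_rep q
    have e' := (h.bijective A).1 (a₁ := ⟨a.ix, k⟩) (a₂ := ⟨b.ix, l⟩)
      ((compareApp_obj a k).symm.trans (Eq.trans e (compareApp_obj b l)))
    obtain ⟨a⟩ := a
    obtain ⟨b⟩ := b
    cases e'
    rfl
  · obtain ⟨⟨a, k⟩, rfl⟩ := (h.bijective A).2 y
    exact ⟨((colim T D x A).incl ⟨a⟩).obj k, compareApp_obj ⟨a⟩ k⟩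
  · obtain ⟨a, k, rfl⟩ := (colim T D x A).exists_rep p
    obtain ⟨b, l, rfl⟩ := (colim T D x A).exists_rep q
    obtain ⟨m, hm⟩ := compare_full h k l
      (eqToHom (compareApp_obj a k).symm ≫ r ≫ eqToHom (compareApp_obj b l))
    exact ⟨m, (hm.trans (HomEq.conj (compareApp_obj a k).symm r (compareApp_obj b l))).eq⟩
  · obtain ⟨a, k, rfl⟩ := (colim T D x A).exists_rep p
    obtain ⟨b, l, rfl⟩ := (colim T D x A).exists_rep q
    exact compare_faithful h e

variable (D x) in
/-- The 2-pro-object given by the generators of a flat 2-functor. -/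
def proObj (h : FlatOn T D x) : ProObj.{w} C where
  I := Gen T D x
  isTwoFiltered := isTwoFiltered h
  X := diagram T D x

end Gen

end

end TwoCat

/-! ### Diagrams of 2-pro-objects and their weights -/

namespace TwoCat

section

open Opposite Bicategory.Opposite

variable {J : Type u₁} [Bicategory.{w₁, v₁} J] {B : Type u₂} [Bicategory.{w₂, v₂} B]

theorem map₂_associator_inv (Q : J ⥤ᵖ B) {a b c d : J} (f : a ⟶ b) (g : b ⟶ c) (h : c ⟶ d) :
    Q.map₂ (α_ f g h).inv = (Q.mapComp f (g ≫ h)).hom ≫ Q.map f ◁ (Q.mapComp g h).hom ≫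
      (α_ (Q.map f) (Q.map g) (Q.map h)).inv ≫ (Q.mapComp f g).inv ▷ Q.map h ≫
        (Q.mapComp (f ≫ g) h).inv := by
  have : Q.map₂Iso (α_ f g h) = Q.mapComp (f ≫ g) h ≪≫ whiskerRightIso (Q.mapComp f g) (Q.map h) ≪≫
      α_ _ _ _ ≪≫ (whiskerLeftIso (Q.map f) (Q.mapComp g h)).symm ≪≫ (Q.mapComp f (g ≫ h)).symm :=
    Iso.ext (Q.map₂_associator f g h)
  refine (congrArg Iso.inv this).trans ?_
  simp

/-- The pseudofunctor between 2-categories given by a pseudofunctor between their opposites. -/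
def unopPseudofunctor (Q : Jᵒᵖ ⥤ᵖ Bᵒᵖ) : J ⥤ᵖ B where
  obj j := (Q.obj (op j)).unop
  map u := (Q.map u.op).unop
  map₂ η := (Q.map₂ (op2 η)).unop2
  map₂_id u := congrArg Hom2.unop2 (Q.map₂_id u.op)
  map₂_comp η θ := congrArg Hom2.unop2 (Q.map₂_comp (op2 η) (op2 θ))
  mapId j := (Q.mapId (op j)).unop2
  mapComp u v := (Q.mapComp v.op u.op).unop2
  map₂_whisker_left u _ _ η := congrArg Hom2.unop2 (Q.map₂_whisker_right (op2 η) u.op)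
  map₂_whisker_right η u := congrArg Hom2.unop2 (Q.map₂_whisker_left u.op (op2 η))
  map₂_associator f g h := congrArg Hom2.unop2 (map₂_associator_inv Q h.op g.op f.op)
  map₂_left_unitor f := congrArg Hom2.unop2 (Q.map₂_right_unitor f.op)
  map₂_right_unitor f := congrArg Hom2.unop2 (Q.map₂_left_unitor f.op)

end

section

open Opposite Bicategory.Opposite

variable {C : Type u} [Bicategory.{w, w} C] [Strict C] {J : Type w} [Bicategory.{w, w} J] [Strict J]

/-- The diagram of category-valued 2-functors of a diagram of 2-pro-objects. -/
def weights (Z : Jᵒᵖ ⥤ᵖ Pro.{w} C) : J ⥤ᵖ StrictPseudofunctor C Cat.{w, w} :=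
  unopPseudofunctor (Z.comp InducedBicategory.forget.toPseudofunctor)

/-- The canonical cone, at an element that is the image of the identity under a 1-cell of
2-pro-objects. -/
theorem kappa_leg_naturality {X Y : Pro.{w} C} (β : X ⟶ Y) {D : C} (x : (ProObj.L Y).obj D) :
    (kappa X).leg ((TwoNatTrans.app β.hom.unop D).toFunctor.obj x) = β ≫ (kappa Y).leg x := by
  have h : ∀ {p q : X ⟶ (toPro C).obj D}, ((proEval X).app D).obj p = ((proEval X).app D).obj q →
      p = q := fun h => ((proEval_invertible X) D).bijective.1 h
  apply h
  refine (congrArg (fun t => Functor.obj t _) (kappa_proEval X D)).trans ?_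
  exact (congrArg ((TwoNatTrans.toHet β.hom.unop).app D).obj
    (congrArg (fun t => Functor.obj t x) (kappa_proEval Y D))).symm

theorem kappa_homEq {X : Pro.{w} C} {D : C} {p q p' q' : X ⟶ (toPro C).obj D} {μ : p ⟶ q}
    {ν : p' ⟶ q'} (h : ((proEval X).app D).map μ ≈ₕ ((proEval X).app D).map ν) : μ ≈ₕ ν := by
  have := ((proEval_invertible X) D).faithful
  exact @HomEq.of_map _ _ _ _ ((proEval X).app D) this _ _ _ _ _ _
    (((proEval_invertible X) D).bijective.1 h.src)
    (((proEval_invertible X) D).bijective.1 h.tgt) h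

theorem kappa_leg₂_naturality {X Y : Pro.{w} C} (β : X ⟶ Y) {D : C} {x y : (ProObj.L Y).obj D}
    (r : x ⟶ y) :
    (kappa X).leg₂ ((TwoNatTrans.app β.hom.unop D).toFunctor.map r) ≈ₕ β ◁ (kappa Y).leg₂ r := by
  refine kappa_homEq ((HomEq.map_congr (kappa_proEval X D) (.refl _)).trans ?_)
  exact (HomEq.map ((TwoNatTrans.toHet β.hom.unop).app D)
    (HomEq.map_congr (kappa_proEval Y D) (.refl r))).symm

theorem kappa_leg₂_cell {X Y : Pro.{w} C} {β γ : X ⟶ Y} (Γ : β ⟶ γ) {D : C}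
    (x : (ProObj.L Y).obj D) :
    (kappa X).leg₂ ((Modif.app Γ.hom.unop2 D).toNatTrans.app x) ≈ₕ Γ ▷ (kappa Y).leg x := by
  refine kappa_homEq ((HomEq.map_congr (kappa_proEval X D) (.refl _)).trans ?_)
  exact (HomEq.app (HetTrans.Hom.app (Modif.toHet Γ.hom.unop2) D)
    (congrArg (fun t => Functor.obj t x) (kappa_proEval Y D))).symm

/-- A diagram of 2-pro-objects is represented termwise by its diagram of weights. -/
noncomputable def kappaSystem (Z : Jᵒᵖ ⥤ᵖ Pro.{w} C) : ConeSystem (weights Z) (toPro C) Z where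
  lam j := kappa (Z.obj (op j))
  leg_map u D x := kappa_leg_naturality (Z.map u.op) x
  leg₂_map u D x y r := kappa_leg₂_naturality (Z.map u.op) r
  leg₂_cell η D x := kappa_leg₂_cell (Z.map₂ (op2 η)) x
  leg₂_unit i D x := by
    refine (HomEq.map ((kappa (Z.obj (op i))).app D) (.of_eq (unit_evalAt (weights Z) D i x))).trans
      (HomEq.trans (HomEq.map _ ?_) (kappa_leg₂_cell (Z.mapId (op i)).hom x))
    exact .of_eq (congrArg (fun t => t.toNatTrans.app x) (congrArg (fun t => Modif.app t D)
      (congrArg Hom2.unop2 (Category.comp_id (Z.mapId (op i)).hom.hom))))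
  leg₂_comp {i j k} u v D x := by
    refine (HomEq.map ((kappa (Z.obj (op k))).app D)
      (.of_eq (comp_evalAt (weights Z) D u v x))).trans
      (HomEq.trans (HomEq.map _ ?_) (kappa_leg₂_cell (Z.mapComp v.op u.op).hom x))
    exact .of_eq (congrArg (fun t => t.toNatTrans.app x) (congrArg (fun t => Modif.app t D)
      (congrArg Hom2.unop2 (Category.comp_id (Z.mapComp v.op u.op).hom.hom))))

end

end TwoCat

/-! ### Preservation of 2-cofiltered pseudo-limits -/

namespace TwoCat

universe a₁ a₂ b₁ b₂

section

variable {E : Type u₁} [Bicategory.{w₁, v₁} E] [Strict E]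

/-- Composition with an invertible 1-cell is an isomorphism of categories. -/
theorem postcomp_isIsoCat {U V : E} {e : U ⟶ V} {e' : V ⟶ U} (h : e ≫ e' = 𝟙 U)
    (h' : e' ≫ e = 𝟙 V) (K : E) : IsIsoCat (postcomp K e) := by
  refine ⟨postcomp K e', ?_, ?_⟩
  · refine HomEq.functor_ext (fun k => ?_) fun {k l} μ => ?_
    · exact (Strict.assoc k e e').trans ((congrArg (fun t => k ≫ t) h).trans (Strict.comp_id k))
    · exact (HomEq.whiskerRight_comp μ e e').symm.trans
        ((HomEq.whiskerRight (.refl μ) h).trans (HomEq.whiskerRight_id μ))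
  · refine HomEq.functor_ext (fun k => ?_) fun {k l} μ => ?_
    · exact (Strict.assoc k e' e).trans ((congrArg (fun t => k ≫ t) h').trans (Strict.comp_id k))
    · exact (HomEq.whiskerRight_comp μ e' e).symm.trans
        ((HomEq.whiskerRight (.refl μ) h').trans (HomEq.whiskerRight_id μ))

variable {C : Type u} [Bicategory.{w₃, v₃} C]
  {P : StrictPseudofunctor C Cat.{a₁, b₁}} {Q : StrictPseudofunctor C Cat.{a₂, b₂}}
  {F : StrictPseudofunctor C E}

namespace WCone

theorem pre_id {V : E} (φ : WCone P F V) : (φ.pre V).obj (𝟙 V) = φ :=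
  HetTrans.ext fun D => HomEq.functor_ext (fun x => Strict.id_comp _)
    fun r => HomEq.id_whiskerLeft _

theorem pre_comp {V K L : E} (φ : WCone P F V) (k : K ⟶ L) (l : L ⟶ V) :
    (φ.pre K).obj (k ≫ l) = (((φ.pre L).obj l).pre K).obj k :=
  HetTrans.ext fun D => HomEq.functor_ext (fun x => Strict.assoc _ _ _)
    fun r => HomEq.comp_whiskerLeft _ _ _

theorem universal_comp_iff {V : E} {φ : WCone Q F V} {τ : HetTrans P Q} (h : τ.Invertible) :
    Universal (P := P) (τ.comp φ) ↔ φ.Universal :=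
  forall_congr' fun K => ⟨fun h' => IsIsoCat.of_comp_right (h.precomp (R := F.comp (corep K))) h',
    fun h' => h'.comp (h.precomp (R := F.comp (corep K)))⟩

theorem Universal.pre_obj {U V : E} {φ : WCone P F V} (h : φ.Universal) {e : U ⟶ V} {e' : V ⟶ U}
    (h₁ : e ≫ e' = 𝟙 U) (h₂ : e' ≫ e = 𝟙 V) : Universal ((φ.pre U).obj e) := fun K => by
  have : ((φ.pre U).obj e).pre K = postcomp K e ⋙ φ.pre K :=
    HomEq.functor_ext (fun k => (φ.pre_comp k e).symm) fun {k l} μ =>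
      HetTrans.hom_homEq (φ.pre_comp k e).symm (φ.pre_comp l e).symm fun D x =>
        HomEq.whiskerRight_comp μ e _
  rw [this]
  exact (postcomp_isIsoCat h₁ h₂ K).comp (h K)

/-- Two universal cones over the same 2-functor, with the same weight, differ by an invertible
1-cell. -/
theorem Universal.exists_unique {U V : E} {φ : WCone P F V} {ψ : WCone P F U} (h : φ.Universal)
    (h' : ψ.Universal) : ∃ (e : U ⟶ V) (e' : V ⟶ U), e ≫ e' = 𝟙 U ∧ e' ≫ e = 𝟙 V ∧
      (φ.pre U).obj e = ψ := by
  obtain ⟨e, he⟩ := (h.bijective U).2 ψ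
  obtain ⟨e', he'⟩ := (h'.bijective V).2 φ
  refine ⟨e, e', (h'.bijective U).1 ?_, (h.bijective V).1 ?_, he⟩
  · rw [pre_comp, he', he, pre_id]
  · rw [pre_comp, he, he', pre_id]

variable {E' : Type u₂} [Bicategory.{w₂, v₂} E'] [Strict E']

theorem push_pre (H : StrictPseudofunctor E E') {U V : E} (φ : WCone P F V) (e : U ⟶ V) :
    ((φ.pre U).obj e).push H = ((φ.push H).pre (H.obj U)).obj (H.map e) :=
  HetTrans.ext fun D => HomEq.functor_ext (fun x => H.map_comp _ _)
    fun r => HomEq.map₂_whiskerLeft H _ _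

end WCone

end

section

open Opposite

variable {C : Type u} [Bicategory.{w, w} C] [Strict C]

/-- The 2-functor of a 2-pro-object is flat, with one generator for each index. -/
theorem ProObj.flatOn (X : ProObj.{w} C) :
    FlatOn X.L (fun p : Σ _ : X.I, PUnit.{w + 1} => X.X.obj (op p.1))
      (fun p => ((proCocone X.X).at' (X.X.obj (op p.1))).incl p.1 |>.obj (𝟙 _)) :=
  FlatOn.psColimit X.isTwoFiltered (proCocone X.X) (fun A => proPsColimit_hasDesc X.X A)
    (K := fun _ => PUnit.{w + 1}) (D := fun j _ => X.X.obj (op j)) (x := fun j _ => 𝟙 _)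
    (fun j => FlatOn.corep (X.X.obj (op j)))

/-- The pseudo-colimit of the weights of a 2-cofiltered diagram of 2-pro-objects is the 2-functor of
a 2-pro-object. -/
theorem exists_proObj_weights {J : Type w} [Bicategory.{w, w} J] [Strict J] (hJ : IsTwoFiltered J)
    (Z : Jᵒᵖ ⥤ᵖ Pro.{w} C) :
    ∃ (W : ProObj.{w} C) (τ : HetTrans W.L (pwColim (weights Z))), τ.Invertible := by
  have h := FlatOn.psColimit hJ (pwCocone (weights Z))
    (fun A => PsObj.hasDesc.{w, w, w + 1})
    (fun j => ProObj.flatOn (Z.obj (op j)))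
  exact ⟨Gen.proObj _ _ h, Gen.compare _ _ _, Gen.compare_invertible h⟩

variable {E : Type u₁} [Bicategory.{w₁, v₁} E] [Strict E]

/-- A 2-functor that preserves the canonical universal cones of 2-pro-objects preserves small
2-cofiltered pseudo-limits: the vertex of such a pseudo-limit represents the pseudo-colimit of the
weights, which is the 2-functor of a 2-pro-object. -/
theorem preserves_of_push_kappa {H : StrictPseudofunctor (Pro.{w} C) E}
    (h : ∀ X : Pro.{w} C, ((kappa X).push H).Universal) :
    PreservesTwoCofilteredPseudoLimits.{w} H := by
  intro J _ _ hJ Z L π hπ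
  -- The pseudo-limit cone `π` is a universal cone `ψ` over `c`, with weight the pseudo-colimit.
  obtain ⟨ψ, hψ⟩ := (kappaSystem Z).exists_wcone (pwCocone (weights Z))
    (fun D => PsObj.hasDesc) π
  have hψU := (hψ.universal_iff (fun j => kappa_universal (Z.obj (op j)))
    (fun D => PsObj.hasDesc)).2 hπ
  -- Up to an isomorphism of weights and an invertible 1-cell of vertices, `ψ` is the canonical cone
  -- of `W`, and the same is true of their images under `H`.
  obtain ⟨W, τ, hτ⟩ := exists_proObj_weights hJ Z
  obtain ⟨e, e', h₁, h₂, he⟩ := (kappa_universal W).exists_unique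
    ((WCone.universal_comp_iff (φ := ψ) hτ).2 hψU)
  have h₃ := (h W).pre_obj (e := H.map e) (e' := H.map e')
    ((H.map_comp e e').symm.trans ((congrArg H.map h₁).trans (H.map_id _)))
    ((H.map_comp e' e).symm.trans ((congrArg H.map h₂).trans (H.map_id _)))
  have h₄ : (WCone.push H (τ.comp ψ : WCone (ProObj.L W) (toPro C) L)).Universal := by
    rw [← he]
    exact (congrArg WCone.Universal (WCone.push_pre H (kappa W) e)).mpr h₃
  exact ((hψ.push H).universal_iff (fun j => h (Z.obj (op j)))
    (fun D => PsObj.hasDesc)).1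
    ((WCone.universal_comp_iff (φ := ψ.push H) hτ).1 h₄)

theorem PreservesTwoCofilteredPseudoLimits.push_kappa {H : StrictPseudofunctor (Pro.{w} C) E}
    (hH : PreservesTwoCofilteredPseudoLimits.{w} H) (X : Pro.{w} C) :
    ((kappa X).push H).Universal :=
  hH.push_universal X (kappa_universal X)

end

end TwoCat

/-! ### A criterion for 2-equivalences -/

namespace TwoCat

section

variable {A : Type u₁} [Bicategory.{w₁, v₁} A] {B : Type u₂} [Bicategory.{w₂, v₂} B]

/-- A 2-natural transformation whose compatibility with 2-cells holds up to equality of endpoints.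
-/
def TwoNatTrans.ofHomEq {F G : StrictPseudofunctor A B} (app : ∀ a, F.obj a ⟶ G.obj a)
    (nat : ∀ {a b : A} (f : a ⟶ b), F.map f ≫ app b = app a ≫ G.map f)
    (nat₂ : ∀ {a b : A} {f g : a ⟶ b} (η : f ⟶ g), F.map₂ η ▷ app b ≈ₕ app a ◁ G.map₂ η) :
    TwoNatTrans F G where
  app := app
  naturality := nat
  naturality₂ η := (nat₂ η).square _ _

/-- A modification whose naturality holds up to equality of endpoints. -/
def Modif.ofHomEq {F G : StrictPseudofunctor A B} {α β : TwoNatTrans F G}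
    (app : ∀ a, α.app a ⟶ β.app a)
    (nat : ∀ {a b : A} (f : a ⟶ b), F.map f ◁ app b ≈ₕ app a ▷ G.map f) : Modif α β where
  app := app
  naturality f := (nat f).square _ _

variable [Strict A] [Strict B]

/-- A 2-functor whose compatibility with whiskering holds up to equality of endpoints. -/
def strictOfHomEq (obj : A → B) (map : ∀ {a b : A}, (a ⟶ b) → (obj a ⟶ obj b))
    (map₂ : ∀ {a b : A} {f g : a ⟶ b}, (f ⟶ g) → (map f ⟶ map g))
    (map_id : ∀ a, map (𝟙 a) = 𝟙 (obj a))
    (map_comp : ∀ {a b c : A} (f : a ⟶ b) (g : b ⟶ c), map (f ≫ g) = map f ≫ map g)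
    (map₂_id : ∀ {a b : A} (f : a ⟶ b), map₂ (𝟙 f) = 𝟙 (map f))
    (map₂_comp : ∀ {a b : A} {f g h : a ⟶ b} (η : f ⟶ g) (θ : g ⟶ h),
      map₂ (η ≫ θ) = map₂ η ≫ map₂ θ)
    (whiskerLeft : ∀ {a b c : A} (f : a ⟶ b) {g g' : b ⟶ c} (η : g ⟶ g'),
      map₂ (f ◁ η) ≈ₕ map f ◁ map₂ η)
    (whiskerRight : ∀ {a b c : A} {f f' : a ⟶ b} (η : f ⟶ f') (g : b ⟶ c),
      map₂ (η ▷ g) ≈ₕ map₂ η ▷ map g) : StrictPseudofunctor A B :=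
  StrictPseudofunctor.mk''
    { obj := obj
      map := map
      map₂ := map₂
      map₂_id := map₂_id
      map₂_comp := map₂_comp
      map_id := map_id
      map_comp := map_comp
      map₂_whisker_left := fun f _ _ η => (whiskerLeft f η).conj_eq _ _
      map₂_whisker_right := fun η g => (whiskerRight η g).conj_eq _ _ }

/-- A 2-natural transformation with invertible components is invertible. -/
theorem TwoNatTrans.exists_inverse {F G : StrictPseudofunctor A B} (α : F ⟶ G)
    (h : ∀ a, ∃ e : G.obj a ⟶ F.obj a, TwoNatTrans.app α a ≫ e = 𝟙 _ ∧
      e ≫ TwoNatTrans.app α a = 𝟙 _) : ∃ β : G ⟶ F, α ≫ β = 𝟙 F ∧ β ≫ α = 𝟙 G := by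
  choose e h₁ h₂ using h
  refine ⟨TwoNatTrans.ofHomEq e (fun {a b} f => ?_) (fun {a b f g} η => ?_),
    TwoNatTrans.hom_ext h₁, TwoNatTrans.hom_ext h₂⟩
  · have h := TwoNatTrans.naturality α f
    calc G.map f ≫ e b = (e a ≫ TwoNatTrans.app α a) ≫ G.map f ≫ e b := by
          rw [h₂, Strict.id_comp]
      _ = e a ≫ (F.map f ≫ TwoNatTrans.app α b) ≫ e b := by
          rw [h, Strict.assoc, Strict.assoc]
      _ = e a ≫ F.map f := by rw [Strict.assoc, h₁, Strict.comp_id]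
  · have h₃ : G.map₂ η ≈ₕ e a ◁ (F.map₂ η ▷ TwoNatTrans.app α b) :=
      (HomEq.id_whiskerLeft _).symm.trans ((HomEq.whiskerLeft (h₂ a).symm (.refl _)).trans
        ((HomEq.comp_whiskerLeft _ _ _).trans (HomEq.whiskerLeft rfl
          (HomEq.twoNatTrans_naturality₂ α η).symm)))
    refine (HomEq.whiskerRight h₃ rfl).trans ((HomEq.whisker_assoc _ _ _).trans
      (HomEq.whiskerLeft rfl ?_))
    exact (HomEq.whiskerRight_comp _ _ _).symm.trans ((HomEq.whiskerRight (.refl _) (h₁ b)).trans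
      (HomEq.whiskerRight_id _))

section

variable {R : StrictPseudofunctor A B}

theorem map_injective_of_isIsoCat (hR : ∀ a b, IsIsoCat (R.mapFunctor a b)) {a b : A} {f g : a ⟶ b}
    (h : R.map f = R.map g) : f = g :=
  (hR a b).bijective.1 h

theorem map_surjective_of_isIsoCat (hR : ∀ a b, IsIsoCat (R.mapFunctor a b)) {a b : A}
    (g : R.obj a ⟶ R.obj b) : ∃ f : a ⟶ b, R.map f = g :=
  (hR a b).bijective.2 g

theorem homEq_of_isIsoCat (hR : ∀ a b, IsIsoCat (R.mapFunctor a b)) {a b : A}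
    {f g f' g' : a ⟶ b} {η : f ⟶ g} {θ : f' ⟶ g'} (h : R.map₂ η ≈ₕ R.map₂ θ) : η ≈ₕ θ := by
  have := (hR a b).faithful
  exact HomEq.of_map (F := R.mapFunctor a b) (map_injective_of_isIsoCat hR h.src)
    (map_injective_of_isIsoCat hR h.tgt) h

theorem map₂_surjective_of_isIsoCat (hR : ∀ a b, IsIsoCat (R.mapFunctor a b)) {a b : A}
    {f g : a ⟶ b} {k l : R.obj a ⟶ R.obj b}
    (hk : k = R.map f) (hl : l = R.map g) (η : k ⟶ l) : ∃ θ : f ⟶ g, R.map₂ θ ≈ₕ η := by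
  subst hk hl
  have := (hR a b).full
  obtain ⟨θ, h⟩ := (R.mapFunctor a b).map_surjective η
  exact ⟨θ, .of_eq h⟩

/-- A 2-functor that is an isomorphism on hom-categories, and that reaches every object up to an
invertible 1-cell, is a 2-equivalence. -/
theorem isTwoEquivalence_of_isIsoCat (hR : ∀ a b, IsIsoCat (R.mapFunctor a b))
    (h : ∀ b, ∃ (a : A) (e : R.obj a ⟶ b) (e' : b ⟶ R.obj a), e ≫ e' = 𝟙 _ ∧ e' ≫ e = 𝟙 _) :
    IsTwoEquivalence R := by
  -- The quasi-inverse sends `f : a ⟶ b` to the unique 1-cell `m f` with `R (m f) ≫ e b = e a ≫ f`.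
  choose o e e' he he' using h
  choose m hm using fun {a b : B} (f : a ⟶ b) =>
    map_surjective_of_isIsoCat hR (e a ≫ f ≫ e' b)
  choose m₂ hm₂ using fun {a b : B} {f g : a ⟶ b} (η : f ⟶ g) =>
    map₂_surjective_of_isIsoCat hR (hm f).symm (hm g).symm (e a ◁ η ▷ e' b)
  have hm' : ∀ {a b : B} (f : a ⟶ b), R.map (m f) ≫ e b = e a ≫ f := fun {a b} f => by
    rw [hm, Strict.assoc, Strict.assoc, he', Strict.comp_id]
  have hm₂' : ∀ {a b : B} {f g : a ⟶ b} (η : f ⟶ g), R.map₂ (m₂ η) ▷ e b ≈ₕ e a ◁ η :=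
    fun {a b f g} η => (HomEq.whiskerRight (hm₂ η) rfl).trans ((HomEq.whisker_assoc _ _ _).trans
      (HomEq.whiskerLeft rfl ((HomEq.whiskerRight_comp _ _ _).symm.trans
        ((HomEq.whiskerRight (.refl η) (he' b)).trans (HomEq.whiskerRight_id η)))))
  -- 1-cells and 2-cells into `R.obj (o b)` may be compared after composition with `e b`.
  have hc : ∀ {a : A} {b : B} {f g : a ⟶ o b}, R.map f ≫ e b = R.map g ≫ e b → f = g :=
    fun {a b f g} h => map_injective_of_isIsoCat hR
      ((postcomp_isIsoCat (he b) (he' b) _).bijective.1 h)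
  have hc₂ : ∀ {a : A} {b : B} {f g f' g' : a ⟶ o b} {η : f ⟶ g} {θ : f' ⟶ g'},
      R.map₂ η ▷ e b ≈ₕ R.map₂ θ ▷ e b → η ≈ₕ θ := fun {a b f g f' g' η θ} h => by
    have := (postcomp_isIsoCat (he b) (he' b) (R.obj a)).faithful
    exact homEq_of_isIsoCat hR (HomEq.of_map (F := postcomp (R.obj a) (e b))
      ((postcomp_isIsoCat (he b) (he' b) _).bijective.1 h.src)
      ((postcomp_isIsoCat (he b) (he' b) _).bijective.1 h.tgt) h)
  let G : StrictPseudofunctor B A := strictOfHomEq o m m₂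
    (fun b => hc (by rw [hm', R.map_id, Strict.id_comp, Strict.comp_id]))
    (fun f g => hc (by
      rw [hm', R.map_comp, Strict.assoc, hm' g, ← Strict.assoc (R.map (m f)), hm' f, Strict.assoc]))
    (fun f => HomEq.eq (hc₂ ((hm₂' (𝟙 f)).trans (by
      rw [R.map₂_id, id_whiskerRight, whiskerLeft_id]
      exact .id (hm' f).symm))))
    (fun η θ => HomEq.eq (hc₂ ((hm₂' (η ≫ θ)).trans (by
      rw [R.map₂_comp, comp_whiskerRight, whiskerLeft_comp]
      exact ((hm₂' η).comp (hm₂' θ)).symm))))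
    (fun f g g' η => hc₂ ((hm₂' (f ◁ η)).trans (HomEq.symm
      ((HomEq.whiskerRight (HomEq.map₂_whiskerLeft R _ _) rfl).trans
        ((HomEq.whisker_assoc _ _ _).trans ((HomEq.whiskerLeft rfl (hm₂' η)).trans
          ((HomEq.comp_whiskerLeft _ _ _).symm.trans ((HomEq.whiskerLeft (hm' f) (.refl η)).trans
            (HomEq.comp_whiskerLeft _ _ _)))))))))
    (fun {a b c f f'} η g => hc₂ ((hm₂' (η ▷ g)).trans (HomEq.symm
      ((HomEq.whiskerRight (HomEq.map₂_whiskerRight R _ _) rfl).trans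
        ((HomEq.whiskerRight_comp _ _ _).symm.trans
          ((HomEq.whiskerRight (.refl (R.map₂ (m₂ η))) (hm' g)).trans
            ((HomEq.whiskerRight_comp _ _ _).trans ((HomEq.whiskerRight (hm₂' η) rfl).trans
              (HomEq.whisker_assoc _ _ _)))))))))
  -- The second transformation consists of the lifts along `R` of the 1-cells `e (R a)`.
  choose t ht using fun a => map_surjective_of_isIsoCat hR (e (R.obj a))
  choose t' ht' using fun a => map_surjective_of_isIsoCat hR (e' (R.obj a))
  refine ⟨G, ?_, ?_⟩
  · let α : G.comp R ⟶ StrictPseudofunctor.id B := TwoNatTrans.ofHomEq e hm' hm₂'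
    obtain ⟨β, h₁, h₂⟩ := TwoNatTrans.exists_inverse α fun b => ⟨e' b, he b, he' b⟩
    exact ⟨α, β, h₁, h₂⟩
  · let α : R.comp G ⟶ StrictPseudofunctor.id A := TwoNatTrans.ofHomEq t
      (fun {a b} f => map_injective_of_isIsoCat hR (by
        refine (R.map_comp _ _).trans (Eq.trans ?_ (R.map_comp _ _).symm)
        exact (congrArg (fun k => R.map (m (R.map f)) ≫ k) (ht b)).trans
          ((hm' (R.map f)).trans (congrArg (fun k => k ≫ R.map f) (ht a)).symm)))
      (fun {a b f g} η => homEq_of_isIsoCat hR (by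
        refine (HomEq.map₂_whiskerRight R _ _).trans (HomEq.trans ?_
          (HomEq.map₂_whiskerLeft R _ _).symm)
        exact (HomEq.whiskerRight (.refl (R.map₂ (m₂ (R.map₂ η)))) (ht b)).trans
          ((hm₂' (R.map₂ η)).trans (HomEq.whiskerLeft (ht a).symm (.refl (R.map₂ η))))))
    obtain ⟨β, h₁, h₂⟩ := TwoNatTrans.exists_inverse α fun a => ⟨t' a,
      map_injective_of_isIsoCat hR ((R.map_comp _ _).trans
        ((congrArg₂ (fun k l => k ≫ l) (ht a) (ht' a)).trans ((he _).trans (R.map_id _).symm))),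
      map_injective_of_isIsoCat hR ((R.map_comp _ _).trans
        ((congrArg₂ (fun k l => k ≫ l) (ht' a) (ht a)).trans ((he' _).trans (R.map_id _).symm)))⟩
    exact ⟨α, β, h₁, h₂⟩

end

end

end TwoCat

/-! ### Extension of 2-functors to 2-pro-objects -/

namespace TwoCat

universe a₁ b₁

section

variable {C : Type u} [Bicategory.{w₃, v₃} C] {E : Type u₁} [Bicategory.{w₁, v₁} E] [Strict E]
  {F G : StrictPseudofunctor C E}

/-- Composition with a 2-natural transformation, on 1-cells with a fixed source. -/
def corepWhisker (β : F ⟶ G) (K : E) : HetTrans (F.comp (corep K)) (G.comp (corep K)) where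
  app D := postcomp K (TwoNatTrans.app β D)
  obj_nat f x := (Strict.assoc _ _ _).trans
    ((congrArg (fun t => x ≫ t) (TwoNatTrans.naturality β f)).trans (Strict.assoc _ _ _).symm)
  map_nat f _ _ r := (HomEq.whiskerRight_comp _ _ _).symm.trans
    ((HomEq.whiskerRight (.refl r) (TwoNatTrans.naturality β f)).trans
      (HomEq.whiskerRight_comp _ _ _))
  nat₂ η x := (HomEq.whisker_assoc _ _ _).trans
    ((HomEq.whiskerLeft rfl (HomEq.twoNatTrans_naturality₂ β η)).trans
      (HomEq.comp_whiskerLeft _ _ _).symm)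

/-- Composition with a modification, on 1-cells with a fixed source. -/
def corepWhisker₂ {β γ : F ⟶ G} (n : β ⟶ γ) (K : E) : corepWhisker β K ⟶ corepWhisker γ K :=
  HetTrans.Hom.mk (fun D =>
    { app := fun x => x ◁ Modif.app n D
      naturality := fun x y r => (whisker_exchange _ _).symm })
    fun f x => (HomEq.comp_whiskerLeft _ _ _).trans
      ((HomEq.whiskerLeft rfl (HomEq.modif_naturality n f)).trans (HomEq.whisker_assoc _ _ _).symm)

namespace WCone

variable {P : StrictPseudofunctor C Cat.{a₁, b₁}}

/-- The composite of a weighted cone over `F` with a 2-natural transformation `F ⟶ G`. -/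
def map (β : F ⟶ G) {K : E} (φ : WCone P F K) : WCone P G K :=
  HetTrans.comp φ (corepWhisker β K)

/-- Universality may be tested after composition with an invertible 2-natural transformation. -/
theorem universal_of_map (β : F ⟶ G)
    (h : ∀ D, ∃ e : G.obj D ⟶ F.obj D, TwoNatTrans.app β D ≫ e = 𝟙 _ ∧
      e ≫ TwoNatTrans.app β D = 𝟙 _) {V : E} {φ : WCone P F V} (hφ : (φ.map β).Universal) :
    φ.Universal := fun K => by
  have hβ : (corepWhisker β K).Invertible := fun D => by
    obtain ⟨e, h₁, h₂⟩ := h D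
    exact postcomp_isIsoCat h₁ h₂ K
  refine IsIsoCat.of_comp_right (hβ.postcomp (P := P)) ?_
  have o : ∀ k : K ⟶ V, ((φ.pre K).obj k).map β = ((φ.map β).pre K).obj k := fun k =>
    HetTrans.ext fun D => HomEq.functor_ext (fun x => Strict.assoc _ _ _)
      fun r => HomEq.whisker_assoc _ _ _
  have : φ.pre K ⋙ HetTrans.postcomp P (corepWhisker β K) = (φ.map β).pre K :=
    HomEq.functor_ext o fun {k l} μ => HetTrans.hom_homEq (o k) (o l) fun D x =>
      (HomEq.whiskerRight_comp μ _ _).symm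
  rw [this]
  exact hφ K

end WCone

end

section

variable {C : Type u} [Bicategory.{w, w} C] [Strict C] {E : Type u₁} [Bicategory.{w₁, v₁} E]
  [Strict E]

/-- The universal element of the 2-functor of the constant 2-pro-object at `D`. -/
abbrev constElt (D : C) : (ProObj.const.{w} D).L.obj D := ((constIncl.{w} D).app D).obj (𝟙 D)

theorem toProMap_constElt {D D' : C} (f : D ⟶ D') :
    (TwoNatTrans.app (toProMap.{w} f) D').toFunctor.obj (constElt D') =
      act (ProObj.const.{w} D).L f (constElt D) :=
  congrArg ((constIncl D).app D').obj ((Strict.comp_id f).trans (Strict.id_comp f).symm)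

theorem toProMap₂_constElt {D D' : C} {f g : D ⟶ D'} (η : f ⟶ g) :
    (Modif.app (toProMap₂.{w} η) D').toNatTrans.app (constElt D') ≈ₕ
      act₂ (ProObj.const.{w} D).L η (constElt D) :=
  HomEq.map ((constIncl D).app D') ((HomEq.whiskerRight_id η).trans (HomEq.id_whiskerLeft η).symm)

/-- A 2-functor on `C` extends along `C → 2-Pro(C)`: the extension sends a 2-pro-object to the
vertex of a universal cone weighted by its 2-functor. -/
theorem exists_extension (hE : HasTwoCofilteredPseudoLimits.{w} E) (F : StrictPseudofunctor C E) :
    ∃ (H : StrictPseudofunctor (Pro.{w} C) E) (θ : (toPro C).comp H ⟶ F),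
      (∀ D, ∃ e : F.obj D ⟶ ((toPro C).comp H).obj D, TwoNatTrans.app θ D ≫ e = 𝟙 _ ∧
        e ≫ TwoNatTrans.app θ D = 𝟙 _) ∧ ∀ X : Pro.{w} C, ((kappa X).push H).Universal := by
  -- The image of `α : X ⟶ Y` is induced by the restriction along `α` of the universal cone of `X`;
  -- `hl`, `hl₂` and `hc` describe it on the legs, on which all equations are tested.
  choose V lam hU using fun X : Pro.{w} C => exists_universal hE X F
  let Φ : ∀ {X Y : Pro.{w} C}, (X ⟶ Y) → WCone (ProObj.L Y) F (V X) := fun {X Y} α =>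
    HetTrans.comp ((proHomFunctor X Y).obj α) (lam X)
  let Φ₂ : ∀ {X Y : Pro.{w} C} {α β : X ⟶ Y} (Γ : α ⟶ β), Φ α ⟶ Φ β := fun {X Y α β} Γ =>
    (HetTrans.postcomp (ProObj.L Y) (lam X)).map ((proHomFunctor X Y).map Γ)
  choose m hm using fun {X Y : Pro.{w} C} (α : X ⟶ Y) => ((hU Y).bijective (V X)).2 (Φ α)
  have hl : ∀ {X Y : Pro.{w} C} (α : X ⟶ Y) {D : C} (y : (ProObj.L Y).obj D),
      m α ≫ (lam Y).leg y = (lam X).leg ((TwoNatTrans.app α.hom.unop D).toFunctor.obj y) :=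
    fun α D y => HetTrans.obj_congr (hm α) rfl
  have hl₂ : ∀ {X Y : Pro.{w} C} (α : X ⟶ Y) {D : C} {y z : (ProObj.L Y).obj D} (r : y ⟶ z),
      m α ◁ (lam Y).leg₂ r ≈ₕ (lam X).leg₂ ((TwoNatTrans.app α.hom.unop D).toFunctor.map r) :=
    fun α D y z r => HetTrans.map_congr (hm α) (.refl r)
  choose m₂ hm₂ using fun {X Y : Pro.{w} C} {α β : X ⟶ Y} (Γ : α ⟶ β) =>
    (hU Y).exists_hom (hm α) (hm β) (Φ₂ Γ)
  have hc : ∀ {X Y : Pro.{w} C} {α β : X ⟶ Y} (Γ : α ⟶ β) {D : C} (y : (ProObj.L Y).obj D),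
      m₂ Γ ▷ (lam Y).leg y ≈ₕ (lam X).leg₂ ((Modif.app Γ.hom.unop2 D).toNatTrans.app y) :=
    fun Γ D y => hm₂ Γ y
  have hcomp : ∀ {X Y Z : Pro.{w} C} (α : X ⟶ Y) (β : Y ⟶ Z), m (α ≫ β) = m α ≫ m β :=
    fun {X Y Z} α β => (hU Z).ext
      (fun D z => (hl (α ≫ β) z).trans (((hl α _).symm.trans
        (congrArg (fun t => m α ≫ t) (hl β z).symm)).trans (Strict.assoc _ _ _).symm))
      fun D y z r => (hl₂ (α ≫ β) r).trans ((hl₂ α _).symm.trans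
        ((HomEq.whiskerLeft rfl (hl₂ β r).symm).trans (HomEq.comp_whiskerLeft _ _ _).symm))
  let H : StrictPseudofunctor (Pro.{w} C) E := strictOfHomEq V m m₂
    (fun X => (hU X).ext (fun D y => (hl (𝟙 X) y).trans (Strict.id_comp _).symm)
      fun D y z r => (hl₂ (𝟙 X) r).trans (HomEq.id_whiskerLeft _).symm)
    hcomp
    (fun {X Y} α => (hU Y).cell_ext fun D y => HomEq.eq ((hc (𝟙 α) y).trans (by
      rw [id_whiskerRight]
      exact (HomEq.of_eq (((lam X).app D).map_id _)).trans (.id (hl α y).symm))))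
    (fun {X Y α β γ} Γ Λ => (hU Y).cell_ext fun D y => HomEq.eq ((hc (Γ ≫ Λ) y).trans (by
      rw [comp_whiskerRight]
      exact (HomEq.of_eq (((lam X).app D).map_comp _ _)).trans ((hc Γ y).comp (hc Λ y)).symm)))
    (fun {X Y Z} α β γ Γ => (hU Z).cell_homEq (hcomp α β) (hcomp α γ) fun D z =>
      (hc (α ◁ Γ) z).trans (HomEq.symm ((HomEq.whisker_assoc _ _ _).trans
        ((HomEq.whiskerLeft rfl (hc Γ z)).trans (hl₂ α _)))))
    (fun {X Y Z α β} Γ γ => (hU Z).cell_homEq (hcomp α γ) (hcomp β γ) fun D z =>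
      (hc (Γ ▷ γ) z).trans (HomEq.symm ((HomEq.whiskerRight_comp _ _ _).symm.trans
        ((HomEq.whiskerRight (.refl _) (hl γ z)).trans (hc Γ _)))))
  let θ : (toPro C).comp H ⟶ F := TwoNatTrans.ofHomEq
    (fun D => (lam ((toPro C).obj D)).leg (constElt D))
    (fun {D D'} f => (hl ((toPro C).map f) (constElt D')).trans
      ((congrArg ((lam ((toPro C).obj D)).app D').obj (toProMap_constElt f)).trans
        ((lam ((toPro C).obj D)).obj_nat f _)))
    (fun {D D' f g} η => (hc ((toPro C).map₂ η) (constElt D')).trans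
      ((HomEq.map ((lam ((toPro C).obj D)).app D') (toProMap₂_constElt η)).trans
        ((lam ((toPro C).obj D)).nat₂ η _)))
  have hθ : ∀ D, ∃ e : F.obj D ⟶ ((toPro C).comp H).obj D, TwoNatTrans.app θ D ≫ e = 𝟙 _ ∧
      e ≫ TwoNatTrans.app θ D = 𝟙 _ := fun D => by
    -- Cones with the weight of the constant 2-pro-object at `D` are 1-cells to `F D`, by the Yoneda
    -- lemma, so the leg at the universal element is invertible.
    have hb : ∀ K : E, IsIsoCat (postcomp K ((lam ((toPro C).obj D)).leg (constElt D))) := fun K =>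
      (hU _ K).comp ((constIncl_invertible D).precomp.comp (yonedaEval_isIsoCat D _))
    obtain ⟨e, he⟩ := (hb (F.obj D)).bijective.2 (𝟙 _)
    refine ⟨e, (hb _).bijective.1 ?_, he⟩
    exact (Strict.assoc _ _ _).trans ((congrArg (fun t => _ ≫ t) he).trans
      ((Strict.comp_id _).trans (Strict.id_comp _).symm))
  refine ⟨H, θ, hθ, fun X => WCone.universal_of_map θ hθ ?_⟩
  -- The image of the canonical cone is, up to `θ`, the universal cone chosen for `X`.
  have : ((kappa X).push H).map θ = lam X := by
    refine HetTrans.ext fun D => HomEq.functor_ext (fun x => ?_) fun {x y} r => ?_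
    · exact (hl ((kappa X).leg x) (constElt D)).trans
        (congrArg ((lam X).app D).obj (congrArg (fun t => Functor.obj t x) (kappa_proEval X D)))
    · exact (hc ((kappa X).leg₂ r) (constElt D)).trans
        (HomEq.map ((lam X).app D) (HomEq.map_congr (kappa_proEval X D) (.refl r)))
  rw [this]
  exact hU X

end

end TwoCat

/-! ### Restriction along the canonical 2-functor -/

namespace TwoCat

section

variable {C : Type u} [Bicategory.{w, w} C] [Strict C] {E : Type u₁} [Bicategory.{w₁, v₁} E]
  [Strict E]

theorem kappa_constElt (D : C) :
    (kappa ((toPro.{w} C).obj D)).leg (constElt D) = 𝟙 ((toPro.{w} C).obj D) :=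
  ((proEval_invertible ((toPro C).obj D)) D).bijective.1
    (congrArg (fun t => Functor.obj t (constElt D)) (kappa_proEval ((toPro C).obj D) D))

variable {H H' : StrictPseudofunctor (Pro.{w} C) E}

/-- The components of `α : H ⟶ H'` are determined, on the canonical cones, by the restriction of `α`
to `C`. -/
theorem app_kappa (α : H ⟶ H') (X : Pro.{w} C) :
    (((kappa X).push H').pre (H.obj X)).obj (TwoNatTrans.app α X) =
      ((kappa X).push H).map ((precompose (toPro C) E).map α) :=
  HetTrans.ext fun D => HomEq.functor_ext
    (fun x => (TwoNatTrans.naturality α ((kappa X).leg x)).symm)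
    fun r => (HomEq.twoNatTrans_naturality₂ α ((kappa X).leg₂ r)).symm

theorem precompose_injective (h : ∀ X : Pro.{w} C, ((kappa X).push H').Universal) {α β : H ⟶ H'}
    (e : (precompose (toPro C) E).map α = (precompose (toPro C) E).map β) : α = β :=
  TwoNatTrans.hom_ext fun X => ((h X).bijective _).1
    ((app_kappa α X).trans ((congrArg (fun t => ((kappa X).push H).map t) e).trans
      (app_kappa β X).symm))

/-- The component at `X` of the extension of `β` is induced by the cone `H κ_X ≫ β`. -/
theorem precompose_surjective (h : ∀ X : Pro.{w} C, ((kappa X).push H').Universal)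
    (β : (toPro C).comp H ⟶ (toPro C).comp H') :
    ∃ α : H ⟶ H', (precompose (toPro C) E).map α = β := by
  choose a ha using fun X : Pro.{w} C =>
    ((h X).bijective (H.obj X)).2 (((kappa X).push H).map β)
  have hl : ∀ (X : Pro.{w} C) {D : C} (x : (ProObj.L X).obj D),
      a X ≫ H'.map ((kappa X).leg x) = H.map ((kappa X).leg x) ≫ TwoNatTrans.app β D :=
    fun X D x => HetTrans.obj_congr (ha X) rfl
  have hl₂ : ∀ (X : Pro.{w} C) {D : C} {x y : (ProObj.L X).obj D} (r : x ⟶ y),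
      a X ◁ H'.map₂ ((kappa X).leg₂ r) ≈ₕ H.map₂ ((kappa X).leg₂ r) ▷ TwoNatTrans.app β D :=
    fun X D x y r => HetTrans.map_congr (ha X) (.refl r)
  have nat : ∀ {X Y : Pro.{w} C} (f : X ⟶ Y), H.map f ≫ a Y = a X ≫ H'.map f :=
    fun {X Y} f => (h Y).ext
      (fun D y => by
        have e₁ : H.map f ≫ H.map ((kappa Y).leg y) = H.map ((kappa X).leg _) :=
          (H.map_comp _ _).symm.trans (congrArg H.map (kappa_leg_naturality f y).symm)
        have e₂ : H'.map f ≫ H'.map ((kappa Y).leg y) = H'.map ((kappa X).leg _) :=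
          (H'.map_comp _ _).symm.trans (congrArg H'.map (kappa_leg_naturality f y).symm)
        refine (Strict.assoc _ _ _).trans ((congrArg (fun t => H.map f ≫ t) (hl Y y)).trans
          ((Strict.assoc _ _ _).symm.trans ((congrArg (fun t => t ≫ TwoNatTrans.app β D) e₁).trans
            ((hl X _).symm.trans ((congrArg (fun t => a X ≫ t) e₂.symm).trans
              (Strict.assoc _ _ _).symm))))))
      (fun D y z r => by
        have e₁ : H.map f ◁ H.map₂ ((kappa Y).leg₂ r) ≈ₕ H.map₂ ((kappa X).leg₂ _) :=
          (HomEq.map₂_whiskerLeft H f _).symm.trans (HomEq.map₂ H (kappa_leg₂_naturality f r).symm)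
        have e₂ : H'.map f ◁ H'.map₂ ((kappa Y).leg₂ r) ≈ₕ H'.map₂ ((kappa X).leg₂ _) :=
          (HomEq.map₂_whiskerLeft H' f _).symm.trans
            (HomEq.map₂ H' (kappa_leg₂_naturality f r).symm)
        exact (HomEq.comp_whiskerLeft _ _ _).trans ((HomEq.whiskerLeft rfl (hl₂ Y r)).trans
          ((HomEq.whisker_assoc _ _ _).symm.trans ((HomEq.whiskerRight e₁ rfl).trans
            ((hl₂ X _).symm.trans ((HomEq.whiskerLeft rfl e₂.symm).trans
              (HomEq.comp_whiskerLeft _ _ _).symm))))))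
  let α : H ⟶ H' := TwoNatTrans.ofHomEq a nat fun {X Y f g} Γ =>
    (h Y).cell_homEq (nat f) (nat g) fun D y => by
      have e₁ : H.map₂ Γ ▷ H.map ((kappa Y).leg y) ≈ₕ H.map₂ ((kappa X).leg₂ _) :=
        (HomEq.map₂_whiskerRight H Γ _).symm.trans (HomEq.map₂ H (kappa_leg₂_cell Γ y).symm)
      have e₂ : H'.map₂ Γ ▷ H'.map ((kappa Y).leg y) ≈ₕ H'.map₂ ((kappa X).leg₂ _) :=
        (HomEq.map₂_whiskerRight H' Γ _).symm.trans (HomEq.map₂ H' (kappa_leg₂_cell Γ y).symm)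
      exact (HomEq.whiskerRight_comp _ _ _).symm.trans
        ((HomEq.whiskerRight (.refl (H.map₂ Γ)) (hl Y y)).trans
          ((HomEq.whiskerRight_comp _ _ _).trans ((HomEq.whiskerRight e₁ rfl).trans
            ((hl₂ X _).symm.trans ((HomEq.whiskerLeft rfl e₂.symm).trans
              (HomEq.whisker_assoc _ _ _).symm)))))
  refine ⟨α, TwoNatTrans.hom_ext fun D => ?_⟩
  -- At `X = c D` the canonical cone contains the identity, so the extension restricts to the given
  -- datum.
  have e₁ : H.map ((kappa ((toPro C).obj D)).leg (constElt D)) = 𝟙 _ :=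
    (congrArg H.map (kappa_constElt D)).trans (H.map_id _)
  have e₂ : H'.map ((kappa ((toPro C).obj D)).leg (constElt D)) = 𝟙 _ :=
    (congrArg H'.map (kappa_constElt D)).trans (H'.map_id _)
  exact (Strict.comp_id _).symm.trans ((congrArg (fun t => a _ ≫ t) e₂.symm).trans
    ((hl _ _).trans ((congrArg (fun t => t ≫ TwoNatTrans.app β D) e₁).trans (Strict.id_comp _))))

theorem precompose_faithful (h : ∀ X : Pro.{w} C, ((kappa X).push H').Universal) {α β : H ⟶ H'}
    {m n : α ⟶ β}
    (e : (precompose (toPro C) E).map₂ m = (precompose (toPro C) E).map₂ n) : m = n := by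
  refine Modif.hom_ext fun X => (h X).cell_ext fun D x => HomEq.eq ?_
  have k : ∀ m : α ⟶ β, Modif.app m X ▷ H'.map ((kappa X).leg x) ≈ₕ
      H.map ((kappa X).leg x) ◁ Modif.app ((precompose (toPro C) E).map₂ m) D := fun m =>
    (HomEq.modif_naturality m ((kappa X).leg x)).symm
  refine (k m).trans (HomEq.trans ?_ (k n).symm)
  rw [e]
  exact .refl _

/-- The component at `X` of the extension of a modification is induced by its whiskering with `H
κ_X`. -/
theorem precompose_full (h : ∀ X : Pro.{w} C, ((kappa X).push H').Universal) {α β : H ⟶ H'}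
    (n : (precompose (toPro C) E).map α ⟶ (precompose (toPro C) E).map β) :
    ∃ m : α ⟶ β, (precompose (toPro C) E).map₂ m = n := by
  choose m hm using fun X : Pro.{w} C => (h X).exists_hom (app_kappa α X) (app_kappa β X)
    (HetTrans.compHom ((kappa X).push H) (corepWhisker₂ n (H.obj X)))
  have hl : ∀ (X : Pro.{w} C) {D : C} (x : (ProObj.L X).obj D),
      m X ▷ H'.map ((kappa X).leg x) ≈ₕ H.map ((kappa X).leg x) ◁ Modif.app n D :=
    fun X D x => hm X x
  have nat : ∀ {X Y : Pro.{w} C} (f : X ⟶ Y), H.map f ◁ m Y ≈ₕ m X ▷ H'.map f :=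
    fun {X Y} f => (h Y).cell_homEq (TwoNatTrans.naturality α f) (TwoNatTrans.naturality β f)
      fun D y => by
        have e₁ : H.map f ≫ H.map ((kappa Y).leg y) = H.map ((kappa X).leg _) :=
          (H.map_comp _ _).symm.trans (congrArg H.map (kappa_leg_naturality f y).symm)
        have e₂ : H'.map f ≫ H'.map ((kappa Y).leg y) = H'.map ((kappa X).leg _) :=
          (H'.map_comp _ _).symm.trans (congrArg H'.map (kappa_leg_naturality f y).symm)
        exact (HomEq.whisker_assoc _ _ _).trans ((HomEq.whiskerLeft rfl (hl Y y)).trans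
          ((HomEq.comp_whiskerLeft _ _ _).symm.trans ((HomEq.whiskerLeft e₁ (.refl _)).trans
            ((hl X _).symm.trans ((HomEq.whiskerRight (.refl (m X)) e₂.symm).trans
              (HomEq.whiskerRight_comp _ _ _))))))
  refine ⟨Modif.ofHomEq m nat, Modif.hom_ext fun D => HomEq.eq ?_⟩
  -- At `X = c D` the canonical cone contains the identity, so the extension restricts to the given
  -- datum.
  have e₁ : H.map ((kappa ((toPro C).obj D)).leg (constElt D)) = 𝟙 _ :=
    (congrArg H.map (kappa_constElt D)).trans (H.map_id _)
  have e₂ : H'.map ((kappa ((toPro C).obj D)).leg (constElt D)) = 𝟙 _ :=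
    (congrArg H'.map (kappa_constElt D)).trans (H'.map_id _)
  exact (HomEq.whiskerRight_id _).symm.trans ((HomEq.whiskerRight (.refl (m _)) e₂.symm).trans
    ((hl _ _).trans ((HomEq.whiskerLeft e₁ (.refl _)).trans (HomEq.id_whiskerLeft _))))

/-- Restriction to `C` is an isomorphism on the hom-categories of `Hom(2-Pro(C), E)_+`. -/
theorem restrict_isIsoCat (H H' : HomPlus.{w} C E) : IsIsoCat ((restrict C E).mapFunctor H H') := by
  have h : ∀ X : Pro.{w} C, ((kappa X).push H'.1).Universal := fun X => H'.2.push_kappa X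
  have h₁ : IsIsoCat ((InducedBicategory.forget (C := StrictPseudofunctor (Pro.{w} C) E)
      (F := Subtype.val)).mapFunctor H H') :=
    ⟨{ obj := fun α => InducedBicategory.mkHom α
       map := fun m => InducedBicategory.mkHom₂ m }, rfl, rfl⟩
  have h₂ : IsIsoCat ((precompose (toPro.{w} C) E).mapFunctor H.1 H'.1) :=
    (isIsoCat_iff _).2 ⟨⟨fun α β e => precompose_injective h e, fun β => precompose_surjective h β⟩,
      ⟨fun {α β} n => precompose_full h n⟩, ⟨fun {α β} m n e => precompose_faithful h e⟩⟩
  exact h₁.comp h₂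

end

end TwoCat

/-- Precomposition with the canonical 2-functor `C → 2-Pro(C)` is a 2-equivalence
`Hom(2-Pro(C), E)_+ → Hom(C, E)`, if `E` is closed under small 2-cofiltered pseudo-limits. -/
theorem mainTheorem4 {C : Type u} [Bicategory.{w, w} C] [Strict C]
    {E : Type u₁} [Bicategory.{w₁, v₁} E] [Strict E]
    (hE : TwoCat.HasTwoCofilteredPseudoLimits.{w} E) :
    TwoCat.IsTwoEquivalence (TwoCat.restrict C E) := by
  refine TwoCat.isTwoEquivalence_of_isIsoCat TwoCat.restrict_isIsoCat fun F => ?_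
  obtain ⟨H, θ, hθ, hH⟩ := TwoCat.exists_extension hE F
  obtain ⟨θ', h₁, h₂⟩ := TwoCat.TwoNatTrans.exists_inverse θ hθ
  exact ⟨⟨H, TwoCat.preserves_of_push_kappa hH⟩, θ, θ', h₁, h₂⟩
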